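/- Fix integers $k\ge 1$ and $d\ge 0$. Time is measured on a real RAM: memory cells hold integers or exact real numbers and are addressed by integers; a program is finite and does not depend on the input size. Each of the following is one step: reading, writing, addition, truncated subtraction and comparison of non-negative integers; reading, writing and comparison of reals; evaluation of a fixed semialgebraic function (over $\mathbb Q$) of a fixed number of reals. Equivalently, up to constant factors, the operations on reals are $+,-,\cdot,/$, comparison and root extraction for polynomials of bounded degree. Constants in $O(\cdot)$ depend only on $k$ and $d$. For $\gamma_1,\dots,\gamma_k:[0,1]\to\mathbb R^d$ write $$\ell(\gamma_1,\dots,\gamma_k)=\max_{t\in[0,1]}\max_{1\le i\le k}\|\gamma_1(t)-\gamma_i(t)\| .$$ A reparameterization is a continuous, not necessarily monotone, map $\rho:[0,1]\to[0,1]$ with $\rho(0)=0$, $\rho(1)=1$. (a) Curves. Let $\pi_1,\dots,\pi_k:[0,1]\to\mathbb R^d$ be polygonal curves, given by their breakpoints and vertices, with $n$ vertices in total. In time $O(n^k)$ one can compute piecewise linear reparameterizations $\rho_1,\dots,\rho_k$ that minimize $\ell(\pi_1\circ\rho_1,\dots,\pi_k\circ\rho_k)$ among all reparameterizations. (b) Complexes.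 A complex $\mathcal C$ in $\mathbb R^d$ is a finite family $\mathcal F$ of non-empty finite, affinely independent subsets of $\mathbb R^d$ (simplices), closed under non-empty subsets (faces), such that $\mathrm{conv}(\Psi)\cap\mathrm{conv}(\Upsilon)=\mathrm{conv}(\Psi\cap\Upsilon)$ whenever $\Psi,\Upsilon\in\mathcal F$ and $\Psi\cap\Upsilon\ne\emptyset$; simplices without a common vertex may cross. Two simplices are adjacent if one is contained in the other; $\mathcal C$ is connected if any two simplices are joined by a chain of adjacent ones. A curve in $\mathcal C$ from a vertex $s$ to a vertex $e$ is a continuous $\pi:[0,1]\to\mathbb R^d$ together with a map $\phi:[0,1]\to\mathcal F$ (its simplicial path) such that: each $\phi^{-1}(\Psi)$ is a finite union of open intervals and points; if $\phi$ takes exactly two values on an interval $[x,y]$, these are adjacent; for all $t$, $\pi(t)$ lies in $\mathrm{conv}(\phi(t))$ but in $\mathrm{conv}(\Upsilon)$ for no proper face $\Upsilon$ of $\phi(t)$; and $\phi(0)=\{s\}$, $\phi(1)=\{e\}$. Let $\mathcal C_1,\dots,\mathcal C_k$ be connected complexes in $\mathbb R^d$ with $n$ simplices in total, given by lists of their vertices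 (with coordinates) and of their simplices (as lists of vertices, in any order), and let $s_i,e_i$ be vertices of $\mathcal C_i$. In time $O(n^k)$ one can compute polygonal curves $\pi_i$ in $\mathcal C_i$ from $s_i$ to $e_i$ with their simplicial paths (given by a simplex of $\mathcal C_i$ for each piece of $\pi_i$, of which the simplices of the path on that piece are faces), and piecewise linear reparameterizations $\rho_i$, such that $\ell(\pi_1\circ\rho_1,\dots,\pi_k\circ\rho_k)$ is minimum among all such curves in the complexes (polygonal or not) and all reparameterizations. -/

import Mathlib

/-- Euclidean `d`-space. -/
abbrev Pt (d : ℕ) : Type := EuclideanSpace ℝ (Fin d)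

/-! ## Curves, reparameterizations, leash length -/

/-- The polygonal curve with vertices `p 0, …, p m` and breakpoints `τ 0 < ⋯ < τ m`: it is affine
on each `[τ j, τ (j+1)]`, takes the value `p j` at `τ j`, and is constant outside
`[τ 0, τ m]`. -/
noncomputable def polyline {V : Type*} [AddCommGroup V] [Module ℝ V] {m : ℕ}
    (τ : Fin (m + 1) → ℝ) (p : Fin (m + 1) → V) (x : ℝ) : V :=
  p 0 + ∑ j : Fin m,
    max 0 (min 1 ((x - τ j.castSucc) / (τ j.succ - τ j.castSucc))) • (p j.succ - p j.castSucc)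

/-- The polygonal curve on `[0,1]` with vertices `p 0, …, p L` at the times `0, 1/L, …, 1`. -/
noncomputable def uniformPolyline {V : Type*} [AddCommGroup V] [Module ℝ V] (L : ℕ)
    (p : ℕ → V) (x : ℝ) : V :=
  polyline (m := L) (fun l => (l : ℕ) / (L : ℝ)) (fun l => p l) x

/-- A polygonal curve in `ℝ^d`, parameterized over `[0,1]`, given by its breakpoints and
vertices. -/
structure PolygonalCurve (d : ℕ) where
  edges : ℕ
  edges_pos : 0 < edges
  time : Fin (edges + 1) → ℝ
  time_strictMono : StrictMono time
  time_zero : time 0 = 0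
  time_last : time (Fin.last edges) = 1
  vertex : Fin (edges + 1) → Pt d

namespace PolygonalCurve

/-- The map `[0,1] → ℝ^d`. -/
noncomputable def curve {d : ℕ} (P : PolygonalCurve d) : ℝ → Pt d := polyline P.time P.vertex

/-- The complexity of a polygonal curve: its number of vertices. -/
def complexity {d : ℕ} (P : PolygonalCurve d) : ℕ := P.edges + 1

end PolygonalCurve

/-- A (not necessarily monotone) reparameterization of `[0,1]`. -/
structure IsReparam (ρ : ℝ → ℝ) : Prop where
  continuousOn : ContinuousOn ρ (Set.Icc 0 1)
  mapsTo : Set.MapsTo ρ (Set.Icc 0 1) (Set.Icc 0 1)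
  zero : ρ 0 = 0
  one : ρ 1 = 1

/-- `δ = max_{t ∈ [0,1]} max_i ‖γ_0(t) - γ_i(t)‖`, the first agent being the one of index `0`. -/
def IsLeashLength {k d : ℕ} [NeZero k] (γ : Fin k → ℝ → Pt d) (δ : ℝ) : Prop :=
  IsGreatest {r : ℝ | ∃ t ∈ Set.Icc (0 : ℝ) 1, ∃ i : Fin k, r = dist (γ 0 t) (γ i t)} δ

/-- The `ρ i` are reparameterizations of the given curves that minimize the leash length. -/
def AreOptimalReparams {k d : ℕ} [NeZero k] (P : Fin k → PolygonalCurve d)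
    (ρ : Fin k → ℝ → ℝ) : Prop :=
  (∀ i, IsReparam (ρ i)) ∧
  ∃ δ, IsLeashLength (fun i t => (P i).curve (ρ i t)) δ ∧
    ∀ ρ' : Fin k → ℝ → ℝ, (∀ i, IsReparam (ρ' i)) →
      ∀ δ', IsLeashLength (fun i t => (P i).curve (ρ' i t)) δ' → δ ≤ δ'

/-! ## Complexes and paths in complexes -/

/-- A finite simplicial complex whose vertices are points of `ℝ^d`. Distinct simplices with no
common vertex may intersect. -/
structure SpatialComplex (d : ℕ) extends PreAbstractSimplicialComplex (Pt d) where
  finite : faces.Finite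
  affineIndependent : ∀ Ψ ∈ faces, AffineIndependent ℝ (fun v : Ψ => (v : Pt d))
  locallyConsistent : ∀ Ψ ∈ faces, ∀ Υ ∈ faces, ((Ψ : Set (Pt d)) ∩ Υ).Nonempty →
    convexHull ℝ (Ψ : Set (Pt d)) ∩ convexHull ℝ (Υ : Set (Pt d)) =
      convexHull ℝ ((Ψ : Set (Pt d)) ∩ Υ)

/-- Two simplices are adjacent if one is a face of the other. -/
def AdjacentSimplices {d : ℕ} (Ψ Υ : Finset (Pt d)) : Prop := Ψ ⊆ Υ ∨ Υ ⊆ Ψ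

namespace SpatialComplex

/-- The complexity of a complex: its number of simplices. -/
noncomputable def size {d : ℕ} (K : SpatialComplex d) : ℕ := K.faces.ncard

/-- Any two simplices are joined by a chain of adjacent simplices. -/
def Connected {d : ℕ} (K : SpatialComplex d) : Prop :=
  ∀ Ψ ∈ K.faces, ∀ Υ ∈ K.faces,
    Relation.ReflTransGen (fun A B => B ∈ K.faces ∧ AdjacentSimplices A B) Ψ Υ

/-- A simplicial path in `K`: each simplex is used on a finite union of open intervals and points,
and if exactly two simplices are used on `[x,y]`, then these are adjacent. -/
structure IsSimplicialPath {d : ℕ} (K : SpatialComplex d) (φ : ℝ → Finset (Pt d)) : Prop where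
  mem : ∀ t ∈ Set.Icc (0 : ℝ) 1, φ t ∈ K.faces
  tame : ∀ Ψ ∈ K.faces, ∃ (J : Finset (ℝ × ℝ)) (Q : Finset ℝ),
    {t | t ∈ Set.Icc (0 : ℝ) 1 ∧ φ t = Ψ} = (⋃ ab ∈ J, Set.Ioo ab.1 ab.2) ∪ (Q : Set ℝ)
  adjacent : ∀ x y : ℝ, 0 ≤ x → x ≤ y → y ≤ 1 → ∀ Ψ Υ : Finset (Pt d),
    φ '' Set.Icc x y = {Ψ, Υ} → AdjacentSimplices Ψ Υ

/-- `π` is a curve in `K` from the vertex `s` to the vertex `e`, and `φ` is its simplicial path: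
`φ t` is the lowest-dimensional simplex containing `π t`. As `K` need not be embedded, this means
that no proper face of `φ t` contains `π t`. -/
structure IsCurveIn {d : ℕ} (K : SpatialComplex d) (s e : Pt d) (π : ℝ → Pt d)
    (φ : ℝ → Finset (Pt d)) : Prop where
  continuousOn : ContinuousOn π (Set.Icc 0 1)
  simplicial : K.IsSimplicialPath φ
  mem : ∀ t ∈ Set.Icc (0 : ℝ) 1, π t ∈ convexHull ℝ (φ t : Set (Pt d))
  lowest : ∀ t ∈ Set.Icc (0 : ℝ) 1, ∀ Υ : Finset (Pt d), Υ ⊂ φ t →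
    π t ∉ convexHull ℝ (Υ : Set (Pt d))
  start : φ 0 = {s}
  target : φ 1 = {e}

end SpatialComplex

/-- The `π i`, with simplicial paths `φ i`, are curves from `s i` to `e i` in the complexes `K i`,
and the `ρ i` are reparameterizations of them, such that the leash length is minimum among all
such curves and reparameterizations. -/
def AreOptimalCurves {k d : ℕ} [NeZero k] (K : Fin k → SpatialComplex d) (s e : Fin k → Pt d)
    (π : Fin k → ℝ → Pt d) (φ : Fin k → ℝ → Finset (Pt d)) (ρ : Fin k → ℝ → ℝ) : Prop :=
  (∀ i, (K i).IsCurveIn (s i) (e i) (π i) (φ i)) ∧ (∀ i, IsReparam (ρ i)) ∧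
  ∃ δ, IsLeashLength (fun i t => π i (ρ i t)) δ ∧
    ∀ (π' : Fin k → ℝ → Pt d) (φ' : Fin k → ℝ → Finset (Pt d)) (ρ' : Fin k → ℝ → ℝ),
      (∀ i, (K i).IsCurveIn (s i) (e i) (π' i) (φ' i)) → (∀ i, IsReparam (ρ' i)) →
        ∀ δ', IsLeashLength (fun i t => π' i (ρ' i t)) δ' → δ ≤ δ'

/-! ## The machine model: a real random access machine -/

/-- `g : ℝ^m → ℝ` is semialgebraic (with integer coefficients): its graph is first-order definable
without parameters in the field `ℝ`. By Tarski's theorem these are the functions that can be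
computed by a fixed number of the operations `+`, `-`, `*`, `/`, root extraction for polynomials of
fixed degree, and comparisons. -/
def SemialgebraicFun {m : ℕ} (g : (Fin m → ℝ) → ℝ) : Prop :=
  letI := FirstOrder.Ring.compatibleRingOfRing ℝ
  (∅ : Set ℝ).DefinableFun FirstOrder.Language.ring g

/-- The memory: integer registers, real registers, integer arrays and real arrays. A program
mentions finitely many registers and arrays; the entries of an array are addressed by the contents
of integer registers. -/
structure Memory where
  ireg : ℕ → ℕ
  rreg : ℕ → ℝ
  iarr : ℕ → ℕ → ℕ
  rarr : ℕ → ℕ → ℝ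

/-- Programs. Integers can be added, subtracted (with cut-off at `0`) and compared; they cannot be
multiplied or divided at unit cost, and reals cannot be rounded to integers. -/
inductive Program : Type
  /-- do nothing -/
  | skip : Program
  /-- `x := c` -/
  | setI (x c : ℕ) : Program
  /-- `x := y + z` -/
  | addI (x y z : ℕ) : Program
  /-- `x := y - z` -/
  | subI (x y z : ℕ) : Program
  /-- `x := A[y]` -/
  | loadI (x A y : ℕ) : Program
  /-- `A[y] := x` -/
  | storeI (A y x : ℕ) : Program
  /-- `x := g (y 0, …, y (m-1))` for a fixed semialgebraic function `g` on real registers -/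
  | opR (x : ℕ) {m : ℕ} (g : (Fin m → ℝ) → ℝ) (hg : SemialgebraicFun g) (y : Fin m → ℕ) : Program
  /-- `x := A[y]` for a real register and a real array -/
  | loadR (x A y : ℕ) : Program
  /-- `A[y] := x` for a real register and a real array -/
  | storeR (A y x : ℕ) : Program
  /-- first `a`, then `b` -/
  | seq (a b : Program) : Program
  /-- `if y ≤ z then a else b`, integer registers -/
  | ifI (y z : ℕ) (a b : Program) : Program
  /-- `if y ≤ z then a else b`, real registers -/
  | ifR (y z : ℕ) (a b : Program) : Program
  /-- `while y < z do a`, integer registers -/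
  | whileI (y z : ℕ) (a : Program) : Program

/-- `Runs a σ T σ'`: started in memory `σ`, the program `a` halts after exactly `T` unit-cost steps
(elementary instructions and tests) in memory `σ'`. -/
inductive Runs : Program → Memory → ℕ → Memory → Prop
  | skip (σ : Memory) : Runs .skip σ 1 σ
  | setI (x c : ℕ) (σ : Memory) :
      Runs (.setI x c) σ 1 { σ with ireg := Function.update σ.ireg x c }
  | addI (x y z : ℕ) (σ : Memory) :
      Runs (.addI x y z) σ 1 { σ with ireg := Function.update σ.ireg x (σ.ireg y + σ.ireg z) }
  | subI (x y z : ℕ) (σ : Memory) :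
      Runs (.subI x y z) σ 1 { σ with ireg := Function.update σ.ireg x (σ.ireg y - σ.ireg z) }
  | loadI (x A y : ℕ) (σ : Memory) :
      Runs (.loadI x A y) σ 1
        { σ with ireg := Function.update σ.ireg x (σ.iarr A (σ.ireg y)) }
  | storeI (A y x : ℕ) (σ : Memory) :
      Runs (.storeI A y x) σ 1
        { σ with
          iarr := Function.update σ.iarr A (Function.update (σ.iarr A) (σ.ireg y) (σ.ireg x)) }
  | opR (x : ℕ) {m : ℕ} (g : (Fin m → ℝ) → ℝ) (hg : SemialgebraicFun g) (y : Fin m → ℕ)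
      (σ : Memory) :
      Runs (.opR x g hg y) σ 1
        { σ with rreg := Function.update σ.rreg x (g (fun j => σ.rreg (y j))) }
  | loadR (x A y : ℕ) (σ : Memory) :
      Runs (.loadR x A y) σ 1
        { σ with rreg := Function.update σ.rreg x (σ.rarr A (σ.ireg y)) }
  | storeR (A y x : ℕ) (σ : Memory) :
      Runs (.storeR A y x) σ 1
        { σ with
          rarr := Function.update σ.rarr A (Function.update (σ.rarr A) (σ.ireg y) (σ.rreg x)) }
  | seq {a b : Program} {σ σ' σ'' : Memory} {T T' : ℕ} :
      Runs a σ T σ' → Runs b σ' T' σ'' → Runs (.seq a b) σ (T + T') σ''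
  | ifI_then {y z : ℕ} {a b : Program} {σ σ' : Memory} {T : ℕ} :
      σ.ireg y ≤ σ.ireg z → Runs a σ T σ' → Runs (.ifI y z a b) σ (T + 1) σ'
  | ifI_else {y z : ℕ} {a b : Program} {σ σ' : Memory} {T : ℕ} :
      ¬ σ.ireg y ≤ σ.ireg z → Runs b σ T σ' → Runs (.ifI y z a b) σ (T + 1) σ'
  | ifR_then {y z : ℕ} {a b : Program} {σ σ' : Memory} {T : ℕ} :
      σ.rreg y ≤ σ.rreg z → Runs a σ T σ' → Runs (.ifR y z a b) σ (T + 1) σ'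
  | ifR_else {y z : ℕ} {a b : Program} {σ σ' : Memory} {T : ℕ} :
      ¬ σ.rreg y ≤ σ.rreg z → Runs b σ T σ' → Runs (.ifR y z a b) σ (T + 1) σ'
  | while_stop {y z : ℕ} {a : Program} {σ : Memory} :
      ¬ σ.ireg y < σ.ireg z → Runs (.whileI y z a) σ 1 σ
  | while_step {y z : ℕ} {a : Program} {σ σ' σ'' : Memory} {T T' : ℕ} :
      σ.ireg y < σ.ireg z → Runs a σ T σ' → Runs (.whileI y z a) σ' T' σ'' →
        Runs (.whileI y z a) σ (T + T' + 1) σ''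

/-! ## Input and output formats -/

/-- The sequence `f 0, …, f (n-1), 0, 0, …`. -/
def padded {α : Type*} [Zero α] {n : ℕ} (f : Fin n → α) (j : ℕ) : α :=
  if h : j < n then f ⟨j, h⟩ else 0

/-- A table with rows of width `w`, stored row by row. -/
def table {α : Type*} [Zero α] {n : ℕ} (w : ℕ) (row : Fin n → ℕ → α) (j : ℕ) : α :=
  padded row (j / w) (j % w)

/-- The input for `k` polygonal curves in `ℝ^d`. Integer array `0` holds the numbers of edges, real
array `i` the breakpoints of curve `i`, real array `k + i` the coordinates of its vertices, in
rows of width `d`. Everything else is `0`. -/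
noncomputable def curvesInput {k d : ℕ} (P : Fin k → PolygonalCurve d) : Memory where
  ireg := 0
  rreg := 0
  iarr := fun A => if A = 0 then padded (fun i => (P i).edges) else 0
  rarr := fun A =>
    if A < k then padded (fun i => padded (P i).time) A
    else padded (fun i => table d (fun j => padded (fun c => (P i).vertex j c))) (A - k)

/-- The `i`-th reparameterization in the output for polygonal curves: the polygonal map whose number
`L` of pieces is in integer register `0`, and whose values at `0, 1/L, …, 1` are in real array
`2 * k + i`. -/
noncomputable def outReparam (k : ℕ) (σ : Memory) (i : Fin k) : ℝ → ℝ :=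
  uniformPolyline (σ.ireg 0) (σ.rarr (2 * k + i))

/-- A complex presented as lists: an enumeration of its vertices, and an enumeration of its simplices,
where each simplex is listed by the indices of its vertices. -/
structure Listing {d : ℕ} (K : SpatialComplex d) where
  numVerts : ℕ
  vert : Fin numVerts → Pt d
  vert_injective : Function.Injective vert
  mem_range_vert : ∀ v, v ∈ Set.range vert ↔ {v} ∈ K.faces
  simplex : Fin K.size ≃ K.faces
  indices : Fin K.size → List (Fin numVerts)
  indices_nodup : ∀ j, (indices j).Nodup
  mem_simplex : ∀ j v, v ∈ (simplex j : Finset (Pt d)) ↔ ∃ a ∈ indices j, vert a = v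

/-- The input for `k` complexes in `ℝ^d`, with start and end vertices given by their indices. Integer
arrays `0`, `1`, `2`, `3` hold, for each complex, the number of vertices, the number of simplices,
the start vertex and the end vertex. Integer array `4 + 2 * i` holds the numbers of vertices of the
simplices of complex `i`, integer array `5 + 2 * i` their vertex indices, in rows of width
`d + 1`. Real array `i` holds the coordinates of the vertices of complex `i`, in rows of width `d`.
Everything else is `0`. -/
noncomputable def complexesInput {k d : ℕ} {K : Fin k → SpatialComplex d}
    (I : ∀ i, Listing (K i)) (s e : ∀ i, Fin (I i).numVerts) : Memory where
  ireg := 0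
  rreg := 0
  iarr := fun A =>
    match A with
    | 0 => padded (fun i => (I i).numVerts)
    | 1 => padded (fun i => (K i).size)
    | 2 => padded (fun i => (s i : ℕ))
    | 3 => padded (fun i => (e i : ℕ))
    | A + 4 =>
      if A % 2 = 0 then padded (fun i => padded (fun j => ((I i).indices j).length)) (A / 2)
      else padded (fun i => table (d + 1)
        (fun j a => (((I i).indices j).map (fun v => (v : ℕ))).getD a 0)) (A / 2)
  rarr := padded (fun i => table d (fun v => padded (fun c => (I i).vert v c)))

/-- The `i`-th curve in the output for complexes: the polygonal curve whose number `L` of pieces is in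
integer register `0`, and whose vertices at the times `0, 1/L, …, 1` are in real array `k + i`, in
rows of width `d`. -/
noncomputable def outCurve (k d : ℕ) (σ : Memory) (i : Fin k) : ℝ → Pt d :=
  uniformPolyline (σ.ireg 0) (fun l => WithLp.toLp 2 (fun c : Fin d => σ.rarr (k + i) (l * d + c)))

/-- The simplicial path `φ` is the one described by the output for complex `i`: entry `l` of integer
array `4 + 2 * k + i` is the index of a simplex that has all simplices of `φ` on
`[l/L, (l+1)/L]` as faces. -/
def OutSimplices {k d : ℕ} {K : Fin k → SpatialComplex d} (I : ∀ i, Listing (K i)) (σ : Memory)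
    (i : Fin k) (φ : ℝ → Finset (Pt d)) : Prop :=
  ∀ l < σ.ireg 0, ∃ h : σ.iarr (4 + 2 * k + i) l < (K i).size,
    ∀ t ∈ Set.Icc ((l : ℝ) / σ.ireg 0) (((l : ℝ) + 1) / σ.ireg 0),
      φ t ⊆ ((I i).simplex ⟨σ.iarr (4 + 2 * k + i) l, h⟩ : Finset (Pt d))

/-!
Both parts are instances of one problem. An agent moves in a finite abstract simplicial complex
whose vertices are placed in a Euclidean space, from a start vertex to an end vertex;
`AgentSystem` bundles `k` such agents. A complex of the input is such a complex with the given
placement. A polygonal curve becomes the path formed by the vertices and edges of its graph in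
`ℝ^(d + 1)`: a point of the graph knows its time, so that a motion along the graph is a
reparameterization of the curve. Distances are measured after a coordinate projection, which
forgets the time in the case of curves.

*Product cells.* A product cell is a choice of a simplex for each agent. Its weight is the
smallest leash length of positions of the agents in these simplices. Among the positions that
attain it, exactly one tuple minimizes the sum of the squared norms (`IsBest.exists`,
`IsBest.unique`); this makes the best positions a first-order definable, hence semialgebraic,
function of the coordinates of the vertices (`semialgebraicFun_bestCoord`), so that they are
computed in a constant number of steps. Larger product cells have smaller weights
(`IsBest.weight_anti`).

*Motions and chains.* In any admissible motion of leash length `δ`, the product cell containing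
the agents can only grow in a neighbourhood of each point in time. For curves this is
`PolygonalCurve.eventually_cellAt_subset`; for complexes, where the simplices may cross, it is
derived from the adjacency and minimality of simplicial paths
(`SpatialComplex.IsCurveIn.eventually_subset`). As `[0, 1]` is connected, the product cells of
start and end are therefore connected by a chain of product cells of weight at most `δ`, each a
facet of the next one or conversely (`AgentSystem.Reach.of_motion`). Conversely, given such a
chain, let the agents move linearly from the best positions in one product cell to those in the
next one. The larger of the two cells contains the motion, and by convexity of the norm the leash
is never longer than at the ends of a piece (`dist_uniformPolyline_le`). Hence the optimum is the
bottleneck value of a path in the graph of product cells and their facets, and a bottleneck path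
yields an optimal motion (`OptimalMotion`). For curves the time coordinates of this motion are the
reparameterizations (`OptimalMotion.areOptimalReparams`). For complexes the motion itself is the
output, and the simplicial path consists of the lowest faces containing the positions
(`SpatialComplex.exists_isCurveIn`, `OptimalMotion.areOptimalCurves`).

*Running time.* Since dimensions are bounded, the graph has `O(n ^ k)` nodes and edges. A
bottleneck path is found in time linear in the number of edges. The weights are split at a pivot
whose rank is bounded away from both ends by a constant fraction; repeatedly sampling sorted
blocks finds it in linear time (`selectPivot_spec`). If the edges lighter than the pivot connect
the terminals, the others are deleted; if adding those of the pivot's weight does not connect them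
either, the edges not heavier than the pivot are contracted; otherwise the pivot is the
bottleneck. Each round takes linear time, by a breadth-first search for connected components, and
removes a quarter of the edges (`bottleneckRound_spec`), so that the times form a geometric series
(`bottleneckPath_spec`).

*Addresses.* The simplices come in no particular order, and a facet has to be found in constant
time. A product cell is therefore addressed by the number `AgentSystem.nodeId` whose binary digits
indicate the vertices of its simplices. The address of a facet is obtained by one subtraction, and
the required powers of two are computed by repeated doubling. This uses that the machine adds
integers and addresses memory at unit cost, regardless of the size of the integers; of the
addressed cells, only `O(n ^ k)` are used.

Programs are analysed with the predicate `Run`, which bounds the running time and describes the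
final memory, together with the relation `Program.Frame`, which says what a program leaves
unchanged.
-/

/-! ### Reasoning about programs -/

namespace Memory

/-- Write an integer register. -/
def setI (σ : Memory) (x v : ℕ) : Memory := { σ with ireg := Function.update σ.ireg x v }

/-- Write a real register. -/
noncomputable def setR (σ : Memory) (x : ℕ) (v : ℝ) : Memory :=
  { σ with rreg := Function.update σ.rreg x v }

/-- Write an entry of an integer array. -/
def stI (σ : Memory) (A y v : ℕ) : Memory :=
  { σ with iarr := Function.update σ.iarr A (Function.update (σ.iarr A) y v) }

/-- Write an entry of a real array. -/
noncomputable def stR (σ : Memory) (A y : ℕ) (v : ℝ) : Memory :=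
  { σ with rarr := Function.update σ.rarr A (Function.update (σ.rarr A) y v) }

variable (σ : Memory) (x y z v A B : ℕ) (r : ℝ)

@[simp] theorem ireg_setI : (σ.setI x v).ireg y = if y = x then v else σ.ireg y := by
  simp [setI, Function.update_apply]
@[simp] theorem rreg_setI : (σ.setI x v).rreg = σ.rreg := rfl
@[simp] theorem iarr_setI : (σ.setI x v).iarr = σ.iarr := rfl
@[simp] theorem rarr_setI : (σ.setI x v).rarr = σ.rarr := rfl
@[simp] theorem ireg_setR : (σ.setR x r).ireg = σ.ireg := rfl
@[simp] theorem rreg_setR : (σ.setR x r).rreg y = if y = x then r else σ.rreg y := by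
  simp [setR, Function.update_apply]
@[simp] theorem iarr_setR : (σ.setR x r).iarr = σ.iarr := rfl
@[simp] theorem rarr_setR : (σ.setR x r).rarr = σ.rarr := rfl
@[simp] theorem ireg_stI : (σ.stI A y v).ireg = σ.ireg := rfl
@[simp] theorem rreg_stI : (σ.stI A y v).rreg = σ.rreg := rfl
@[simp] theorem rarr_stI : (σ.stI A y v).rarr = σ.rarr := rfl
@[simp] theorem iarr_stI :
    (σ.stI A y v).iarr B z = if B = A ∧ z = y then v else σ.iarr B z := by
  by_cases h : B = A
  · subst h; simp [stI, Function.update_apply]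
  · simp [stI, h]
@[simp] theorem iarr_stI_of_ne (h : B ≠ A) : (σ.stI A y v).iarr B = σ.iarr B := by
  funext z; simp [h]
@[simp] theorem ireg_stR : (σ.stR A y r).ireg = σ.ireg := rfl
@[simp] theorem rreg_stR : (σ.stR A y r).rreg = σ.rreg := rfl
@[simp] theorem iarr_stR : (σ.stR A y r).iarr = σ.iarr := rfl
@[simp] theorem rarr_stR :
    (σ.stR A y r).rarr B z = if B = A ∧ z = y then r else σ.rarr B z := by
  by_cases h : B = A
  · subst h; simp [stR, Function.update_apply]
  · simp [stR, h]

end Memory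

namespace Program

/-- The program contains no loops. -/
def loopFree : Program → Prop
  | seq a b => a.loopFree ∧ b.loopFree
  | ifI _ _ a b => a.loopFree ∧ b.loopFree
  | ifR _ _ a b => a.loopFree ∧ b.loopFree
  | whileI _ _ _ => False
  | _ => True

/-- A bound on the running time of a loop-free program. -/
def steps : Program → ℕ
  | seq a b => a.steps + b.steps
  | ifI _ _ a b => a.steps + b.steps + 1
  | ifR _ _ a b => a.steps + b.steps + 1
  | _ => 1

/-- The effect of a loop-free program on the memory. -/
noncomputable def exec : Program → Memory → Memory
  | skip, σ => σ
  | setI x c, σ => σ.setI x c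
  | addI x y z, σ => σ.setI x (σ.ireg y + σ.ireg z)
  | subI x y z, σ => σ.setI x (σ.ireg y - σ.ireg z)
  | loadI x A y, σ => σ.setI x (σ.iarr A (σ.ireg y))
  | storeI A y x, σ => σ.stI A (σ.ireg y) (σ.ireg x)
  | opR x g _ y, σ => σ.setR x (g fun j => σ.rreg (y j))
  | loadR x A y, σ => σ.setR x (σ.rarr A (σ.ireg y))
  | storeR A y x, σ => σ.stR A (σ.ireg y) (σ.rreg x)
  | seq a b, σ => b.exec (a.exec σ)
  | ifI y z a b, σ => if σ.ireg y ≤ σ.ireg z then a.exec σ else b.exec σ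
  | ifR y z a b, σ => if σ.rreg y ≤ σ.rreg z then a.exec σ else b.exec σ
  | whileI _ _ _, σ => σ

/-- The integer registers that a program may write. -/
def wI : Program → ℕ → Prop
  | setI x _, r => r = x
  | addI x _ _, r => r = x
  | subI x _ _, r => r = x
  | loadI x _ _, r => r = x
  | seq a b, r => a.wI r ∨ b.wI r
  | ifI _ _ a b, r => a.wI r ∨ b.wI r
  | ifR _ _ a b, r => a.wI r ∨ b.wI r
  | whileI _ _ a, r => a.wI r
  | _, _ => False

/-- The real registers that a program may write. -/
def wR : Program → ℕ → Prop
  | opR x _ _ _, r => r = x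
  | loadR x _ _, r => r = x
  | seq a b, r => a.wR r ∨ b.wR r
  | ifI _ _ a b, r => a.wR r ∨ b.wR r
  | ifR _ _ a b, r => a.wR r ∨ b.wR r
  | whileI _ _ a, r => a.wR r
  | _, _ => False

/-- The integer arrays that a program may write. -/
def wIA : Program → ℕ → Prop
  | storeI A _ _, r => r = A
  | seq a b, r => a.wIA r ∨ b.wIA r
  | ifI _ _ a b, r => a.wIA r ∨ b.wIA r
  | ifR _ _ a b, r => a.wIA r ∨ b.wIA r
  | whileI _ _ a, r => a.wIA r
  | _, _ => False

/-- The real arrays that a program may write. -/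
def wRA : Program → ℕ → Prop
  | storeR A _ _, r => r = A
  | seq a b, r => a.wRA r ∨ b.wRA r
  | ifI _ _ a b, r => a.wRA r ∨ b.wRA r
  | ifR _ _ a b, r => a.wRA r ∨ b.wRA r
  | whileI _ _ a, r => a.wRA r
  | _, _ => False

attribute [simp] loopFree steps exec wI wR wIA wRA

/-- The memories agree on everything that the program does not write. -/
structure Frame (c : Program) (σ σ' : Memory) : Prop where
  ireg : ∀ x, ¬ c.wI x → σ'.ireg x = σ.ireg x
  rreg : ∀ x, ¬ c.wR x → σ'.rreg x = σ.rreg x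
  iarr : ∀ A, ¬ c.wIA A → σ'.iarr A = σ.iarr A
  rarr : ∀ A, ¬ c.wRA A → σ'.rarr A = σ.rarr A

theorem Frame.refl (c : Program) (σ : Memory) : Frame c σ σ := by constructor <;> simp

theorem Frame.trans {c : Program} {σ σ' σ'' : Memory} (h : Frame c σ σ') (h' : Frame c σ' σ'') :
    Frame c σ σ'' :=
  ⟨fun x hx => (h'.ireg x hx).trans (h.ireg x hx), fun x hx => (h'.rreg x hx).trans (h.rreg x hx),
    fun x hx => (h'.iarr x hx).trans (h.iarr x hx), fun x hx => (h'.rarr x hx).trans (h.rarr x hx)⟩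

theorem Frame.mono {c c' : Program} {σ σ' : Memory} (h : Frame c σ σ') (h1 : ∀ x, c.wI x → c'.wI x)
    (h2 : ∀ x, c.wR x → c'.wR x) (h3 : ∀ x, c.wIA x → c'.wIA x) (h4 : ∀ x, c.wRA x → c'.wRA x) :
    Frame c' σ σ' :=
  ⟨fun x hx => h.ireg x fun q => hx (h1 x q), fun x hx => h.rreg x fun q => hx (h2 x q),
    fun x hx => h.iarr x fun q => hx (h3 x q), fun x hx => h.rarr x fun q => hx (h4 x q)⟩

theorem Frame.left {a b : Program} {σ σ' : Memory} (h : Frame a σ σ') : Frame (.seq a b) σ σ' :=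
  h.mono (fun _ => Or.inl) (fun _ => Or.inl) (fun _ => Or.inl) (fun _ => Or.inl)

theorem Frame.right {a b : Program} {σ σ' : Memory} (h : Frame b σ σ') : Frame (.seq a b) σ σ' :=
  h.mono (fun _ => Or.inr) (fun _ => Or.inr) (fun _ => Or.inr) (fun _ => Or.inr)

theorem _root_.Runs.frame {c : Program} {σ σ' : Memory} {T : ℕ} (h : Runs c σ T σ') :
    Frame c σ σ' := by
  induction h with
  | skip σ => exact .refl _ _
  | setI | addI | subI | loadI => constructor <;> simp +contextual
  | storeI | storeR => constructor <;> simp +contextual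
  | opR | loadR => constructor <;> simp +contextual
  | seq _ _ h1 h2 => exact h1.left.trans h2.right
  | ifI_then _ _ h | ifR_then _ _ h =>
    exact h.mono (fun _ => Or.inl) (fun _ => Or.inl) (fun _ => Or.inl) (fun _ => Or.inl)
  | ifI_else _ _ h | ifR_else _ _ h =>
    exact h.mono (fun _ => Or.inr) (fun _ => Or.inr) (fun _ => Or.inr) (fun _ => Or.inr)
  | while_stop => exact .refl _ _
  | while_step _ _ _ h1 h2 =>
    exact Frame.trans (h1.mono (fun _ => id) (fun _ => id) (fun _ => id) (fun _ => id)) h2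

/-- A loop-free program terminates within `steps` steps, and its effect is `exec`. -/
theorem loopFree.runs {c : Program} (hc : c.loopFree) (σ : Memory) :
    ∃ T ≤ c.steps, Runs c σ T (c.exec σ) := by
  induction c generalizing σ with
  | skip => exact ⟨1, le_rfl, .skip _⟩
  | setI x v => exact ⟨1, le_rfl, .setI _ _ _⟩
  | addI x y z => exact ⟨1, le_rfl, .addI _ _ _ _⟩
  | subI x y z => exact ⟨1, le_rfl, .subI _ _ _ _⟩
  | loadI x y z => exact ⟨1, le_rfl, .loadI _ _ _ _⟩
  | storeI x y z => exact ⟨1, le_rfl, .storeI _ _ _ _⟩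
  | opR x g hg y => exact ⟨1, le_rfl, .opR _ _ hg _ _⟩
  | loadR x y z => exact ⟨1, le_rfl, .loadR _ _ _ _⟩
  | storeR x y z => exact ⟨1, le_rfl, .storeR _ _ _ _⟩
  | seq a b ha hb =>
    obtain ⟨T, hT, h⟩ := ha hc.1 σ
    obtain ⟨T', hT', h'⟩ := hb hc.2 (a.exec σ)
    exact ⟨T + T', by simp only [steps]; omega, h.seq h'⟩
  | ifI y z a b ha hb =>
    by_cases hyz : σ.ireg y ≤ σ.ireg z
    · obtain ⟨T, hT, h⟩ := ha hc.1 σ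
      exact ⟨T + 1, by simp only [steps]; omega, by simpa [hyz] using Runs.ifI_then hyz h⟩
    · obtain ⟨T, hT, h⟩ := hb hc.2 σ
      exact ⟨T + 1, by simp only [steps]; omega,
        by simpa only [exec, hyz, if_false] using Runs.ifI_else hyz h⟩
  | ifR y z a b ha hb =>
    by_cases hyz : σ.rreg y ≤ σ.rreg z
    · obtain ⟨T, hT, h⟩ := ha hc.1 σ
      exact ⟨T + 1, by simp only [steps]; omega, by simpa [hyz] using Runs.ifR_then hyz h⟩
    · obtain ⟨T, hT, h⟩ := hb hc.2 σ
      exact ⟨T + 1, by simp only [steps]; omega,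
        by simpa only [exec, hyz, if_false] using Runs.ifR_else hyz h⟩
  | whileI y z a => exact hc.elim

/-- `x := x + 1`; integer register `0` is overwritten. -/
def inc (x : ℕ) : Program := seq (setI 0 1) (addI x x 0)

/-- `for i = 0, …, n - 1 do a`, where `i` and `n` are integer registers. -/
def forI (i n : ℕ) (a : Program) : Program := seq (setI i 0) (whileI i n (seq a (inc i)))

@[simp] theorem wI_inc (x r : ℕ) : (inc x).wI r ↔ r = 0 ∨ r = x := by simp [inc]
@[simp] theorem wR_inc (x r : ℕ) : (inc x).wR r ↔ False := by simp [inc]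
@[simp] theorem wIA_inc (x r : ℕ) : (inc x).wIA r ↔ False := by simp [inc]
@[simp] theorem wRA_inc (x r : ℕ) : (inc x).wRA r ↔ False := by simp [inc]
@[simp] theorem loopFree_inc (x : ℕ) : (inc x).loopFree := by simp [inc]
theorem exec_inc {x : ℕ} (hx : x ≠ 0) (σ : Memory) :
    (inc x).exec σ = (σ.setI 0 1).setI x (σ.ireg x + 1) := by simp [inc, hx]
@[simp] theorem wI_forI (i n r : ℕ) (a : Program) :
    (forI i n a).wI r ↔ r = i ∨ a.wI r ∨ r = 0 := by simp [forI]; tauto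
@[simp] theorem wR_forI (i n r : ℕ) (a : Program) : (forI i n a).wR r ↔ a.wR r := by simp [forI]
@[simp] theorem wIA_forI (i n r : ℕ) (a : Program) : (forI i n a).wIA r ↔ a.wIA r := by simp [forI]
@[simp] theorem wRA_forI (i n r : ℕ) (a : Program) : (forI i n a).wRA r ↔ a.wRA r := by simp [forI]

end Program

open Program

/-- Started in `σ`, the program halts, and its running time and final memory satisfy `R`. -/
def Run (c : Program) (σ : Memory) (R : ℕ → Memory → Prop) : Prop :=
  ∃ T σ', Runs c σ T σ' ∧ R T σ'

namespace Run

theorem mono {c : Program} {σ : Memory} {R R' : ℕ → Memory → Prop} (h : Run c σ R)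
    (hR : ∀ T σ', Frame c σ σ' → R T σ' → R' T σ') : Run c σ R' := by
  obtain ⟨T, σ', h, hr⟩ := h
  exact ⟨T, σ', h, hR _ _ h.frame hr⟩

theorem seq {a b : Program} {σ : Memory} {R : ℕ → Memory → Prop}
    (h : Run a σ fun T σ' => Run b σ' fun T' σ'' => R (T + T') σ'') : Run (.seq a b) σ R := by
  obtain ⟨T, σ', h, T', σ'', h', hr⟩ := h
  exact ⟨_, _, h.seq h', hr⟩

/-- Run `a` with a known specification, then go on. -/
theorem seq' {a b : Program} {σ : Memory} {R R' : ℕ → Memory → Prop} (ha : Run a σ R')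
    (h : ∀ T σ', Frame a σ σ' → R' T σ' → Run b σ' fun T' σ'' => R (T + T') σ'') :
    Run (.seq a b) σ R :=
  seq (ha.mono h)

theorem of_loopFree {c : Program} {σ : Memory} {R : ℕ → Memory → Prop} (hc : c.loopFree)
    (h : ∀ T ≤ c.steps, R T (c.exec σ)) : Run c σ R := by
  obtain ⟨T, hT, hr⟩ := hc.runs σ
  exact ⟨T, _, hr, h T hT⟩

theorem ifI {y z : ℕ} {a b : Program} {σ : Memory} {R : ℕ → Memory → Prop}
    (h1 : σ.ireg y ≤ σ.ireg z → Run a σ fun T σ' => R (T + 1) σ')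
    (h2 : σ.ireg z < σ.ireg y → Run b σ fun T σ' => R (T + 1) σ') : Run (.ifI y z a b) σ R := by
  by_cases h : σ.ireg y ≤ σ.ireg z
  · obtain ⟨T, σ', hr, hR⟩ := h1 h
    exact ⟨_, _, .ifI_then h hr, hR⟩
  · obtain ⟨T, σ', hr, hR⟩ := h2 (not_le.1 h)
    exact ⟨_, _, .ifI_else h hr, hR⟩

/-- Loops: the invariant `Inv` is preserved by the body, and the potential `Φ` pays for it. -/
theorem whileI {y z : ℕ} {a : Program} {σ₀ : Memory} (Inv : Memory → Prop) (Φ : Memory → ℕ)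
    (h0 : Inv σ₀)
    (hb : ∀ σ, Frame a σ₀ σ → Inv σ → σ.ireg y < σ.ireg z →
      Run a σ fun T σ' => Inv σ' ∧ T + 1 + Φ σ' ≤ Φ σ) :
    Run (.whileI y z a) σ₀ fun T σ' => Inv σ' ∧ σ'.ireg z ≤ σ'.ireg y ∧ T + Φ σ' ≤ Φ σ₀ + 1 := by
  suffices H : ∀ N, ∀ σ, Φ σ ≤ N → Frame a σ₀ σ → Inv σ → Run (.whileI y z a) σ fun T σ' =>
      Inv σ' ∧ σ'.ireg z ≤ σ'.ireg y ∧ T + Φ σ' ≤ Φ σ + 1 from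
    H _ σ₀ le_rfl (.refl _ _) h0
  intro N
  induction N with
  | zero =>
    intro σ hN hF hI
    by_cases hc : σ.ireg y < σ.ireg z
    · obtain ⟨T, σ', -, -, h⟩ := hb σ hF hI hc
      omega
    · exact ⟨1, σ, by constructor; exact hc, hI, not_lt.1 hc, by omega⟩
  | succ N ih =>
    intro σ hN hF hI
    by_cases hc : σ.ireg y < σ.ireg z
    · obtain ⟨T, σ', hr, hI', h⟩ := hb σ hF hI hc
      obtain ⟨T', σ'', hr', hI'', hc', h'⟩ := ih σ' (by omega) (hF.trans hr.frame) hI'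
      exact ⟨_, σ'', .while_step hc hr hr', hI'', hc', by omega⟩
    · exact ⟨1, σ, by constructor; exact hc, hI, not_lt.1 hc, by omega⟩

/-- Counting loops, with amortized cost `c` of the body with respect to the potential `Φ`. -/
theorem forI_amortized {i n : ℕ} {a : Program} {σ₀ : Memory} (c : ℕ) (Φ : Memory → ℕ)
    (Inv : ℕ → Memory → Prop) (hi : i ≠ 0) (hn : n ≠ 0) (hin : i ≠ n)
    (hai : ¬ a.wI i) (han : ¬ a.wI n) (h0 : Inv 0 (σ₀.setI i 0))
    (hb : ∀ j σ, j < σ₀.ireg n → Frame (forI i n a) σ₀ σ → σ.ireg i = j → Inv j σ →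
      Run a σ fun T σ' => Inv (j + 1) ((σ'.setI 0 1).setI i (j + 1)) ∧
        T + Φ ((σ'.setI 0 1).setI i (j + 1)) ≤ c + Φ σ) :
    Run (forI i n a) σ₀ fun T σ' => Inv (σ₀.ireg n) σ' ∧
      T + Φ σ' ≤ (c + 3) * σ₀.ireg n + 2 + Φ (σ₀.setI i 0) := by
  refine seq (of_loopFree (by simp) fun T hT => ?_)
  simp only [exec, steps] at hT ⊢
  have hfr : Frame (forI i n a) σ₀ (σ₀.setI i 0) := by
    constructor <;> simp +contextual
  refine (whileI (fun σ => Inv (σ.ireg i) σ ∧ σ.ireg i ≤ σ₀.ireg n ∧ σ.ireg n = σ₀.ireg n)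
    (fun σ => (c + 3) * (σ₀.ireg n - σ.ireg i) + Φ σ)
    (by simp [h0, hin.symm]) ?_).mono ?_
  · rintro σ hF ⟨hI, hle, hN⟩ hlt
    refine seq' (hb (σ.ireg i) σ (by omega) (hfr.trans
      (hF.mono (fun x => by simp; tauto) (by simp) (by simp) (by simp))) rfl hI) ?_
    rintro T σ' hF' ⟨hI', hT'⟩
    have hii := hF'.ireg i hai
    have hnn := hF'.ireg n han
    refine of_loopFree (by simp) fun T1 hT1 => ?_
    rw [exec_inc hi, hii]
    simp only [inc, steps] at hT1
    refine ⟨⟨by simpa using hI', by simp; omega, by simp [hin.symm, hn]; omega⟩, ?_⟩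
    simp only [Memory.ireg_setI, if_true]
    obtain ⟨w, hw⟩ : ∃ w, σ₀.ireg n - σ.ireg i = w + 1 := ⟨σ₀.ireg n - σ.ireg i - 1, by omega⟩
    have : σ₀.ireg n - (σ.ireg i + 1) = w := by omega
    rw [hw, this]
    have : (c + 3) * (w + 1) = (c + 3) * w + c + 3 := by ring
    omega
  · rintro T' σ' - ⟨⟨hI, hle, hN⟩, hge, hT'⟩
    have he : σ'.ireg i = σ₀.ireg n := by omega
    refine ⟨by rw [← he]; exact hI, ?_⟩
    simp at hT'
    omega

/-- Counting loops whose body takes constant time. -/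
theorem forI {i n : ℕ} {a : Program} {σ₀ : Memory} (c : ℕ)
    (Inv : ℕ → Memory → Prop) (hi : i ≠ 0) (hn : n ≠ 0) (hin : i ≠ n)
    (hai : ¬ a.wI i) (han : ¬ a.wI n) (h0 : Inv 0 (σ₀.setI i 0))
    (hb : ∀ j σ, j < σ₀.ireg n → Frame (Program.forI i n a) σ₀ σ → σ.ireg i = j → Inv j σ →
      Run a σ fun T σ' => Inv (j + 1) ((σ'.setI 0 1).setI i (j + 1)) ∧ T ≤ c) :
    Run (Program.forI i n a) σ₀ fun T σ' => Inv (σ₀.ireg n) σ' ∧ T ≤ (c + 3) * σ₀.ireg n + 2 := by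
  simpa using forI_amortized (σ₀ := σ₀) (a := a) c (fun _ => 0) Inv hi hn hin hai han h0
    (by simpa using hb)

/-- Counting loops whose body is loop-free. -/
theorem forI_loopFree {i n : ℕ} {a : Program} {σ₀ : Memory}
    (Inv : ℕ → Memory → Prop) (hi : i ≠ 0) (hn : n ≠ 0) (hin : i ≠ n) (ha : a.loopFree)
    (hai : ¬ a.wI i) (han : ¬ a.wI n) (h0 : Inv 0 (σ₀.setI i 0))
    (hb : ∀ j σ, j < σ₀.ireg n → Frame (Program.forI i n a) σ₀ σ → σ.ireg i = j → Inv j σ →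
      Inv (j + 1) (((a.exec σ).setI 0 1).setI i (j + 1))) :
    Run (Program.forI i n a) σ₀ fun T σ' =>
      Inv (σ₀.ireg n) σ' ∧ T ≤ (a.steps + 3) * σ₀.ireg n + 2 :=
  forI _ Inv hi hn hin hai han h0 fun j σ h1 h2 h3 h4 =>
    of_loopFree ha fun _ hT => ⟨hb j σ h1 h2 h3 h4, hT⟩

end Run

/-- The name of the array number `x` of the `t`-th family of working arrays, where all names
below `b` are in use. -/
def nm (b t x : ℕ) : ℕ := b + Nat.pair t x

@[simp] theorem nm_inj (b t x t' x' : ℕ) : nm b t x = nm b t' x' ↔ t = t' ∧ x = x' := by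
  simp [nm]

theorem le_nm (b t x : ℕ) : b ≤ nm b t x := Nat.le_add_right _ _

set_option linter.unusedSectionVars false

/-! ### Selecting a pivot in linear time -/

/-- The number of `x ∈ [a, b)` such that `f x` has the property `D`. -/
noncomputable def cnt (D : ℝ → Prop) (f : ℕ → ℝ) (a b : ℕ) : ℕ :=
  open Classical in ((Finset.Ico a b).filter fun x => D (f x)).card

theorem cnt_add (D : ℝ → Prop) (f : ℕ → ℝ) {a b c : ℕ} (h : a ≤ b) (h' : b ≤ c) :
    cnt D f a c = cnt D f a b + cnt D f b c := by
  classical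
  unfold cnt
  rw [← Finset.card_union_of_disjoint, ← Finset.filter_union, Finset.Ico_union_Ico_eq_Ico h h']
  exact Finset.disjoint_filter_filter (Finset.Ico_disjoint_Ico_consecutive a b c)

theorem cnt_congr {D : ℝ → Prop} {f g : ℕ → ℝ} {a b : ℕ} (h : ∀ x, a ≤ x → x < b → f x = g x) :
    cnt D f a b = cnt D g a b := by
  classical
  unfold cnt
  congr 1
  refine Finset.filter_congr fun x hx => ?_
  rw [Finset.mem_Ico] at hx
  rw [h x hx.1 hx.2]

theorem cnt_le (D : ℝ → Prop) (f : ℕ → ℝ) (a b : ℕ) : cnt D f a b ≤ b - a := by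
  classical
  exact (Finset.card_filter_le _ _).trans (by simp)

theorem cnt_self (D : ℝ → Prop) (f : ℕ → ℝ) (a : ℕ) : cnt D f a a = 0 := by
  have := cnt_le D f a a
  omega

theorem cnt_true (f : ℕ → ℝ) (a b : ℕ) : cnt (fun _ => True) f a b = b - a := by
  simp [cnt]

theorem cnt_shift (D : ℝ → Prop) (f : ℕ → ℝ) (a n : ℕ) :
    cnt D f a (a + n) = cnt D (fun x => f (a + x)) 0 n := by
  classical
  unfold cnt
  conv_rhs => rw [← Finset.card_map (addLeftEmbedding a)]
  congr 1
  ext x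
  simp only [Finset.mem_filter, Finset.mem_Ico, Finset.mem_map, addLeftEmbedding_apply]
  constructor
  · rintro ⟨⟨h1, h2⟩, h3⟩
    exact ⟨x - a, ⟨⟨by omega, by omega⟩, by rwa [Nat.add_sub_cancel' h1]⟩, by omega⟩
  · rintro ⟨y, ⟨⟨-, h2⟩, h3⟩, rfl⟩
    exact ⟨⟨by omega, by omega⟩, h3⟩

theorem cnt_not (D : ℝ → Prop) (f : ℕ → ℝ) (a b : ℕ) :
    cnt D f a b + cnt (fun x => ¬ D x) f a b = b - a := by
  classical
  unfold cnt
  rw [Finset.card_filter_add_card_filter_not]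
  simp

theorem cnt_perm {D : ℝ → Prop} {f g : ℕ → ℝ} {a b : ℕ} (e : Equiv.Perm ℕ)
    (he : ∀ x, ¬ (a ≤ x ∧ x < b) → e x = x) (hg : g = f ∘ e) : cnt D g a b = cnt D f a b := by
  classical
  have hmem : ∀ x, (a ≤ x ∧ x < b) ↔ (a ≤ e x ∧ e x < b) := by
    intro x
    constructor
    · intro h
      by_contra h'
      have h2 := he _ h'
      rw [e.injective h2] at h'
      exact h' h
    · intro h
      by_contra h'
      rw [he _ h'] at h
      exact h' h
  unfold cnt
  rw [← Finset.card_map e.toEmbedding]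
  congr 1
  ext x
  simp only [Finset.mem_map, Finset.mem_filter, Finset.mem_Ico, hg, Function.comp_apply,
    Equiv.coe_toEmbedding]
  constructor
  · rintro ⟨y, ⟨h1, h2⟩, rfl⟩
    exact ⟨(hmem y).1 h1, h2⟩
  · rintro ⟨h1, h2⟩
    exact ⟨e.symm x, ⟨(hmem _).2 (by simpa using h1), by simpa using h2⟩, by simp⟩

/-- If `P` holds on an initial segment of `[0, N)`, then its cardinality determines that segment. -/
theorem initial_segment (P : ℕ → Prop) (N : ℕ) (hP : ∀ x y, x ≤ y → y < N → P y → P x) :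
    ∃ c ≤ N, ∀ x < N, P x ↔ x < c := by
  classical
  by_cases h : ∃ x, x < N ∧ ¬ P x
  · refine ⟨Nat.find h, (Nat.find_spec h).1.le, fun x hx => ⟨fun hp => ?_, fun hc => ?_⟩⟩
    · by_contra hc
      exact (Nat.find_spec h).2 (hP _ x (not_lt.1 hc) hx hp)
    · by_contra hp
      exact Nat.find_min h hc ⟨hx, hp⟩
  · push Not at h
    exact ⟨N, le_rfl, fun x hx => ⟨fun _ => hx, fun _ => h x hx⟩⟩

theorem cnt_initial {D : ℝ → Prop} {f : ℕ → ℝ} {N c : ℕ} (hc : c ≤ N)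
    (h : ∀ x < N, D (f x) ↔ x < c) : cnt D f 0 N = c := by
  classical
  have : (Finset.Ico 0 N).filter (fun x => D (f x)) = Finset.range c := by
    ext x
    simp only [Finset.mem_filter, Finset.mem_Ico, Finset.mem_range]
    constructor
    · rintro ⟨⟨-, h1⟩, h2⟩
      exact (h x h1).1 h2
    · intro hx
      exact ⟨⟨Nat.zero_le _, by omega⟩, (h x (by omega)).2 hx⟩
  unfold cnt
  rw [this, Finset.card_range]

/-- Every fourth element of a sorted block represents the block up to rank error `3`. -/
theorem cnt_decimate {D : ℝ → Prop} (hD : ∀ x y, x ≤ y → D y → D x) {g : ℕ → ℝ} {lo b : ℕ}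
    (hg : ∀ x y, lo ≤ x → x ≤ y → y < lo + 4 * b → g x ≤ g y) :
    4 * cnt D (fun u => g (lo + 3 + 4 * u)) 0 b ≤ cnt D g lo (lo + 4 * b) ∧
    cnt D g lo (lo + 4 * b) ≤ 4 * cnt D (fun u => g (lo + 3 + 4 * u)) 0 b + 3 := by
  obtain ⟨c, hc, h⟩ := initial_segment (fun x => D (g (lo + x))) (4 * b) fun x y hxy hy =>
    hD _ _ (hg _ _ (by omega) (by omega) (by omega))
  rw [cnt_shift, cnt_initial hc h, cnt_initial (c := c / 4) (by omega)]
  · omega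
  · intro u hu
    have := h (3 + 4 * u) (by omega)
    rw [← add_assoc] at this
    rw [this]
    omega

/-- `x := y`; integer register `0` is overwritten. -/
def mv (x y : ℕ) : Program := seq (setI 0 0) (addI x y 0)

@[simp] theorem wI_mv (x y r : ℕ) : (mv x y).wI r ↔ r = 0 ∨ r = x := by simp [mv]
@[simp] theorem wR_mv (x y r : ℕ) : (mv x y).wR r ↔ False := by simp [mv]
@[simp] theorem wIA_mv (x y r : ℕ) : (mv x y).wIA r ↔ False := by simp [mv]
@[simp] theorem wRA_mv (x y r : ℕ) : (mv x y).wRA r ↔ False := by simp [mv]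

/-- Exchange sort of the real array `V` between the indices in integer registers `1` and `2`. -/
def sortBlock (V : ℕ) : Program :=
  seq (mv 3 1) (whileI 3 2 (seq (seq (mv 4 3) (whileI 4 2
    (seq (loadR 1 V 3) (seq (loadR 2 V 4)
      (seq (ifR 1 2 skip (seq (storeR V 3 2) (storeR V 4 1))) (inc 4)))))) (inc 3)))

/-- `g` arises from `f` by permuting the entries in `[a, b)`. -/
def PermOn (a b : ℕ) (f g : ℕ → ℝ) : Prop :=
  ∃ e : Equiv.Perm ℕ, (∀ x, ¬ (a ≤ x ∧ x < b) → e x = x) ∧ g = f ∘ e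

theorem PermOn.refl (a b : ℕ) (f : ℕ → ℝ) : PermOn a b f f := ⟨1, by simp, by simp⟩

theorem PermOn.swap {a b : ℕ} {f g h : ℕ → ℝ} (hf : PermOn a b f g) {i j : ℕ} (hi : a ≤ i)
    (hi' : i < b) (hj : a ≤ j) (hj' : j < b)
    (hh : ∀ x, h x = if x = j then g i else if x = i then g j else g x) : PermOn a b f h := by
  obtain ⟨e, he, rfl⟩ := hf
  refine ⟨(Equiv.swap i j).trans e, fun x hx => ?_, ?_⟩
  · rw [Equiv.trans_apply, Equiv.swap_apply_of_ne_of_ne, he x hx]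
    · rintro rfl; omega
    · rintro rfl; omega
  · funext x
    rw [hh]
    simp only [Function.comp_apply, Equiv.trans_apply, Equiv.swap_apply_def]
    split_ifs <;> simp_all

/-- Sorting takes quadratic time, which is linear for blocks of bounded length. -/
theorem sortBlock_spec (V : ℕ) (σ : Memory) :
    Run (sortBlock V) σ fun T σ' =>
      T ≤ 40 * ((σ.ireg 2 - σ.ireg 1) * (σ.ireg 2 - σ.ireg 1) + (σ.ireg 2 - σ.ireg 1) + 1) ∧
      PermOn (σ.ireg 1) (σ.ireg 2) (σ.rarr V) (σ'.rarr V) ∧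
      ∀ x y, σ.ireg 1 ≤ x → x ≤ y → y < σ.ireg 2 → σ'.rarr V x ≤ σ'.rarr V y := by
  obtain ⟨lo, hlo⟩ : ∃ lo, lo = σ.ireg 1 := ⟨_, rfl⟩
  obtain ⟨hi, hhi⟩ : ∃ hi, hi = σ.ireg 2 := ⟨_, rfl⟩
  obtain ⟨f, hf⟩ : ∃ f, f = σ.rarr V := ⟨_, rfl⟩
  simp only [← hlo, ← hhi, ← hf]
  refine Run.seq (Run.of_loopFree (by simp [mv]) fun T hT => ?_)
  simp [mv] at hT ⊢
  refine (Run.whileI (fun τ => τ.ireg 1 = lo ∧ τ.ireg 2 = hi ∧ lo ≤ τ.ireg 3 ∧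
      PermOn lo hi f (τ.rarr V) ∧
      (∀ x y, lo ≤ x → x < τ.ireg 3 → x ≤ y → y < hi → τ.rarr V x ≤ τ.rarr V y))
    (fun τ => (20 * (hi - lo) + 20) * (hi - τ.ireg 3)) ?_ ?_).mono ?_
  · simp [← hlo, ← hhi, ← hf]
    exact ⟨.refl _ _ _, fun x y h1 h2 => by omega⟩
  · rintro τ - ⟨h1, h2, h3, hp, hs⟩ hlt
    rw [h2] at hlt
    obtain ⟨i, hi3⟩ : ∃ i, i = τ.ireg 3 := ⟨_, rfl⟩
    rw [← hi3] at h3 hs hlt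
    have hb : Run (seq (mv 4 3) (whileI 4 2
        (seq (loadR 1 V 3) (seq (loadR 2 V 4)
          (seq (ifR 1 2 skip (seq (storeR V 3 2) (storeR V 4 1))) (inc 4)))))) τ fun T ρ =>
        T ≤ 20 * (hi - lo) + 6 ∧ PermOn lo hi f (ρ.rarr V) ∧
        (∀ x y, lo ≤ x → x < i + 1 → x ≤ y → y < hi → ρ.rarr V x ≤ ρ.rarr V y) := by
      refine Run.seq (Run.of_loopFree (by simp [mv]) fun T hT => ?_)
      simp [mv] at hT ⊢
      refine (Run.whileI (fun ρ => ρ.ireg 1 = lo ∧ ρ.ireg 2 = hi ∧ ρ.ireg 3 = i ∧ i ≤ ρ.ireg 4 ∧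
          PermOn lo hi f (ρ.rarr V) ∧
          (∀ x y, lo ≤ x → x < i → x ≤ y → y < hi → ρ.rarr V x ≤ ρ.rarr V y) ∧
          (∀ y, i ≤ y → y < ρ.ireg 4 → ρ.rarr V i ≤ ρ.rarr V y))
        (fun ρ => 20 * (hi - ρ.ireg 4)) ?_ ?_).mono ?_
      · simp [h1, h2, ← hi3]
        exact ⟨hp, hs, fun y _ _ => by omega⟩
      · rintro ρ - ⟨g1, g2, g3, g4, gp, gs, gm⟩ glt
        refine Run.of_loopFree (by simp) fun T hT => ?_
        simp [inc] at hT ⊢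
        rw [g2] at glt
        rw [g3]
        have hΦ : T + 1 + 20 * (hi - (ρ.ireg 4 + 1)) ≤ 20 * (hi - ρ.ireg 4) := by omega
        by_cases hc : ρ.rarr V i ≤ ρ.rarr V (ρ.ireg 4)
        · simp [hc, g1, g2, g3]
          refine ⟨⟨by omega, gp, gs, fun y h1 h2 => ?_⟩, hΦ⟩
          rcases Nat.lt_or_ge y (ρ.ireg 4) with h | h
          · exact gm y h1 h
          · obtain rfl : y = ρ.ireg 4 := by omega
            exact hc
        · simp [hc, g1, g2, g3]
          obtain ⟨v, hv⟩ : ∃ v, v = ρ.rarr V := ⟨_, rfl⟩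
          obtain ⟨j, hj⟩ : ∃ j, j = ρ.ireg 4 := ⟨_, rfl⟩
          rw [← hv, ← hj] at hc
          rw [← hv] at gp gs gm
          rw [← hj] at glt g4 gm hΦ
          simp only [← hv, ← hj]
          push Not at hc
          have hij : i ≠ j := by rintro rfl; exact lt_irrefl _ hc
          refine ⟨⟨by omega, gp.swap (i := i) (j := j) h3 hlt (by omega) glt fun x => by simp [hv],
            ?_, ?_⟩, hΦ⟩
          · intro x y q1 q2 q3 q4
            have e1 : x ≠ j := by omega
            have e2 : x ≠ i := by omega
            simp only [e1, e2, if_false]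
            split_ifs
            · exact gs x i q1 q2 (by omega) hlt
            · exact gs x j q1 q2 (by omega) glt
            · exact gs x y q1 q2 q3 q4
          · intro y q1 q2
            simp only [hij, if_false]
            split_ifs with e1 e2
            · exact hc.le
            · exact le_rfl
            · exact hc.le.trans (gm y q1 (by omega))
      · rintro T' ρ - ⟨⟨g1, g2, g3, g4, gp, gs, gm⟩, gge, hT'⟩
        rw [g2] at gge
        simp [← hi3] at hT'
        refine ⟨by omega, gp, fun x y q1 q2 q3 q4 => ?_⟩
        rcases Nat.lt_or_ge x i with h | h
        · exact gs x y q1 h q3 q4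
        · obtain rfl : x = i := by omega
          exact gm y q3 (by omega)
    refine Run.seq' hb ?_
    rintro T ρ hF ⟨hT, gp, gs⟩
    have e1 := hF.ireg 1 (by simp)
    have e2 := hF.ireg 2 (by simp)
    have e3 := hF.ireg 3 (by simp)
    refine Run.of_loopFree (by simp) fun T1 hT1 => ?_
    simp [inc, e1, e2, e3, h1, h2, ← hi3] at hT1 ⊢
    refine ⟨⟨by omega, gp, fun x y q1 q2 => gs x y q1 (by omega)⟩, ?_⟩
    obtain ⟨w, hw⟩ : ∃ w, hi - i = w + 1 := ⟨hi - i - 1, by omega⟩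
    have : hi - (i + 1) = w := by omega
    rw [hw, this, mul_add]
    omega
  · rintro T' τ - ⟨⟨h1, h2, h3, hp, hs⟩, hge, hT'⟩
    rw [h2] at hge
    simp [← hlo] at hT'
    refine ⟨?_, hp, fun x y q1 q2 q3 => hs x y q1 (by omega) q2 q3⟩
    nlinarith

/-- The copying part of `sampleBlock`. -/
def copyFourth (V : ℕ) : Program :=
  whileI 9 2 (seq (loadR 1 V 9) (seq (storeR V 8 1) (seq (inc 8) (seq (setI 0 4) (addI 9 9 0)))))

/-- Sort the block between the indices in integer registers `1` and `2`, move every fourth of its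
entries to the position in integer register `8`, and go on to the next block. -/
def sampleBlock (V : ℕ) : Program :=
  seq (sortBlock V) (seq (seq (mv 9 1) (seq (setI 0 3) (addI 9 9 0)))
    (seq (copyFourth V) (seq (mv 1 2) (addI 2 2 6))))

theorem copyFourth_spec (V : ℕ) (σ : Memory) (lo b out : ℕ) (g : ℕ → ℝ) (h9 : σ.ireg 9 = lo + 3)
    (h2 : σ.ireg 2 = lo + 4 * b) (h8 : σ.ireg 8 = out) (ho : out ≤ lo) (hg : σ.rarr V = g) :
    Run (copyFourth V) σ fun T σ' => T ≤ 10 * b + 1 ∧ σ'.ireg 8 = out + b ∧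
      (∀ x, x < out → σ'.rarr V x = g x) ∧ (∀ x, out + b ≤ x → σ'.rarr V x = g x) ∧
      (∀ u < b, σ'.rarr V (out + u) = g (lo + 3 + 4 * u)) := by
  refine (Run.whileI (fun τ => ∃ t ≤ b, τ.ireg 2 = lo + 4 * b ∧ τ.ireg 9 = lo + 3 + 4 * t ∧
      τ.ireg 8 = out + t ∧
      (∀ x, x < out → τ.rarr V x = g x) ∧ (∀ x, out + t ≤ x → τ.rarr V x = g x) ∧
      (∀ u < t, τ.rarr V (out + u) = g (lo + 3 + 4 * u)))
    (fun τ => 10 * (b - (τ.ireg 8 - out))) ?_ ?_).mono ?_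
  · exact ⟨0, Nat.zero_le _, h2, by simpa using h9, by simpa using h8, fun x _ => by rw [hg],
      fun x _ => by rw [hg], fun u hu => by omega⟩
  · rintro τ - ⟨t, ht, e2, e9, e8, k1, k2, k3⟩ hlt
    rw [e9, e2] at hlt
    refine Run.of_loopFree (by simp) fun T hT => ?_
    simp [inc] at hT ⊢
    refine ⟨⟨t + 1, by omega, e2, by omega, by omega, ?_, ?_, ?_⟩, by omega⟩
    · intro x hx
      rw [if_neg (by omega), k1 x hx]
    · intro x hx
      rw [if_neg (by omega), k2 x (by omega)]
    · intro u hu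
      by_cases hut : u = t
      · subst hut
        rw [if_pos e8.symm, e9, k2 _ (by omega)]
      · rw [if_neg (by omega), k3 u (by omega)]
  · rintro T τ - ⟨⟨t, ht, e2, e9, e8, k1, k2, k3⟩, hge, hT⟩
    obtain rfl : t = b := by omega
    simp only [h8] at hT
    exact ⟨by omega, e8, k1, k2, k3⟩

theorem sampleBlock_spec (V : ℕ) (σ : Memory) (lo b out : ℕ) (f : ℕ → ℝ) (h1 : σ.ireg 1 = lo)
    (h2 : σ.ireg 2 = lo + 4 * b) (h8 : σ.ireg 8 = out) (ho : 4 * out = lo) (hf : σ.rarr V = f)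
    (hb : 1 ≤ b) :
    Run (sampleBlock V) σ fun T σ' => T ≤ 900 * (b * b) ∧ σ'.ireg 1 = lo + 4 * b ∧
      σ'.ireg 2 = lo + 4 * b + σ.ireg 6 ∧ σ'.ireg 8 = out + b ∧
      (∀ x, x < out → σ'.rarr V x = f x) ∧ (∀ x, lo + 4 * b ≤ x → σ'.rarr V x = f x) ∧
      (∀ D : ℝ → Prop, (∀ x y, x ≤ y → D y → D x) →
        4 * cnt D (σ'.rarr V) out (out + b) ≤ cnt D f lo (lo + 4 * b) ∧
        cnt D f lo (lo + 4 * b) ≤ 4 * cnt D (σ'.rarr V) out (out + b) + 3) := by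
  refine Run.seq' (sortBlock_spec V σ) ?_
  rintro T1 τ hF ⟨hT1, ⟨e, he, hg⟩, hs⟩
  rw [h1, h2] at hT1 he hs
  have t1 := hF.ireg 1 (by simp [sortBlock])
  have t2 := hF.ireg 2 (by simp [sortBlock])
  have t6 := hF.ireg 6 (by simp [sortBlock])
  have t8 := hF.ireg 8 (by simp [sortBlock])
  refine Run.seq (Run.of_loopFree (by simp [mv]) fun T2 hT2 => ?_)
  simp [mv] at hT2 ⊢
  refine Run.seq' (copyFourth_spec V _ lo b out (τ.rarr V) (by simp [t1, h1]) (by simp [t2, h2])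
    (by simp [t8, h8]) (by omega) (by simp)) ?_
  rintro T3 ρ hF' ⟨hT3, r8, k1, k2, k3⟩
  have r2 := hF'.ireg 2 (by simp [copyFourth])
  have r6 := hF'.ireg 6 (by simp [copyFourth])
  simp [t2, t6, h2] at r2 r6
  refine Run.of_loopFree (by simp) fun T4 hT4 => ?_
  simp [r2, r6, r8] at hT4 ⊢
  have hfe : ∀ x, ¬ (lo ≤ x ∧ x < lo + 4 * b) → τ.rarr V x = f x := by
    intro x hx
    rw [hg, hf]
    simp [he x hx]
  refine ⟨?_, fun x hx => ?_, fun x hx => ?_, ?_⟩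
  · have : lo + 4 * b - lo = 4 * b := by omega
    rw [this] at hT1
    nlinarith
  · rw [k1 x hx, hfe x (by omega)]
  · rw [k2 x (by omega), hfe x (by omega)]
  · intro D hD
    have := cnt_decimate hD hs
    rw [cnt_perm (f := f) e he (by rw [hg, hf])] at this
    rw [cnt_shift D (ρ.rarr V) out b, cnt_congr (g := fun u => τ.rarr V (lo + 3 + 4 * u))]
    · exact this
    · intro u _ hu
      exact k3 u hu

/-- One round of sampling: the first `n` entries of the array `V`, where `n` is in integer register
`5`, are divided into blocks whose length is in integer register `6`. -/
def sampleLevel (V : ℕ) : Program :=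
  seq (seq (setI 8 0) (seq (setI 1 0) (mv 2 6)))
    (seq (whileI 2 10 (sampleBlock V))
      (seq (mv 5 8) (seq (addI 6 6 6) (seq (addI 7 7 7) (seq (mv 10 5) (inc 10))))))

/-- A round takes `n * b` steps up to a constant, and reduces the number of entries by a factor of `4`.
The ranks, times `4`, change by at most `3` for each of the `q` complete blocks, and by the length of the
incomplete one. The block length is doubled for the next round. -/
theorem sampleLevel_spec (V : ℕ) (σ : Memory) (n b : ℕ) (f : ℕ → ℝ)
    (h6 : σ.ireg 6 = 4 * b) (h10 : σ.ireg 10 = n + 1) (hb : 1 ≤ b) (hn : 4 * b ≤ n)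
    (hf : σ.rarr V = f) :
    Run (sampleLevel V) σ fun T σ' => T ≤ 1000 * (n * b) ∧ ∃ q, 1 ≤ q ∧ q * (4 * b) ≤ n ∧
      σ'.ireg 5 = q * b ∧ σ'.ireg 6 = 8 * b ∧ σ'.ireg 7 = 2 * σ.ireg 7 ∧ σ'.ireg 10 = q * b + 1 ∧
      (∀ D : ℝ → Prop, (∀ x y, x ≤ y → D y → D x) →
        4 * cnt D (σ'.rarr V) 0 (q * b) ≤ cnt D f 0 n ∧
        cnt D f 0 n ≤ 4 * cnt D (σ'.rarr V) 0 (q * b) + 3 * q + 4 * b) := by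
  refine Run.seq (Run.of_loopFree (by simp [mv]) fun T1 hT1 => ?_)
  simp [mv] at hT1 ⊢
  refine Run.seq' (Run.whileI (fun τ => ∃ q, q * (4 * b) ≤ n ∧ τ.ireg 1 = q * (4 * b) ∧
      τ.ireg 2 = q * (4 * b) + 4 * b ∧ τ.ireg 8 = q * b ∧ τ.ireg 10 = n + 1 ∧
      τ.ireg 6 = 4 * b ∧ (∀ x, q * (4 * b) ≤ x → τ.rarr V x = f x) ∧
      (∀ D : ℝ → Prop, (∀ x y, x ≤ y → D y → D x) →
        4 * cnt D (τ.rarr V) 0 (q * b) ≤ cnt D f 0 (q * (4 * b)) ∧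
        cnt D f 0 (q * (4 * b)) ≤ 4 * cnt D (τ.rarr V) 0 (q * b) + 3 * q))
    (fun τ => 225 * b * (n - τ.ireg 1) + (n + 1 - τ.ireg 1)) ?_ ?_) ?_
  · refine ⟨0, by simp, by simp, by simp [h6], by simp, by simp [h10], by simp [h6],
      fun x _ => by simp [hf], fun D _ => by simp [cnt_self]⟩
  · rintro τ - ⟨q, hq, e1, e2, e8, e10, e6, hfe, hc⟩ hlt
    rw [e2, e10] at hlt
    refine (sampleBlock_spec V τ (q * (4 * b)) b (q * b) (τ.rarr V) e1 e2 e8 (by ring) rfl hb).mono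
      ?_
    rintro T ρ hF ⟨hT, r1, r2, r8, k1, k2, k3⟩
    have r6 := hF.ireg 6 (by simp [sampleBlock, sortBlock, copyFourth])
    have r10 := hF.ireg 10 (by simp [sampleBlock, sortBlock, copyFourth])
    have s1 : (q + 1) * (4 * b) = q * (4 * b) + 4 * b := by ring
    have s2 : (q + 1) * b = q * b + b := by ring
    refine ⟨⟨q + 1, by omega, by rw [r1, s1], by rw [r2, e6, s1], by rw [r8, s2], by rw [r10, e10],
      by rw [r6, e6], fun x hx => ?_, fun D hD => ?_⟩, ?_⟩
    · rw [k2 x (by omega), hfe x (by omega)]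
    · rw [s1, s2, cnt_add D f (Nat.zero_le _) (Nat.le_add_right (q * (4 * b)) (4 * b)),
        cnt_add D (ρ.rarr V) (Nat.zero_le _) (Nat.le_add_right (q * b) b),
        cnt_congr (f := ρ.rarr V) (g := τ.rarr V) (a := 0) fun x _ hx => k1 x hx]
      obtain ⟨a1, a2⟩ := hc D hD
      obtain ⟨a3, a4⟩ := k3 D hD
      rw [cnt_congr (f := τ.rarr V) (g := f) fun x hx _ => hfe x hx] at a3 a4
      omega
    · rw [r1, e1]
      obtain ⟨w, hw⟩ : ∃ w, n - q * (4 * b) = w + 4 * b := ⟨n - q * (4 * b) - 4 * b, by omega⟩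
      have : n - (q * (4 * b) + 4 * b) = w := by omega
      rw [hw, this]
      have : 225 * b * (w + 4 * b) = 225 * b * w + 900 * (b * b) := by ring
      omega
  · rintro T2 τ hF ⟨⟨q, hq, e1, e2, e8, e10, e6, hfe, hc⟩, hge, hT2⟩
    rw [e10, e2] at hge
    have e7 := hF.ireg 7 (by simp [sampleBlock, sortBlock, copyFourth])
    simp at e7 hT2
    refine Run.of_loopFree (by simp) fun T3 hT3 => ?_
    simp [inc, e8, e6, e7] at hT3 ⊢
    refine ⟨?_, q, ?_, hq, by simp, by ring, by ring, by simp, fun D hD => ?_⟩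
    · nlinarith
    · rcases Nat.eq_zero_or_pos q with rfl | h
      · simp at hge; omega
      · exact h
    · obtain ⟨a1, a2⟩ := hc D hD
      rw [cnt_add D f (Nat.zero_le _) hq]
      have := cnt_le D f (q * (4 * b)) n
      omega

/-- Copy the weights from the array `W` to the array `V`; their number is in integer register
`20`. Then determine an element of middle rank up to a constant factor. -/
def selectPivot (V W : ℕ) : Program :=
  seq (forI 12 20 (seq (loadR 1 W 12) (storeR V 12 1)))
  (seq (seq (mv 5 20) (seq (setI 6 64) (seq (setI 7 1024) (seq (mv 10 5) (inc 10)))))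
  (seq (whileI 7 10 (sampleLevel V))
  (seq (seq (setI 1 0) (mv 2 5))
  (seq (sortBlock V)
  (seq (seq (setI 3 0) (setI 4 2))
  (seq (whileI 4 10 (seq (inc 3) (seq (inc 4) (inc 4)))) (loadR 3 V 3)))))))

/-- The accumulated rank error of the sampling rounds stays below a quarter of the number of
elements: blocks of length `B = 4 * b` contribute `3 / B` of it, and the incomplete blocks form a
geometric series dominated by its last term. -/
theorem sample_error {m n b s q : ℕ} {err : ℝ} (hb : 1 ≤ b) (hsn : s * n ≤ m)
    (hq : q * (4 * b) ≤ n)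
    (herr : err ≤ 6 * m * (1 / 64 - 1 / (4 * b)) + (4 * s * b - 64) / 7) :
    err + s * (3 * q + 4 * b) ≤
      6 * m * (1 / 64 - 1 / (4 * (2 * b))) + (4 * (4 * s) * (2 * b) - 64) / 7 := by
  have hb' : (1 : ℝ) ≤ b := by exact_mod_cast hb
  have h1 : (s : ℝ) * q * (4 * b) ≤ m := by
    have : s * (q * (4 * b)) ≤ m := (Nat.mul_le_mul_left s hq).trans hsn
    have h : (s : ℝ) * (q * (4 * b)) ≤ m := by exact_mod_cast this
    linarith
  have h2 : (s : ℝ) * q ≤ m / (4 * b) := by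
    rw [le_div_iff₀ (by positivity)]
    exact h1
  have h3 : (6 : ℝ) * m * (1 / 64 - 1 / (4 * (2 * b))) = 6 * m * (1 / 64 - 1 / (4 * b)) +
      3 * (m / (4 * b)) := by
    field_simp
    ring
  rw [h3]
  linarith

/-- The pivot is found in linear time, and at least a quarter of the weights are on either side of it.
As the number of entries is divided by `4` from round to round while the block length is doubled, the
times of the rounds form a geometric series. The rounds stop when the number of entries is below a
multiple of the block length, and then sorting them takes less than linear time. -/
theorem selectPivot_spec (V W : ℕ) (hVW : W ≠ V) (σ : Memory) (m : ℕ) (h20 : σ.ireg 20 = m)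
    (hm : 1 ≤ m) :
    Run (selectPivot V W) σ fun T σ' => T ≤ 200000 * m ∧
      m ≤ 4 * cnt (fun x => x ≤ σ'.rreg 3) (σ.rarr W) 0 m ∧
      m ≤ 4 * cnt (fun x => σ'.rreg 3 ≤ x) (σ.rarr W) 0 m := by
  obtain ⟨f, hf⟩ : ∃ f, f = σ.rarr W := ⟨_, rfl⟩
  rw [← hf]
  refine Run.seq' (Run.forI_loopFree (fun j τ => ∀ x < j, τ.rarr V x = f x) (by simp) (by simp)
    (by simp) (by simp) (by simp) (by simp) (by simp) ?_) ?_
  · intro j τ hj hF hi hI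
    have hW := hF.rarr W (by simp [hVW])
    simp [hi, hW]
    intro x hx
    split_ifs with h
    · rw [h, hf]
    · exact hI x (by omega)
  rintro T1 τ hF ⟨hV, hT1⟩
  rw [h20] at hV hT1
  simp at hT1
  have t20 := hF.ireg 20 (by simp)
  refine Run.seq (Run.of_loopFree (by simp [mv]) fun T2 hT2 => ?_)
  simp [mv, inc, t20, h20] at hT2 ⊢
  refine Run.seq' (Run.whileI (fun ρ => ∃ n b s : ℕ, ∃ err : ℝ, 1 ≤ n ∧ 16 ≤ b ∧ ρ.ireg 5 = n ∧
      ρ.ireg 6 = 4 * b ∧ ρ.ireg 7 = 64 * b ∧ ρ.ireg 10 = n + 1 ∧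
      err ≤ 6 * m * (1 / 64 - 1 / (4 * b)) + (4 * s * b - 64) / 7 ∧
      (4 * s * b = 64 ∨ 8 * s * b ≤ m) ∧
      (∀ D : ℝ → Prop, (∀ x y, x ≤ y → D y → D x) →
        s * cnt D (ρ.rarr V) 0 n ≤ cnt D f 0 m ∧
        (cnt D f 0 m : ℝ) ≤ s * cnt D (ρ.rarr V) 0 n + err))
    (fun ρ => 1500 * (ρ.ireg 5 * ρ.ireg 6)) ?_ ?_) ?_
  · refine ⟨m, 16, 1, 0, hm, le_rfl, by simp, by simp, by simp, by simp, by norm_num, by simp,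
      fun D _ => ?_⟩
    simp only [Memory.rarr_setI]
    rw [cnt_congr (g := f) fun x _ hx => hV x hx]
    simp
  · rintro ρ - ⟨n, b, s, err, hn, hb, e5, e6, e7, e10, herr, hsb, hc⟩ hlt
    rw [e7, e10] at hlt
    refine (sampleLevel_spec V ρ n b _ e6 e10 (by omega) (by omega) rfl).mono ?_
    rintro T π - ⟨hT, q, hq1, hq, p5, p6, p7, p10, hd⟩
    have hsn : s * n ≤ m := by simpa [cnt_true] using (hc (fun _ => True) (by simp)).1
    refine ⟨⟨q * b, 2 * b, 4 * s, err + s * (3 * q + 4 * b), ?_, by omega, p5, by rw [p6]; ring,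
      by rw [p7, e7]; ring, p10, ?_, ?_, ?_⟩, ?_⟩
    · exact Nat.mul_pos hq1 (by omega)
    · have := sample_error (by omega) hsn hq herr
      push_cast
      exact this
    · right
      have : s * (64 * b) ≤ s * n := Nat.mul_le_mul_left s (by omega)
      nlinarith
    · intro D hD
      obtain ⟨a1, a2⟩ := hc D hD
      obtain ⟨a3, a4⟩ := hd D hD
      constructor
      · have := Nat.mul_le_mul_left s a3
        calc 4 * s * cnt D (π.rarr V) 0 (q * b) = s * (4 * cnt D (π.rarr V) 0 (q * b)) := by ring
          _ ≤ _ := this.trans a1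
      · have h : (cnt D (ρ.rarr V) 0 n : ℝ) ≤ 4 * cnt D (π.rarr V) 0 (q * b) + 3 * q + 4 * b := by
          exact_mod_cast a4
        have := mul_le_mul_of_nonneg_left h (Nat.cast_nonneg (α := ℝ) s)
        push_cast
        linarith
    · rw [e5, e6, p5, p6]
      have h1 : q * b * (8 * b) = 2 * (q * (4 * b)) * b := by ring
      have h2 : q * (4 * b) * b ≤ n * b := Nat.mul_le_mul_right b hq
      have h3 : 1 * 16 ≤ n * b := Nat.mul_le_mul hn hb
      have h4 : n * (4 * b) = 4 * (n * b) := by ring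
      rw [h4, h1]
      nlinarith
  rintro T3 ρ - ⟨⟨n, b, s, err, hn, hb, e5, e6, e7, e10, herr, hsb, hc⟩, hge, hT3⟩
  rw [e7, e10] at hge
  simp [e5, e6] at hT3
  refine Run.seq (Run.of_loopFree (by simp) fun T4 hT4 => ?_)
  simp at hT4 ⊢
  refine Run.seq' (sortBlock_spec V _) ?_
  simp [e5]
  rintro T5 π hF' hT5 ⟨e, he, hπ⟩ hs
  have p10 := hF'.ireg 10 (by simp [sortBlock])
  simp [e10] at p10
  refine Run.seq (Run.of_loopFree (by simp) fun T6 hT6 => ?_)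
  simp at hT6 ⊢
  refine Run.seq' (Run.whileI (fun α => α.ireg 10 = n + 1 ∧ α.ireg 4 = 2 * α.ireg 3 + 2 ∧
      2 * α.ireg 3 ≤ n ∧ α.rarr V = π.rarr V) (fun α => 10 * (n + 1 - α.ireg 4)) ?_ ?_) ?_
  · simp [p10]
  · rintro α - ⟨a10, a4, a3, aV⟩ hlt
    refine Run.of_loopFree (by simp) fun T hT => ?_
    simp at hT ⊢
    exact ⟨⟨a10, by omega, by omega, aV⟩, by omega⟩
  rintro T7 α - ⟨⟨a10, a4, a3, aV⟩, hge', hT7⟩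
  refine Run.of_loopFree (by simp) fun T8 hT8 => ?_
  simp at hT8 ⊢
  simp at hT7
  obtain ⟨i, hi⟩ : ∃ i, i = α.ireg 3 := ⟨_, rfl⟩
  rw [aV, ← hi]
  rw [← hi] at a3 a4
  obtain ⟨p, hp⟩ : ∃ p, p = π.rarr V i := ⟨_, rfl⟩
  rw [← hp]
  have hsn := hc (fun _ => True) (by simp)
  simp only [cnt_true, Nat.sub_zero] at hsn
  have hperm : ∀ D : ℝ → Prop, cnt D (π.rarr V) 0 n = cnt D (ρ.rarr V) 0 n := fun D =>
    cnt_perm (f := ρ.rarr V) e (by simpa using he) (by simpa using hπ)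
  have herr' : err ≤ m / 4 := by
    have h1 : (0 : ℝ) ≤ 1 / (4 * b) := by positivity
    have hm0 : (0 : ℝ) ≤ m := Nat.cast_nonneg m
    have h2 : (6 * m * (1 / 64 - 1 / (4 * b)) : ℝ) ≤ 6 * m * (1 / 64) := by
      apply mul_le_mul_of_nonneg_left <;> linarith
    rcases hsb with h | h
    · have : (4 * s * b : ℝ) = 64 := by exact_mod_cast h
      linarith
    · have : (8 * s * b : ℝ) ≤ m := by exact_mod_cast h
      linarith
  refine ⟨?_, ?_, ?_⟩
  · have h1 : n * n ≤ n * (64 * b) := Nat.mul_le_mul_left n (by omega)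
    have h2 : n * (64 * b) = 16 * (n * (4 * b)) := by ring
    have h3 : 1 * 16 ≤ n * b := Nat.mul_le_mul hn hb
    have h4 : n * (4 * b) = 4 * (n * b) := by ring
    have h5 : n * 16 ≤ n * b := Nat.mul_le_mul_left n hb
    omega
  · obtain ⟨a1, a2⟩ := hc (fun x => x ≤ p) fun x y hxy hy => hxy.trans hy
    rw [← hperm] at a1
    have h1 : i + 1 ≤ cnt (fun x => x ≤ p) (π.rarr V) 0 n := by
      rw [cnt_add _ _ (Nat.zero_le (i + 1)) (by omega : i + 1 ≤ n),
        cnt_initial (c := i + 1) le_rfl]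
      · omega
      · intro x hx
        simp only [hx, iff_true]
        rw [hp]
        exact hs x i (by omega) (by omega)
    have h2 : s * (i + 1) ≤ cnt (fun x => x ≤ p) f 0 m := (Nat.mul_le_mul_left s h1).trans a1
    have h3 : s * n ≤ s * (2 * (i + 1)) := Nat.mul_le_mul_left s (by omega)
    have h4 : s * (2 * (i + 1)) = 2 * (s * (i + 1)) := by ring
    have h5 : (m : ℝ) ≤ 4 * cnt (fun x => x ≤ p) f 0 m := by
      have h6 : (s * n : ℝ) ≤ 2 * cnt (fun x => x ≤ p) f 0 m := by exact_mod_cast (by omega)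
      linarith [hsn.2]
    exact_mod_cast h5
  · obtain ⟨a1, a2⟩ := hc (fun x => x < p) fun x y hxy hy => hxy.trans_lt hy
    rw [← hperm] at a2
    have h1 : cnt (fun x => x < p) (π.rarr V) 0 n ≤ i := by
      rw [cnt_add _ _ (Nat.zero_le i) (by omega : i ≤ n)]
      have h0 : cnt (fun x => x < p) (π.rarr V) i n = 0 := by
        classical
        unfold cnt
        rw [Finset.card_eq_zero, Finset.filter_eq_empty_iff]
        intro x hx
        rw [Finset.mem_Ico] at hx
        rw [hp, not_lt]
        exact hs i x hx.1 hx.2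
      have := cnt_le (fun x => x < p) (π.rarr V) 0 i
      omega
    have hcn := cnt_not (fun x => x < p) f 0 m
    simp only [not_lt] at hcn
    have h2 : (s * cnt (fun x => x < p) (π.rarr V) 0 n : ℝ) ≤ s * i := by
      exact_mod_cast Nat.mul_le_mul_left s h1
    have h3 : (s * i * 2 : ℝ) ≤ s * n := by
      have : s * (2 * i) ≤ s * n := Nat.mul_le_mul_left s a3
      have h : (s * (2 * i) : ℝ) ≤ s * n := by exact_mod_cast this
      linarith
    have h4 : (s * n : ℝ) ≤ m := by exact_mod_cast hsn.1
    have h5 : (cnt (fun x => x < p) f 0 m : ℝ) + cnt (fun x => p ≤ x) f 0 m = m := by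
      exact_mod_cast (by simpa using hcn)
    have h6 : (m : ℝ) ≤ 4 * cnt (fun x => p ≤ x) f 0 m := by linarith
    exact_mod_cast h6

/-! ### Connected components in linear time -/

/-- The edge list `(A e, B e)`, `e < m`, together with the marks `M`, as an adjacency relation:
`u` and `v` are joined by a marked edge. -/
def MarkedAdj (A B M : ℕ → ℕ) (m u v : ℕ) : Prop := ∃ e < m, 1 ≤ M e ∧ A e = u ∧ B e = v

/-- `u` is an endpoint of an edge. -/
def IsNode (A : ℕ → ℕ) (m u : ℕ) : Prop := ∃ e < m, A e = u

/-- `H` and `X` hold linked lists of marked edges: those with first endpoint `u` and of index less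
than `H u`, in decreasing order. Entries of `H` and `X` are edge indices plus one, and `0` marks the
end of a list. -/
structure EdgeLists (A M : ℕ → ℕ) (m : ℕ) (H X : ℕ → ℕ) : Prop where
  head_le : ∀ u, IsNode A m u → H u ≤ m
  head : ∀ u, IsNode A m u → H u ≠ 0 → 1 ≤ M (H u - 1) ∧ A (H u - 1) = u
  next_le : ∀ e < m, 1 ≤ M e → X e ≤ e
  next : ∀ e < m, 1 ≤ M e → X e ≠ 0 → 1 ≤ M (X e - 1) ∧ A (X e - 1) = A e
  skip : ∀ e < m, 1 ≤ M e → ∀ e' < e, 1 ≤ M e' → A e' = A e → e' < X e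

/-- The number of edges that are still in the lists. -/
noncomputable def remaining (A M : ℕ → ℕ) (m : ℕ) (H : ℕ → ℕ) : ℕ :=
  ((Finset.range m).filter fun e => 1 ≤ M e ∧ e < H (A e)).card

theorem remaining_le (A M : ℕ → ℕ) (m : ℕ) (H : ℕ → ℕ) : remaining A M m H ≤ m :=
  (Finset.card_filter_le _ _).trans (by simp)

/-- The state of the labelling of components. A node in the component of `r` gets the label `r + 1`,
and `0` means that the node has not been reached. An edge that has been taken from its list joins
nodes of equal labels. -/
structure Labelling (A B M : ℕ → ℕ) (m : ℕ) (H X L : ℕ → ℕ) : Prop where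
  lists : EdgeLists A M m H X
  closed : ∀ e < m, 1 ≤ M e → H (A e) ≤ e → L (B e) = L (A e) ∧ L (A e) ≠ 0
  sound : ∀ u, IsNode A m u → L u ≠ 0 → Relation.ReflTransGen (MarkedAdj A B M m) (L u - 1) u

/-- The state of a breadth-first search from `r`. The queue is `Q` with read and write positions
`qh` and `qt`; `P` holds the queue positions of parents, `S` the queue positions of nodes, and `L₀` is
the labelling at the start of the search. -/
structure Searching (A B M : ℕ → ℕ) (m r : ℕ) (L₀ H X L Q P S : ℕ → ℕ) (qh qt : ℕ) : Prop
    extends Labelling A B M m H X L where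
  qh_le : qh ≤ qt
  qt_pos : 0 < qt
  root : Q 0 = r
  node : ∀ q < qt, IsNode A m (Q q)
  label : ∀ q < qt, L (Q q) = r + 1
  tree : ∀ q < qt, q ≠ 0 → P q < q ∧ MarkedAdj A B M m (Q (P q)) (Q q)
  active : ∀ u, IsNode A m u → L u ≠ 0 → H u = 0 ∨ ∃ q, qh ≤ q ∧ q < qt ∧ Q q = u
  keep : ∀ u, IsNode A m u → L₀ u ≠ 0 → L u ≠ 0
  pos : ∀ u, IsNode A m u → L₀ u = 0 → L u ≠ 0 → S u < qt ∧ Q (S u) = u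

section
variable {A B M : ℕ → ℕ} {m r : ℕ} {L₀ H X L Q P S : ℕ → ℕ} {qh qt : ℕ}

theorem Searching.advance (h : Searching A B M m r L₀ H X L Q P S qh qt) (hlt : qh < qt)
    (h0 : H (Q qh) = 0) : Searching A B M m r L₀ H X L Q P S (qh + 1) qt :=
  { h with
    qh_le := hlt
    active := fun u hu hL => by
      rcases h.active u hu hL with h1 | ⟨q, h1, h2, h3⟩
      · exact .inl h1
      · rcases Nat.eq_or_lt_of_le h1 with rfl | h4
        · exact .inl (h3 ▸ h0)
        · exact .inr ⟨q, h4, h2, h3⟩ }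

theorem EdgeLists.take (h : EdgeLists A M m H X) {u : ℕ} (hu : IsNode A m u) (h0 : H u ≠ 0)
    {H' : ℕ → ℕ} (hH : ∀ z, H' z = if z = u then X (H u - 1) else H z) :
    EdgeLists A M m H' X ∧ remaining A M m H' + 1 ≤ remaining A M m H := by
  have h1 := h.head_le u hu
  obtain ⟨h2, h3⟩ := h.head u hu h0
  have h4 := h.next_le (H u - 1) (by omega) h2
  constructor
  · refine ⟨fun z hz => ?_, fun z hz hz0 => ?_, h.next_le, h.next, h.skip⟩
    · rw [hH]
      split_ifs
      · omega
      · exact h.head_le z hz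
    · rw [hH] at hz0 ⊢
      split_ifs at hz0 ⊢ with hzu
      · have := h.next (H u - 1) (by omega) h2 hz0
        rw [h3, ← hzu] at this
        rwa [← hzu]
      · exact h.head z hz hz0
  · unfold remaining
    rw [Nat.add_one_le_iff]
    refine Finset.card_lt_card (Finset.ssubset_iff_of_subset ?_ |>.2 ⟨H u - 1, ?_, ?_⟩)
    · intro e he
      simp only [Finset.mem_filter, Finset.mem_range] at he ⊢
      refine ⟨he.1, he.2.1, ?_⟩
      have := he.2.2
      rw [hH] at this
      split_ifs at this with hu
      · rw [hu]; omega
      · exact this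
    · simp only [Finset.mem_filter, Finset.mem_range, h3]
      exact ⟨by omega, h2, by omega⟩
    · simp only [Finset.mem_filter, Finset.mem_range, h3, hH, if_true]
      omega

/-- Taking an edge from the list of an active node, to a node that is labelled already. By symmetry
of the edge list, that node has the label of the current search. -/
theorem Searching.skip_edge (h : Searching A B M m r L₀ H X L Q P S qh qt) (hlt : qh < qt)
    (hsym : ∀ e < m, 1 ≤ M e → ∃ e' < m, 1 ≤ M e' ∧ A e' = B e ∧ B e' = A e)
    (h0 : H (Q qh) ≠ 0) (hv : L (B (H (Q qh) - 1)) ≠ 0)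
    {H' : ℕ → ℕ} (hH : ∀ z, H' z = if z = Q qh then X (H (Q qh) - 1) else H z) :
    Searching A B M m r L₀ H' X L Q P S qh qt := by
  obtain ⟨u, hu⟩ : ∃ u, u = Q qh := ⟨_, rfl⟩
  rw [← hu] at h0 hv hH
  have hN : IsNode A m u := hu ▸ h.node qh hlt
  have h1 := h.lists.head_le u hN
  obtain ⟨h2, h3⟩ := h.lists.head u hN h0
  refine { h with lists := (h.lists.take hN h0 hH).1, closed := ?_, active := ?_ }
  · intro e he hm hle
    rw [hH] at hle
    split_ifs at hle with hue
    · rcases Nat.lt_or_ge e (H u) with h4 | h4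
      · rcases Nat.eq_or_lt_of_le (Nat.le_sub_one_of_lt h4) with h5 | h5
        · have hLu : L u = r + 1 := hu ▸ h.label qh hlt
          subst h5
          rw [h3, hLu]
          refine ⟨?_, by simp⟩
          obtain ⟨e', he', hm', hA', hB'⟩ := hsym _ he hm
          rcases h.active _ ⟨e', he', hA'⟩ hv with h6 | ⟨q, -, h7, h8⟩
          · have := (h.closed e' he' hm' (by rw [hA', h6]; exact Nat.zero_le _)).1
            rw [hA', hB', h3, hLu] at this
            exact this.symm
          · rw [← h8]
            exact h.label q h7
        · have := h.lists.skip (H u - 1) (by omega) h2 e h5 hm (by rw [hue, h3])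
          omega
      · exact h.closed e he hm (by rw [hue]; exact h4)
    · exact h.closed e he hm hle
  · intro z hz hL
    rw [hH]
    split_ifs with hzu
    · exact .inr ⟨qh, le_rfl, hlt, by rw [hzu, hu]⟩
    · exact h.active z hz hL

/-- Taking an edge from the list of an active node, to a node that has not been reached. -/
theorem Searching.visit (h : Searching A B M m r L₀ H X L Q P S qh qt) (hlt : qh < qt)
    (hsym : ∀ e < m, 1 ≤ M e → ∃ e' < m, 1 ≤ M e' ∧ A e' = B e ∧ B e' = A e)
    (h0 : H (Q qh) ≠ 0) {v : ℕ} (hv : v = B (H (Q qh) - 1)) (hv0 : L v = 0)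
    {H' L' Q' P' S' : ℕ → ℕ} (hH : ∀ z, H' z = if z = Q qh then X (H (Q qh) - 1) else H z)
    (hL : ∀ z, L' z = if z = v then r + 1 else L z) (hQ : ∀ z, Q' z = if z = qt then v else Q z)
    (hP : ∀ z, P' z = if z = qt then qh else P z) (hS : ∀ z, S' z = if z = v then qt else S z) :
    Searching A B M m r L₀ H' X L' Q' P' S' qh (qt + 1) := by
  obtain ⟨u, hu⟩ : ∃ u, u = Q qh := ⟨_, rfl⟩
  rw [← hu] at h0 hv hH
  have hN : IsNode A m u := hu ▸ h.node qh hlt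
  have h1 := h.lists.head_le u hN
  obtain ⟨h2, h3⟩ := h.lists.head u hN h0
  have hLu : L u = r + 1 := hu ▸ h.label qh hlt
  have hadj : MarkedAdj A B M m u v := ⟨H u - 1, by omega, h2, h3, hv.symm⟩
  have hNv : IsNode A m v := by
    obtain ⟨e', he', -, hA', -⟩ := hsym (H u - 1) (by omega) h2
    exact ⟨e', he', by rw [hA', hv]⟩
  have hLne : ∀ z, L z ≠ 0 → L' z = L z := fun z hz => by
    rw [hL, if_neg]
    rintro rfl
    exact hz hv0
  have hQlt : ∀ q < qt, Q' q = Q q := fun q hq => by rw [hQ, if_neg hq.ne]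
  have hPlt : ∀ q < qt, P' q = P q := fun q hq => by rw [hP, if_neg hq.ne]
  refine ⟨⟨(h.lists.take hN h0 hH).1, ?_, ?_⟩, by have := h.qh_le; omega, by omega, ?_, ?_, ?_, ?_,
    ?_, ?_, ?_⟩
  · intro e he hm hle
    rw [hH] at hle
    have key : H (A e) ≤ e → L' (B e) = L' (A e) ∧ L' (A e) ≠ 0 := fun hle => by
      obtain ⟨a1, a2⟩ := h.closed e he hm hle
      rw [hLne _ a2, hLne _ (a1 ▸ a2)]
      exact ⟨a1, a2⟩
    split_ifs at hle with hue
    · rcases Nat.lt_or_ge e (H u) with h4 | h4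
      · rcases Nat.eq_or_lt_of_le (Nat.le_sub_one_of_lt h4) with h5 | h5
        · subst h5
          rw [h3, ← hv, hL, if_pos rfl, hLne u (by omega), hLu]
          exact ⟨rfl, by simp⟩
        · have := h.lists.skip (H u - 1) (by omega) h2 e h5 hm (by rw [hue, h3])
          omega
      · exact key (by rw [hue]; exact h4)
    · exact key hle
  · intro z hz hz0
    rw [hL] at hz0 ⊢
    split_ifs at hz0 ⊢ with hzv
    · have := h.sound u hN (by omega)
      rw [hLu] at this
      rw [hzv]
      exact this.tail hadj
    · exact h.sound z hz hz0
  · rw [hQlt 0 h.qt_pos, h.root]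
  · intro q hq
    rw [hQ]
    split_ifs with hqq
    · exact hNv
    · exact h.node q (by omega)
  · intro q hq
    rw [hQ]
    split_ifs with hqq
    · rw [hL, if_pos rfl]
    · rw [hLne _ (by rw [h.label q (by omega)]; simp), h.label q (by omega)]
  · intro q hq hq0
    by_cases hqq : q = qt
    · subst hqq
      rw [hP, if_pos rfl, hQlt qh hlt, hQ q, if_pos rfl, ← hu]
      exact ⟨hlt, hadj⟩
    · obtain ⟨a1, a2⟩ := h.tree q (by omega) hq0
      rw [hPlt q (by omega), hQlt q (by omega), hQlt _ (by omega)]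
      exact ⟨a1, a2⟩
  · intro z hz hz0
    by_cases hzv : z = v
    · exact .inr ⟨qt, h.qh_le, by omega, by rw [hQ, if_pos rfl, hzv]⟩
    · rw [hL, if_neg hzv] at hz0
      rcases h.active z hz hz0 with h4 | ⟨q, h4, h5, h6⟩
      · rw [hH]
        split_ifs with hzu
        · exact .inr ⟨qh, le_rfl, by omega, by rw [hQlt qh hlt, hzu, hu]⟩
        · exact .inl h4
      · exact .inr ⟨q, h4, by omega, by rw [hQlt q h5, h6]⟩
  · intro z hz hz0
    rw [hL]
    split_ifs
    · simp
    · exact h.keep z hz hz0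
  · intro z hz hz0 hz1
    rw [hS]
    split_ifs with hzv
    · exact ⟨by omega, by rw [hQ, if_pos rfl, hzv]⟩
    · rw [hL, if_neg hzv] at hz1
      obtain ⟨a1, a2⟩ := h.pos z hz hz0 hz1
      exact ⟨by omega, by rw [hQlt _ a1, a2]⟩

/-- The start of a search. -/
theorem Labelling.start (h : Labelling A B M m H X L) (hr : IsNode A m r) (hr0 : L r = 0)
    (ha : ∀ u, IsNode A m u → L u ≠ 0 → H u = 0) {L' Q' S' : ℕ → ℕ} (P : ℕ → ℕ)
    (hL : ∀ z, L' z = if z = r then r + 1 else L z) (hQ : Q' 0 = r) (hS : S' r = 0) :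
    Searching A B M m r L H X L' Q' P S' 0 1 := by
  have hLne : ∀ z, L z ≠ 0 → L' z = L z := fun z hz => by
    rw [hL, if_neg]
    rintro rfl
    exact hz hr0
  refine ⟨⟨h.lists, ?_, ?_⟩, by omega, by omega, hQ, ?_, ?_, ?_, ?_, ?_, ?_⟩
  · intro e he hm hle
    obtain ⟨a1, a2⟩ := h.closed e he hm hle
    rw [hLne _ a2, hLne _ (a1 ▸ a2)]
    exact ⟨a1, a2⟩
  · intro z hz hz0
    rw [hL] at hz0 ⊢
    split_ifs at hz0 ⊢ with hzr
    · rw [hzr]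
      exact .refl
    · exact h.sound z hz hz0
  · intro q hq
    obtain rfl : q = 0 := by omega
    rw [hQ]; exact hr
  · intro q hq
    obtain rfl : q = 0 := by omega
    rw [hQ, hL, if_pos rfl]
  · intro q hq
    omega
  · intro z hz hz0
    by_cases hzr : z = r
    · exact .inr ⟨0, le_rfl, by omega, by rw [hQ, hzr]⟩
    · rw [hL, if_neg hzr] at hz0
      exact .inl (ha z hz hz0)
  · intro z hz hz0
    rw [hLne _ hz0]
    exact hz0
  · intro z hz hz0 hz1
    rw [hL] at hz1
    split_ifs at hz1 with hzr
    · exact ⟨by rw [hzr, hS]; omega, by rw [hzr, hS, hQ]⟩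
    · exact absurd hz0 hz1

end

/-- The loop of `search`. -/
def searchLoop (b : ℕ) : Program :=
  whileI 21 22 (seq (loadI 13 (nm b 7 0) 21) (seq (loadI 16 (nm b 4 0) 13) (seq (setI 14 0)
    (ifI 16 14 (inc 21)
      (seq (setI 14 1) (seq (subI 15 16 14) (seq (loadI 16 (nm b 5 0) 15)
        (seq (storeI (nm b 4 0) 13 16) (seq (loadI 19 (nm b 2 0) 15)
        (seq (loadI 14 (nm b 6 0) 19) (seq (setI 23 0)
        (ifI 14 23
          (seq (storeI (nm b 6 0) 19 18) (seq (storeI (nm b 7 0) 22 19)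
            (seq (storeI (nm b 8 0) 22 21) (seq (storeI (nm b 9 0) 19 22) (inc 22)))))
          skip))))))))))))

/-- Breadth-first search from the node in integer register `17`, along marked edges. Working arrays:
first endpoints `1`, second endpoints `2`, marks `3`, list heads `4`, list links `5`, labels `6`,
queue `7`, parents `8`, positions `9`. -/
def search (b : ℕ) : Program :=
  seq (seq (mv 18 17) (seq (inc 18) (seq (storeI (nm b 6 0) 17 18) (seq (setI 21 0)
    (seq (setI 22 1) (seq (storeI (nm b 7 0) 21 17) (storeI (nm b 9 0) 17 21)))))))
    (searchLoop b)

theorem searchLoop_spec (b : ℕ) (σ : Memory) {A B M X L₀ : ℕ → ℕ} {m r : ℕ}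
    (hB : σ.iarr (nm b 2 0) = B) (hX : σ.iarr (nm b 5 0) = X) (h18 : σ.ireg 18 = r + 1)
    (hsym : ∀ e < m, 1 ≤ M e → ∃ e' < m, 1 ≤ M e' ∧ A e' = B e ∧ B e' = A e)
    (hS : Searching A B M m r L₀ (σ.iarr (nm b 4 0)) X (σ.iarr (nm b 6 0)) (σ.iarr (nm b 7 0))
      (σ.iarr (nm b 8 0)) (σ.iarr (nm b 9 0)) (σ.ireg 21) (σ.ireg 22)) :
    Run (searchLoop b) σ fun T σ' =>
      Searching A B M m r L₀ (σ'.iarr (nm b 4 0)) X (σ'.iarr (nm b 6 0)) (σ'.iarr (nm b 7 0))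
        (σ'.iarr (nm b 8 0)) (σ'.iarr (nm b 9 0)) (σ'.ireg 22) (σ'.ireg 22) ∧
      T + 60 * remaining A M m (σ'.iarr (nm b 4 0)) ≤
        60 * remaining A M m (σ.iarr (nm b 4 0)) + 30 * (σ.ireg 22 - σ.ireg 21) + 1 ∧
      σ'.ireg 22 + remaining A M m (σ'.iarr (nm b 4 0)) ≤
        σ.ireg 22 + remaining A M m (σ.iarr (nm b 4 0)) := by
  refine (Run.whileI (fun τ => Searching A B M m r L₀ (τ.iarr (nm b 4 0)) X (τ.iarr (nm b 6 0))
      (τ.iarr (nm b 7 0)) (τ.iarr (nm b 8 0)) (τ.iarr (nm b 9 0)) (τ.ireg 21) (τ.ireg 22) ∧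
      τ.ireg 22 + remaining A M m (τ.iarr (nm b 4 0)) ≤
        σ.ireg 22 + remaining A M m (σ.iarr (nm b 4 0)))
    (fun τ => 60 * remaining A M m (τ.iarr (nm b 4 0)) + 30 * (τ.ireg 22 - τ.ireg 21))
    ⟨hS, le_rfl⟩ ?_).mono ?_
  · rintro τ hF ⟨hI, hq⟩ hlt
    have tB := hF.iarr (nm b 2 0) (by simp)
    have tX := hF.iarr (nm b 5 0) (by simp)
    have t18 := hF.ireg 18 (by simp)
    rw [hB] at tB
    rw [hX] at tX
    rw [h18] at t18
    clear hF
    obtain ⟨u, hu⟩ : ∃ u, u = τ.iarr (nm b 7 0) (τ.ireg 21) := ⟨_, rfl⟩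
    obtain ⟨w, hw⟩ : ∃ w, w = τ.iarr (nm b 4 0) u := ⟨_, rfl⟩
    refine Run.of_loopFree (by simp) fun T hT => ?_
    simp [inc] at hT ⊢
    simp only [← hu, ← hw]
    by_cases hw0 : w = 0
    · have h1 := hI.advance hlt (by rw [← hu, ← hw, hw0])
      simp [hw0]
      exact ⟨⟨h1, hq⟩, by omega⟩
    · have hN := hI.node _ hlt
      rw [← hu] at hN
      have hne : τ.iarr (nm b 4 0) (τ.iarr (nm b 7 0) (τ.ireg 21)) ≠ 0 := by
        rw [← hu, ← hw]; exact hw0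
      simp [hw0, tB, tX, t18]
      have hrem : ∀ H' : ℕ → ℕ, (∀ z, H' z = if z = u then X (w - 1) else τ.iarr (nm b 4 0) z) →
          remaining A M m H' + 1 ≤ remaining A M m (τ.iarr (nm b 4 0)) := fun H' hH' =>
        (hI.lists.take hN (by rw [← hw]; exact hw0) (by rw [← hw]; exact hH')).2
      by_cases hv0 : τ.iarr (nm b 6 0) (B (w - 1)) = 0
      · simp [hv0]
        refine ⟨⟨hI.visit hlt hsym hne rfl (by rw [← hu, ← hw]; exact hv0) (fun z => ?_) (fun z => ?_)
          (fun z => ?_) (fun z => ?_) (fun z => ?_), ?_⟩, ?_⟩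
        · simp [← hu, ← hw]
        · simp [← hu, ← hw]
        · simp [← hu, ← hw]
        · simp
        · simp [← hu, ← hw]
        · refine (?_ : ∀ k, k + 1 ≤ remaining A M m (τ.iarr (nm b 4 0)) →
            τ.ireg 22 + 1 + k ≤ σ.ireg 22 + remaining A M m (σ.iarr (nm b 4 0))) _
            (hrem _ fun z => by simp)
          intro k hk
          omega
        · refine (?_ : ∀ k, k + 1 ≤ remaining A M m (τ.iarr (nm b 4 0)) →
            T + 1 + (60 * k + 30 * (τ.ireg 22 + 1 - τ.ireg 21)) ≤
              60 * remaining A M m (τ.iarr (nm b 4 0)) + 30 * (τ.ireg 22 - τ.ireg 21)) _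
            (hrem _ fun z => by simp)
          intro k hk
          omega
      · simp [hv0]
        refine ⟨⟨hI.skip_edge hlt hsym hne (by rw [← hu, ← hw]; exact hv0) (fun z => ?_), ?_⟩, ?_⟩
        · simp [← hu, ← hw]
        · refine (?_ : ∀ k, k + 1 ≤ remaining A M m (τ.iarr (nm b 4 0)) →
            τ.ireg 22 + k ≤ σ.ireg 22 + remaining A M m (σ.iarr (nm b 4 0))) _
            (hrem _ fun z => by simp)
          intro k hk
          omega
        · refine (?_ : ∀ k, k + 1 ≤ remaining A M m (τ.iarr (nm b 4 0)) →
            T + 1 + (60 * k + 30 * (τ.ireg 22 - τ.ireg 21)) ≤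
              60 * remaining A M m (τ.iarr (nm b 4 0)) + 30 * (τ.ireg 22 - τ.ireg 21)) _
            (hrem _ fun z => by simp)
          intro k hk
          omega
  · rintro T τ - ⟨⟨hI, hq⟩, hge, hT⟩
    have := hI.qh_le
    obtain h : τ.ireg 21 = τ.ireg 22 := by omega
    rw [h] at hI hT
    refine ⟨hI, by omega, hq⟩

theorem search_spec (b : ℕ) (σ : Memory) {A B M X : ℕ → ℕ} {m r : ℕ}
    (hB : σ.iarr (nm b 2 0) = B) (hX : σ.iarr (nm b 5 0) = X) (h17 : σ.ireg 17 = r)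
    (hsym : ∀ e < m, 1 ≤ M e → ∃ e' < m, 1 ≤ M e' ∧ A e' = B e ∧ B e' = A e)
    (hL : Labelling A B M m (σ.iarr (nm b 4 0)) X (σ.iarr (nm b 6 0))) (hr : IsNode A m r)
    (hr0 : σ.iarr (nm b 6 0) r = 0)
    (ha : ∀ u, IsNode A m u → σ.iarr (nm b 6 0) u ≠ 0 → σ.iarr (nm b 4 0) u = 0) :
    Run (search b) σ fun T σ' =>
      Searching A B M m r (σ.iarr (nm b 6 0)) (σ'.iarr (nm b 4 0)) X (σ'.iarr (nm b 6 0))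
        (σ'.iarr (nm b 7 0)) (σ'.iarr (nm b 8 0)) (σ'.iarr (nm b 9 0)) (σ'.ireg 22) (σ'.ireg 22) ∧
      T + 60 * remaining A M m (σ'.iarr (nm b 4 0)) ≤
        60 * remaining A M m (σ.iarr (nm b 4 0)) + 50 ∧
      σ'.ireg 22 ≤ m + 1 := by
  refine Run.seq (Run.of_loopFree (by simp [mv]) fun T hT => ?_)
  simp [mv, inc, h17] at hT ⊢
  refine (searchLoop_spec b _ (A := A) (B := B) (M := M) (X := X) (m := m) (r := r)
    (L₀ := σ.iarr (nm b 6 0)) (by simpa using hB)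
    (by simpa using hX) (by simp) hsym ?_).mono ?_
  · simp
    exact hL.start hr hr0 ha _ (fun z => by simp) (by simp) (by simp)
  · rintro T' σ' - ⟨h1, h2, h3⟩
    simp at h2 h3
    have := remaining_le A M m (σ.iarr (nm b 4 0))
    exact ⟨h1, by omega, by omega⟩

/-- Empty lists and labels for all nodes; the number of edges is in integer register `20`. -/
def initSearch (b : ℕ) : Program :=
  forI 12 20 (seq (loadI 13 (nm b 1 0) 12) (seq (setI 14 0)
    (seq (storeI (nm b 4 0) 13 14) (storeI (nm b 6 0) 13 14))))

/-- Link the marked edges with the same first endpoint. -/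
def buildLists (b : ℕ) : Program :=
  forI 12 20 (seq (loadI 15 (nm b 3 0) 12) (seq (setI 14 1) (ifI 14 15
    (seq (loadI 13 (nm b 1 0) 12) (seq (loadI 16 (nm b 4 0) 13) (seq (storeI (nm b 5 0) 12 16)
      (seq (mv 16 12) (seq (inc 16) (storeI (nm b 4 0) 13 16))))))
    skip)))

theorem initLists_spec (b : ℕ) (σ : Memory) {A B M : ℕ → ℕ} {m : ℕ}
    (hA : σ.iarr (nm b 1 0) = A) (hM : σ.iarr (nm b 3 0) = M) (h20 : σ.ireg 20 = m) :
    Run (seq (initSearch b) (buildLists b)) σ fun T σ' => T ≤ 60 * m + 10 ∧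
      Labelling A B M m (σ'.iarr (nm b 4 0)) (σ'.iarr (nm b 5 0)) (σ'.iarr (nm b 6 0)) ∧
      ∀ u, IsNode A m u → σ'.iarr (nm b 6 0) u = 0 := by
  refine Run.seq' (Run.forI_loopFree (fun j τ => ∀ x < j, τ.iarr (nm b 4 0) (A x) = 0 ∧
    τ.iarr (nm b 6 0) (A x) = 0) (by simp) (by simp) (by simp) (by simp) (by simp) (by simp)
    (by simp) ?_) ?_
  · intro j τ hj hF hi hI
    have tA := hF.iarr (nm b 1 0) (by simp)
    rw [hA] at tA
    simp [hi, tA]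
    intro x hx
    rcases Nat.eq_or_lt_of_le hx with rfl | h
    · simp
    · simp [(hI x h).1, (hI x h).2]
  rintro T τ hF ⟨h0, hT⟩
  have tA := hF.iarr (nm b 1 0) (by simp [initSearch])
  have tM := hF.iarr (nm b 3 0) (by simp [initSearch])
  have t20 := hF.ireg 20 (by simp [initSearch])
  rw [h20] at h0 hT t20
  rw [hA] at tA
  rw [hM] at tM
  simp at hT
  refine (Run.forI_loopFree (fun j ρ => (∀ u, IsNode A m u → ρ.iarr (nm b 6 0) u = 0) ∧
      (∀ u, IsNode A m u → ρ.iarr (nm b 4 0) u ≤ j) ∧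
      (∀ u, IsNode A m u → ρ.iarr (nm b 4 0) u ≠ 0 →
        1 ≤ M (ρ.iarr (nm b 4 0) u - 1) ∧ A (ρ.iarr (nm b 4 0) u - 1) = u) ∧
      (∀ e < j, 1 ≤ M e → e < ρ.iarr (nm b 4 0) (A e)) ∧
      (∀ e < j, 1 ≤ M e → ρ.iarr (nm b 5 0) e ≤ e) ∧
      (∀ e < j, 1 ≤ M e → ρ.iarr (nm b 5 0) e ≠ 0 →
        1 ≤ M (ρ.iarr (nm b 5 0) e - 1) ∧ A (ρ.iarr (nm b 5 0) e - 1) = A e) ∧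
      (∀ e < j, 1 ≤ M e → ∀ e' < e, 1 ≤ M e' → A e' = A e → e' < ρ.iarr (nm b 5 0) e))
    (by simp) (by simp) (by simp) (by simp [mv]) (by simp) (by simp) ?_ ?_).mono ?_
  · simp only [Memory.iarr_setI]
    refine ⟨?_, ?_, ?_, fun e he => by omega, fun e he => by omega, fun e he => by omega,
      fun e he => by omega⟩
    · rintro u ⟨e, he, rfl⟩; exact (h0 e he).2
    · rintro u ⟨e, he, rfl⟩; exact (h0 e he).1.le
    · rintro u ⟨e, he, rfl⟩ h; exact absurd (h0 e he).1 h
  · rintro j ρ hj hF' hi ⟨i1, i2, i3, i4, i5, i6, i7⟩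
    have rA := hF'.iarr (nm b 1 0) (by simp)
    have rM := hF'.iarr (nm b 3 0) (by simp)
    rw [tA] at rA
    rw [tM] at rM
    rw [t20] at hj
    by_cases hMj : 1 ≤ M j
    · simp [hi, rA, rM, hMj, inc, mv]
      have hNj : IsNode A m (A j) := ⟨j, hj, rfl⟩
      refine ⟨i1, ?_, ?_, ?_, ?_, ?_, ?_⟩
      · intro u hu
        have := i2 u hu
        split_ifs <;> omega
      · intro u hu
        split_ifs with h
        · intro _
          exact ⟨hMj, h.symm⟩
        · exact i3 u hu
      · intro e he hMe
        split_ifs with h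
        · omega
        · have hej : e ≠ j := by rintro rfl; exact h rfl
          exact i4 e (by omega) hMe
      · intro e he hMe
        split_ifs with h
        · rw [h]; exact i2 _ hNj
        · exact i5 e (by omega) hMe
      · intro e he hMe
        split_ifs with h
        · rw [h]; exact i3 _ hNj
        · exact i6 e (by omega) hMe
      · intro e he hMe e' he' hMe' hA'
        split_ifs with h
        · subst h
          rw [← hA']
          exact i4 e' he' hMe'
        · exact i7 e (by omega) hMe e' he' hMe' hA'
    · have hne : ∀ e, 1 ≤ M e → e < j + 1 → e < j := by
        intro e he h
        rcases Nat.eq_or_lt_of_le (Nat.le_of_lt_succ h) with rfl | h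
        · exact absurd he hMj
        · exact h
      simp [hi, rM, hMj]
      exact ⟨i1, fun u hu => (i2 u hu).trans (by omega), i3, fun e he h => i4 e (hne e h (by omega)) h,
        fun e he h => i5 e (hne e h (by omega)) h, fun e he h => i6 e (hne e h (by omega)) h,
        fun e he h => i7 e (hne e h (by omega)) h⟩
  · rintro T' ρ - ⟨⟨i1, i2, i3, i4, i5, i6, i7⟩, hT'⟩
    rw [t20] at hT' i2 i4 i5 i6 i7
    simp [mv, inc] at hT'
    refine ⟨by omega, ⟨⟨i2, i3, i5, i6, i7⟩, ?_, ?_⟩, i1⟩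
    · intro e he hM hle
      have := i4 e he hM
      omega
    · intro u hu h
      exact absurd (i1 u hu) h

/-- Label the nodes by the connected components of the graph of marked edges. -/
def components (b : ℕ) : Program :=
  seq (seq (initSearch b) (buildLists b))
    (forI 12 20 (seq (seq (loadI 17 (nm b 1 0) 12) (seq (loadI 13 (nm b 6 0) 17) (setI 14 0)))
      (ifI 13 14 (search b) skip)))

/-- The components of a symmetric edge list are labelled in linear time, as each edge is taken from its
list once. -/
theorem components_spec (b : ℕ) (σ : Memory) {A B M : ℕ → ℕ} {m : ℕ}
    (hA : σ.iarr (nm b 1 0) = A) (hB : σ.iarr (nm b 2 0) = B) (hM : σ.iarr (nm b 3 0) = M)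
    (h20 : σ.ireg 20 = m)
    (hsym : ∀ e < m, 1 ≤ M e → ∃ e' < m, 1 ≤ M e' ∧ A e' = B e ∧ B e' = A e) :
    Run (components b) σ fun T σ' => T ≤ 300 * m + 20 ∧
      ∀ u v, IsNode A m u → IsNode A m v → (σ'.iarr (nm b 6 0) u = σ'.iarr (nm b 6 0) v ↔
        Relation.ReflTransGen (MarkedAdj A B M m) u v) := by
  refine Run.seq' (initLists_spec b σ (B := B) hA hM h20) ?_
  rintro T τ hF ⟨hT, hL, h0⟩
  have tA := hF.iarr (nm b 1 0) (by simp [initSearch, buildLists])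
  have tB := hF.iarr (nm b 2 0) (by simp [initSearch, buildLists])
  have t20 := hF.ireg 20 (by simp [initSearch, buildLists])
  rw [h20] at t20
  rw [hA] at tA
  rw [hB] at tB
  refine (Run.forI_amortized 60 (fun ρ => 60 * remaining A M m (ρ.iarr (nm b 4 0)))
    (fun j ρ => Labelling A B M m (ρ.iarr (nm b 4 0)) (τ.iarr (nm b 5 0)) (ρ.iarr (nm b 6 0)) ∧
      (∀ u, IsNode A m u → ρ.iarr (nm b 6 0) u ≠ 0 → ρ.iarr (nm b 4 0) u = 0) ∧
      ∀ x < j, ρ.iarr (nm b 6 0) (A x) ≠ 0)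
    (by simp) (by simp) (by simp) (by simp [search, searchLoop])
    (by simp [search, searchLoop]) ?_ ?_).mono ?_
  · simp
    exact ⟨hL, fun u hu h => absurd (h0 u hu) h⟩
  · rintro j ρ hj hF' hi ⟨hl, hh, hx⟩
    have rA := hF'.iarr (nm b 1 0) (by simp [search, searchLoop])
    have rB := hF'.iarr (nm b 2 0) (by simp [search, searchLoop])
    have rX := hF'.iarr (nm b 5 0) (by simp [search, searchLoop])
    rw [tA] at rA
    rw [tB] at rB
    rw [t20] at hj
    have hN : IsNode A m (A j) := ⟨j, hj, rfl⟩
    refine Run.seq (Run.of_loopFree (by simp) fun T1 hT1 => ?_)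
    simp [hi, rA] at hT1 ⊢
    refine Run.ifI ?_ ?_
    · simp
      intro hz
      refine (search_spec b _ (A := A) (B := B) (M := M) (X := τ.iarr (nm b 5 0)) (m := m)
        (r := A j) (by simpa using rB) (by simpa using rX) (by simp) hsym (by simpa using hl) hN (by simpa using hz)
        (by simpa using hh)).mono ?_
      rintro T2 π - ⟨hS, hT2, -⟩
      simp at hT2 hS
      refine ⟨⟨hS.toLabelling, ?_, ?_⟩, by omega⟩
      · intro u hu hu0
        rcases hS.active u hu hu0 with h | ⟨q, h1, h2, -⟩
        · exact h
        · omega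
      · intro x hx'
        rcases Nat.eq_or_lt_of_le hx' with rfl | h
        · have h1 := hS.label 0 hS.qt_pos
          rw [hS.root] at h1
          rw [h1]
          simp
        · exact hS.keep _ ⟨x, by omega, rfl⟩ (hx x h)
    · simp
      intro hz
      refine Run.of_loopFree (by simp) fun T2 hT2 => ?_
      simp at hT2 ⊢
      refine ⟨⟨hl, hh, ?_⟩, by omega⟩
      intro x hx'
      rcases Nat.eq_or_lt_of_le hx' with rfl | h
      · omega
      · exact hx x h
  · rintro T' ρ - ⟨⟨hl, hh, hx⟩, hT'⟩
    rw [t20] at hT' hx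
    have := remaining_le A M m (τ.iarr (nm b 4 0))
    simp at hT'
    refine ⟨by omega, ?_⟩
    have hadj : ∀ u v, MarkedAdj A B M m u v → MarkedAdj A B M m v u := by
      rintro u v ⟨e, he, hM, rfl, rfl⟩
      obtain ⟨e', he', hM', h1, h2⟩ := hsym e he hM
      exact ⟨e', he', hM', h1, h2⟩
    intro u v hu hv
    have hne : ∀ w, IsNode A m w → ρ.iarr (nm b 6 0) w ≠ 0 := by
      rintro w ⟨e, he, rfl⟩
      exact hx e he
    constructor
    · intro he
      have h1 := hl.sound u hu (hne u hu)
      have h2 := hl.sound v hv (hne v hv)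
      rw [← he] at h2
      have h3 := Relation.reflTransGen_swap.1 h1
      exact (Relation.ReflTransGen.mono (fun a c h => hadj _ _ h) _ _ h3).trans h2
    · intro h
      clear hv
      induction h with
      | refl => rfl
      | tail _ h ih =>
        rw [ih]
        obtain ⟨e, he, hM, rfl, rfl⟩ := h
        exact (hl.closed e he hM (by rw [hh _ ⟨e, he, rfl⟩ (hx e he)]; exact Nat.zero_le _)).1.symm

/-! ### Bottleneck connections in linear time -/

/-- The nodes `u` and `v` are joined by an edge of weight at most `θ`. -/
def LinkLE (A B : ℕ → ℕ) (W : ℕ → ℝ) (m : ℕ) (θ : ℝ) (u v : ℕ) : Prop :=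
  ∃ e < m, A e = u ∧ B e = v ∧ W e ≤ θ

/-- The edge list is symmetric. -/
def SymmEdges (A B : ℕ → ℕ) (W : ℕ → ℝ) (m : ℕ) : Prop :=
  ∀ e < m, ∃ e' < m, A e' = B e ∧ B e' = A e ∧ W e' = W e

section
variable {A B A' B' M f : ℕ → ℕ} {W W' : ℕ → ℝ} {m m' s t : ℕ} {p : ℝ}

/-- Edges of weight at least `p` are not needed if the terminals are connected without them. -/
theorem joined_iff_of_delete (hM : ∀ e < m, 1 ≤ M e ↔ W e < p)
    (hst : Relation.ReflTransGen (MarkedAdj A B M m) s t)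
    (hnew : ∀ u v w, (∃ e < m', A' e = u ∧ B' e = v ∧ W' e = w) ↔
      ∃ e < m, W e < p ∧ A e = u ∧ B e = v ∧ W e = w) (θ : ℝ) :
    Relation.ReflTransGen (LinkLE A' B' W' m' θ) s t ↔
      Relation.ReflTransGen (LinkLE A B W m θ) s t := by
  constructor
  · refine fun h => Relation.ReflTransGen.mono ?_ _ _ h
    rintro u v ⟨e, he, h1, h2, h3⟩
    obtain ⟨e', he', -, h4, h5, h6⟩ := (hnew u v (W' e)).1 ⟨e, he, h1, h2, rfl⟩
    exact ⟨e', he', h4, h5, h6.trans_le h3⟩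
  · intro h
    rcases lt_or_ge θ p with hθ | hθ
    · refine Relation.ReflTransGen.mono ?_ _ _ h
      rintro u v ⟨e, he, h1, h2, h3⟩
      obtain ⟨e', he', h4, h5, h6⟩ := (hnew u v (W e)).2 ⟨e, he, h3.trans_lt hθ, h1, h2, rfl⟩
      exact ⟨e', he', h4, h5, h6.trans_le h3⟩
    · refine Relation.ReflTransGen.mono ?_ _ _ hst
      rintro u v ⟨e, he, h0, h1, h2⟩
      have h3 := (hM e he).1 h0
      obtain ⟨e', he', h4, h5, h6⟩ := (hnew u v (W e)).2 ⟨e, he, h3, h1, h2, rfl⟩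
      exact ⟨e', he', h4, h5, by linarith⟩

/-- Edges of weight at most `p` can be contracted if they do not connect the terminals. -/
theorem joined_iff_of_contract (hsym : SymmEdges A B W m) (hM : ∀ e < m, 1 ≤ M e ↔ W e ≤ p)
    (hs : IsNode A m s) (ht : IsNode A m t)
    (hf : ∀ u v, IsNode A m u → IsNode A m v →
      (f u = f v ↔ Relation.ReflTransGen (MarkedAdj A B M m) u v))
    (hst : f s ≠ f t)
    (hnew : ∀ u v w, (∃ e < m', A' e = u ∧ B' e = v ∧ W' e = w) ↔
      ∃ e < m, p < W e ∧ f (A e) = u ∧ f (B e) = v ∧ W e = w) (θ : ℝ) :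
    Relation.ReflTransGen (LinkLE A' B' W' m' θ) (f s) (f t) ↔
      Relation.ReflTransGen (LinkLE A B W m θ) s t := by
  have hB : ∀ e < m, IsNode A m (B e) := fun e he => by
    obtain ⟨e', he', h, -⟩ := hsym e he
    exact ⟨e', he', h⟩
  have hup : p ≤ θ → ∀ u v, Relation.ReflTransGen (MarkedAdj A B M m) u v →
      Relation.ReflTransGen (LinkLE A B W m θ) u v := fun hp u v h => by
    refine Relation.ReflTransGen.mono ?_ _ _ h
    rintro u v ⟨e, he, h0, h1, h2⟩
    exact ⟨e, he, h1, h2, ((hM e he).1 h0).trans hp⟩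
  constructor
  · intro h
    rcases lt_or_ge θ p with hθ | hθ
    · exfalso
      rcases Relation.ReflTransGen.cases_head h with h | ⟨c, ⟨e, he, h1, h2, h3⟩, -⟩
      · exact hst h
      · obtain ⟨e', he', h4, -, -, h6⟩ := (hnew _ _ (W' e)).1 ⟨e, he, h1, h2, rfl⟩
        linarith
    · obtain ⟨x, hx, hxt, hsx⟩ : ∃ x, IsNode A m x ∧ f x = f t ∧
          Relation.ReflTransGen (LinkLE A B W m θ) s x := by
        generalize f t = z at h
        induction h with
        | refl => exact ⟨s, hs, rfl, .refl⟩
        | tail _ hl ih =>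
          obtain ⟨x, hx, hxt, hsx⟩ := ih
          obtain ⟨e, he, h1, h2, h3⟩ := hl
          obtain ⟨e', he', h4, h5, h6, h7⟩ := (hnew _ _ (W' e)).1 ⟨e, he, h1, h2, rfl⟩
          refine ⟨B e', hB e' he', h6, ?_⟩
          refine (hsx.trans (hup hθ _ _ ((hf x (A e') hx ⟨e', he', rfl⟩).1 (hxt.trans h5.symm)))).tail
            ⟨e', he', rfl, rfl, h7.trans_le h3⟩
      exact hsx.trans (hup hθ _ _ ((hf x t hx ht).1 hxt))
  · intro h
    clear hst ht
    induction h with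
    | refl => exact .refl
    | tail _ hl ih =>
      obtain ⟨e, he, rfl, rfl, h3⟩ := hl
      rcases le_or_gt (W e) p with h4 | h4
      · rw [← (hf (A e) (B e) ⟨e, he, rfl⟩ (hB e he)).2
          (.single ⟨e, he, (hM e he).2 h4, rfl, rfl⟩)]
        exact ih
      · obtain ⟨e', he', h5, h6, h7⟩ := (hnew _ _ (W e)).2 ⟨e, he, h4, rfl, rfl, rfl⟩
        exact ih.tail ⟨e', he', h5, h6, h7.trans_le h3⟩

theorem SymmEdges.of_new {q : ℝ → Prop} (hsym : SymmEdges A B W m)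
    (hnew : ∀ u v w, (∃ e < m', A' e = u ∧ B' e = v ∧ W' e = w) ↔
      ∃ e < m, q (W e) ∧ f (A e) = u ∧ f (B e) = v ∧ W e = w) : SymmEdges A' B' W' m' := by
  intro e he
  obtain ⟨e₁, h1, h2, h3, h4, h5⟩ := (hnew _ _ _).1 ⟨e, he, rfl, rfl, rfl⟩
  obtain ⟨e₂, g1, g2, g3, g4⟩ := hsym e₁ h1
  obtain ⟨e₃, k1, k2, k3, k4⟩ := (hnew (B' e) (A' e) (W' e)).2
    ⟨e₂, g1, by rwa [g4], by rw [g2, h4], by rw [g3, h3], by rw [g4, h5]⟩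
  exact ⟨e₃, k1, k2, k3, k4⟩

theorem SymmEdges.isNode (hsym : SymmEdges A B W m) (hne : s ≠ t) {θ : ℝ}
    (h : Relation.ReflTransGen (LinkLE A B W m θ) s t) : IsNode A m s ∧ IsNode A m t := by
  constructor
  · rcases Relation.ReflTransGen.cases_head h with h | ⟨c, ⟨e, he, h1, -⟩, -⟩
    · exact absurd h hne
    · exact ⟨e, he, h1⟩
  · rcases Relation.ReflTransGen.cases_tail h with h | ⟨c, -, ⟨e, he, -, h1, -⟩⟩
    · exact absurd h.symm hne
    · obtain ⟨e', he', h2, -⟩ := hsym e he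
      exact ⟨e', he', h2.trans h1⟩

end

/-- Set the marks of all edges; `c` computes the mark in integer register `13` from the weight in
real register `1` and the pivot in real register `3`. -/
def mark (b : ℕ) (c : Program) : Program :=
  forI 12 20 (seq (loadR 1 (nm b 1 0) 12) (seq c (storeI (nm b 3 0) 12 13)))

/-- Mark edges lighter than the pivot. -/
def markLt (b : ℕ) : Program := mark b (ifR 3 1 (setI 13 0) (setI 13 1))

/-- Mark edges not heavier than the pivot. -/
def markLe (b : ℕ) : Program := mark b (ifR 1 3 (setI 13 1) (setI 13 0))

/-- Mark edges not lighter than the pivot. -/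
def markGe (b : ℕ) : Program := mark b (ifR 3 1 (setI 13 1) (setI 13 0))

theorem markLt_spec (b : ℕ) (σ : Memory) {m : ℕ} (h20 : σ.ireg 20 = m) :
    Run (markLt b) σ fun T σ' => T ≤ 20 * m + 10 ∧
      ∀ e < m, 1 ≤ σ'.iarr (nm b 3 0) e ↔ σ.rarr (nm b 1 0) e < σ.rreg 3 := by
  refine (Run.forI_loopFree (fun j τ => ∀ e < j, 1 ≤ τ.iarr (nm b 3 0) e ↔
    σ.rarr (nm b 1 0) e < σ.rreg 3) (by simp) (by simp) (by simp) (by simp) (by simp) (by simp)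
    (by simp) ?_).mono ?_
  · intro j τ hj hF hi hI
    have tW := hF.rarr (nm b 1 0) (by simp)
    have t3 := hF.rreg 3 (by simp)
    intro e he
    by_cases h : σ.rreg 3 ≤ σ.rarr (nm b 1 0) j
    all_goals
      simp [hi, tW, t3, h]
      by_cases hej : e = j
      · subst hej
        simp [h, lt_of_not_ge]
      · simpa [hej] using hI e (by omega)
  · rintro T σ' - ⟨h, hT⟩
    rw [h20] at h hT
    simp at hT
    exact ⟨by omega, h⟩

theorem markLe_spec (b : ℕ) (σ : Memory) {m : ℕ} (h20 : σ.ireg 20 = m) :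
    Run (markLe b) σ fun T σ' => T ≤ 20 * m + 10 ∧
      ∀ e < m, 1 ≤ σ'.iarr (nm b 3 0) e ↔ σ.rarr (nm b 1 0) e ≤ σ.rreg 3 := by
  refine (Run.forI_loopFree (fun j τ => ∀ e < j, 1 ≤ τ.iarr (nm b 3 0) e ↔
    σ.rarr (nm b 1 0) e ≤ σ.rreg 3) (by simp) (by simp) (by simp) (by simp) (by simp) (by simp)
    (by simp) ?_).mono ?_
  · intro j τ hj hF hi hI
    have tW := hF.rarr (nm b 1 0) (by simp)
    have t3 := hF.rreg 3 (by simp)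
    intro e he
    by_cases h : σ.rarr (nm b 1 0) j ≤ σ.rreg 3
    all_goals
      simp [hi, tW, t3, h]
      by_cases hej : e = j
      · subst hej
        simp [h]
      · simpa [hej] using hI e (by omega)
  · rintro T σ' - ⟨h, hT⟩
    rw [h20] at h hT
    simp at hT
    exact ⟨by omega, h⟩

theorem markGe_spec (b : ℕ) (σ : Memory) {m : ℕ} (h20 : σ.ireg 20 = m) :
    Run (markGe b) σ fun T σ' => T ≤ 20 * m + 10 ∧
      ∀ e < m, 1 ≤ σ'.iarr (nm b 3 0) e ↔ σ.rreg 3 ≤ σ.rarr (nm b 1 0) e := by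
  refine (Run.forI_loopFree (fun j τ => ∀ e < j, 1 ≤ τ.iarr (nm b 3 0) e ↔
    σ.rreg 3 ≤ σ.rarr (nm b 1 0) e) (by simp) (by simp) (by simp) (by simp) (by simp) (by simp)
    (by simp) ?_).mono ?_
  · intro j τ hj hF hi hI
    have tW := hF.rarr (nm b 1 0) (by simp)
    have t3 := hF.rreg 3 (by simp)
    intro e he
    by_cases h : σ.rreg 3 ≤ σ.rarr (nm b 1 0) j
    all_goals
      simp [hi, tW, t3, h]
      by_cases hej : e = j
      · subst hej
        simp [h]
      · simpa [hej] using hI e (by omega)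
  · rintro T σ' - ⟨h, hT⟩
    rw [h20] at h hT
    simp at hT
    exact ⟨by omega, h⟩

/-- Delete the marked edges, and replace the endpoints of the others by their labels. The
terminals are in integer registers `24` and `25`. -/
def contract (b : ℕ) : Program :=
  seq (setI 22 0) (seq
    (forI 12 20 (seq (loadI 15 (nm b 3 0) 12) (seq (setI 14 0) (ifI 15 14
      (seq (loadI 13 (nm b 1 0) 12) (seq (loadI 13 (nm b 6 0) 13) (seq (storeI (nm b 1 0) 22 13)
      (seq (loadI 13 (nm b 2 0) 12) (seq (loadI 13 (nm b 6 0) 13) (seq (storeI (nm b 2 0) 22 13)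
      (seq (loadR 1 (nm b 1 0) 12) (seq (storeR (nm b 1 0) 22 1) (inc 22)))))))))
      skip))))
    (seq (mv 20 22) (seq (loadI 24 (nm b 6 0) 24) (loadI 25 (nm b 6 0) 25))))

/-- The remaining edges are exactly the unmarked ones, with their endpoints replaced by the labels `f`. -/
theorem contract_spec (b : ℕ) (σ : Memory) {A B M f : ℕ → ℕ} {W : ℕ → ℝ} {m : ℕ}
    (hA : σ.iarr (nm b 1 0) = A) (hB : σ.iarr (nm b 2 0) = B) (hM : σ.iarr (nm b 3 0) = M)
    (hf : σ.iarr (nm b 6 0) = f) (hW : σ.rarr (nm b 1 0) = W) (h20 : σ.ireg 20 = m) :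
    Run (contract b) σ fun T σ' => T ≤ 30 * m + 20 ∧ σ'.ireg 24 = f (σ.ireg 24) ∧
      σ'.ireg 25 = f (σ.ireg 25) ∧
      σ'.ireg 20 + ((Finset.range m).filter fun e => 1 ≤ M e).card = m ∧
      ∀ u v w, (∃ e < σ'.ireg 20, σ'.iarr (nm b 1 0) e = u ∧ σ'.iarr (nm b 2 0) e = v ∧
          σ'.rarr (nm b 1 0) e = w) ↔
        ∃ e < m, ¬ 1 ≤ M e ∧ f (A e) = u ∧ f (B e) = v ∧ W e = w := by
  refine Run.seq (Run.of_loopFree (by simp) fun T1 hT1 => ?_)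
  simp at hT1 ⊢
  refine Run.seq' (Run.forI_loopFree (fun j τ => τ.ireg 22 ≤ j ∧
    τ.ireg 22 + ((Finset.range j).filter fun e => 1 ≤ M e).card = j ∧
    (∀ e, j ≤ e → τ.iarr (nm b 1 0) e = A e ∧ τ.iarr (nm b 2 0) e = B e ∧
      τ.rarr (nm b 1 0) e = W e) ∧
    ∀ u v w, (∃ e < τ.ireg 22, τ.iarr (nm b 1 0) e = u ∧ τ.iarr (nm b 2 0) e = v ∧
          τ.rarr (nm b 1 0) e = w) ↔
        ∃ e < j, ¬ 1 ≤ M e ∧ f (A e) = u ∧ f (B e) = v ∧ W e = w)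
    (by simp) (by simp) (by simp) (by simp) (by simp) (by simp) (by simp [hA, hB, hW]) ?_) ?_
  · rintro j τ hj hF hi ⟨h1, h2, h3, h4⟩
    have tM := hF.iarr (nm b 3 0) (by simp)
    have tf := hF.iarr (nm b 6 0) (by simp)
    simp [hM, hf] at tM tf
    obtain ⟨hAj, hBj, hWj⟩ := h3 j le_rfl
    rw [Finset.range_add_one, Finset.filter_insert]
    by_cases h : M j = 0
    · simp [hi, tM, tf, h, inc, hAj, hBj, hWj]
      refine ⟨h1, by omega, ?_, ?_⟩
      · intro e he
        have hne : e ≠ τ.ireg 22 := by omega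
        simpa [hne] using h3 e (by omega)
      · intro u v w
        constructor
        · rintro ⟨e, he, k1, k2, k3⟩
          by_cases hne : e = τ.ireg 22
          · simp [hne] at k1 k2 k3
            exact ⟨j, by omega, h, k1, k2, k3⟩
          · simp [hne] at k1 k2 k3
            obtain ⟨e', g1, g2, g3⟩ := (h4 u v w).1 ⟨e, by omega, k1, k2, k3⟩
            exact ⟨e', by omega, by omega, g3⟩
        · rintro ⟨e, he, k0, k1, k2, k3⟩
          rcases Nat.eq_or_lt_of_le he with rfl | hlt
          · exact ⟨τ.ireg 22, by omega, by simpa using k1, by simpa using k2, by simpa using k3⟩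
          · obtain ⟨e', g1, g2, g3, g4⟩ := (h4 u v w).2 ⟨e, hlt, by omega, k1, k2, k3⟩
            have hne : e' ≠ τ.ireg 22 := by omega
            exact ⟨e', by omega, by simpa [hne] using g2, by simpa [hne] using g3,
              by simpa [hne] using g4⟩
    · have h' : 1 ≤ M j := by omega
      rw [if_pos h', Finset.card_insert_of_notMem (by simp)]
      simp [hi, tM, h]
      refine ⟨by omega, by omega, fun e he => h3 e (by omega), fun u v w => ?_⟩
      rw [h4]
      constructor
      · rintro ⟨e, g1, g2, g3⟩
        exact ⟨e, by omega, by omega, g3⟩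
      · rintro ⟨e, g1, g2, g3⟩
        have : e ≠ j := by rintro rfl; omega
        exact ⟨e, by omega, by omega, g3⟩
  · rintro T2 τ hF ⟨⟨h1, h2, h3, h4⟩, hT2⟩
    have tf := hF.iarr (nm b 6 0) (by simp)
    have t24 := hF.ireg 24 (by simp)
    have t25 := hF.ireg 25 (by simp)
    simp [h20] at h1 h2 h3 h4 hT2
    simp [hf] at tf t24 t25
    refine Run.of_loopFree (by simp [mv]) fun T3 hT3 => ?_
    simp [mv, tf, t24, t25, inc] at hT2 hT3 ⊢
    exact ⟨by omega, by omega, h4⟩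

/-- Test integer registers for equality. -/
def ifEq (x y : ℕ) (a c : Program) : Program := ifI x y (ifI y x a c) c

theorem Run.ifEq {x y : ℕ} {a c : Program} {σ : Memory} {R : ℕ → Memory → Prop}
    (h1 : σ.ireg x = σ.ireg y → Run a σ fun T σ' => ∀ T' ≤ T + 2, R T' σ')
    (h2 : σ.ireg x ≠ σ.ireg y → Run c σ fun T σ' => ∀ T' ≤ T + 2, R T' σ') :
    Run (ifEq x y a c) σ R := by
  refine Run.ifI (fun h => Run.ifI (fun h' => ?_) (fun h' => ?_)) (fun h => ?_)
  · exact (h1 (by omega)).mono fun T _ _ hr => hr _ (by omega)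
  · exact (h2 (by omega)).mono fun T _ _ hr => hr _ (by omega)
  · exact (h2 (by omega)).mono fun T _ _ hr => hr _ (by omega)

/-- Give every node its own name as a label. -/
def idLabels (b : ℕ) : Program :=
  forI 12 20 (seq (loadI 13 (nm b 1 0) 12) (storeI (nm b 6 0) 13 13))

theorem idLabels_spec (b : ℕ) (σ : Memory) {m : ℕ} (h20 : σ.ireg 20 = m) :
    Run (idLabels b) σ fun T σ' => T ≤ 10 * m + 10 ∧
      ∀ u, IsNode (σ.iarr (nm b 1 0)) m u → σ'.iarr (nm b 6 0) u = u := by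
  refine (Run.forI_loopFree (fun j τ => ∀ e < j,
    τ.iarr (nm b 6 0) (σ.iarr (nm b 1 0) e) = σ.iarr (nm b 1 0) e) (by simp) (by simp) (by simp)
    (by simp) (by simp) (by simp) (by simp) ?_).mono ?_
  · intro j τ hj hF hi hI
    have tA := hF.iarr (nm b 1 0) (by simp)
    simp [hi, tA]
    intro e he
    split_ifs with h
    · exact h.symm
    · exact hI e (Nat.lt_of_le_of_ne he (by rintro rfl; exact h rfl))
  · rintro T σ' - ⟨h, hT⟩
    rw [h20] at h hT
    simp at hT
    refine ⟨by omega, ?_⟩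
    rintro u ⟨e, he, rfl⟩
    exact h e he

/-- One round of the search for the bottleneck: the edges are halved at the pivot, and either the
heavy half is deleted or the light half is contracted, unless the pivot is found to be the
bottleneck. In the latter case integer register `26` is set. -/
def bottleneckRound (b : ℕ) : Program :=
  seq (selectPivot (nm b 2 0) (nm b 1 0)) (seq (markLt b) (seq (components b)
    (seq (seq (loadI 13 (nm b 6 0) 24) (loadI 14 (nm b 6 0) 25))
    (ifEq 13 14 (seq (markGe b) (seq (idLabels b) (contract b)))
      (seq (markLe b) (seq (components b) (seq (seq (loadI 13 (nm b 6 0) 24) (loadI 14 (nm b 6 0) 25))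
        (ifEq 13 14 (setI 26 1) (contract b)))))))))

/-- The current edge list is symmetric, and its terminals, which are in integer registers `24` and
`25`, are distinct and are connected below exactly the thresholds with the property `J`. -/
structure Reduced (b : ℕ) (J : ℝ → Prop) (σ : Memory) : Prop where
  symm : SymmEdges (σ.iarr (nm b 1 0)) (σ.iarr (nm b 2 0)) (σ.rarr (nm b 1 0)) (σ.ireg 20)
  ne : σ.ireg 24 ≠ σ.ireg 25
  joined : ∀ θ, Relation.ReflTransGen
    (LinkLE (σ.iarr (nm b 1 0)) (σ.iarr (nm b 2 0)) (σ.rarr (nm b 1 0)) (σ.ireg 20) θ)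
    (σ.ireg 24) (σ.ireg 25) ↔ J θ
  exists_joined : ∃ θ, J θ

theorem cnt_eq_card_filter (D : ℝ → Prop) (f : ℕ → ℝ) (m : ℕ) {M : ℕ → ℕ}
    (h : ∀ e < m, 1 ≤ M e ↔ D (f e)) :
    cnt D f 0 m = ((Finset.range m).filter fun e => 1 ≤ M e).card := by
  classical
  unfold cnt
  rw [Nat.Ico_zero_eq_range]
  congr 1
  refine Finset.filter_congr fun e he => ?_
  rw [h e (Finset.mem_range.1 he)]

/-- A round takes linear time. Either the pivot is the bottleneck, or at least a quarter of the edges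
disappears without a change of the thresholds that connect the terminals. -/
theorem bottleneckRound_spec (b : ℕ) (σ : Memory) {J : ℝ → Prop} (hR : Reduced b J σ) :
    Run (bottleneckRound b) σ fun T σ' => T ≤ 210000 * σ.ireg 20 ∧ 1 ≤ σ.ireg 20 ∧
      ((σ'.ireg 26 = 1 ∧ IsLeast {θ | J θ} (σ'.rreg 3)) ∨
        (σ'.ireg 26 = σ.ireg 26 ∧ Reduced b J σ' ∧ 4 * σ'.ireg 20 ≤ 3 * σ.ireg 20)) := by
  obtain ⟨m, hm⟩ : ∃ m, m = σ.ireg 20 := ⟨_, rfl⟩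
  obtain ⟨s, hs⟩ : ∃ s, s = σ.ireg 24 := ⟨_, rfl⟩
  obtain ⟨t, ht⟩ : ∃ t, t = σ.ireg 25 := ⟨_, rfl⟩
  obtain ⟨A, hA⟩ : ∃ A, A = σ.iarr (nm b 1 0) := ⟨_, rfl⟩
  obtain ⟨B, hB⟩ : ∃ B, B = σ.iarr (nm b 2 0) := ⟨_, rfl⟩
  obtain ⟨W, hW⟩ : ∃ W, W = σ.rarr (nm b 1 0) := ⟨_, rfl⟩
  obtain ⟨hsym, hne, hJ, θ₀, hθ₀⟩ := hR
  rw [← hA, ← hB, ← hW, ← hm] at hsym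
  simp only [← hA, ← hB, ← hW, ← hm, ← hs, ← ht] at hJ
  rw [← hs, ← ht] at hne
  rw [← hm]
  obtain ⟨hsN, htN⟩ := hsym.isNode hne ((hJ θ₀).2 hθ₀)
  have hm1 : 1 ≤ m := by obtain ⟨e, he, -⟩ := hsN; omega
  refine Run.seq' (selectPivot_spec (nm b 2 0) (nm b 1 0) (by simp) σ m hm.symm hm1) ?_
  rintro T1 τ hF ⟨hT1, hp1, hp2⟩
  rw [← hW] at hp1 hp2
  obtain ⟨p, hp⟩ : ∃ p, p = τ.rreg 3 := ⟨_, rfl⟩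
  rw [← hp] at hp1 hp2
  have tA := hF.iarr (nm b 1 0) (by simp [selectPivot, sampleLevel, sampleBlock, sortBlock, copyFourth])
  have tB := hF.iarr (nm b 2 0) (by simp [selectPivot, sampleLevel, sampleBlock, sortBlock, copyFourth])
  have tW := hF.rarr (nm b 1 0) (by simp [selectPivot, sampleLevel, sampleBlock, sortBlock, copyFourth])
  have t20 := hF.ireg 20 (by simp [selectPivot, sampleLevel, sampleBlock, sortBlock, copyFourth])
  have t24 := hF.ireg 24 (by simp [selectPivot, sampleLevel, sampleBlock, sortBlock, copyFourth])
  have t25 := hF.ireg 25 (by simp [selectPivot, sampleLevel, sampleBlock, sortBlock, copyFourth])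
  have t26 := hF.ireg 26 (by simp [selectPivot, sampleLevel, sampleBlock, sortBlock, copyFourth])
  rw [← hA] at tA
  rw [← hB] at tB
  rw [← hW] at tW
  rw [← hm] at t20
  rw [← hs] at t24
  rw [← ht] at t25
  clear hF
  refine Run.seq' (markLt_spec b τ t20) ?_
  rintro T2 ρ hF ⟨hT2, hM⟩
  rw [tW, ← hp] at hM
  have rA := hF.iarr (nm b 1 0) (by simp [markLt, mark])
  have rB := hF.iarr (nm b 2 0) (by simp [markLt, mark])
  have rW := hF.rarr (nm b 1 0) (by simp [markLt, mark])
  have r3 := hF.rreg 3 (by simp [markLt, mark])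
  have r20 := hF.ireg 20 (by simp [markLt, mark])
  have r24 := hF.ireg 24 (by simp [markLt, mark])
  have r25 := hF.ireg 25 (by simp [markLt, mark])
  have r26 := hF.ireg 26 (by simp [markLt, mark])
  rw [tA] at rA
  rw [tB] at rB
  rw [tW] at rW
  rw [← hp] at r3
  rw [t20] at r20
  rw [t24] at r24
  rw [t25] at r25
  rw [t26] at r26
  clear hF
  refine Run.seq' (components_spec b ρ rA rB rfl r20 fun e he hMe => ?_) ?_
  · obtain ⟨e', he', h1, h2, h3⟩ := hsym e he
    exact ⟨e', he', by rw [hM e' he', h3, ← hM e he]; exact hMe, h1, h2⟩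
  rintro T3 π hF ⟨hT3, hL⟩
  obtain ⟨M, hMM⟩ : ∃ M, M = ρ.iarr (nm b 3 0) := ⟨_, rfl⟩
  rw [← hMM] at hM hL
  have pA := hF.iarr (nm b 1 0) (by simp [components, search, searchLoop, initSearch, buildLists])
  have pB := hF.iarr (nm b 2 0) (by simp [components, search, searchLoop, initSearch, buildLists])
  have pW := hF.rarr (nm b 1 0) (by simp [components, search, searchLoop, initSearch, buildLists])
  have p3 := hF.rreg 3 (by simp [components, search, searchLoop, initSearch, buildLists])
  have p20 := hF.ireg 20 (by simp [components, search, searchLoop, initSearch, buildLists])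
  have p24 := hF.ireg 24 (by simp [components, search, searchLoop, initSearch, buildLists])
  have p25 := hF.ireg 25 (by simp [components, search, searchLoop, initSearch, buildLists])
  have p26 := hF.ireg 26 (by simp [components, search, searchLoop, initSearch, buildLists])
  rw [rA] at pA
  rw [rB] at pB
  rw [rW] at pW
  rw [r3] at p3
  rw [r20] at p20
  rw [r24] at p24
  rw [r25] at p25
  rw [r26] at p26
  clear hF
  refine Run.seq (Run.of_loopFree (by simp) fun T4 hT4 => ?_)
  simp [p24, p25] at hT4 ⊢
  refine Run.ifEq ?_ ?_
  · intro heq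
    simp at heq
    rw [hL s t hsN htN] at heq
    refine Run.seq' (markGe_spec b _ (m := m) (by simpa using p20)) ?_
    rintro T5 α hF ⟨hT5, hM'⟩
    simp [p3, pW] at hM'
    have aA := hF.iarr (nm b 1 0) (by simp [markGe, mark])
    have aB := hF.iarr (nm b 2 0) (by simp [markGe, mark])
    have aW := hF.rarr (nm b 1 0) (by simp [markGe, mark])
    have a20 := hF.ireg 20 (by simp [markGe, mark])
    have a24 := hF.ireg 24 (by simp [markGe, mark])
    have a25 := hF.ireg 25 (by simp [markGe, mark])
    have a26 := hF.ireg 26 (by simp [markGe, mark])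
    simp [pA, pB, pW, p20, p24, p25, p26] at aA aB aW a20 a24 a25 a26
    clear hF
    refine Run.seq' (idLabels_spec b α a20) ?_
    rintro T6 β hF ⟨hT6, hid⟩
    rw [aA] at hid
    have bA := hF.iarr (nm b 1 0) (by simp [idLabels])
    have bB := hF.iarr (nm b 2 0) (by simp [idLabels])
    have bM := hF.iarr (nm b 3 0) (by simp [idLabels])
    have bW := hF.rarr (nm b 1 0) (by simp [idLabels])
    have b20 := hF.ireg 20 (by simp [idLabels])
    have b24 := hF.ireg 24 (by simp [idLabels])
    have b25 := hF.ireg 25 (by simp [idLabels])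
    have b26 := hF.ireg 26 (by simp [idLabels])
    rw [aA] at bA
    rw [aB] at bB
    rw [aW] at bW
    rw [a20] at b20
    rw [a24] at b24
    rw [a25] at b25
    rw [a26] at b26
    clear hF
    refine (contract_spec b β bA bB bM rfl bW b20).mono ?_
    rintro T7 γ hF ⟨hT7, g24, g25, g20, hnew⟩ T' hT'
    have g26 := hF.ireg 26 (by simp [contract])
    rw [b26] at g26
    rw [b24, hid s hsN] at g24
    rw [b25, hid t htN] at g25
    have hnew' : ∀ u v w, (∃ e < γ.ireg 20, γ.iarr (nm b 1 0) e = u ∧ γ.iarr (nm b 2 0) e = v ∧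
        γ.rarr (nm b 1 0) e = w) ↔ ∃ e < m, W e < p ∧ A e = u ∧ B e = v ∧ W e = w := by
      intro u v w
      rw [hnew]
      refine exists_congr fun e => and_congr_right fun he => ?_
      obtain ⟨e', he', h1, -⟩ := hsym e he
      rw [hid _ ⟨e, he, rfl⟩, hid _ ⟨e', he', h1⟩, hM' e he, not_le]
    refine ⟨by omega, hm1, .inr ⟨g26, ⟨hsym.of_new (f := id) (q := fun w => w < p) hnew',
      by rw [g24, g25]; exact hne, fun θ => ?_, θ₀, hθ₀⟩, ?_⟩⟩
    · rw [g24, g25, ← hJ]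
      exact joined_iff_of_delete hM heq hnew' θ
    · rw [cnt_eq_card_filter _ _ _ hM'] at hp2
      omega
  · intro hneq
    simp at hneq
    rw [hL s t hsN htN] at hneq
    refine Run.seq' (markLe_spec b _ (m := m) (by simpa using p20)) ?_
    rintro T5 α hF ⟨hT5, hM'⟩
    simp [p3, pW] at hM'
    have aA := hF.iarr (nm b 1 0) (by simp [markLe, mark])
    have aB := hF.iarr (nm b 2 0) (by simp [markLe, mark])
    have aW := hF.rarr (nm b 1 0) (by simp [markLe, mark])
    have a3 := hF.rreg 3 (by simp [markLe, mark])
    have a20 := hF.ireg 20 (by simp [markLe, mark])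
    have a24 := hF.ireg 24 (by simp [markLe, mark])
    have a25 := hF.ireg 25 (by simp [markLe, mark])
    have a26 := hF.ireg 26 (by simp [markLe, mark])
    simp [pA, pB, pW, p3, p20, p24, p25, p26] at aA aB aW a3 a20 a24 a25 a26
    clear hF
    refine Run.seq' (components_spec b α aA aB rfl a20 fun e he hMe => ?_) ?_
    · obtain ⟨e', he', h1, h2, h3⟩ := hsym e he
      exact ⟨e', he', by rw [hM' e' he', h3, ← hM' e he]; exact hMe, h1, h2⟩
    rintro T6 β hF ⟨hT6, hL'⟩
    have bA := hF.iarr (nm b 1 0) (by simp [components, search, searchLoop, initSearch, buildLists])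
    have bB := hF.iarr (nm b 2 0) (by simp [components, search, searchLoop, initSearch, buildLists])
    have bM := hF.iarr (nm b 3 0) (by simp [components, search, searchLoop, initSearch, buildLists])
    have bW := hF.rarr (nm b 1 0) (by simp [components, search, searchLoop, initSearch, buildLists])
    have b3 := hF.rreg 3 (by simp [components, search, searchLoop, initSearch, buildLists])
    have b20 := hF.ireg 20 (by simp [components, search, searchLoop, initSearch, buildLists])
    have b24 := hF.ireg 24 (by simp [components, search, searchLoop, initSearch, buildLists])
    have b25 := hF.ireg 25 (by simp [components, search, searchLoop, initSearch, buildLists])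
    have b26 := hF.ireg 26 (by simp [components, search, searchLoop, initSearch, buildLists])
    rw [aA] at bA
    rw [aB] at bB
    rw [aW] at bW
    rw [a3] at b3
    rw [a20] at b20
    rw [a24] at b24
    rw [a25] at b25
    rw [a26] at b26
    clear hF
    obtain ⟨M', hMM'⟩ : ∃ M', M' = α.iarr (nm b 3 0) := ⟨_, rfl⟩
    rw [← hMM'] at hM' hL' bM
    refine Run.seq (Run.of_loopFree (by simp) fun T7 hT7 => ?_)
    simp [b24, b25] at hT7 ⊢
    refine Run.ifEq ?_ ?_
    · intro heq
      simp at heq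
      rw [hL' s t hsN htN] at heq
      refine Run.of_loopFree (by simp) fun T8 hT8 T' hT' => ?_
      simp at hT8 ⊢
      intro T'' hT''
      refine ⟨by omega, hm1, .inl ?_⟩
      rw [b3]
      constructor
      · show J p
        rw [← hJ]
        refine Relation.ReflTransGen.mono ?_ _ _ heq
        rintro u v ⟨e, he, h0, h1, h2⟩
        exact ⟨e, he, h1, h2, (hM' e he).1 h0⟩
      · intro θ hθ
        by_contra hlt
        push Not at hlt
        apply hneq
        refine Relation.ReflTransGen.mono ?_ _ _ ((hJ θ).2 hθ)
        rintro u v ⟨e, he, h1, h2, h3⟩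
        exact ⟨e, he, (hM e he).2 (h3.trans_lt hlt), h1, h2⟩
    · intro hneq'
      simp at hneq'
      refine (contract_spec b _ (A := A) (B := B) (M := M') (f := β.iarr (nm b 6 0)) (W := W)
        (m := m) (by simpa using bA) (by simpa using bB) (by simpa using bM) (by simp)
        (by simpa using bW) (by simpa using b20)).mono ?_
      rintro T8 γ hF ⟨hT8, g24, g25, g20, hnew⟩ T' hT'
      have g26 := hF.ireg 26 (by simp [contract])
      simp [b24, b25, b26] at g24 g25 g26
      have hnew' : ∀ u v w, (∃ e < γ.ireg 20, γ.iarr (nm b 1 0) e = u ∧ γ.iarr (nm b 2 0) e = v ∧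
          γ.rarr (nm b 1 0) e = w) ↔ ∃ e < m, p < W e ∧ β.iarr (nm b 6 0) (A e) = u ∧
            β.iarr (nm b 6 0) (B e) = v ∧ W e = w := by
        intro u v w
        rw [hnew]
        refine exists_congr fun e => and_congr_right fun he => ?_
        rw [hM' e he, not_le]
      intro T'' hT''
      refine ⟨by omega, hm1, .inr ⟨g26, ⟨hsym.of_new (q := fun w => p < w) hnew', ?_, fun θ => ?_,
        θ₀, hθ₀⟩, ?_⟩⟩
      · rw [g24, g25]
        exact hneq'
      · rw [g24, g25, ← hJ]
        exact joined_iff_of_contract hsym hM' hsN htN hL' hneq' hnew' θ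
      · rw [cnt_eq_card_filter _ _ _ hM'] at hp1
        omega

/-- Make a working copy of the edge list. -/
def loadEdges (b : ℕ) : Program :=
  seq (mv 20 28) (forI 12 20 (seq (loadI 13 (nm b 10 0) 12) (seq (storeI (nm b 1 0) 12 13)
    (seq (loadI 13 (nm b 11 0) 12) (seq (storeI (nm b 2 0) 12 13)
    (seq (loadR 1 (nm b 3 0) 12) (storeR (nm b 1 0) 12 1)))))))

theorem loadEdges_spec (b : ℕ) (σ : Memory) {m : ℕ} (h28 : σ.ireg 28 = m) :
    Run (loadEdges b) σ fun T σ' => T ≤ 20 * m + 10 ∧ σ'.ireg 20 = m ∧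
      ∀ e < m, σ'.iarr (nm b 1 0) e = σ.iarr (nm b 10 0) e ∧
        σ'.iarr (nm b 2 0) e = σ.iarr (nm b 11 0) e ∧
        σ'.rarr (nm b 1 0) e = σ.rarr (nm b 3 0) e := by
  refine Run.seq (Run.of_loopFree (by simp [mv]) fun T1 hT1 => ?_)
  simp [mv, h28] at hT1 ⊢
  refine (Run.forI_loopFree (fun j τ => τ.ireg 20 = m ∧ ∀ e < j,
    τ.iarr (nm b 1 0) e = σ.iarr (nm b 10 0) e ∧ τ.iarr (nm b 2 0) e = σ.iarr (nm b 11 0) e ∧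
    τ.rarr (nm b 1 0) e = σ.rarr (nm b 3 0) e)
    (by simp) (by simp) (by simp) (by simp) (by simp) (by simp) (by simp) ?_).mono ?_
  · rintro j τ hj hF hi ⟨h20, hI⟩
    have t1 := hF.iarr (nm b 10 0) (by simp)
    have t2 := hF.iarr (nm b 11 0) (by simp)
    have t3 := hF.rarr (nm b 3 0) (by simp)
    simp at t1 t2 t3
    simp [hi, t1, t2, t3, h20]
    intro e he
    by_cases hej : e = j
    · simp [hej]
    · simpa [hej] using hI e (by omega)
  · rintro T σ' - ⟨⟨h20, h⟩, hT⟩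
    simp at hT h
    exact ⟨by omega, h20, h⟩

/-- Follow the parents from the node in integer register `30` to the root of the search, and list
the nodes of this path in the array `12`. -/
def followParents (b : ℕ) : Program :=
  seq (seq (loadI 16 (nm b 9 0) 30) (seq (setI 12 0) (setI 14 0)))
    (seq (whileI 14 16 (seq (loadI 13 (nm b 7 0) 16) (seq (storeI (nm b 12 0) 12 13)
      (seq (inc 12) (loadI 16 (nm b 8 0) 16)))))
    (seq (loadI 13 (nm b 7 0) 16) (seq (storeI (nm b 12 0) 12 13) (mv 29 12))))

/-- In a search tree, where parents come earlier in the queue, the path from `s` to the root `t` is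
listed in linear time. -/
theorem followParents_spec (b : ℕ) (σ : Memory) {Q P : ℕ → ℕ} {R : ℕ → ℕ → Prop} {s t qt : ℕ}
    (hQ : σ.iarr (nm b 7 0) = Q) (hP : σ.iarr (nm b 8 0) = P) (h30 : σ.ireg 30 = s)
    (hs : σ.iarr (nm b 9 0) s < qt) (hs' : Q (σ.iarr (nm b 9 0) s) = s) (ht : Q 0 = t)
    (htree : ∀ q < qt, q ≠ 0 → P q < q ∧ R (Q q) (Q (P q))) :
    Run (followParents b) σ fun T σ' => T ≤ 20 * qt + 20 ∧ σ'.ireg 29 < qt ∧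
      σ'.iarr (nm b 12 0) 0 = s ∧ σ'.iarr (nm b 12 0) (σ'.ireg 29) = t ∧
      ∀ l < σ'.ireg 29, R (σ'.iarr (nm b 12 0) l) (σ'.iarr (nm b 12 0) (l + 1)) := by
  refine Run.seq (Run.of_loopFree (by simp) fun T1 hT1 => ?_)
  simp [h30] at hT1 ⊢
  refine Run.seq' (Run.whileI (fun τ => τ.ireg 14 = 0 ∧ τ.ireg 16 + τ.ireg 12 < qt ∧
      (if 0 < τ.ireg 12 then τ.iarr (nm b 12 0) 0 else Q (τ.ireg 16)) = s ∧
      ∀ l < τ.ireg 12, R (τ.iarr (nm b 12 0) l)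
        (if l + 1 < τ.ireg 12 then τ.iarr (nm b 12 0) (l + 1) else Q (τ.ireg 16)))
    (fun τ => 10 * τ.ireg 16) ?_ ?_) ?_
  · simp
    exact ⟨hs, hs'⟩
  · rintro τ hF ⟨i14, i1, i2, i3⟩ hlt
    have tQ := hF.iarr (nm b 7 0) (by simp)
    have tP := hF.iarr (nm b 8 0) (by simp)
    simp [hQ, hP] at tQ tP
    refine Run.of_loopFree (by simp) fun T hT => ?_
    simp [inc, tQ, tP] at hT ⊢
    obtain ⟨h1, h2⟩ := htree (τ.ireg 16) (by omega) (by omega)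
    refine ⟨⟨i14, by omega, ?_, fun l hl => ?_⟩, by omega⟩
    · split_ifs with h
      · simpa [← h] using i2
      · simpa [Nat.pos_of_ne_zero (Ne.symm h)] using i2
    · by_cases hlt' : l < τ.ireg 12
      · have h3 := i3 l hlt'
        simp only [hlt'.ne, hlt', if_true, if_false]
        by_cases h4 : l + 1 = τ.ireg 12
        · simpa [h4] using h3
        · have h5 : l + 1 < τ.ireg 12 := by omega
          simpa [h4, h5] using h3
      · obtain rfl : l = τ.ireg 12 := by omega
        simpa using h2
  · rintro T2 τ hF ⟨⟨i14, i1, i2, i3⟩, hge, hT2⟩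
    have tQ := hF.iarr (nm b 7 0) (by simp)
    simp [hQ] at tQ
    have i16 : τ.ireg 16 = 0 := by omega
    rw [i16] at i1 i2 i3 hT2
    rw [ht] at i2 i3
    simp at hT2
    refine Run.of_loopFree (by simp [mv]) fun T3 hT3 => ?_
    simp [mv, tQ, i16, ht] at hT3 ⊢
    refine ⟨by omega, by omega, ?_, fun l hl => ?_⟩
    · split_ifs with h
      · simpa [← h] using i2
      · simpa [Nat.pos_of_ne_zero (Ne.symm h)] using i2
    · have h3 := i3 l hl
      simp only [hl.ne, if_false]
      by_cases h4 : l + 1 = τ.ireg 12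
      · simpa [h4] using h3
      · have h5 : l + 1 < τ.ireg 12 := by omega
        simpa [h4, h5] using h3

/-- Find the bottleneck and a bottleneck path. The edge list is in the arrays `10` and `11` and the
real array `3`, its length in integer register `28`, the terminals in integer registers `30` and `31`.
The length of the path is returned in integer register `29`, its nodes in array `12`. -/
def bottleneckPath (b : ℕ) : Program :=
  seq (loadEdges b) (seq (seq (mv 24 30) (seq (mv 25 31) (seq (setI 26 0) (setI 27 1))))
    (seq (whileI 26 27 (bottleneckRound b))
    (seq (loadEdges b) (seq (markLe b) (seq (seq (initSearch b) (buildLists b))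
    (seq (mv 17 31) (seq (search b) (followParents b))))))))

theorem LinkLE.congr {A B A' B' : ℕ → ℕ} {W W' : ℕ → ℝ} {m : ℕ}
    (h : ∀ e < m, A' e = A e ∧ B' e = B e ∧ W' e = W e) (θ : ℝ) :
    LinkLE A' B' W' m θ = LinkLE A B W m θ := by
  funext u v
  refine propext (exists_congr fun e => and_congr_right fun he => ?_)
  obtain ⟨h1, h2, h3⟩ := h e he
  rw [h1, h2, h3]

/-- A bottleneck path is found in time linear in the number of edges: the times of the rounds form a
geometric series. -/
theorem bottleneckPath_spec (b : ℕ) (σ : Memory) {A B : ℕ → ℕ} {W : ℕ → ℝ} {m s t : ℕ}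
    (hA : σ.iarr (nm b 10 0) = A) (hB : σ.iarr (nm b 11 0) = B) (hW : σ.rarr (nm b 3 0) = W)
    (h28 : σ.ireg 28 = m) (h30 : σ.ireg 30 = s) (h31 : σ.ireg 31 = t)
    (hsym : SymmEdges A B W m) (hne : s ≠ t)
    (hex : ∃ θ, Relation.ReflTransGen (LinkLE A B W m θ) s t) :
    Run (bottleneckPath b) σ fun T σ' => T ≤ 1000000 * m ∧ 0 < σ'.ireg 29 ∧ σ'.ireg 29 ≤ m ∧
      σ'.iarr (nm b 12 0) 0 = s ∧ σ'.iarr (nm b 12 0) (σ'.ireg 29) = t ∧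
      ∃ p, IsLeast {θ | Relation.ReflTransGen (LinkLE A B W m θ) s t} p ∧
        ∀ l < σ'.ireg 29, LinkLE A B W m p (σ'.iarr (nm b 12 0) l) (σ'.iarr (nm b 12 0) (l + 1)) := by
  have hm1 : 1 ≤ m := by
    obtain ⟨θ, hθ⟩ := hex
    obtain ⟨e, he, -⟩ := (hsym.isNode hne hθ).1
    omega
  refine Run.seq' (loadEdges_spec b σ h28) ?_
  rintro T1 τ hF ⟨hT1, t20, hcopy⟩
  have t30 := hF.ireg 30 (by simp [loadEdges, mv])
  have t31 := hF.ireg 31 (by simp [loadEdges, mv])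
  have t28 := hF.ireg 28 (by simp [loadEdges, mv])
  have t10 := hF.iarr (nm b 10 0) (by simp [loadEdges, mv])
  have t11 := hF.iarr (nm b 11 0) (by simp [loadEdges, mv])
  have t3 := hF.rarr (nm b 3 0) (by simp [loadEdges, mv])
  rw [hA, hB, hW] at hcopy
  rw [hA] at t10
  rw [hB] at t11
  rw [hW] at t3
  rw [h30] at t30
  rw [h31] at t31
  rw [h28] at t28
  clear hF
  refine Run.seq (Run.of_loopFree (by simp [mv]) fun T2 hT2 => ?_)
  simp [mv, t30, t31] at hT2 ⊢
  refine Run.seq' (Run.whileI (fun ρ => ρ.ireg 27 = 1 ∧ ((ρ.ireg 26 = 1 ∧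
      IsLeast {θ | Relation.ReflTransGen (LinkLE A B W m θ) s t} (ρ.rreg 3)) ∨
      (ρ.ireg 26 = 0 ∧
        Reduced b (fun θ => Relation.ReflTransGen (LinkLE A B W m θ) s t) ρ)))
    (fun ρ => 900000 * (ρ.ireg 20 * (1 - ρ.ireg 26))) ?_ ?_) ?_
  · simp
    refine ⟨?_, ?_, ?_, hex⟩
    · simp [t20]
      intro e he
      obtain ⟨e', he', h1, h2, h3⟩ := hsym e he
      obtain ⟨c1, c2, c3⟩ := hcopy e he
      obtain ⟨d1, d2, d3⟩ := hcopy e' he'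
      exact ⟨e', he', by rw [d1, c2, h1], by rw [d2, c1, h2], by rw [d3, c3, h3]⟩
    · simpa using hne
    · intro θ
      simp [t20, LinkLE.congr hcopy]
  · rintro ρ - ⟨r27, hI⟩ hlt
    obtain ⟨r26, hI⟩ : ρ.ireg 26 = 0 ∧
        Reduced b (fun θ => Relation.ReflTransGen (LinkLE A B W m θ) s t) ρ := by
      rcases hI with ⟨h, -⟩ | h
      · omega
      · exact h
    refine (bottleneckRound_spec b ρ hI).mono ?_
    rintro T π hF ⟨hT, h20, h⟩
    have p27 := hF.ireg 27 (by
      simp [bottleneckRound, selectPivot, sampleLevel, sampleBlock, sortBlock, copyFourth, markLt,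
        markLe, markGe, mark, components, initSearch, buildLists, search, searchLoop, ifEq, idLabels,
        contract])
    rcases h with ⟨h1, h2⟩ | ⟨h1, h2, h3⟩
    · refine ⟨⟨by omega, .inl ⟨h1, h2⟩⟩, ?_⟩
      rw [h1, r26]
      omega
    · refine ⟨⟨by omega, .inr ⟨by omega, h2⟩⟩, ?_⟩
      rw [h1, r26]
      omega
  rintro T3 ρ hF ⟨⟨r27, hI⟩, hge, hT3⟩
  have hdef : ∀ c, c = bottleneckRound b → ∀ x, x = 28 ∨ x = 30 ∨ x = 31 → ¬ c.wI x := by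
    rintro c rfl x (rfl | rfl | rfl) <;>
    simp [bottleneckRound, selectPivot, sampleLevel, sampleBlock, sortBlock, copyFourth, markLt,
        markLe, markGe, mark, components, initSearch, buildLists, search, searchLoop, ifEq, idLabels,
        contract]
  have r28 := hF.ireg 28 (hdef _ rfl _ (by simp))
  have r30 := hF.ireg 30 (hdef _ rfl _ (by simp))
  have r31 := hF.ireg 31 (hdef _ rfl _ (by simp))
  have r10 := hF.iarr (nm b 10 0) (by
      simp [bottleneckRound, selectPivot, sampleLevel, sampleBlock, sortBlock, copyFourth, markLt,
        markLe, markGe, mark, components, initSearch, buildLists, search, searchLoop, ifEq, idLabels,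
        contract])
  have r11 := hF.iarr (nm b 11 0) (by
      simp [bottleneckRound, selectPivot, sampleLevel, sampleBlock, sortBlock, copyFourth, markLt,
        markLe, markGe, mark, components, initSearch, buildLists, search, searchLoop, ifEq, idLabels,
        contract])
  have r3 := hF.rarr (nm b 3 0) (by
      simp [bottleneckRound, selectPivot, sampleLevel, sampleBlock, sortBlock, copyFourth, markLt,
        markLe, markGe, mark, components, initSearch, buildLists, search, searchLoop, ifEq, idLabels,
        contract])
  simp [t28, t30, t31, t10, t11, t3] at r28 r30 r31 r10 r11 r3
  clear hF
  obtain ⟨r26, hp⟩ : ρ.ireg 26 = 1 ∧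
      IsLeast {θ | Relation.ReflTransGen (LinkLE A B W m θ) s t} (ρ.rreg 3) := by
    rcases hI with h | ⟨h, -⟩
    · exact h
    · omega
  rw [r26] at hT3
  simp [t20] at hT3
  obtain ⟨p, hpp⟩ : ∃ p, p = ρ.rreg 3 := ⟨_, rfl⟩
  rw [← hpp] at hp
  refine Run.seq' (loadEdges_spec b ρ r28) ?_
  rintro T4 π hF ⟨hT4, p20, hcopy'⟩
  rw [r10, r11, r3] at hcopy'
  have p30 := hF.ireg 30 (by simp [loadEdges, mv])
  have p31 := hF.ireg 31 (by simp [loadEdges, mv])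
  have p3 := hF.rreg 3 (by simp [loadEdges, mv])
  rw [r30] at p30
  rw [r31] at p31
  rw [← hpp] at p3
  clear hF
  refine Run.seq' (markLe_spec b π p20) ?_
  rintro T5 α hF ⟨hT5, hM⟩
  rw [p3] at hM
  have a30 := hF.ireg 30 (by simp [markLe, mark])
  have a31 := hF.ireg 31 (by simp [markLe, mark])
  have a20 := hF.ireg 20 (by simp [markLe, mark])
  have a1 := hF.iarr (nm b 1 0) (by simp [markLe, mark])
  have a2 := hF.iarr (nm b 2 0) (by simp [markLe, mark])
  rw [p30] at a30
  rw [p31] at a31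
  rw [p20] at a20
  clear hF
  refine Run.seq' (initLists_spec b α (A := π.iarr (nm b 1 0)) (B := π.iarr (nm b 2 0))
    (M := α.iarr (nm b 3 0)) a1 rfl a20) ?_
  rintro T6 β hF ⟨hT6, hL, hL0⟩
  have b30 := hF.ireg 30 (by simp [initSearch, buildLists])
  have b31 := hF.ireg 31 (by simp [initSearch, buildLists])
  have b1 := hF.iarr (nm b 1 0) (by simp [initSearch, buildLists])
  have b2 := hF.iarr (nm b 2 0) (by simp [initSearch, buildLists])
  have b3 := hF.iarr (nm b 3 0) (by simp [initSearch, buildLists])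
  rw [a30] at b30
  rw [a31] at b31
  rw [a1] at b1
  rw [a2] at b2
  clear hF
  obtain ⟨M, hMM⟩ : ∃ M, M = α.iarr (nm b 3 0) := ⟨_, rfl⟩
  obtain ⟨A', hA'⟩ : ∃ A', A' = π.iarr (nm b 1 0) := ⟨_, rfl⟩
  obtain ⟨B', hB'⟩ : ∃ B', B' = π.iarr (nm b 2 0) := ⟨_, rfl⟩
  rw [← hMM] at hM hL b3
  rw [← hA'] at hL hL0 b1
  rw [← hB'] at hL b2
  simp only [← hA', ← hB'] at hcopy'
  have hM' : ∀ e < m, 1 ≤ M e ↔ W e ≤ p := fun e he => by rw [hM e he, (hcopy' e he).2.2]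
  have hsym' : ∀ e < m, 1 ≤ M e → ∃ e' < m, 1 ≤ M e' ∧ A' e' = B' e ∧ B' e' = A' e := by
    intro e he hMe
    obtain ⟨e', he', h1, h2, h3⟩ := hsym e he
    refine ⟨e', he', ?_, ?_, ?_⟩
    · rw [hM' e' he', h3, ← hM' e he]
      exact hMe
    · rw [(hcopy' e' he').1, (hcopy' e he).2.1, h1]
    · rw [(hcopy' e' he').2.1, (hcopy' e he).1, h2]
  have hlink : ∀ u v, MarkedAdj A' B' M m u v → LinkLE A B W m p v u := by
    rintro u v ⟨e, he, h0, h1, h2⟩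
    obtain ⟨e', he', h3, h4, h5⟩ := hsym' e he h0
    rw [(hcopy' e' he').1, h2] at h4
    rw [(hcopy' e' he').2.1, h1] at h5
    exact ⟨e', he', h4, h5, (hM' e' he').1 h3⟩
  have hlink' : ∀ u v, LinkLE A B W m p u v → MarkedAdj A' B' M m v u := by
    rintro u v ⟨e, he, h1, h2, h3⟩
    obtain ⟨e', he', h4, h5, h6⟩ := hsym' e he ((hM' e he).2 h3)
    exact ⟨e', he', h4, by rw [h5, (hcopy' e he).2.1, h2], by rw [h6, (hcopy' e he).1, h1]⟩
  obtain ⟨hsN, htN⟩ := hsym.isNode hne hp.1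
  have hN : ∀ u, IsNode A m u → IsNode A' m u := by
    rintro u ⟨e, he, rfl⟩
    exact ⟨e, he, (hcopy' e he).1⟩
  refine Run.seq (Run.of_loopFree (by simp) fun T7 hT7 => ?_)
  simp [b31] at hT7 ⊢
  refine Run.seq' (search_spec b _ (A := A') (B := B') (M := M) (X := β.iarr (nm b 5 0)) (m := m)
    (r := t) (by simpa using b2) (by simp) (by simp) hsym' (by simpa using hL) (hN t htN)
    (by simpa using hL0 t (hN t htN)) (by simpa using fun u hu h => absurd (hL0 u hu) h)) ?_
  rintro T8 γ hF ⟨hS, hT8, hqt⟩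
  simp at hS hT8
  have g30 := hF.ireg 30 (by simp [search, searchLoop])
  simp [b30] at g30
  have hlab : ∀ u, Relation.ReflTransGen (MarkedAdj A' B' M m) t u → γ.iarr (nm b 6 0) u ≠ 0 := by
    intro u hu
    induction hu with
    | refl =>
      have := hS.label 0 hS.qt_pos
      rw [hS.root] at this
      rw [this]; simp
    | tail _ h ih =>
      obtain ⟨e, he, h0, rfl, rfl⟩ := h
      have hh : γ.iarr (nm b 4 0) (A' e) = 0 := by
        rcases hS.active _ ⟨e, he, rfl⟩ ih with h | ⟨q, h1, h2, -⟩
        · exact h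
        · omega
      obtain ⟨h1, h2⟩ := hS.closed e he h0 (by rw [hh]; exact Nat.zero_le _)
      rw [h1]
      exact h2
  have hpos := hS.pos s (hN s hsN) (hL0 s (hN s hsN)) (hlab s
    (Relation.ReflTransGen.mono (fun v u h => hlink' u v h) _ _ (Relation.reflTransGen_swap.2 hp.1)))
  refine (followParents_spec b γ (Q := γ.iarr (nm b 7 0)) (P := γ.iarr (nm b 8 0))
    (R := LinkLE A B W m p) (s := s) (t := t) (qt := γ.ireg 22) rfl rfl g30 hpos.1 hpos.2 hS.root
    fun q hq h0 => ⟨(hS.tree q hq h0).1, hlink _ _ (hS.tree q hq h0).2⟩).mono ?_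
  rintro T9 ω - ⟨hT9, w1, w2, w3, w4⟩
  have hrem := remaining_le A' M m (β.iarr (nm b 4 0))
  refine ⟨by omega, ?_, by omega, w2, w3, p, hp, w4⟩
  rcases Nat.eq_zero_or_pos (ω.ireg 29) with h | h
  · rw [h, w2] at w3
    exact absurd w3 hne
  · exact h

/-! ### Semialgebraic sets and functions -/

/-- `S` is semialgebraic: first-order definable without parameters in the field of real numbers. -/
def SemialgebraicSet {α : Type} (S : Set (α → ℝ)) : Prop :=
  letI := FirstOrder.Ring.compatibleRingOfRing ℝ
  (∅ : Set ℝ).Definable FirstOrder.Language.ring S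

/-- `f` is given by a term in the language of rings. -/
def TermFun {α : Type} (f : (α → ℝ) → ℝ) : Prop :=
  letI := FirstOrder.Ring.compatibleRingOfRing ℝ
  ∃ t : FirstOrder.Language.ring.Term α, ∀ v, t.realize v = f v

section
variable {α β : Type}

theorem TermFun.var (i : α) : TermFun fun v => v i :=
  letI := FirstOrder.Ring.compatibleRingOfRing ℝ
  ⟨.var i, fun _ => rfl⟩

theorem TermFun.zero : TermFun fun _ : α → ℝ => 0 :=
  letI := FirstOrder.Ring.compatibleRingOfRing ℝ
  ⟨0, fun _ => by simp⟩

theorem TermFun.one : TermFun fun _ : α → ℝ => 1 :=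
  letI := FirstOrder.Ring.compatibleRingOfRing ℝ
  ⟨1, fun _ => by simp⟩

theorem TermFun.add {f g : (α → ℝ) → ℝ} (hf : TermFun f) (hg : TermFun g) :
    TermFun fun v => f v + g v :=
  letI := FirstOrder.Ring.compatibleRingOfRing ℝ
  let ⟨t, ht⟩ := hf
  let ⟨u, hu⟩ := hg
  ⟨t + u, fun v => by simp [ht, hu]⟩

theorem TermFun.mul {f g : (α → ℝ) → ℝ} (hf : TermFun f) (hg : TermFun g) :
    TermFun fun v => f v * g v :=
  letI := FirstOrder.Ring.compatibleRingOfRing ℝ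
  let ⟨t, ht⟩ := hf
  let ⟨u, hu⟩ := hg
  ⟨t * u, fun v => by simp [ht, hu]⟩

theorem TermFun.neg {f : (α → ℝ) → ℝ} (hf : TermFun f) : TermFun fun v => - f v :=
  letI := FirstOrder.Ring.compatibleRingOfRing ℝ
  let ⟨t, ht⟩ := hf
  ⟨-t, fun v => by simp [ht]⟩

theorem TermFun.sub {f g : (α → ℝ) → ℝ} (hf : TermFun f) (hg : TermFun g) :
    TermFun fun v => f v - g v := by
  simpa [sub_eq_add_neg] using hf.add hg.neg

theorem TermFun.sq {f : (α → ℝ) → ℝ} (hf : TermFun f) : TermFun fun v => f v ^ 2 := by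
  simpa [pow_two] using hf.mul hf

theorem TermFun.sum {ι : Type*} (s : Finset ι) {f : ι → (α → ℝ) → ℝ} (hf : ∀ i, TermFun (f i)) :
    TermFun fun v => ∑ i ∈ s, f i v := by
  classical
  induction s using Finset.induction_on with
  | empty => simpa using TermFun.zero
  | insert a s ha ih => simpa [Finset.sum_insert ha] using (hf a).add ih

theorem SemialgebraicSet.eq {f g : (α → ℝ) → ℝ} (hf : TermFun f) (hg : TermFun g) :
    SemialgebraicSet {v | f v = g v} := by
  let := FirstOrder.Ring.compatibleRingOfRing ℝ
  obtain ⟨t, ht⟩ := hf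
  obtain ⟨u, hu⟩ := hg
  refine Set.empty_definable_iff.2 ⟨t.equal u, ?_⟩
  ext v
  simp [← ht, ← hu]

theorem SemialgebraicSet.and {P Q : (α → ℝ) → Prop} (hP : SemialgebraicSet {v | P v})
    (hQ : SemialgebraicSet {v | Q v}) : SemialgebraicSet {v | P v ∧ Q v} := by
  let := FirstOrder.Ring.compatibleRingOfRing ℝ
  exact Set.Definable.inter hP hQ

theorem SemialgebraicSet.not {P : (α → ℝ) → Prop} (hP : SemialgebraicSet {v | P v}) :
    SemialgebraicSet {v | ¬ P v} := by
  let := FirstOrder.Ring.compatibleRingOfRing ℝ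
  exact Set.Definable.compl hP

theorem SemialgebraicSet.imp {P Q : (α → ℝ) → Prop} (hP : SemialgebraicSet {v | P v})
    (hQ : SemialgebraicSet {v | Q v}) : SemialgebraicSet {v | P v → Q v} := by
  have := (hP.and hQ.not).not
  simpa using this

theorem SemialgebraicSet.forall_finite {ι : Type*} [Finite ι] {P : ι → (α → ℝ) → Prop}
    (hP : ∀ i, SemialgebraicSet {v | P i v}) : SemialgebraicSet {v | ∀ i, P i v} := by
  let := FirstOrder.Ring.compatibleRingOfRing ℝ
  have : {v | ∀ i, P i v} = ⋂ i, {v | P i v} := by ext; simp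
  rw [this]
  exact Set.definable_iInter_of_finite hP

/-- Quantification over tuples of real numbers. -/
theorem SemialgebraicSet.exists_tuple [Finite β] {P : (α → ℝ) → (β → ℝ) → Prop}
    (hP : SemialgebraicSet {v : α ⊕ β → ℝ | P (v ∘ Sum.inl) (v ∘ Sum.inr)}) :
    SemialgebraicSet {v | ∃ u, P v u} := by
  let := FirstOrder.Ring.compatibleRingOfRing ℝ
  have := Set.Definable.exists_of_finite (β := β) hP
  simpa [SemialgebraicSet] using this

theorem SemialgebraicSet.forall_tuple [Finite β] {P : (α → ℝ) → (β → ℝ) → Prop}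
    (hP : SemialgebraicSet {v : α ⊕ β → ℝ | P (v ∘ Sum.inl) (v ∘ Sum.inr)}) :
    SemialgebraicSet {v | ∀ u, P v u} := by
  have := (exists_tuple (P := fun v u => ¬ P v u) hP.not).not
  simpa using this

theorem SemialgebraicSet.le {f g : (α → ℝ) → ℝ} (hf : TermFun f) (hg : TermFun g) :
    SemialgebraicSet {v | f v ≤ g v} := by
  obtain ⟨t, ht⟩ := hf
  obtain ⟨u, hu⟩ := hg
  have h1 : TermFun fun v : α ⊕ Unit → ℝ => f (v ∘ Sum.inl) := by
    let := FirstOrder.Ring.compatibleRingOfRing ℝ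
    exact ⟨t.relabel Sum.inl, fun v => by simp [← ht]⟩
  have h2 : TermFun fun v : α ⊕ Unit → ℝ => g (v ∘ Sum.inl) := by
    let := FirstOrder.Ring.compatibleRingOfRing ℝ
    exact ⟨u.relabel Sum.inl, fun v => by simp [← hu]⟩
  have := SemialgebraicSet.exists_tuple (α := α) (β := Unit)
    (P := fun v w => g v = f v + (w ()) ^ 2) (SemialgebraicSet.eq h2 (h1.add (TermFun.var _).sq))
  convert this using 1
  ext v
  simp only [Set.mem_ofPred_eq]
  constructor
  · intro h
    exact ⟨fun _ => √(g v - f v), by rw [Real.sq_sqrt (by linarith)]; ring⟩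
  · rintro ⟨w, hw⟩
    nlinarith [sq_nonneg (w ())]

theorem SemialgebraicSet.comp {S : Set (α → ℝ)} (hS : SemialgebraicSet S) (f : α → β) :
    SemialgebraicSet {v : β → ℝ | v ∘ f ∈ S} := by
  let := FirstOrder.Ring.compatibleRingOfRing ℝ
  exact Set.Definable.preimage_comp f hS

/-- A function on `m`-tuples, whose coordinates are named by `α`, is semialgebraic if its graph is. -/
theorem SemialgebraicFun.of_graph {m : ℕ} (e : α ≃ Fin m) (g : (α → ℝ) → ℝ)
    (h : SemialgebraicSet {w : Option α → ℝ | g (w ∘ some) = w none}) :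
    SemialgebraicFun fun v : Fin m → ℝ => g (v ∘ e) := by
  have := h.comp (Option.map e)
  convert! this using 1

end

/-! ### Best positions of the agents in convex sets -/

/-- The projection of `ℝ^e` to `ℝ^d` that keeps the coordinates `σ 0, …, σ (d - 1)`. -/
noncomputable def proj {d e : ℕ} (σ : Fin d → Fin e) : Pt e →ₗ[ℝ] Pt d where
  toFun x := WithLp.toLp 2 fun c => x (σ c)
  map_add' x y := by ext c; simp
  map_smul' r x := by ext c; simp

@[simp] theorem proj_apply {d e : ℕ} (σ : Fin d → Fin e) (x : Pt e) (c : Fin d) :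
    proj σ x c = x (σ c) := rfl

theorem continuous_proj {d e : ℕ} (σ : Fin d → Fin e) : Continuous (proj σ) :=
  (proj σ).continuous_of_finiteDimensional

/-- `x` places the agents in the sets `H i`, such that the largest distance `w` from the first
agent, measured in the coordinates selected by `σ`, is minimum, and such that moreover the sum of
the squared norms is minimum. For convex sets, the latter makes `x` unique. -/
structure IsBest {k d e : ℕ} [NeZero k] (σ : Fin d → Fin e) (H : Fin k → Set (Pt e))
    (x : Fin k → Pt e) (w : ℝ) : Prop where
  mem : ∀ i, x i ∈ H i
  dist_le : ∀ i, dist (proj σ (x 0)) (proj σ (x i)) ≤ w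
  le_of_feasible : ∀ x' : Fin k → Pt e, (∀ i, x' i ∈ H i) → ∀ w' : ℝ,
    (∀ i, dist (proj σ (x' 0)) (proj σ (x' i)) ≤ w') →
      w ≤ w' ∧ (w' = w → ∑ i, ‖x i‖ ^ 2 ≤ ∑ i, ‖x' i‖ ^ 2)

section
variable {k d e : ℕ} [NeZero k] {σ : Fin d → Fin e} {H H' : Fin k → Set (Pt e)}
  {x x' : Fin k → Pt e} {w w' : ℝ}

theorem IsBest.exists (hc : ∀ i, IsCompact (H i)) (hn : ∀ i, (H i).Nonempty) :
    ∃ x w, IsBest σ H x w := by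
  have hne : (Finset.univ : Finset (Fin k)).Nonempty := ⟨0, Finset.mem_univ _⟩
  let f : (Fin k → Pt e) → ℝ := fun x =>
    Finset.univ.sup' hne fun i => dist (proj σ (x 0)) (proj σ (x i))
  have hf : Continuous f := by
    refine Continuous.finset_sup'_apply hne fun i _ => ?_
    exact ((continuous_proj σ).comp (continuous_apply 0)).dist
      ((continuous_proj σ).comp (continuous_apply i))
  have hS : IsCompact (Set.univ.pi H) := isCompact_univ_pi hc
  obtain ⟨x₀, hx₀, hmin⟩ := hS.exists_isMinOn (Set.univ_pi_nonempty_iff.2 hn) hf.continuousOn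
  have hS' : IsCompact (Set.univ.pi H ∩ {x | f x ≤ f x₀}) :=
    hS.inter_right (isClosed_le hf continuous_const)
  obtain ⟨x₁, hx₁, hmin₁⟩ := hS'.exists_isMinOn ⟨x₀, hx₀, by simp⟩
    (f := fun x : Fin k → Pt e => ∑ i, ‖x i‖ ^ 2) (by fun_prop)
  refine ⟨x₁, f x₀, fun i => hx₁.1 i trivial, fun i => ?_, fun x' hx' w' hw' => ⟨?_, ?_⟩⟩
  · exact (Finset.le_sup' (fun i => dist (proj σ (x₁ 0)) (proj σ (x₁ i)))
      (Finset.mem_univ i)).trans hx₁.2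
  · exact (hmin fun i _ => hx' i : f x₀ ≤ f x').trans (Finset.sup'_le _ _ fun i _ => hw' i)
  · rintro rfl
    exact hmin₁ ⟨fun i _ => hx' i, Finset.sup'_le _ _ fun i _ => hw' i⟩

/-- The smallest leash length decreases when the sets grow. -/
theorem IsBest.weight_anti (h : IsBest σ H x w) (h' : IsBest σ H' x' w') (hH : ∀ i, H i ⊆ H' i) :
    w' ≤ w :=
  (h'.le_of_feasible x (fun i => hH i (h.mem i)) w h.dist_le).1

theorem dist_combination_le {a b : ℝ} (ha : 0 ≤ a) (hb : 0 ≤ b) (hab : a + b = 1)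
    {u u' v v' : Pt d} (h : dist u v ≤ w) (h' : dist u' v' ≤ w) :
    dist (a • u + b • u') (a • v + b • v') ≤ w := by
  have h1 : u - v ∈ Metric.closedBall (0 : Pt d) w := by simpa [dist_eq_norm] using h
  have h2 : u' - v' ∈ Metric.closedBall (0 : Pt d) w := by simpa [dist_eq_norm] using h'
  have hu := convex_closedBall (0 : Pt d) w h1 h2 ha hb hab
  rw [mem_closedBall_zero_iff] at hu
  rwa [dist_eq_norm, show a • u + b • u' - (a • v + b • v') = a • (u - v) + b • (u' - v') by module]

/-- By strict convexity of the sum of the squared norms, as the midpoint of two best positions is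
admissible. -/
theorem IsBest.unique (hH : ∀ i, Convex ℝ (H i)) (h : IsBest σ H x w) (h' : IsBest σ H x' w') :
    x = x' ∧ w = w' := by
  have hw : w = w' := le_antisymm (h.le_of_feasible x' h'.mem w' h'.dist_le).1
    (h'.le_of_feasible x h.mem w h.dist_le).1
  subst hw
  refine ⟨?_, rfl⟩
  have h1 := (h.le_of_feasible x' h'.mem w h'.dist_le).2 rfl
  have h2 := (h'.le_of_feasible x h.mem w h.dist_le).2 rfl
  have h3 := (h.le_of_feasible (fun i => (1 / 2 : ℝ) • x i + (1 / 2 : ℝ) • x' i)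
    (fun i => hH i (h.mem i) (h'.mem i) (by norm_num) (by norm_num) (by norm_num)) w
    (fun i => by
      simp only [map_add, map_smul]
      exact dist_combination_le (by norm_num) (by norm_num) (by norm_num)
        (h.dist_le i) (h'.dist_le i))).2 rfl
  have h4 : ∀ i, ‖(1 / 2 : ℝ) • x i + (1 / 2 : ℝ) • x' i‖ ^ 2 =
      1 / 2 * ‖x i‖ ^ 2 + 1 / 2 * ‖x' i‖ ^ 2 - 1 / 4 * ‖x i - x' i‖ ^ 2 := by
    intro i
    have hp := parallelogram_law_with_norm ℝ (x i) (x' i)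
    rw [← smul_add, norm_smul]
    norm_num
    nlinarith
  simp only [h4, Finset.sum_sub_distrib, Finset.sum_add_distrib, ← Finset.mul_sum] at h3
  have h5 : ∑ i, ‖x i - x' i‖ ^ 2 ≤ 0 := by linarith
  funext i
  have h6 := (Finset.sum_eq_zero_iff_of_nonneg (fun i _ => by positivity)).1
    (le_antisymm h5 (Finset.sum_nonneg fun i _ => by positivity)) i (Finset.mem_univ i)
  simpa [sub_eq_zero] using h6

end

theorem mem_convexHull_range_iff {E ι : Type*} [AddCommGroup E] [Module ℝ E] [Fintype ι]
    {p : ι → E} {x : E} :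
    x ∈ convexHull ℝ (Set.range p) ↔
      ∃ u : ι → ℝ, (∀ i, 0 ≤ u i) ∧ ∑ i, u i = 1 ∧ ∑ i, u i • p i = x := by
  classical
  constructor
  · intro hx
    have : convexHull ℝ (Set.range p) ⊆ Fintype.linearCombination ℝ p '' stdSimplex ℝ ι := by
      refine convexHull_min ?_ ((convex_stdSimplex ℝ ι).linear_image _)
      rintro _ ⟨i, rfl⟩
      exact ⟨Pi.single i 1, single_mem_stdSimplex ℝ i,
        by simp⟩
    obtain ⟨u, ⟨hu, hu1⟩, hux⟩ := this hx
    exact ⟨u, hu, hu1, hux⟩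
  · rintro ⟨u, hu, hu1, rfl⟩
    exact mem_convexHull_of_exists_fintype u p hu hu1 (fun i => ⟨i, rfl⟩) rfl

/-! ### The best position is a semialgebraic function of the vertices -/

section
variable {k d e D : ℕ} [NeZero k]

/-- The names of the coordinates of `D` vertices of a cell for each of `k` agents. -/
abbrev VertexCoord (k e D : ℕ) : Type := Fin k × Fin D × Fin e

/-- The names of the unknowns: the leash length, the coordinates of the positions, and the
barycentric coordinates of the positions. -/
abbrev Unknown (k e D : ℕ) : Type := Option (Fin k × Fin e) ⊕ (Fin k × Fin D)

/-- The cells given by the coordinates of their vertices. -/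
def cellHull (y : VertexCoord k e D → ℝ) (i : Fin k) : Set (Pt e) :=
  convexHull ℝ (Set.range fun a : Fin D => WithLp.toLp 2 fun c => y (i, a, c))

/-- The positions given by the unknowns. -/
noncomputable def unknownPos (u : Unknown k e D → ℝ) (i : Fin k) : Pt e :=
  WithLp.toLp 2 fun c => u (.inl (some (i, c)))

/-- The unknowns `u` describe positions in the cells and a bound on their distances. -/
def Feasible (σ : Fin d → Fin e) (y : VertexCoord k e D → ℝ) (u : Unknown k e D → ℝ) : Prop :=
  (∀ ia, 0 ≤ u (.inr ia)) ∧ (∀ i, ∑ a, u (.inr (i, a)) = 1) ∧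
  (∀ ic : Fin k × Fin e, ∑ a, u (.inr (ic.1, a)) * y (ic.1, a, ic.2) = u (.inl (some ic))) ∧
  0 ≤ u (.inl none) ∧
  ∀ i, ∑ c, (u (.inl (some (0, σ c))) - u (.inl (some (i, σ c)))) ^ 2 ≤ u (.inl none) ^ 2

/-- The unknowns `u` describe the best positions in the cells. -/
def Optimal (σ : Fin d → Fin e) (y : VertexCoord k e D → ℝ) (u : Unknown k e D → ℝ) : Prop :=
  Feasible σ y u ∧ ∀ u', Feasible σ y u' → u (.inl none) ≤ u' (.inl none) ∧
    (u' (.inl none) = u (.inl none) →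
      ∑ ic, u (.inl (some ic)) ^ 2 ≤ ∑ ic, u' (.inl (some ic)) ^ 2)

theorem semialgebraicSet_feasible (σ : Fin d → Fin e) :
    SemialgebraicSet {v : VertexCoord k e D ⊕ Unknown k e D → ℝ |
      Feasible σ (v ∘ Sum.inl) (v ∘ Sum.inr)} := by
  refine .and ?_ (.and ?_ (.and ?_ (.and ?_ ?_)))
  · exact .forall_finite fun i => .le .zero (.var _)
  · exact .forall_finite fun i => .eq (.sum _ fun a => .var _) .one
  · exact .forall_finite fun i => .eq (.sum _ fun a => .mul (.var _) (.var _)) (.var _)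
  · exact .le .zero (.var _)
  · exact .forall_finite fun i => .le (.sum _ fun a => .sq (.sub (.var _) (.var _))) (.sq (.var _))

theorem semialgebraicSet_optimal (σ : Fin d → Fin e) :
    SemialgebraicSet {v : VertexCoord k e D ⊕ Unknown k e D → ℝ |
      Optimal σ (v ∘ Sum.inl) (v ∘ Sum.inr)} := by
  refine .and (semialgebraicSet_feasible σ) (.forall_tuple (P := fun (v : VertexCoord k e D ⊕ Unknown k e D → ℝ)
      (u' : Unknown k e D → ℝ) =>
    Feasible σ (v ∘ Sum.inl) u' → v (.inr (.inl none)) ≤ u' (.inl none) ∧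
    (u' (.inl none) = v (.inr (.inl none)) →
      ∑ ic, v (.inr (.inl (some ic))) ^ 2 ≤ ∑ ic, u' (.inl (some ic)) ^ 2)) (.imp ?_ (.and ?_ ?_)))
  · exact (semialgebraicSet_feasible σ).comp (Sum.map Sum.inl id)
  · exact .le (.var _) (.var _)
  · exact .imp (.eq (.var _) (.var _)) (.le (.sum _ fun _ => .sq (.var _))
      (.sum _ fun _ => .sq (.var _)))

theorem dist_proj_le_iff {σ : Fin d → Fin e} {x x' : Pt e} {w : ℝ} (hw : 0 ≤ w) :
    dist (proj σ x) (proj σ x') ≤ w ↔ ∑ c, (x (σ c) - x' (σ c)) ^ 2 ≤ w ^ 2 := by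
  rw [EuclideanSpace.dist_eq, Real.sqrt_le_left hw]
  simp [Real.dist_eq, sq_abs]

theorem Feasible.pos {σ : Fin d → Fin e} {y : VertexCoord k e D → ℝ} {u : Unknown k e D → ℝ}
    (h : Feasible σ y u) : (∀ i, unknownPos u i ∈ cellHull y i) ∧
      ∀ i, dist (proj σ (unknownPos u 0)) (proj σ (unknownPos u i)) ≤ u (.inl none) := by
  obtain ⟨h1, h2, h3, h4, h5⟩ := h
  refine ⟨fun i => mem_convexHull_range_iff.2 ⟨fun a => u (.inr (i, a)), fun a => h1 _, h2 i, ?_⟩,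
    fun i => (dist_proj_le_iff h4).2 (h5 i)⟩
  ext c
  simpa [unknownPos] using h3 (i, c)

theorem Feasible.of_pos {σ : Fin d → Fin e} {y : VertexCoord k e D → ℝ} {x : Fin k → Pt e} {w : ℝ}
    (h : ∀ i, x i ∈ cellHull y i) (hw : ∀ i, dist (proj σ (x 0)) (proj σ (x i)) ≤ w) :
    ∃ u : Unknown k e D → ℝ, Feasible σ y u ∧ unknownPos u = x ∧ u (.inl none) = w := by
  choose l h1 h2 h3 using fun i => mem_convexHull_range_iff.1 (h i)
  have h0 : 0 ≤ w := by simpa using hw 0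
  refine ⟨Sum.elim (fun o => o.elim w fun ic => x ic.1 ic.2) fun ia => l ia.1 ia.2,
    ⟨fun ia => h1 _ _, h2, ?_, h0, fun i => (dist_proj_le_iff h0).1 (hw i)⟩, rfl, rfl⟩
  rintro ⟨i, c⟩
  simp [← h3 i]

theorem optimal_iff {σ : Fin d → Fin e} {y : VertexCoord k e D → ℝ} {u : Unknown k e D → ℝ} :
    Optimal σ y u ↔
      Feasible σ y u ∧ IsBest σ (cellHull y) (unknownPos u) (u (.inl none)) := by
  have hn : ∀ u : Unknown k e D → ℝ,
      ∑ ic, u (.inl (some ic)) ^ 2 = ∑ i, ‖unknownPos u i‖ ^ 2 := fun u => by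
    simp [unknownPos, EuclideanSpace.norm_sq_eq, Fintype.sum_prod_type, sq_abs]
  refine and_congr_right fun hf => ⟨fun h => ⟨hf.pos.1, hf.pos.2, fun x' hx' w' hw' => ?_⟩,
    fun h u' hu' => ?_⟩
  · obtain ⟨u', hu', rfl, rfl⟩ := Feasible.of_pos hx' hw'
    simpa [hn] using h u' hu'
  · simpa [hn] using h.le_of_feasible _ hu'.pos.1 _ hu'.pos.2

theorem exists_optimal [NeZero D] (σ : Fin d → Fin e) (y : VertexCoord k e D → ℝ) :
    ∃ u, Optimal σ y u := by
  obtain ⟨x, w, h⟩ := IsBest.exists (σ := σ) (H := cellHull y)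
    (fun i => (Set.finite_range _).isCompact_convexHull (𝕜 := ℝ))
    (fun i => (Set.range_nonempty _).convexHull)
  obtain ⟨u, hu, rfl, rfl⟩ := Feasible.of_pos h.mem h.dist_le
  exact ⟨u, optimal_iff.2 ⟨hu, h⟩⟩

/-- The leash length, or one of the coordinates, of the best position, as a function of the
coordinates of the vertices. -/
noncomputable def bestCoord (σ : Fin d → Fin e) [NeZero D] (o : Option (Fin k × Fin e))
    (y : VertexCoord k e D → ℝ) : ℝ :=
  (exists_optimal σ y).choose (.inl o)

theorem bestCoord_eq {σ : Fin d → Fin e} [NeZero D] {y : VertexCoord k e D → ℝ}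
    {u : Unknown k e D → ℝ} (h : Optimal σ y u) (o : Option (Fin k × Fin e)) :
    bestCoord σ o y = u (.inl o) := by
  have h' := (exists_optimal σ y).choose_spec
  obtain ⟨hx, hw⟩ := (optimal_iff.1 h').2.unique (fun i => convex_convexHull _ _)
    (optimal_iff.1 h).2
  cases o with
  | none => exact hw
  | some ic => exact congrFun (congrArg WithLp.ofLp (congrFun hx ic.1)) ic.2

theorem isBest_bestCoord (σ : Fin d → Fin e) [NeZero D] (y : VertexCoord k e D → ℝ) :
    IsBest σ (cellHull y) (fun i => WithLp.toLp 2 fun c => bestCoord σ (some (i, c)) y)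
      (bestCoord σ none y) :=
  (optimal_iff.1 (exists_optimal σ y).choose_spec).2

/-- The best position is the one that satisfies the first-order condition `Optimal`. Hence the machine
computes each of its coordinates in one step. -/
theorem semialgebraicFun_bestCoord (σ : Fin d → Fin e) [NeZero D] (o : Option (Fin k × Fin e))
    {m : ℕ} (f : VertexCoord k e D ≃ Fin m) :
    SemialgebraicFun fun v : Fin m → ℝ => bestCoord σ o (v ∘ f) := by
  refine .of_graph f _ ?_
  have : {w : Option (VertexCoord k e D) → ℝ | bestCoord σ o (w ∘ some) = w none} =
      {w | ∃ u, Optimal σ (w ∘ some) u ∧ u (.inl o) = w none} := by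
    ext w
    constructor
    · intro h
      exact ⟨_, (exists_optimal σ (w ∘ some)).choose_spec, h⟩
    · rintro ⟨u, hu, h⟩
      exact (bestCoord_eq hu o).trans h
  rw [this]
  refine .exists_tuple (P := fun w u => Optimal σ (w ∘ some) u ∧ u (.inl o) = w none) (.and ?_ ?_)
  · exact (semialgebraicSet_optimal σ).comp (Sum.map some id)
  · exact .eq (.var _) (.var _)

end

/-! ### Systems of agents and their product cells -/

/-- For each of `k` agents, a list of cells (the faces of an abstract simplicial complex whose
vertices are natural numbers), positions of the vertices in `ℝ^e`, and a start and an end vertex.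
The `j`-th cell of agent `i` has the vertices `idx i j a`, `a < len i j`. -/
structure AgentSystem (k e : ℕ) where
  numCells : Fin k → ℕ
  numVerts : Fin k → ℕ
  len : Fin k → ℕ → ℕ
  idx : Fin k → ℕ → ℕ → ℕ
  pos : Fin k → ℕ → Pt e
  src : Fin k → ℕ
  tgt : Fin k → ℕ

namespace AgentSystem
variable {k d e : ℕ}

/-- The vertices of the `j`-th cell of agent `i`. -/
def cell (S : AgentSystem k e) (i : Fin k) (j : ℕ) : Finset ℕ :=
  (Finset.range (S.len i j)).image (S.idx i j)

/-- A product cell: a cell for each agent. -/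
def IsNode (S : AgentSystem k e) (c : Fin k → Finset ℕ) : Prop :=
  ∀ i, ∃ j < S.numCells i, S.cell i j = c i

/-- The product cell of the start vertices. -/
def srcNode (S : AgentSystem k e) (i : Fin k) : Finset ℕ := {S.src i}

/-- The product cell of the end vertices. -/
def tgtNode (S : AgentSystem k e) (i : Fin k) : Finset ℕ := {S.tgt i}

/-- The lists are without repetitions, the cells have at most `D` vertices and are closed under
taking faces, and the start and end vertices are cells. -/
structure Valid (S : AgentSystem k e) (D : ℕ) : Prop where
  len_pos : ∀ i, ∀ j < S.numCells i, 0 < S.len i j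
  len_le : ∀ i, ∀ j < S.numCells i, S.len i j ≤ D
  idx_inj : ∀ i, ∀ j < S.numCells i, ∀ a < S.len i j, ∀ b < S.len i j,
    S.idx i j a = S.idx i j b → a = b
  idx_lt : ∀ i, ∀ j < S.numCells i, ∀ a < S.len i j, S.idx i j a < S.numVerts i
  exists_face : ∀ i, ∀ j < S.numCells i, ∀ U ⊆ S.cell i j, U.Nonempty →
    ∃ j' < S.numCells i, S.cell i j' = U
  isNode_src : S.IsNode S.srcNode
  isNode_tgt : S.IsNode S.tgtNode

/-- The sets in which the agents move in a product cell. -/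
def hull (S : AgentSystem k e) (c : Fin k → Finset ℕ) (i : Fin k) : Set (Pt e) :=
  convexHull ℝ (S.pos i '' c i)

variable [NeZero k] (S : AgentSystem k e) (σ : Fin d → Fin e)

/-- The best positions of the agents in a product cell, and the leash length there. -/
noncomputable def best (c : Fin k → Finset ℕ) : (Fin k → Pt e) × ℝ :=
  Classical.epsilon fun p => IsBest σ (S.hull c) p.1 p.2

/-- The smallest leash length in a product cell. -/
noncomputable def weight (c : Fin k → Finset ℕ) : ℝ := (S.best σ c).2

/-- `c'` arises from `c` by removing a vertex from the cell of one agent. -/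
def Facet (c c' : Fin k → Finset ℕ) : Prop :=
  ∃ i, ∃ g ∈ c i, 2 ≤ (c i).card ∧ c' = Function.update c i ((c i).erase g)

/-- Both product cells have weight at most `θ`, and one is a facet of the other. -/
def Step (θ : ℝ) (c c' : Fin k → Finset ℕ) : Prop :=
  S.IsNode c ∧ S.IsNode c' ∧ (Facet c c' ∨ Facet c' c) ∧ S.weight σ c ≤ θ ∧ S.weight σ c' ≤ θ

/-- The product cells are connected by a chain of product cells of weight at most `θ`. -/
def Reach (θ : ℝ) : (Fin k → Finset ℕ) → (Fin k → Finset ℕ) → Prop :=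
  Relation.ReflTransGen (S.Step σ θ)

variable {S σ} {D : ℕ} {c c' : Fin k → Finset ℕ} {θ : ℝ}

theorem IsNode.nonempty (hS : S.Valid D) (hc : S.IsNode c) (i : Fin k) : (c i).Nonempty := by
  obtain ⟨j, hj, h⟩ := hc i
  rw [← h, cell, Finset.image_nonempty, Finset.nonempty_range_iff]
  exact (hS.len_pos i j hj).ne'

theorem IsNode.isBest (hS : S.Valid D) (hc : S.IsNode c) :
    IsBest σ (S.hull c) (S.best σ c).1 (S.weight σ c) := by
  obtain ⟨x, w, h⟩ := IsBest.exists (σ := σ) (H := S.hull c)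
    (fun i => ((c i).finite_toSet.image _).isCompact_convexHull (𝕜 := ℝ))
    (fun i => ((Finset.coe_nonempty.2 (hc.nonempty hS i)).image _).convexHull)
  exact Classical.epsilon_spec (p := fun p : (Fin k → Pt e) × ℝ => IsBest σ (S.hull c) p.1 p.2)
    ⟨(x, w), h⟩

theorem hull_mono (h : ∀ i, c i ⊆ c' i) (i : Fin k) : S.hull c i ⊆ S.hull c' i :=
  convexHull_mono (Set.image_mono (Finset.coe_subset.2 (h i)))

theorem IsNode.weight_anti (hS : S.Valid D) (hc : S.IsNode c) (hc' : S.IsNode c')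
    (h : ∀ i, c i ⊆ c' i) : S.weight σ c' ≤ S.weight σ c :=
  (hc.isBest hS).weight_anti (hc'.isBest hS) (hull_mono h)

theorem IsNode.weight_le (hS : S.Valid D) (hc : S.IsNode c) {x : Fin k → Pt e}
    (hx : ∀ i, x i ∈ S.hull c i) {w : ℝ} (hw : ∀ i, dist (proj σ (x 0)) (proj σ (x i)) ≤ w) :
    S.weight σ c ≤ w :=
  ((hc.isBest hS).le_of_feasible x hx w hw).1

theorem IsNode.update (hc : S.IsNode c) (i : Fin k) {U : Finset ℕ}
    (hU : ∃ j < S.numCells i, S.cell i j = U) : S.IsNode (Function.update c i U) := by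
  intro i'
  by_cases h : i' = i
  · subst h; simpa using hU
  · simpa [h] using hc i'

theorem IsNode.erase (hS : S.Valid D) (hc : S.IsNode c) (i : Fin k) (g : ℕ)
    (h2 : 2 ≤ (c i).card) : S.IsNode (Function.update c i ((c i).erase g)) := by
  refine hc.update i ?_
  obtain ⟨j, hj, h⟩ := hc i
  refine hS.exists_face i j hj _ (h ▸ Finset.erase_subset _ _) ?_
  rw [← Finset.card_pos]
  have := Finset.pred_card_le_card_erase (s := c i) (a := g)
  omega

theorem Step.symm (h : S.Step σ θ c c') : S.Step σ θ c' c :=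
  ⟨h.2.1, h.1, h.2.2.1.symm, h.2.2.2.2, h.2.2.2.1⟩

theorem Reach.symm (h : S.Reach σ θ c c') : S.Reach σ θ c' c := by
  induction h with
  | refl => exact .refl
  | tail _ h ih => exact .head h.symm ih

theorem Reach.mono {θ' : ℝ} (h : S.Reach σ θ c c') (hθ : θ ≤ θ') : S.Reach σ θ' c c' :=
  Relation.ReflTransGen.mono (fun _ _ h => ⟨h.1, h.2.1, h.2.2.1, h.2.2.2.1.trans hθ,
    h.2.2.2.2.trans hθ⟩) _ _ h

/-- A product cell is connected to its faces, as the weights of the larger cells are smaller. -/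
theorem Reach.of_subset {c c' : Fin k → Finset ℕ} (hS : S.Valid D) (hc : S.IsNode c) (hc' : S.IsNode c')
    (h : ∀ i, c i ⊆ c' i) (hw : S.weight σ c ≤ θ) : S.Reach σ θ c c' := by
  by_cases he : c = c'
  · rw [he]; exact .refl
  obtain ⟨i, hi⟩ := Function.ne_iff.1 he
  obtain ⟨g, hg, hgc⟩ := Finset.exists_of_ssubset ((h i).ssubset_of_ne hi)
  have h2 : 2 ≤ (c' i).card := by
    have := Finset.card_lt_card ((h i).ssubset_of_ne hi)
    have := (hc.nonempty hS i).card_pos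
    omega
  have hn := hc'.erase hS i g h2
  have hsub : ∀ i', c i' ⊆ Function.update c' i ((c' i).erase g) i' := by
    intro i'
    by_cases h' : i' = i
    · subst h'
      simpa using Finset.subset_erase.2 ⟨h i', hgc⟩
    · simpa [h'] using h i'
  exact (Reach.of_subset hS hc hn hsub hw).tail ⟨hn, hc', .inr ⟨i, g, hg, h2, rfl⟩,
    (hc.weight_anti hS hn hsub).trans hw, (hc.weight_anti hS hc' h).trans hw⟩
termination_by ∑ i, (c' i).card
decreasing_by
  refine Finset.sum_lt_sum (fun i' _ => ?_) ⟨i, Finset.mem_univ i, ?_⟩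
  · by_cases h' : i' = i
    · subst h'
      simpa using Finset.card_erase_le
    · simp [h']
  · simpa using Finset.card_lt_card (Finset.erase_ssubset hg)

/-- If the agents move such that the product cell containing them can only grow in a neighbourhood
of each point in time, then the product cells at the beginning and at the end are connected. -/
theorem Reach.of_motion (hS : S.Valid D) {c : ℝ → Fin k → Finset ℕ}
    (hc : ∀ t ∈ Set.Icc (0 : ℝ) 1, S.IsNode (c t)) (hw : ∀ t ∈ Set.Icc (0 : ℝ) 1,
      S.weight σ (c t) ≤ θ)
    (hl : ∀ t ∈ Set.Icc (0 : ℝ) 1, ∀ᶠ s in nhdsWithin t (Set.Icc 0 1), ∀ i, c t i ⊆ c s i) :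
    S.Reach σ θ (c 0) (c 1) := by
  refine isPreconnected_Icc.induction₂ (fun s t => S.Reach σ θ (c s) (c t)) ?_ ?_ ?_
    (Set.left_mem_Icc.2 zero_le_one) (Set.right_mem_Icc.2 zero_le_one)
  · intro t ht
    filter_upwards [hl t ht, self_mem_nhdsWithin] with s hs hsI
    exact .of_subset hS (hc t ht) (hc s hsI) hs (hw t ht)
  · exact fun _ _ _ _ _ _ h h' => Relation.ReflTransGen.trans h h'
  · exact fun _ _ _ _ h => h.symm

/-! ### Numbering the product cells -/

/-- The numbers of the bits that are set in the number of a product cell. -/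
def bits (c : Fin k → Finset ℕ) : Finset ℕ := Finset.univ.biUnion fun i => (c i).image (· * k + i)

/-- The number of a product cell. -/
def nodeId (c : Fin k → Finset ℕ) : ℕ := ∑ i, ∑ g ∈ c i, 2 ^ (g * k + i)

theorem mul_add_inj {i i' : Fin k} {g g' : ℕ} (h : g * k + i = g' * k + i') : g = g' ∧ i = i' := by
  have hk : 0 < k := i.pos
  have h1 := congrArg (· / k) h
  have h2 := congrArg (· % k) h
  simp [Nat.add_div_of_dvd_right (Dvd.intro_left _ rfl), hk, Nat.mod_eq_of_lt,
    Nat.div_eq_of_lt] at h1 h2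
  exact ⟨h1, Fin.ext h2⟩

theorem nodeId_eq (c : Fin k → Finset ℕ) : nodeId c = ∑ n ∈ bits c, 2 ^ n := by
  rw [bits, Finset.sum_biUnion]
  · refine Finset.sum_congr rfl fun i _ => ?_
    rw [Finset.sum_image]
    exact fun g _ g' _ h => (mul_add_inj h).1
  · intro i _ i' _ hne
    simp only [Function.onFun, Finset.disjoint_left, Finset.mem_image]
    rintro _ ⟨g, _, rfl⟩ ⟨g', _, h⟩
    exact hne (mul_add_inj h).2.symm

theorem mem_bits {i : Fin k} {g : ℕ} : g * k + i ∈ bits c ↔ g ∈ c i := by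
  simp only [bits, Finset.mem_biUnion, Finset.mem_image, Finset.mem_univ, true_and]
  constructor
  · rintro ⟨i', g', hg', h⟩
    obtain ⟨rfl, rfl⟩ := mul_add_inj h
    exact hg'
  · exact fun h => ⟨i, g, h, rfl⟩

theorem nodeId_injective : Function.Injective (nodeId (k := k)) := by
  intro c c' h
  rw [nodeId_eq, nodeId_eq] at h
  have := Finset.geomSum_injective le_rfl h
  funext i
  ext g
  rw [← mem_bits, ← mem_bits, this]

theorem nodeId_mono (h : ∀ i, c i ⊆ c' i) : nodeId c ≤ nodeId c' :=
  Finset.sum_le_sum fun i _ => Finset.sum_le_sum_of_subset (h i)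

theorem nodeId_pos (h : ∀ i, (c i).Nonempty) : 0 < nodeId c :=
  Finset.sum_pos (fun i _ => Finset.sum_pos (fun _ _ => by positivity) (h i)) ⟨0, Finset.mem_univ _⟩

theorem nodeId_erase {i : Fin k} {g : ℕ} (hg : g ∈ c i) :
    nodeId (Function.update c i ((c i).erase g)) = nodeId c - 2 ^ (g * k + i) := by
  have h1 : nodeId c = (∑ i' ∈ Finset.univ.erase i, ∑ g ∈ c i', 2 ^ (g * k + i')) +
      (∑ g' ∈ (c i).erase g, 2 ^ (g' * k + i) + 2 ^ (g * k + i)) := by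
    rw [Finset.sum_erase_add _ _ hg, nodeId]
    exact (Finset.sum_erase_add _ _ (Finset.mem_univ i)).symm
  have h2 : nodeId (Function.update c i ((c i).erase g)) =
      (∑ i' ∈ Finset.univ.erase i, ∑ g ∈ c i', 2 ^ (g * k + i')) +
      ∑ g' ∈ (c i).erase g, 2 ^ (g' * k + i) := by
    rw [nodeId, ← Finset.sum_erase_add _ _ (Finset.mem_univ i)]
    congr 1
    · refine Finset.sum_congr rfl fun i' hi' => ?_
      rw [Function.update_of_ne (Finset.ne_of_mem_erase hi')]
    · simp
  omega

/-! ### The graph of product cells -/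

variable (S) in
/-- `u` is the number of the product cell `c`; the number `0` is a second one for the start. -/
def NodeOf (u : ℕ) (c : Fin k → Finset ℕ) : Prop :=
  S.IsNode c ∧ (u = nodeId c ∨ u = 0 ∧ c = S.srcNode)

theorem NodeOf.unique (hS : S.Valid D) {u : ℕ} (h : S.NodeOf u c) (h' : S.NodeOf u c') :
    c = c' := by
  have h0 := nodeId_pos (h.1.nonempty hS)
  have h0' := nodeId_pos (h'.1.nonempty hS)
  rcases h.2 with h1 | ⟨h1, h2⟩ <;> rcases h'.2 with h1' | ⟨h1', h2'⟩
  · exact nodeId_injective (h1.symm.trans h1')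
  · omega
  · omega
  · rw [h2, h2']

/-- Of a product cell and one of its faces, the one with the larger number contains both. As the start
is minimal, this holds for its copy with the number `0` as well. -/
theorem NodeOf.max (hS : S.Valid D) {u v : ℕ} (h : S.NodeOf u c) (h' : S.NodeOf v c')
    (hcc : (∀ i, c i ⊆ c' i) ∨ ∀ i, c' i ⊆ c i) :
    ∃ b, S.NodeOf (max u v) b ∧ (∀ i, c i ⊆ b i) ∧ ∀ i, c' i ⊆ b i := by
  wlog hsub : ∀ i, c i ⊆ c' i generalizing u v c c'
  · obtain ⟨b, hb, h1, h2⟩ := this h' h hcc.symm (hcc.resolve_left hsub)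
    exact ⟨b, by rwa [max_comm], h2, h1⟩
  rcases le_or_gt u v with huv | huv
  · exact ⟨c', by rwa [max_eq_right huv], hsub, fun i => subset_rfl⟩
  · suffices c = c' from ⟨c, by rwa [max_eq_left huv.le], fun i => subset_rfl, fun i => by rw [this]⟩
    have h0 := nodeId_mono hsub
    rcases h.2 with h1 | ⟨h1, h2⟩
    · rcases h'.2 with h1' | ⟨h1', h2'⟩
      · omega
      · funext i
        have := hsub i
        rw [h2', srcNode, Finset.subset_singleton_iff] at this
        rw [h2', srcNode]
        exact this.resolve_left (h.1.nonempty hS i).ne_empty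
    · omega

variable (S σ) in
/-- The edges `(A e, B e)`, `e < m`, connect the product cells and their facets, and there is
an edge that connects the start with its copy. The weights of the edges are the maxima of the
weights of the product cells. -/
structure IsEdgeList (A B : ℕ → ℕ) (W : ℕ → ℝ) (m : ℕ) : Prop where
  symm : SymmEdges A B W m
  facet : ∀ c c', S.IsNode c → S.IsNode c' → Facet c c' → ∃ e < m, A e = nodeId c ∧
    B e = nodeId c' ∧ W e = max (S.weight σ c) (S.weight σ c')
  clone : ∃ e < m, A e = 0 ∧ B e = nodeId S.srcNode ∧ W e = S.weight σ S.srcNode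
  sound : ∀ e < m, ∃ c c', S.NodeOf (A e) c ∧ S.NodeOf (B e) c' ∧
    ((∀ i, c i ⊆ c' i) ∨ ∀ i, c' i ⊆ c i) ∧ W e = max (S.weight σ c) (S.weight σ c')

variable {A B : ℕ → ℕ} {W : ℕ → ℝ} {m : ℕ}

/-- Chains of product cells give rise to paths from the copy of the start. -/
theorem IsEdgeList.connected (hE : S.IsEdgeList σ A B W m) (h : S.Reach σ θ S.srcNode c)
    (hw : S.weight σ S.srcNode ≤ θ) :
    Relation.ReflTransGen (LinkLE A B W m θ) 0 (nodeId c) := by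
  induction h with
  | refl =>
    obtain ⟨e, he, hA, hB, hW⟩ := hE.clone
    exact .single ⟨e, he, hA, hB, hW ▸ hw⟩
  | tail _ h ih =>
    refine ih.tail ?_
    obtain ⟨h1, h2, hf | hf, hw1, hw2⟩ := h
    · obtain ⟨e, he, hA, hB, hW⟩ := hE.facet _ _ h1 h2 hf
      exact ⟨e, he, hA, hB, hW ▸ max_le hw1 hw2⟩
    · obtain ⟨e, he, hA, hB, hW⟩ := hE.facet _ _ h2 h1 hf
      obtain ⟨e', he', hA', hB', hW'⟩ := hE.symm e he
      exact ⟨e', he', hA'.trans hB, hB'.trans hA, hW'.trans hW ▸ max_le hw2 hw1⟩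

/-- The nodes of a path from the copy of the start are product cells of weight at most `p`, and
consecutive ones are contained in the one with the larger number. -/
theorem IsEdgeList.path (hS : S.Valid D) (hE : S.IsEdgeList σ A B W m) {PA : ℕ → ℕ} {L : ℕ}
    {p : ℝ} (hL : 0 < L) (h0 : PA 0 = 0) (hT : PA L = nodeId S.tgtNode)
    (hl : ∀ l < L, LinkLE A B W m p (PA l) (PA (l + 1))) :
    ∃ node : ℕ → Fin k → Finset ℕ, (∀ l ≤ L, S.NodeOf (PA l) (node l) ∧
        S.weight σ (node l) ≤ p) ∧ node 0 = S.srcNode ∧ node L = S.tgtNode ∧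
      ∀ l < L, ∃ b, S.NodeOf (max (PA l) (PA (l + 1))) b ∧ (∀ i, node l i ⊆ b i) ∧
        ∀ i, node (l + 1) i ⊆ b i := by
  have key : ∀ l < L, ∃ c c', S.NodeOf (PA l) c ∧ S.NodeOf (PA (l + 1)) c' ∧
      ((∀ i, c i ⊆ c' i) ∨ ∀ i, c' i ⊆ c i) ∧ S.weight σ c ≤ p ∧ S.weight σ c' ≤ p := by
    intro l hlL
    obtain ⟨e, he, hA, hB, hW⟩ := hl l hlL
    obtain ⟨c, c', h1, h2, h3, h4⟩ := hE.sound e he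
    rw [h4, max_le_iff] at hW
    exact ⟨c, c', hA ▸ h1, hB ▸ h2, h3, hW⟩
  have ex : ∀ l, ∃ c, l ≤ L → S.NodeOf (PA l) c ∧ S.weight σ c ≤ p := by
    intro l
    by_cases hlL : l < L
    · obtain ⟨c, c', h1, h2, h3, h4, h5⟩ := key l hlL
      exact ⟨c, fun _ => ⟨h1, h4⟩⟩
    · obtain ⟨c, c', h1, h2, h3, h4, h5⟩ := key (L - 1) (by omega)
      refine ⟨c', fun h => ?_⟩
      rw [show L - 1 + 1 = l by omega] at h2
      exact ⟨h2, h5⟩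
  choose node hnode using ex
  refine ⟨node, hnode, ?_, ?_, fun l hlL => ?_⟩
  · exact (hnode 0 (by omega)).1.unique hS ⟨hS.isNode_src, .inr ⟨h0, rfl⟩⟩
  · exact (hnode L le_rfl).1.unique hS ⟨hS.isNode_tgt, .inl hT⟩
  · obtain ⟨c, c', h1, h2, h3, -, -⟩ := key l hlL
    obtain rfl := h1.unique hS (hnode l hlL.le).1
    obtain rfl := h2.unique hS (hnode (l + 1) hlL).1
    exact h1.max hS h2 h3

end AgentSystem

/-! ### Straight-line programs with parameters -/

namespace Program

/-- Run `f 0, …, f (n - 1)` one after the other. -/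
def rep : (n : ℕ) → (Fin n → Program) → Program
  | 0, _ => skip
  | n + 1, f => seq (rep n fun a => f a.castSucc) (f (Fin.last n))

section
variable {n : ℕ} {f : Fin n → Program}

@[simp] theorem wI_rep (x : ℕ) : (rep n f).wI x ↔ ∃ a, (f a).wI x := by
  induction n with
  | zero => simp [rep]
  | succ n ih => simp [rep, ih, Fin.exists_fin_succ']
@[simp] theorem wR_rep (x : ℕ) : (rep n f).wR x ↔ ∃ a, (f a).wR x := by
  induction n with
  | zero => simp [rep]
  | succ n ih => simp [rep, ih, Fin.exists_fin_succ']
@[simp] theorem wIA_rep (x : ℕ) : (rep n f).wIA x ↔ ∃ a, (f a).wIA x := by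
  induction n with
  | zero => simp [rep]
  | succ n ih => simp [rep, ih, Fin.exists_fin_succ']
@[simp] theorem wRA_rep (x : ℕ) : (rep n f).wRA x ↔ ∃ a, (f a).wRA x := by
  induction n with
  | zero => simp [rep]
  | succ n ih => simp [rep, ih, Fin.exists_fin_succ']
@[simp] theorem loopFree_rep : (rep n f).loopFree ↔ ∀ a, (f a).loopFree := by
  induction n with
  | zero => simp [rep]
  | succ n ih => simp [rep, ih, Fin.forall_fin_succ']

end

/-- `x := n * y` for a constant `n`. -/
def mulC (x y : ℕ) : ℕ → Program
  | 0 => setI x 0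
  | n + 1 => seq (mulC x y n) (addI x x y)

section
variable (x y n r : ℕ)
@[simp] theorem wI_mulC : (mulC x y n).wI r ↔ r = x := by
  induction n <;> simp_all [mulC]
@[simp] theorem wR_mulC : (mulC x y n).wR r ↔ False := by
  induction n <;> simp_all [mulC]
@[simp] theorem wIA_mulC : (mulC x y n).wIA r ↔ False := by
  induction n <;> simp_all [mulC]
@[simp] theorem wRA_mulC : (mulC x y n).wRA r ↔ False := by
  induction n <;> simp_all [mulC]
@[simp] theorem loopFree_mulC : (mulC x y n).loopFree := by
  induction n <;> simp_all [mulC]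
theorem exec_mulC (h : y ≠ x) (σ : Memory) : (mulC x y n).exec σ = σ.setI x (n * σ.ireg y) := by
  induction n with
  | zero => simp [mulC]
  | succ n ih => simp [mulC, ih, h, Memory.setI, add_mul]
end

/-- A bound on the running time of a loop-free program, for a given run. -/
theorem loopFree.time_le {c : Program} (hc : c.loopFree) {σ σ' : Memory} {T : ℕ}
    (h : Runs c σ T σ') : T ≤ c.steps := by
  induction h with
  | seq _ _ h1 h2 => have := h1 hc.1; have := h2 hc.2; simp only [steps]; omega
  | ifI_then _ _ h | ifR_then _ _ h => have := h hc.1; simp only [steps]; omega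
  | ifI_else _ _ h | ifR_else _ _ h => have := h hc.2; simp only [steps]; omega
  | while_stop => exact hc.elim
  | while_step => exact hc.elim
  | _ => simp

end Program

theorem Run.time_le {c : Program} {σ : Memory} {R : ℕ → Memory → Prop} (hc : c.loopFree)
    (h : Run c σ R) : Run c σ fun T σ' => R T σ' ∧ T ≤ c.steps := by
  obtain ⟨T, σ', hr, hR⟩ := h
  exact ⟨T, σ', hr, hR, hc.time_le hr⟩

/-- The invariant may refer to the time used so far. -/
theorem Run.rep {n : ℕ} {f : Fin n → Program} {σ₀ : Memory} (Inv : ℕ → ℕ → Memory → Prop)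
    (h0 : Inv 0 1 σ₀) (hb : ∀ (a : Fin n) T σ, Frame (Program.rep n f) σ₀ σ → Inv a T σ →
      Run (f a) σ fun T' σ' => Inv (a + 1) (T + T') σ') :
    Run (Program.rep n f) σ₀ fun T σ' => Inv n T σ' := by
  induction n with
  | zero => exact ⟨1, σ₀, .skip _, h0⟩
  | succ n ih =>
    refine (Run.seq' (ih (f := fun a => f a.castSucc) ?_) fun T σ hF hI => ?_)
    · intro a T σ hF hI
      exact hb a.castSucc T σ hF.left hI
    · exact hb (Fin.last n) T σ hF.left hI

section
variable {t x c : ℕ}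
@[simp] theorem nm_eq_small (h : c < 100) : nm 100 t x = c ↔ False := by
  simp only [nm, iff_false]; omega
@[simp] theorem small_eq_nm (h : c < 100) : c = nm 100 t x ↔ False := by
  simp only [nm, iff_false]; omega
end

/-! ### Visiting a product cell -/

/-- The names of the arrays that hold a system of agents. -/
structure Layout (k : ℕ) where
  verts : ℕ
  cells : ℕ
  src : ℕ
  tgt : ℕ
  len : Fin k → ℕ
  idx : Fin k → ℕ
  coord : Fin k → ℕ

/-- The system of agents is stored in memory. The lists of the vertices of the cells are stored in
rows of width `D`. -/
structure Layout.Holds {k e : ℕ} (ly : Layout k) (S : AgentSystem k e) (D : ℕ) (μ : Memory) :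
    Prop where
  verts : ∀ i, μ.iarr ly.verts (i : Fin k) = S.numVerts i
  cells : ∀ i, μ.iarr ly.cells (i : Fin k) = S.numCells i
  src : ∀ i, μ.iarr ly.src (i : Fin k) = S.src i
  tgt : ∀ i, μ.iarr ly.tgt (i : Fin k) = S.tgt i
  len : ∀ i, ∀ j < S.numCells i, μ.iarr (ly.len i) j = S.len i j
  idx : ∀ i, ∀ j < S.numCells i, ∀ a < S.len i j, μ.iarr (ly.idx i) (D * j + a) = S.idx i j a
  coord : ∀ i, ∀ v < S.numVerts i, ∀ c : Fin e, μ.rarr (ly.coord i) (e * v + c) = S.pos i v c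

/-- All names of arrays are smaller than `b`. -/
structure Layout.Below {k : ℕ} (ly : Layout k) (b : ℕ) : Prop where
  verts : ly.verts < b
  cells : ly.cells < b
  src : ly.src < b
  tgt : ly.tgt < b
  len : ∀ i, ly.len i < b
  idx : ∀ i, ly.idx i < b
  coord : ∀ i, ly.coord i < b

theorem Layout.Holds.frame {k e D b : ℕ} {ly : Layout k} {S : AgentSystem k e} {μ μ' : Memory}
    (h : ly.Holds S D μ) (hb : ly.Below b) (hi : ∀ A < b, μ'.iarr A = μ.iarr A)
    (hr : ∀ A < b, μ'.rarr A = μ.rarr A) : ly.Holds S D μ' := by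
  constructor
  · simpa only [hi _ hb.verts] using h.verts
  · simpa only [hi _ hb.cells] using h.cells
  · simpa only [hi _ hb.src] using h.src
  · simpa only [hi _ hb.tgt] using h.tgt
  · simpa only [fun i => hi _ (hb.len i)] using h.len
  · simpa only [fun i => hi _ (hb.idx i)] using h.idx
  · simpa only [fun i => hr _ (hb.coord i)] using h.coord

theorem Layout.Holds.frame' {k e D : ℕ} {ly : Layout k} {S : AgentSystem k e} {μ μ' : Memory}
    (h : ly.Holds S D μ) (hi : μ'.iarr = μ.iarr) (hr : μ'.rarr = μ.rarr) : ly.Holds S D μ' := by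
  obtain ⟨h1, h2, h3, h4, h5, h6, h7⟩ := h
  constructor <;> simp only [hi, hr] <;> assumption

namespace AgentSystem

/-- The `a`-th vertex of a cell, where the list of the vertices is filled up with the first one. -/
def slot {k e : ℕ} (S : AgentSystem k e) (i : Fin k) (j a : ℕ) : ℕ :=
  S.idx i j (if a < S.len i j then a else 0)

end AgentSystem

namespace Program

/-- The integer register with the current cell of agent `i`. -/
def cellReg (i : ℕ) : ℕ := nm 100 0 i

/-- The integer register with the number of cells of agent `i`. -/
def countReg (i : ℕ) : ℕ := nm 100 1 i

/-- The integer register with the difference of the numbers of the current product cell and its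
facet without the `a`-th vertex of agent `i`. -/
def dropReg (i a : ℕ) : ℕ := nm 100 2 (Nat.pair i a)

/-- The real register with coordinate `c` of the `a`-th vertex of agent `i`. -/
def coordReg (i a c : ℕ) : ℕ := nm 100 0 (Nat.pair i (Nat.pair a c))

section
variable {k : ℕ} (ly : Layout k) (D e b : ℕ)

/-- Load the `a`-th vertex of the cell of agent `i`. -/
def loadSlot (i : Fin k) (a : ℕ) : Program :=
  seq (seq (setI 53 (a + 1)) (ifI 53 50 (loadI 56 (ly.idx i) 51) (mv 56 52))) <|
  seq (seq (loadI 55 (nm b 22 0) 56) <| seq (mulC 57 55 (2 ^ (i : ℕ))) <|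
    seq (ifI 53 50 (addI 58 58 57) skip) <| seq (setI 59 2) <|
    seq (ifI 59 50 (mv (dropReg i a) 57) (setI (dropReg i a) 0)) (mulC 60 56 e)) <|
  seq (rep e fun c => seq (loadR (coordReg i a c) (ly.coord i) 60) (inc 60)) (inc 51)

/-- Load the vertices of the cell of agent `i`. -/
def loadCell (i : Fin k) : Program :=
  seq (loadI 50 (ly.len i) (cellReg i)) <| seq (mulC 51 (cellReg i) D) <|
  seq (loadI 52 (ly.idx i) 51) <| rep D fun a => loadSlot ly e b i a

/-- Load the vertices of the current product cell, and compute its number in register `58`. -/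
def loadNode : Program := seq (setI 58 0) (rep k fun i => loadCell ly D e b i)

end

end Program

section
variable {k d e D b : ℕ} {ly : Layout k} {S : AgentSystem k e}

/-- The powers of `2` from which the numbers of the product cells are composed. -/
def HoldsPowers (S : AgentSystem k e) (b : ℕ) (μ : Memory) : Prop :=
  ∀ i, ∀ v < S.numVerts i, μ.iarr (nm b 22 0) v = 2 ^ (k * v)

/-- What register `dropReg i a` should contain. -/
def AgentSystem.drop (S : AgentSystem k e) (i : Fin k) (j a : ℕ) : ℕ :=
  if 2 ≤ S.len i j then 2 ^ (S.slot i j a * k + i) else 0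

theorem loadSlot_spec {μ : Memory} (hly : ly.Holds S D μ) (hp : HoldsPowers S b μ)
    (hS : S.Valid D) {i : Fin k} {j a : ℕ} (hj : j < S.numCells i)
    (h50 : μ.ireg 50 = S.len i j) (h51 : μ.ireg 51 = D * j + a) (h52 : μ.ireg 52 = S.idx i j 0) :
    Run (loadSlot ly e b i a) μ fun _ μ' =>
      μ'.ireg 50 = S.len i j ∧ μ'.ireg 51 = D * j + (a + 1) ∧ μ'.ireg 52 = S.idx i j 0 ∧
      μ'.ireg 58 = μ.ireg 58 + (if a < S.len i j then 2 ^ (S.idx i j a * k + i) else 0) ∧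
      μ'.ireg (dropReg i a) = S.drop i j a ∧
      ∀ c : Fin e, μ'.rreg (coordReg i a c) = S.pos i (S.slot i j a) c := by
  have hlt : S.slot i j a < S.numVerts i := by
    unfold AgentSystem.slot
    split_ifs with h
    · exact hS.idx_lt i j hj a h
    · exact hS.idx_lt i j hj 0 (hS.len_pos i j hj)
  have hpow : 2 ^ (i : ℕ) * 2 ^ (k * S.slot i j a) = 2 ^ (S.slot i j a * k + i) := by ring
  have h1 : Run (seq (setI 53 (a + 1)) (ifI 53 50 (loadI 56 (ly.idx i) 51) (mv 56 52))) μ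
      fun _ μ' => μ'.ireg 56 = S.slot i j a ∧ μ'.ireg 53 = a + 1 := by
    refine Run.of_loopFree (by simp [mv]) fun T hT => ?_
    by_cases h : a < S.len i j
    · simp [h50, h51, Nat.succ_le_of_lt h, hly.idx i j hj a h, AgentSystem.slot, h]
    · simp [mv, h50, h52, h, AgentSystem.slot]
  refine Run.seq' h1 fun T1 μ1 hF1 ⟨h56, h53⟩ => ?_
  have h50' := (hF1.ireg 50 (by simp)).trans h50
  have hpw : μ1.iarr (nm b 22 0) (S.slot i j a) = 2 ^ (k * S.slot i j a) := by
    rw [hF1.iarr _ (by simp)]; exact hp i _ hlt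
  have h58 := hF1.ireg 58 (by simp)
  have h2 : Run (seq (loadI 55 (nm b 22 0) 56) <| seq (mulC 57 55 (2 ^ (i : ℕ))) <|
      seq (ifI 53 50 (addI 58 58 57) skip) <| seq (setI 59 2) <|
      seq (ifI 59 50 (mv (dropReg i a) 57) (setI (dropReg i a) 0)) (mulC 60 56 e)) μ1
      fun _ μ' => μ'.ireg 58 = μ.ireg 58 +
          (if a < S.len i j then 2 ^ (S.idx i j a * k + i) else 0) ∧
        μ'.ireg (dropReg i a) = S.drop i j a ∧ μ'.ireg 60 = e * S.slot i j a := by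
    refine Run.of_loopFree (by simp [mv]) fun T hT => ?_
    have : (if a < S.len i j then 2 ^ (S.idx i j a * k + i) else 0) =
        if a < S.len i j then 2 ^ (S.slot i j a * k + i) else 0 := by
      unfold AgentSystem.slot
      split_ifs <;> rfl
    rw [this]
    simp only [exec, exec_mulC _ _ _ (show 55 ≠ 57 by decide),
      exec_mulC _ _ _ (show 56 ≠ 60 by decide)]
    by_cases h : a < S.len i j <;> by_cases h' : 2 ≤ S.len i j <;>
      simp [mv, dropReg, AgentSystem.drop, h50', h53, h56, h58, hpw, h, h', hpow]
  refine Run.seq' h2 fun T2 μ2 hF2 ⟨h58', hdrop, h60⟩ => ?_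
  have hco : ∀ c : Fin e, μ2.rarr (ly.coord i) (e * S.slot i j a + c) =
      S.pos i (S.slot i j a) c := fun c => by
    rw [hF2.rarr _ (by simp), hF1.rarr _ (by simp)]; exact hly.coord i _ hlt c
  refine Run.seq' (Run.rep (fun c _ μ' => μ'.ireg 60 = e * S.slot i j a + c ∧
    ∀ c' : Fin e, c' < c → μ'.rreg (coordReg i a c') = S.pos i (S.slot i j a) c')
    ⟨by simp [h60], by simp⟩ fun c T μ' hF ⟨hi, hc⟩ => ?_) fun T3 μ3 hF3 ⟨_, hc⟩ => ?_
  · refine Run.of_loopFree (by simp) fun T hT => ?_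
    have := hF.rarr (ly.coord i) (by simp)
    refine ⟨by simp [inc, hi]; rfl, fun c' hc' => ?_⟩
    rcases Nat.lt_succ_iff_lt_or_eq.1 hc' with h | h
    · simp [inc, coordReg, (Fin.val_ne_of_ne (ne_of_lt h) : (c' : ℕ) ≠ c)]
      exact hc c' h
    · obtain rfl := Fin.ext h
      simp [inc, hi, this, hco]
  · refine Run.of_loopFree (by simp) fun T hT => ?_
    rw [exec_inc (by decide)]
    have hd : dropReg i a = nm 100 2 (Nat.pair i a) := rfl
    refine ⟨?_, ?_, ?_, ?_, ?_, fun c => by simpa using hc c c.2⟩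
    · simp [hF3.ireg 50, hF2.ireg 50, hd, h50']
    · simp [hF3.ireg 51, hF2.ireg 51, hF1.ireg 51, hd, h51]; rfl
    · simp [hF3.ireg 52, hF2.ireg 52, hF1.ireg 52, hd, h52]
    · simp [hF3.ireg 58, h58']
    · simp [hd, hF3.ireg (nm 100 2 (Nat.pair i a))]; exact hdrop

theorem loadCell_spec {μ : Memory} (hly : ly.Holds S D μ) (hp : HoldsPowers S b μ)
    (hS : S.Valid D) {i : Fin k} {j : ℕ} (hj : j < S.numCells i) (hr : μ.ireg (cellReg i) = j) :
    Run (loadCell ly D e b i) μ fun _ μ' =>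
      μ'.ireg 58 = μ.ireg 58 + ∑ g ∈ S.cell i j, 2 ^ (g * k + i) ∧
      ∀ a : Fin D, μ'.ireg (dropReg i a) = S.drop i j a ∧
        ∀ c : Fin e, μ'.rreg (coordReg i a c) = S.pos i (S.slot i j a) c := by
  refine Run.seq (Run.of_loopFree (by simp) fun _ _ => ?_)
  refine Run.seq (Run.of_loopFree (by simp) fun _ _ => ?_)
  refine Run.seq (Run.of_loopFree (by simp) fun _ _ => ?_)
  simp only [exec, exec_mulC 51 (cellReg i) D (by simp [cellReg])]
  unfold cellReg at hr
  refine (Run.rep (fun a _ μ' => μ'.ireg 50 = S.len i j ∧ μ'.ireg 51 = D * j + a ∧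
      μ'.ireg 52 = S.idx i j 0 ∧
      μ'.ireg 58 = μ.ireg 58 + ∑ a' ∈ Finset.range a,
        (if a' < S.len i j then 2 ^ (S.idx i j a' * k + i) else 0) ∧
      ∀ a' : Fin D, a' < a → μ'.ireg (dropReg i a') = S.drop i j a' ∧
        ∀ c : Fin e, μ'.rreg (coordReg i a' c) = S.pos i (S.slot i j a') c)
    ⟨?_, ?_, ?_, ?_, by simp⟩ ?_).mono ?_
  · simp [cellReg, hr, hly.len i j hj]
  · simp [cellReg, hr]
  · have := hly.idx i j hj 0 (hS.len_pos i j hj)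
    simp only [add_zero] at this
    simp [cellReg, hr, this]
  · simp
  · rintro a T μ' hF ⟨h50, h51, h52, h58, ha⟩
    have hia : μ'.iarr = μ.iarr := funext fun A => by rw [hF.iarr A (by simp [loadSlot])]; simp
    have hra : μ'.rarr = μ.rarr := funext fun A => by rw [hF.rarr A (by simp [loadSlot])]; simp
    refine (loadSlot_spec (hly.frame' hia hra) (by simpa only [HoldsPowers, hia] using hp) hS hj
      h50 h51 h52).mono ?_
    rintro T' μ'' hF' ⟨g50, g51, g52, g58, gd, gc⟩
    refine ⟨g50, g51, g52, ?_, fun a' ha' => ?_⟩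
    · rw [g58, h58, Finset.sum_range_succ, add_assoc]
    · rcases Nat.lt_succ_iff_lt_or_eq.1 ha' with h | h
      · have hne : (a' : ℕ) ≠ a := Fin.val_ne_of_ne (ne_of_lt h)
        rw [hF'.ireg _ (by simp [loadSlot, dropReg, hne]), (ha a' h).1]
        refine ⟨rfl, fun c => ?_⟩
        rw [hF'.rreg _ (by simp [loadSlot, coordReg, hne]), (ha a' h).2]
      · obtain rfl := Fin.ext h
        exact ⟨gd, gc⟩
  · rintro T μ' hF ⟨-, -, -, h58, ha⟩
    refine ⟨?_, fun a => ha a a.2⟩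
    rw [h58, AgentSystem.cell, Finset.sum_image]
    · rw [← Finset.sum_filter]
      congr 1
      refine Finset.sum_congr ?_ fun _ _ => rfl
      ext a
      simp only [Finset.mem_filter, Finset.mem_range, and_iff_right_iff_imp]
      exact fun h => h.trans_le (hS.len_le i j hj)
    · intro a ha a' ha' h
      simp only [Finset.coe_range, Set.mem_Iio] at ha ha'
      exact hS.idx_inj i j hj a ha a' ha' h

/-- Loading the product cell given by the cell registers. -/
theorem loadNode_spec {μ : Memory} (hly : ly.Holds S D μ) (hp : HoldsPowers S b μ)
    (hS : S.Valid D) {j : Fin k → ℕ} (hj : ∀ i, j i < S.numCells i)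
    (hr : ∀ i : Fin k, μ.ireg (cellReg i) = j i) :
    Run (loadNode ly D e b) μ fun _ μ' =>
      μ'.ireg 58 = AgentSystem.nodeId (fun i => S.cell i (j i)) ∧
      ∀ (i : Fin k) (a : Fin D), μ'.ireg (dropReg i a) = S.drop i (j i) a ∧
        ∀ c : Fin e, μ'.rreg (coordReg i a c) = S.pos i (S.slot i (j i) a) c := by
  refine Run.seq (Run.of_loopFree (by simp) fun _ _ => ?_)
  simp only [exec]
  refine (Run.rep (fun n _ μ' => μ'.ireg 58 = ∑ i with (i : Fin k) < n,
      ∑ g ∈ S.cell i (j i), 2 ^ (g * k + i) ∧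
      ∀ i : Fin k, i < n → ∀ a : Fin D, μ'.ireg (dropReg i a) = S.drop i (j i) a ∧
        ∀ c : Fin e, μ'.rreg (coordReg i a c) = S.pos i (S.slot i (j i) a) c)
    ⟨by simp, by simp⟩ ?_).mono ?_
  · rintro i T μ' hF ⟨h58, ha⟩
    have hia : μ'.iarr = μ.iarr := funext fun A => by
      rw [hF.iarr A (by simp [loadCell, loadSlot])]; simp
    have hra : μ'.rarr = μ.rarr := funext fun A => by
      rw [hF.rarr A (by simp [loadCell, loadSlot])]; simp
    have hri : μ'.ireg (cellReg i) = j i := by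
      rw [hF.ireg _ (by simp [loadCell, loadSlot, cellReg, dropReg])]
      simpa [cellReg] using hr i
    refine (loadCell_spec (hly.frame' hia hra) (by simpa only [HoldsPowers, hia] using hp) hS
      (hj i) hri).mono ?_
    rintro T' μ'' hF' ⟨g58, g⟩
    refine ⟨?_, fun i' hi' => ?_⟩
    · rw [g58, h58]
      have : (Finset.univ.filter fun i' : Fin k => (i' : ℕ) < i + 1) =
          insert i (Finset.univ.filter fun i' : Fin k => (i' : ℕ) < i) := by
        ext i'
        simp only [Finset.mem_filter, Finset.mem_univ, true_and, Finset.mem_insert, Fin.ext_iff]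
        omega
      rw [this, Finset.sum_insert (by simp), add_comm]
    · rcases Nat.lt_succ_iff_lt_or_eq.1 hi' with h | h
      · have hne : (i' : ℕ) ≠ i := Fin.val_ne_of_ne (ne_of_lt h)
        intro a
        rw [hF'.ireg _ (by simp [loadCell, loadSlot, dropReg, hne]), (ha i' h a).1]
        refine ⟨rfl, fun c => ?_⟩
        rw [hF'.rreg _ (by simp [loadCell, loadSlot, coordReg, hne]), (ha i' h a).2]
      · obtain rfl := Fin.ext h
        exact g
  · rintro T μ' hF ⟨h58, ha⟩
    refine ⟨?_, fun i => ha i i.2⟩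
    rw [h58, AgentSystem.nodeId]
    exact Finset.sum_congr (by simp) fun _ _ => rfl

end

namespace Program

section
variable {d k e D : ℕ} [NeZero k] [NeZero D] (σ : Fin d → Fin e) (b : ℕ)

/-- Compute the leash length, or a coordinate, of the best position in the current product cell. -/
noncomputable def bestOp (D : ℕ) [NeZero D] (o : Option (Fin k × Fin e)) : Program :=
  opR 1 (fun v => bestCoord σ o (v ∘ Fintype.equivFin (VertexCoord k e D)))
    (semialgebraicFun_bestCoord σ o _) fun n =>
      let y := (Fintype.equivFin (VertexCoord k e D)).symm n
      coordReg y.1 y.2.1 y.2.2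

/-- Store the best position in the current product cell. -/
noncomputable def storeBest (k D : ℕ) [NeZero k] [NeZero D] : Program :=
  seq (seq (bestOp (k := k) σ D none) (storeR (nm b 21 0) 58 1)) <|
  rep k fun i => seq (storeI (nm b 20 i) 58 (cellReg i)) <|
    rep e fun c => seq (bestOp σ D (some (i, c))) (storeR (nm b 20 (Nat.pair i c)) 58 1)

/-- Add an edge and its reverse to the edge list. Their end points are the current product cell and
its facet without the `a`-th vertex of agent `i`. -/
def emit (i a : ℕ) : Program :=
  seq (subI 61 58 (dropReg i a)) <| seq (storeI (nm b 10 0) 62 58) <|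
  seq (storeI (nm b 11 0) 62 61) <| seq (inc 62) <| seq (storeI (nm b 10 0) 62 61) <|
  seq (storeI (nm b 11 0) 62 58) (inc 62)

/-- Store the best position in the current product cell and the edges to its facets. -/
noncomputable def visit (ly : Layout k) (D : ℕ) [NeZero D] : Program :=
  seq (loadNode ly D e b) <| seq (storeBest σ b k D) <|
  rep k fun i => rep D fun a => emit b i a

end
end Program

section
variable {d k e D b : ℕ} [NeZero k] [NeZero D] {σ : Fin d → Fin e} {ly : Layout k}
  {S : AgentSystem k e}

theorem exec_bestOp (μ : Memory) (o : Option (Fin k × Fin e)) :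
    (bestOp σ D o).exec μ =
      μ.setR 1 (bestCoord σ o fun y : VertexCoord k e D => μ.rreg (coordReg y.1 y.2.1 y.2.2)) := by
  have : ((fun n => μ.rreg (coordReg ((Fintype.equivFin (VertexCoord k e D)).symm n).1
      ((Fintype.equivFin (VertexCoord k e D)).symm n).2.1
      ((Fintype.equivFin (VertexCoord k e D)).symm n).2.2)) ∘
      Fintype.equivFin (VertexCoord k e D)) =
      fun y : VertexCoord k e D => μ.rreg (coordReg y.1 y.2.1 y.2.2) := by
    funext y
    simp
  simp only [bestOp, exec, this]

/-- The product cell given by a tuple of indices. -/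
def AgentSystem.node (S : AgentSystem k e) (j : Fin k → ℕ) (i : Fin k) : Finset ℕ := S.cell i (j i)

theorem AgentSystem.slot_mem (hS : S.Valid D) {i : Fin k} {j : ℕ} (hj : j < S.numCells i)
    (a : ℕ) : S.slot i j a ∈ S.cell i j := by
  refine Finset.mem_image_of_mem _ (Finset.mem_range.2 ?_)
  have := hS.len_pos i j hj
  split_ifs <;> assumption

theorem AgentSystem.exists_slot (hS : S.Valid D) {i : Fin k} {j : ℕ} (hj : j < S.numCells i)
    {g : ℕ} (hg : g ∈ S.cell i j) : ∃ a : Fin D, S.slot i j a = g := by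
  obtain ⟨a, ha, rfl⟩ := Finset.mem_image.1 hg
  rw [Finset.mem_range] at ha
  exact ⟨⟨a, ha.trans_le (hS.len_le i j hj)⟩, by simp [slot, ha]⟩

theorem AgentSystem.card_cell (hS : S.Valid D) {i : Fin k} {j : ℕ} (hj : j < S.numCells i) :
    (S.cell i j).card = S.len i j := by
  rw [cell, Finset.card_image_of_injOn, Finset.card_range]
  intro a ha a' ha' h
  simp only [Finset.coe_range, Set.mem_Iio] at ha ha'
  exact hS.idx_inj i j hj a ha a' ha' h

theorem AgentSystem.cellHull_eq (hS : S.Valid D) {j : Fin k → ℕ} (hj : ∀ i, j i < S.numCells i) :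
    cellHull (fun y : VertexCoord k e D => S.pos y.1 (S.slot y.1 (j y.1) y.2.1) y.2.2) =
      S.hull (S.node j) := by
  funext i
  simp only [cellHull, hull, node]
  congr 1
  ext x
  simp only [Set.mem_range, Set.mem_image, Finset.mem_coe]
  constructor
  · rintro ⟨a, rfl⟩
    exact ⟨_, slot_mem hS (hj i) a, rfl⟩
  · rintro ⟨g, hg, rfl⟩
    obtain ⟨a, rfl⟩ := exists_slot hS (hj i) hg
    exact ⟨a, rfl⟩

theorem AgentSystem.isNode_node {j : Fin k → ℕ} (hj : ∀ i, j i < S.numCells i) :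
    S.IsNode (S.node j) := fun i => ⟨j i, hj i, rfl⟩

/-- The best position in the product cell `c` is stored under the number `u`, together with the
indices of the cells. -/
def HoldsNode (S : AgentSystem k e) (σ : Fin d → Fin e) (b : ℕ) (μ : Memory) (u : ℕ)
    (c : Fin k → Finset ℕ) : Prop :=
  μ.rarr (nm b 21 0) u = S.weight σ c ∧ ∀ i : Fin k,
    (μ.iarr (nm b 20 i) u < S.numCells i ∧ S.cell i (μ.iarr (nm b 20 i) u) = c i) ∧
    ∀ x : Fin e, μ.rarr (nm b 20 (Nat.pair i x)) u = (S.best σ c).1 i x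

theorem storeBest_spec {μ : Memory} (hS : S.Valid D) {j : Fin k → ℕ}
    (hj : ∀ i, j i < S.numCells i) (hr : ∀ i : Fin k, μ.ireg (cellReg i) = j i)
    (hy : ∀ (i : Fin k) (a : Fin D) (c : Fin e),
      μ.rreg (coordReg i a c) = S.pos i (S.slot i (j i) a) c) :
    Run (storeBest σ b k D) μ fun _ μ' =>
      HoldsNode S σ b μ' (μ.ireg 58) (S.node j) ∧ ∀ u c, u ≠ μ.ireg 58 → HoldsNode S σ b μ u c →
        HoldsNode S σ b μ' u c := by
  have hn := S.isNode_node hj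
  have hbest := isBest_bestCoord σ
    (fun y : VertexCoord k e D => S.pos y.1 (S.slot y.1 (j y.1) y.2.1) y.2.2)
  rw [S.cellHull_eq hS hj] at hbest
  obtain ⟨hx, hw⟩ := hbest.unique (fun i => convex_convexHull _ _) (hn.isBest hS)
  have hyf : (fun y : VertexCoord k e D => μ.rreg (coordReg y.1 y.2.1 y.2.2)) =
      fun y => S.pos y.1 (S.slot y.1 (j y.1) y.2.1) y.2.2 := funext fun y => hy _ _ _
  have hop : ∀ (o : Option (Fin k × Fin e)) (μ' : Memory),
      (∀ x, 100 ≤ x → μ'.rreg x = μ.rreg x) → (bestOp σ D o).exec μ' =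
        μ'.setR 1 (bestCoord σ o fun y : VertexCoord k e D =>
          S.pos y.1 (S.slot y.1 (j y.1) y.2.1) y.2.2) := by
    intro o μ' h
    rw [exec_bestOp, ← hyf]
    simp only [h _ (le_nm _ _ _), coordReg]
  refine Run.seq (Run.of_loopFree (by simp [bestOp]) fun _ _ => ?_)
  simp only [exec, hop none μ (fun _ _ => rfl), hw]
  refine (Run.rep (fun n _ μ' => (∀ i : Fin k, i < n → μ'.iarr (nm b 20 i) (μ.ireg 58) = j i ∧
      ∀ x : Fin e, μ'.rarr (nm b 20 (Nat.pair i x)) (μ.ireg 58) = (S.best σ (S.node j)).1 i x) ∧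
      ∀ u, u ≠ μ.ireg 58 → ∀ i : Fin k, μ'.iarr (nm b 20 i) u = μ.iarr (nm b 20 i) u ∧
        ∀ x : Fin e, μ'.rarr (nm b 20 (Nat.pair i x)) u = μ.rarr (nm b 20 (Nat.pair i x)) u)
    ⟨by simp, fun u hu i => by simp [hu]⟩ ?_).mono ?_
  · rintro i T μ' hF ⟨h1, h2⟩
    have h58 : μ'.ireg 58 = μ.ireg 58 := by
      rw [hF.ireg 58 (by simp [bestOp])]; simp
    have hri : μ'.ireg (cellReg i) = j i := by
      rw [hF.ireg _ (by simp [bestOp])]; simpa using hr i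
    have hrr : ∀ x, 100 ≤ x → μ'.rreg x = μ.rreg x := fun x hx => by
      rw [hF.rreg x (by simp [bestOp]; intros; omega)]
      simp; intro; omega
    refine Run.seq (Run.of_loopFree (by simp) fun _ _ => ?_)
    simp only [exec, h58, hri]
    refine (Run.rep (fun m _ μ'' => (∀ x : Fin e, x < m →
        μ''.rarr (nm b 20 (Nat.pair i x)) (μ.ireg 58) = (S.best σ (S.node j)).1 i x) ∧
        ∀ u, u ≠ μ.ireg 58 → ∀ x : Fin e,
          μ''.rarr (nm b 20 (Nat.pair i x)) u = μ.rarr (nm b 20 (Nat.pair i x)) u)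
      ⟨by simp, fun u hu x => by simpa using (h2 u hu i).2 x⟩ ?_).mono ?_
    · rintro x T' μ'' hF' ⟨g1, g2⟩
      have h58' : μ''.ireg 58 = μ.ireg 58 := by
        rw [hF'.ireg 58 (by simp [bestOp])]; simpa using h58
      have hrr' : ∀ x, 100 ≤ x → μ''.rreg x = μ.rreg x := fun x hx => by
        rw [hF'.rreg x (by simp [bestOp]; intros; omega)]
        simpa using hrr x hx
      refine Run.of_loopFree (by simp [bestOp]) fun _ _ => ?_
      simp only [exec, hop _ μ'' hrr']
      refine ⟨fun x' hx' => ?_, fun u hu x' => ?_⟩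
      · rcases Nat.lt_succ_iff_lt_or_eq.1 hx' with h | h
        · simpa [h58', h.ne] using g1 x' h
        · obtain rfl := Fin.ext h
          simp [h58', ← hx]
      · simpa [h58', hu] using g2 u hu x'
    · rintro T' μ'' hF' ⟨g1, g2⟩
      refine ⟨fun i' hi' => ?_, fun u hu i' => ?_⟩
      · rcases Nat.lt_succ_iff_lt_or_eq.1 hi' with h | h
        · rw [hF'.iarr _ (by simp [bestOp])]
          refine ⟨by simpa [h.ne] using (h1 i' h).1, fun x => ?_⟩
          rw [hF'.rarr _ (by simp [bestOp, h.ne])]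
          simpa using (h1 i' h).2 x
        · obtain rfl := Fin.ext h
          rw [hF'.iarr _ (by simp [bestOp])]
          exact ⟨by simp, fun x => g1 x x.2⟩
      · by_cases h : i' = i
        · subst h
          rw [hF'.iarr _ (by simp [bestOp])]
          exact ⟨by simpa [hu] using (h2 u hu i').1, fun x => g2 u hu x⟩
        · have h' : (i' : ℕ) ≠ i := Fin.val_ne_of_ne h
          rw [hF'.iarr _ (by simp [bestOp])]
          refine ⟨by simpa [h'] using (h2 u hu i').1, fun x => ?_⟩
          rw [hF'.rarr _ (by simp [bestOp, h'])]
          simpa using (h2 u hu i').2 x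
  · rintro T μ' hF ⟨h1, h2⟩
    refine ⟨⟨?_, fun i => ?_⟩, fun u c hu hc => ⟨?_, fun i => ?_⟩⟩
    · rw [hF.rarr _ (by simp [bestOp])]
      simp
    · rw [(h1 i i.2).1]
      exact ⟨⟨hj i, rfl⟩, (h1 i i.2).2⟩
    · rw [hF.rarr _ (by simp [bestOp])]
      simpa [hu] using hc.1
    · obtain ⟨g1, g2⟩ := hc.2 i
      rw [(h2 u hu i).1]
      exact ⟨g1, fun x => ((h2 u hu i).2 x).trans (g2 x)⟩

/-- The first `m` edges connect product cells with faces, and the reverse edges are present. -/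
def EdgesSound (S : AgentSystem k e) (A B : ℕ → ℕ) (m : ℕ) : Prop :=
  (∀ n < m, ∃ n' < m, A n' = B n ∧ B n' = A n) ∧
  ∀ n < m, ∃ c c', S.IsNode c ∧ S.IsNode c' ∧ ((∀ i, c i ⊆ c' i) ∨ ∀ i, c' i ⊆ c i) ∧
    A n = AgentSystem.nodeId c ∧ B n = AgentSystem.nodeId c'

/-- One of the first `m` edges leads from `u` to `v`. -/
def HasEdge (A B : ℕ → ℕ) (m u v : ℕ) : Prop := ∃ n < m, A n = u ∧ B n = v

theorem emit_spec {μ : Memory} {i a : ℕ} {c c' : Fin k → Finset ℕ} (hc : S.IsNode c)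
    (hc' : S.IsNode c') (hsub : ∀ i, c' i ⊆ c i) (h58 : μ.ireg 58 = AgentSystem.nodeId c)
    (hd : AgentSystem.nodeId c - μ.ireg (dropReg i a) = AgentSystem.nodeId c')
    (hs : EdgesSound S (μ.iarr (nm b 10 0)) (μ.iarr (nm b 11 0)) (μ.ireg 62)) :
    Run (emit b i a) μ fun _ μ' => μ'.ireg 62 = μ.ireg 62 + 2 ∧
      EdgesSound S (μ'.iarr (nm b 10 0)) (μ'.iarr (nm b 11 0)) (μ'.ireg 62) ∧
      HasEdge (μ'.iarr (nm b 10 0)) (μ'.iarr (nm b 11 0)) (μ'.ireg 62) (AgentSystem.nodeId c)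
        (AgentSystem.nodeId c') ∧
      ∀ u v, HasEdge (μ.iarr (nm b 10 0)) (μ.iarr (nm b 11 0)) (μ.ireg 62) u v →
        HasEdge (μ'.iarr (nm b 10 0)) (μ'.iarr (nm b 11 0)) (μ'.ireg 62) u v := by
  refine Run.of_loopFree (by simp [emit]) fun _ _ => ?_
  have hA : ∀ n, ((emit b i a).exec μ).iarr (nm b 10 0) n = if n = μ.ireg 62 + 1 then
      AgentSystem.nodeId c' else if n = μ.ireg 62 then AgentSystem.nodeId c else
      μ.iarr (nm b 10 0) n := by
    intro n
    simp [emit, inc, h58, hd]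
  have hB : ∀ n, ((emit b i a).exec μ).iarr (nm b 11 0) n = if n = μ.ireg 62 + 1 then
      AgentSystem.nodeId c else if n = μ.ireg 62 then AgentSystem.nodeId c' else
      μ.iarr (nm b 11 0) n := by
    intro n
    simp [emit, inc, h58, hd]
  have hm : ((emit b i a).exec μ).ireg 62 = μ.ireg 62 + 2 := by simp [emit, inc]
  generalize (emit b i a).exec μ = μ' at hA hB hm
  have hold : ∀ n < μ.ireg 62, μ'.iarr (nm b 10 0) n = μ.iarr (nm b 10 0) n ∧
      μ'.iarr (nm b 11 0) n = μ.iarr (nm b 11 0) n := by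
    intro n hn
    rw [hA, hB]
    simp [show n ≠ μ.ireg 62 + 1 by omega, show n ≠ μ.ireg 62 by omega]
  have hcases : ∀ n < μ.ireg 62 + 2, n < μ.ireg 62 ∨ n = μ.ireg 62 ∨ n = μ.ireg 62 + 1 := by
    intro n hn; omega
  rw [hm]
  refine ⟨rfl, ⟨fun n hn => ?_, fun n hn => ?_⟩, ⟨μ.ireg 62, by omega, by simp [hA, hB]⟩, ?_⟩
  · rcases hcases n hn with h | rfl | rfl
    · obtain ⟨n', hn', h1, h2⟩ := hs.1 n h
      exact ⟨n', by omega, by rw [(hold n' hn').1, (hold n h).2, h1],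
        by rw [(hold n' hn').2, (hold n h).1, h2]⟩
    · exact ⟨μ.ireg 62 + 1, by omega, by simp [hA, hB]⟩
    · exact ⟨μ.ireg 62, by omega, by simp [hA, hB]⟩
  · rcases hcases n hn with h | rfl | rfl
    · rw [(hold n h).1, (hold n h).2]
      exact hs.2 n h
    · exact ⟨c, c', hc, hc', .inr hsub, by simp [hA, hB]⟩
    · exact ⟨c', c, hc', hc, .inl hsub, by simp [hA, hB]⟩
  · rintro u v ⟨n, hn, h1, h2⟩
    exact ⟨n, by omega, by rw [(hold n hn).1, (hold n hn).2]; exact ⟨h1, h2⟩⟩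

/-- The product cells of the tuples in `P`, and the edges to their facets, are stored. -/
structure Visited (S : AgentSystem k e) (σ : Fin d → Fin e) (b : ℕ) (P : Set (Fin k → ℕ))
    (μ : Memory) : Prop where
  node : ∀ j ∈ P, HoldsNode S σ b μ (AgentSystem.nodeId (S.node j)) (S.node j)
  sound : EdgesSound S (μ.iarr (nm b 10 0)) (μ.iarr (nm b 11 0)) (μ.ireg 62)
  facet : ∀ j ∈ P, ∀ c', AgentSystem.Facet (S.node j) c' →
    HasEdge (μ.iarr (nm b 10 0)) (μ.iarr (nm b 11 0)) (μ.ireg 62)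
      (AgentSystem.nodeId (S.node j)) (AgentSystem.nodeId c')

theorem HoldsNode.congr {μ μ' : Memory} {u : ℕ} {c : Fin k → Finset ℕ}
    (h : HoldsNode S σ b μ u c) (hi : ∀ x, μ'.iarr (nm b 20 x) = μ.iarr (nm b 20 x))
    (h1 : ∀ x, μ'.rarr (nm b 20 x) = μ.rarr (nm b 20 x))
    (h2 : μ'.rarr (nm b 21 0) = μ.rarr (nm b 21 0)) : HoldsNode S σ b μ' u c := by
  simpa only [HoldsNode, hi, h1, h2] using h

/-- Removing a vertex from the cell of one agent, or nothing if there is only one. -/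
theorem exists_face_of_drop (hS : S.Valid D) {j : Fin k → ℕ} (hj : ∀ i, j i < S.numCells i)
    (i : Fin k) (a : ℕ) : ∃ c', S.IsNode c' ∧ (∀ i', c' i' ⊆ S.node j i') ∧
      AgentSystem.nodeId (S.node j) - S.drop i (j i) a = AgentSystem.nodeId c' ∧
      (2 ≤ S.len i (j i) →
        c' = Function.update (S.node j) i ((S.node j i).erase (S.slot i (j i) a))) := by
  by_cases h : 2 ≤ S.len i (j i)
  · refine ⟨_, (S.isNode_node hj).erase hS i _ ?_, fun i' => ?_, ?_, fun _ => rfl⟩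
    · rwa [AgentSystem.node, S.card_cell hS (hj i)]
    · by_cases h' : i' = i
      · subst h'
        simpa using Finset.erase_subset _ _
      · simp [h']
    · rw [AgentSystem.nodeId_erase (S.slot_mem hS (hj i) a), AgentSystem.drop, if_pos h]
  · exact ⟨S.node j, S.isNode_node hj, fun _ => subset_rfl, by simp [AgentSystem.drop, h],
      fun h' => absurd h' h⟩

/-- The time for a product cell is bounded by a constant, of which one step is set aside for each
edge that is added; register `62` counts the edges. -/
theorem visit_spec {μ : Memory} (hly : ly.Holds S D μ) (hp : HoldsPowers S b μ)
    (hS : S.Valid D) {P : Set (Fin k → ℕ)} {j : Fin k → ℕ} (hj : ∀ i, j i < S.numCells i)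
    (hr : ∀ i : Fin k, μ.ireg (cellReg i) = j i) (hP : Visited S σ b P μ) :
    Run (visit σ b ly D) μ fun T μ' => Visited S σ b (insert j P) μ' ∧
      T + μ'.ireg 62 ≤ (visit σ b ly D).steps + 2 * D * k + μ.ireg 62 := by
  have hn := S.isNode_node hj
  refine (Run.time_le (R := fun _ μ' => Visited S σ b (insert j P) μ' ∧
      μ'.ireg 62 ≤ μ.ireg 62 + 2 * D * k) (by
    simp [visit, loadNode, loadCell, loadSlot, storeBest, bestOp, emit, mv]) ?_).mono
    fun T μ' _ h => ⟨h.1.1, by omega⟩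
  refine Run.seq' (loadNode_spec hly hp hS hj hr) fun T1 μ1 hF1 ⟨h58, hld⟩ => ?_
  have hr1 : ∀ i : Fin k, μ1.ireg (cellReg i) = j i := fun i => by
    rw [hF1.ireg _ (by simp [loadNode, loadCell, loadSlot, cellReg, dropReg])]; exact hr i
  refine Run.seq' (storeBest_spec (b := b) (σ := σ) hS hj hr1 fun i a => (hld i a).2)
    fun T2 μ2 hF2 ⟨hnode, hother⟩ => ?_
  rw [h58] at hnode hother
  have i10 : ∀ x, x ≠ 20 → μ2.iarr (nm b x 0) = μ.iarr (nm b x 0) := fun x hx => by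
    rw [hF2.iarr _ (by simp [storeBest, bestOp, hx]),
      hF1.iarr _ (by simp [loadNode, loadCell, loadSlot])]
  have h62 : μ2.ireg 62 = μ.ireg 62 := by
    rw [hF2.ireg _ (by simp [storeBest, bestOp]),
      hF1.ireg _ (by simp [loadNode, loadCell, loadSlot, dropReg])]
  have hnodes : ∀ j' ∈ insert j P,
      HoldsNode S σ b μ2 (AgentSystem.nodeId (S.node j')) (S.node j') := by
    rintro j' (rfl | hj')
    · exact hnode
    · by_cases he : AgentSystem.nodeId (S.node j') = AgentSystem.nodeId (S.node j)
      · rw [AgentSystem.nodeId_injective he]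
        exact hnode
      · refine hother _ _ he ((hP.node j' hj').congr ?_ ?_ ?_)
        · exact fun x => hF1.iarr _ (by simp [loadNode, loadCell, loadSlot])
        · exact fun x => hF1.rarr _ (by simp [loadNode, loadCell, loadSlot])
        · exact hF1.rarr _ (by simp [loadNode, loadCell, loadSlot])
  have hd2 : ∀ (i : Fin k) (a : Fin D), μ2.ireg (dropReg i a) = S.drop i (j i) a := fun i a => by
    rw [hF2.ireg _ (by simp [storeBest, bestOp, dropReg])]
    exact (hld i a).1
  have h582 : μ2.ireg 58 = AgentSystem.nodeId (S.node j) := by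
    rw [hF2.ireg _ (by simp [storeBest, bestOp])]
    exact h58
  choose face hface using exists_face_of_drop hS hj
  let Done : Memory → Fin k → ℕ → Prop := fun μ' i a => HasEdge (μ'.iarr (nm b 10 0))
    (μ'.iarr (nm b 11 0)) (μ'.ireg 62) (AgentSystem.nodeId (S.node j))
    (AgentSystem.nodeId (face i a))
  let Keep : Memory → Memory → Prop := fun μ' μ'' => ∀ u v, HasEdge (μ'.iarr (nm b 10 0))
    (μ'.iarr (nm b 11 0)) (μ'.ireg 62) u v → HasEdge (μ''.iarr (nm b 10 0))
    (μ''.iarr (nm b 11 0)) (μ''.ireg 62) u v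
  refine (Run.rep (fun n _ μ' => EdgesSound S (μ'.iarr (nm b 10 0)) (μ'.iarr (nm b 11 0))
      (μ'.ireg 62) ∧ Keep μ μ' ∧ (∀ i : Fin k, i < n → ∀ a < D, Done μ' i a) ∧
      μ'.ireg 62 ≤ μ.ireg 62 + 2 * D * n) ⟨?_, ?_, by simp, by simp [h62]⟩ ?_).mono ?_
  · rw [i10 _ (by simp), i10 _ (by simp), h62]
    exact hP.sound
  · intro u v h
    rwa [i10 _ (by simp), i10 _ (by simp), h62]
  · rintro i T μ3 hF3 ⟨hs, hk, hdone, hm⟩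
    refine (Run.rep (fun n _ μ' => EdgesSound S (μ'.iarr (nm b 10 0)) (μ'.iarr (nm b 11 0))
      (μ'.ireg 62) ∧ Keep μ3 μ' ∧ (∀ a < n, Done μ' i a) ∧
      μ'.ireg 62 ≤ μ3.ireg 62 + 2 * n) ⟨hs, fun _ _ h => h, by simp, by simp⟩ ?_).mono ?_
    · rintro a T' μ4 hF4 ⟨hs', hk', hdone', hm'⟩
      have g58 : μ4.ireg 58 = AgentSystem.nodeId (S.node j) := by
        rw [hF4.ireg _ (by simp [emit]), hF3.ireg _ (by simp [emit]), h582]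
      have gd : μ4.ireg (dropReg i a) = S.drop i (j i) a := by
        rw [hF4.ireg _ (by simp [emit, dropReg]), hF3.ireg _ (by simp [emit, dropReg]), hd2]
      obtain ⟨f1, f2, f3, f4⟩ := hface i a
      refine (emit_spec hn f1 f2 g58 (by rw [gd, f3]) hs').mono ?_
      rintro T'' μ5 hF5 ⟨e1, e2, e3, e4⟩
      refine ⟨e2, fun u v h => e4 u v (hk' u v h), fun a' ha' => ?_, by rw [e1]; omega⟩
      rcases Nat.lt_succ_iff_lt_or_eq.1 ha' with h | rfl
      · exact e4 _ _ (hdone' a' h)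
      · exact e3
    · rintro T' μ4 hF4 ⟨hs', hk', hdone', hm'⟩
      refine ⟨hs', fun u v h => hk' u v (hk u v h), fun i' hi' a ha => ?_, ?_⟩
      · rcases Nat.lt_succ_iff_lt_or_eq.1 hi' with h | h
        · exact hk' _ _ (hdone i' h a ha)
        · obtain rfl := Fin.ext h
          exact hdone' a ha
      · have : 2 * D * (i + 1) = 2 * D * i + 2 * D := by ring
        omega
  · rintro T μ3 hF3 ⟨hs, hk, hdone, hm⟩
    refine ⟨⟨fun j' hj' => (hnodes j' hj').congr ?_ ?_ ?_, hs, ?_⟩, hm⟩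
    · exact fun x => hF3.iarr _ (by simp [emit])
    · exact fun x => hF3.rarr _ (by simp [emit])
    · exact hF3.rarr _ (by simp [emit])
    · rintro j' (rfl | hj') c' hc'
      · obtain ⟨i, g, hg, h2, rfl⟩ := hc'
        obtain ⟨a, rfl⟩ := S.exists_slot hS (hj i) hg
        rw [AgentSystem.node, S.card_cell hS (hj i)] at h2
        rw [← (hface i a).2.2.2 h2]
        exact hdone i i.2 a a.2
      · exact hk _ _ (hP.facet j' hj' c' hc')

end

/-! ### Enumerating the product cells -/

namespace Program
section
variable {k : ℕ} {body : Program}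

/-- Nested loops over the cells of the agents in a list. -/
def nest (body : Program) : List (Fin k) → Program
  | [] => body
  | i :: l => forI (cellReg i) (countReg i) (nest body l)

theorem wI_nest {l : List (Fin k)} {x : ℕ} (h : (nest body l).wI x) :
    body.wI x ∨ x = 0 ∨ ∃ i ∈ l, x = cellReg i := by
  induction l with
  | nil => exact .inl h
  | cons i l ih =>
    simp only [nest, wI_forI] at h
    rcases h with h | h | h
    · exact .inr (.inr ⟨i, by simp, h⟩)
    · rcases ih h with h | h | ⟨i', hi', h⟩
      · exact .inl h
      · exact .inr (.inl h)
      · exact .inr (.inr ⟨i', by simp [hi'], h⟩)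
    · exact .inr (.inl h)

@[simp] theorem wIA_nest (l : List (Fin k)) (x : ℕ) : (nest body l).wIA x ↔ body.wIA x := by
  induction l <;> simp_all [nest]
@[simp] theorem wRA_nest (l : List (Fin k)) (x : ℕ) : (nest body l).wRA x ↔ body.wRA x := by
  induction l <;> simp_all [nest]

end
end Program

@[simp] theorem cellReg_inj (i i' : ℕ) : cellReg i = cellReg i' ↔ i = i' := by simp [cellReg]

theorem cellReg_ne (i : ℕ) : cellReg i ≠ 0 := by simp [cellReg]

theorem countReg_ne (i : ℕ) : countReg i ≠ 0 := by simp [countReg]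

theorem cellReg_ne_countReg (i i' : ℕ) : cellReg i ≠ countReg i' := by simp [cellReg, countReg]

/-- The nested loops visit all tuples; `Φ` measures the output of the body. -/
theorem nest_spec {k : ℕ} {body : Program} {N : Fin k → ℕ} {t : ℕ} {Φ : Memory → ℕ}
    {Inv : Set (Fin k → ℕ) → Memory → Prop}
    (hcell : ∀ i : Fin k, ¬ body.wI (cellReg i)) (hcount : ∀ i : Fin k, ¬ body.wI (countReg i))
    (hInv : ∀ P μ x v, Inv P μ → (x = 0 ∨ ∃ i : Fin k, x = cellReg i) →
      Inv P (μ.setI x v) ∧ Φ (μ.setI x v) = Φ μ)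
    (hN : ∀ P μ, Inv P μ → ∀ i : Fin k, μ.ireg (countReg i) = N i)
    (hN0 : ∀ i, 0 < N i)
    (hbody : ∀ P μ j, (∀ i : Fin k, μ.ireg (cellReg i) = j i) → (∀ i, j i < N i) → Inv P μ →
      Run body μ fun T μ' => Inv (insert j P) μ' ∧ T + Φ μ' ≤ t + Φ μ)
    {l : List (Fin k)} (hl : l.Nodup) {P : Set (Fin k → ℕ)} {μ : Memory} {j₀ : Fin k → ℕ}
    (hj₀ : ∀ i ∉ l, μ.ireg (cellReg i) = j₀ i ∧ j₀ i < N i) (hP : Inv P μ) :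
    Run (nest body l) μ fun T μ' =>
      Inv (P ∪ {j | (∀ i ∉ l, j i = j₀ i) ∧ ∀ i ∈ l, j i < N i}) μ' ∧
      T + Φ μ' ≤ (t + 5 * l.length) * (l.map N).prod + Φ μ := by
  induction l generalizing P μ j₀ with
  | nil =>
    refine (hbody P μ j₀ (fun i => (hj₀ i (by simp)).1) (fun i => (hj₀ i (by simp)).2) hP).mono ?_
    rintro T μ' - ⟨h, hT⟩
    refine ⟨?_, by simpa using hT⟩
    convert h using 1
    ext j
    simp [funext_iff, or_comm]
  | cons i l ih =>
    obtain ⟨hil, hl⟩ := List.nodup_cons.1 hl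
    have hw : ∀ x, (∀ i' ∈ l, x ≠ cellReg i') → x ≠ 0 → ¬ body.wI x → ¬ (nest body l).wI x := by
      intro x h1 h2 h3 h
      rcases wI_nest h with h | h | ⟨i', hi', h⟩
      · exact h3 h
      · exact h2 h
      · exact h1 i' hi' h
    have hNi := hN P μ hP i
    refine (Run.forI_amortized ((t + 5 * l.length) * (l.map N).prod) Φ
      (fun n μ' => Inv (P ∪ {j | (∀ i' ∉ i :: l, j i' = j₀ i') ∧ j i < n ∧ ∀ i' ∈ l, j i' < N i'}) μ')
      (cellReg_ne i) (countReg_ne i) (cellReg_ne_countReg i i) ?_ ?_ ?_ ?_).mono ?_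
    · refine hw _ (fun i' hi' h => ?_) (cellReg_ne i) (hcell i)
      rw [cellReg_inj, Fin.val_inj] at h
      exact hil (h ▸ hi')
    · exact hw _ (fun i' _ => (cellReg_ne_countReg i' i).symm) (countReg_ne i) (hcount i)
    · simpa using (hInv P μ (cellReg i) 0 hP (.inr ⟨i, rfl⟩)).1
    · intro n μ' hn hF hi hI
      rw [hNi] at hn
      refine (ih hl (P := P ∪ {j | (∀ i' ∉ i :: l, j i' = j₀ i') ∧ j i < n ∧ ∀ i' ∈ l, j i' < N i'})
        (j₀ := Function.update j₀ i n) (fun i' hi' => ?_) hI).mono ?_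
      · by_cases h : i' = i
        · subst h
          simpa using ⟨hi, hn⟩
        · have h1 : i' ∉ i :: l := by simp [h, hi']
          rw [hF.ireg _ ?_]
          · simpa [h] using hj₀ i' h1
          · have h' : (i' : ℕ) ≠ i := Fin.val_ne_of_ne h
            simp only [wI_forI, cellReg_inj, h', false_or, cellReg_ne, or_false]
            refine hw _ (fun i'' hi'' he => ?_) (cellReg_ne i') (hcell i')
            rw [cellReg_inj, Fin.val_inj] at he
            exact hi' (he ▸ hi'')
      · rintro T μ'' - ⟨hI', hT⟩
        obtain ⟨g1, g1'⟩ := hInv _ μ'' 0 1 hI' (.inl rfl)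
        obtain ⟨g2, g2'⟩ := hInv _ _ (cellReg i) (n + 1) g1 (.inr ⟨i, rfl⟩)
        refine ⟨?_, by rw [g2', g1']; exact hT⟩
        convert g2 using 1
        rw [Set.union_assoc]
        congr 1
        ext j
        simp only [Set.mem_union, Set.mem_ofPred_eq, List.mem_cons, not_or]
        constructor
        · rintro ⟨h1, h2, h3⟩
          rcases Nat.lt_succ_iff_lt_or_eq.1 h2 with h | h
          · exact .inl ⟨h1, h, h3⟩
          · refine .inr ⟨fun i' hi' => ?_, h3⟩
            by_cases hii : i' = i
            · subst hii; simpa using h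
            · simpa [hii] using h1 i' ⟨hii, hi'⟩
        · rintro (⟨h1, h2, h3⟩ | ⟨h1, h3⟩)
          · exact ⟨h1, by omega, h3⟩
          · refine ⟨fun i' hi' => ?_, ?_, h3⟩
            · simpa [hi'.1] using h1 i' hi'.2
            · have := h1 i hil
              simp at this
              omega
    · rintro T μ' - ⟨hI, hT⟩
      rw [hNi] at hI hT
      refine ⟨?_, ?_⟩
      · convert hI using 2
        ext j
        simp only [Set.mem_ofPred_eq, List.mem_cons, forall_eq_or_imp]
      · rw [(hInv P μ (cellReg i) 0 hP (.inr ⟨i, rfl⟩)).2] at hT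
        refine hT.trans ?_
        have h1 : 0 < (l.map N).prod := List.prod_pos (by simpa using fun i _ => hN0 i)
        have h2 := hN0 i
        have h3 : 1 ≤ N i * (l.map N).prod := Nat.mul_pos h2 h1
        have h4 : N i ≤ N i * (l.map N).prod := Nat.le_mul_of_pos_right _ h1
        simp only [List.length_cons, List.map_cons, List.prod_cons]
        nlinarith

/-! ### Building the graph of product cells -/

theorem semialgebraicFun_max : SemialgebraicFun fun v : Fin 2 → ℝ => max (v 0) (v 1) := by
  refine .of_graph (.refl _) (fun v : Fin 2 → ℝ => max (v 0) (v 1)) ?_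
  have : {w : Option (Fin 2) → ℝ | max ((w ∘ some) 0) ((w ∘ some) 1) = w none} =
      {w | (w (some 0) ≤ w (some 1) → w (some 1) = w none) ∧
        (w (some 1) ≤ w (some 0) → w (some 0) = w none)} := by
    ext w
    simp only [Function.comp_apply, Set.mem_ofPred_eq]
    rcases le_total (w (some 0)) (w (some 1)) with h | h
    · rw [max_eq_right h]
      exact ⟨fun h' => ⟨fun _ => h', fun h'' => (le_antisymm h h'').trans h'⟩, fun h' => h'.1 h⟩
    · rw [max_eq_left h]
      exact ⟨fun h' => ⟨fun h'' => (le_antisymm h h'').trans h', fun _ => h'⟩, fun h' => h'.2 h⟩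
  rw [this]
  exact .and (.imp (.le (.var _) (.var _)) (.eq (.var _) (.var _)))
    (.imp (.le (.var _) (.var _)) (.eq (.var _) (.var _)))

namespace Program
section
variable {d k e : ℕ} [NeZero k] (σ : Fin d → Fin e) (b : ℕ) (ly : Layout k)

/-- Compute the powers of `2` with exponents `k * v`, where `v` ranges over the numbers of
vertices. -/
def powers : Program :=
  seq (setI 63 0) <|
  seq (rep k fun i => seq (setI 64 i) (seq (loadI 65 ly.verts 64) (addI 63 63 65))) <|
  seq (setI 66 1) <| forI 67 63 <| seq (storeI (nm b 22 0) 67 66) <|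
    seq (mulC 68 66 (2 ^ k)) (mv 66 68)

/-- Load the numbers of cells. -/
def counts : Program := rep k fun i => seq (setI 64 i) (loadI (countReg i) ly.cells 64)

/-- Register `x` becomes the number of the product cell of the vertices listed in array `A`. -/
def vertexNode (k x A : ℕ) : Program :=
  seq (setI x 0) <| rep k fun i => seq (setI 64 i) <| seq (loadI 65 A 64) <|
    seq (loadI 65 (nm b 22 0) 65) <| seq (mulC 70 65 (2 ^ (i : ℕ))) (addI x x 70)

/-- Make a copy of the start, with the number `0`, and connect it to the start. -/
def clone (k e : ℕ) : Program :=
  seq (seq (setI 72 0) (seq (loadR 1 (nm b 21 0) 69) (storeR (nm b 21 0) 72 1))) <|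
  seq (rep k fun i => seq (loadI 73 (nm b 20 i) 69) <| seq (storeI (nm b 20 i) 72 73) <|
    rep e fun c => seq (loadR 1 (nm b 20 (Nat.pair i c)) 69)
      (storeR (nm b 20 (Nat.pair i c)) 72 1)) <|
  seq (storeI (nm b 10 0) 62 72) <| seq (storeI (nm b 11 0) 62 69) <| seq (inc 62) <|
  seq (storeI (nm b 10 0) 62 69) <| seq (storeI (nm b 11 0) 62 72) (inc 62)

/-- The weights of the edges are the maxima of the weights of their end points. -/
def edgeWeights : Program :=
  forI 74 62 <| seq (loadI 75 (nm b 10 0) 74) <| seq (loadR 1 (nm b 21 0) 75) <|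
    seq (loadI 75 (nm b 11 0) 74) <| seq (loadR 2 (nm b 21 0) 75) <|
    seq (opR 3 _ semialgebraicFun_max ![1, 2]) (storeR (nm b 3 0) 74 3)

end
end Program

section
variable {d k e D b : ℕ} [NeZero k] [NeZero D] {σ : Fin d → Fin e} {ly : Layout k}
  {S : AgentSystem k e}

theorem powers_spec {μ : Memory} (hly : ly.Holds S D μ) :
    Run (powers b ly) μ fun T μ' => HoldsPowers S b μ' ∧
      T ≤ (2 ^ k + 10) * ∑ i, S.numVerts i + (4 * k + 10) := by
  have hstep : ∀ n, (mulC 68 66 n).steps = n + 1 := fun n => by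
    induction n <;> simp_all [mulC]
  refine Run.seq (Run.of_loopFree (by simp) fun _ h1 => ?_)
  have h2 : Run (rep k fun i => seq (setI 64 i) (seq (loadI 65 ly.verts 64) (addI 63 63 65)))
      ((setI 63 0).exec μ) fun T μ' => μ'.ireg 63 = ∑ i, S.numVerts i ∧ T ≤ 1 + 3 * k := by
    refine (Run.rep (fun n T μ' => μ'.ireg 63 = ∑ i with (i : Fin k) < n, S.numVerts i ∧
      T ≤ 1 + 3 * n) (by simp) ?_).mono ?_
    · rintro i T μ' hF ⟨h63, hT⟩
      refine Run.of_loopFree (by simp) fun T' hT' => ⟨?_, by simp at hT'; omega⟩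
      have := hF.iarr ly.verts (by simp)
      have hs : (Finset.univ.filter fun i' : Fin k => (i' : ℕ) < i + 1) =
          insert i (Finset.univ.filter fun i' : Fin k => (i' : ℕ) < i) := by
        ext i'
        simp only [Finset.mem_filter, Finset.mem_univ, true_and, Finset.mem_insert, Fin.ext_iff]
        omega
      rw [hs, Finset.sum_insert (by simp), add_comm]
      simp [h63, this, hly.verts]
    · rintro T μ' - ⟨h63, hT⟩
      exact ⟨by rw [h63]; simp, hT⟩
  refine Run.seq' h2 fun T2 μ2 hF2 ⟨h63, hT2⟩ => ?_
  refine Run.seq (Run.of_loopFree (by simp) fun _ h3 => ?_)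
  refine (Run.forI_loopFree (fun n μ' => μ'.ireg 66 = 2 ^ (k * n) ∧
    ∀ v < n, μ'.iarr (nm b 22 0) v = 2 ^ (k * v)) (by simp) (by simp) (by simp) (by simp [mv])
    (by simp [mv]) (by simp [mv]) ⟨by simp, by simp⟩ ?_).mono ?_
  · rintro n μ' hn hF hi ⟨h66, hv⟩
    simp only [exec, exec_mulC _ _ _ (show 66 ≠ 68 by decide)]
    refine ⟨?_, fun v hv' => ?_⟩
    · simp [mv, h66]; ring
    · rcases Nat.lt_succ_iff_lt_or_eq.1 hv' with h | rfl
      · simpa [mv, hi, h.ne] using hv v h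
      · simp [mv, hi, h66]
  · rintro T μ' - ⟨⟨-, hv⟩, hT⟩
    simp only [exec, Memory.ireg_setI, steps, hstep, mv] at hv hT h1 h3
    norm_num [h63] at hv hT
    refine ⟨fun i v hvi => hv v (hvi.trans_le (Finset.single_le_sum (f := S.numVerts)
      (fun _ _ => Nat.zero_le _) (Finset.mem_univ i))), ?_⟩
    nlinarith

theorem vertexNode_spec {μ : Memory} {x A : ℕ} (hx : x ≠ 64) (hx' : x ≠ 65) (hx'' : x ≠ 70)
    {v : Fin k → ℕ} (hA : ∀ i : Fin k, μ.iarr A i = v i) (hv : ∀ i, v i < S.numVerts i)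
    (hp : HoldsPowers S b μ) : Run (vertexNode b k x A) μ fun _ μ' =>
      μ'.ireg x = AgentSystem.nodeId fun i : Fin k => {v i} := by
  refine Run.seq (Run.of_loopFree (by simp) fun _ _ => ?_)
  refine (Run.rep (fun n T μ' => μ'.ireg x = ∑ i with (i : Fin k) < n, 2 ^ (v i * k + i))
    (by simp) ?_).mono ?_
  · rintro i T μ' hF h
    refine Run.of_loopFree (by simp) fun _ _ => ?_
    have h1 : μ'.iarr A = μ.iarr A := by rw [hF.iarr _ (by simp)]; simp
    have h2 : μ'.iarr (nm b 22 0) (v i) = 2 ^ (k * v i) := by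
      rw [hF.iarr _ (by simp)]; exact hp i _ (hv i)
    have hs : (Finset.univ.filter fun i' : Fin k => (i' : ℕ) < i + 1) =
        insert i (Finset.univ.filter fun i' : Fin k => (i' : ℕ) < i) := by
      ext i'
      simp only [Finset.mem_filter, Finset.mem_univ, true_and, Finset.mem_insert, Fin.ext_iff]
      omega
    rw [hs, Finset.sum_insert (by simp)]
    simp only [exec, exec_mulC _ _ _ (show 65 ≠ 70 by decide)]
    simp [hx, hx', hx'', h, h1, h2, hA]
    ring
  · rintro T μ' - h
    rw [h, AgentSystem.nodeId]
    simp

/-- All product cells and the edges are stored. -/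
structure GraphStored (S : AgentSystem k e) (σ : Fin d → Fin e) (b : ℕ) (μ : Memory) : Prop where
  node : ∀ u c, S.NodeOf u c → HoldsNode S σ b μ u c
  symm : ∀ n < μ.ireg 62, ∃ n' < μ.ireg 62, μ.iarr (nm b 10 0) n' = μ.iarr (nm b 11 0) n ∧
    μ.iarr (nm b 11 0) n' = μ.iarr (nm b 10 0) n
  facet : ∀ c c', S.IsNode c → AgentSystem.Facet c c' →
    HasEdge (μ.iarr (nm b 10 0)) (μ.iarr (nm b 11 0)) (μ.ireg 62)
      (AgentSystem.nodeId c) (AgentSystem.nodeId c')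
  clone : HasEdge (μ.iarr (nm b 10 0)) (μ.iarr (nm b 11 0)) (μ.ireg 62) 0
    (AgentSystem.nodeId S.srcNode)
  sound : ∀ n < μ.ireg 62, ∃ c c', S.NodeOf (μ.iarr (nm b 10 0) n) c ∧
    S.NodeOf (μ.iarr (nm b 11 0) n) c' ∧ ((∀ i, c i ⊆ c' i) ∨ ∀ i, c' i ⊆ c i)

theorem clone_spec {μ : Memory} (hS : S.Valid D)
    (hV : Visited S σ b {j | ∀ i, j i < S.numCells i} μ)
    (h69 : μ.ireg 69 = AgentSystem.nodeId S.srcNode) :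
    Run (clone b k e) μ fun _ μ' => GraphStored S σ b μ' ∧ μ'.ireg 62 = μ.ireg 62 + 2 := by
  have hex : ∀ c, S.IsNode c → ∃ j : Fin k → ℕ, (∀ i, j i < S.numCells i) ∧ S.node j = c := by
    intro c hc
    choose j h1 h2 using hc
    exact ⟨j, h1, funext h2⟩
  have hsrc0 : AgentSystem.nodeId S.srcNode ≠ 0 :=
    (AgentSystem.nodeId_pos (hS.isNode_src.nonempty hS)).ne'
  refine Run.seq (Run.of_loopFree (by simp) fun _ _ => ?_)
  refine Run.seq' (Run.rep (fun n _ μ' => (∀ i : Fin k, i < n →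
      μ'.iarr (nm b 20 i) 0 = μ.iarr (nm b 20 i) (μ.ireg 69) ∧
      ∀ x : Fin e, μ'.rarr (nm b 20 (Nat.pair i x)) 0 =
        μ.rarr (nm b 20 (Nat.pair i x)) (μ.ireg 69)) ∧
      ∀ u, u ≠ 0 → ∀ i : Fin k, μ'.iarr (nm b 20 i) u = μ.iarr (nm b 20 i) u ∧
        ∀ x : Fin e, μ'.rarr (nm b 20 (Nat.pair i x)) u = μ.rarr (nm b 20 (Nat.pair i x)) u)
    ⟨by simp, fun u hu i => by simp⟩ ?_) fun T1 μ1 hF1 ⟨h1, h2⟩ => ?_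
  · rintro i T μ' hF ⟨h1, h2⟩
    have h69' : μ'.ireg 69 = μ.ireg 69 := by
      rw [hF.ireg _ (by simp)]; simp
    have h72 : μ'.ireg 72 = 0 := by
      rw [hF.ireg _ (by simp)]; simp
    refine Run.seq (Run.of_loopFree (by simp) fun _ _ => ?_)
    refine Run.seq (Run.of_loopFree (by simp) fun _ _ => ?_)
    refine (Run.rep (fun m _ μ'' => (∀ x : Fin e, x < m →
        μ''.rarr (nm b 20 (Nat.pair i x)) 0 = μ.rarr (nm b 20 (Nat.pair i x)) (μ.ireg 69)) ∧
        ∀ u, u ≠ 0 → ∀ x : Fin e,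
          μ''.rarr (nm b 20 (Nat.pair i x)) u = μ.rarr (nm b 20 (Nat.pair i x)) u)
      ⟨by simp, fun u hu x => by simpa using (h2 u hu i).2 x⟩ ?_).mono ?_
    · rintro x T' μ'' hF' ⟨g1, g2⟩
      have h69' : μ''.ireg 69 = μ.ireg 69 := by
        rw [hF'.ireg _ (by simp)]; simpa using h69'
      have h72' : μ''.ireg 72 = 0 := by
        rw [hF'.ireg _ (by simp)]; simpa using h72
      refine Run.of_loopFree (by simp) fun _ _ => ?_
      refine ⟨fun x' hx' => ?_, fun u hu x' => ?_⟩
      · rcases Nat.lt_succ_iff_lt_or_eq.1 hx' with h | h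
        · simpa [h72', h.ne] using g1 x' h
        · obtain rfl := Fin.ext h
          simp [h72', h69', g2 _ (h69 ▸ hsrc0)]
      · simpa [h72', hu] using g2 u hu x'
    · rintro T' μ'' hF' ⟨g1, g2⟩
      refine ⟨fun i' hi' => ?_, fun u hu i' => ?_⟩
      · rcases Nat.lt_succ_iff_lt_or_eq.1 hi' with h | h
        · rw [hF'.iarr _ (by simp)]
          refine ⟨by simpa [h.ne] using (h1 i' h).1, fun x => ?_⟩
          rw [hF'.rarr _ (by simp [h.ne])]
          simpa using (h1 i' h).2 x
        · obtain rfl := Fin.ext h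
          rw [hF'.iarr _ (by simp)]
          exact ⟨by simp [h72, h69', (h2 _ (h69 ▸ hsrc0) i').1], fun x => g1 x x.2⟩
      · by_cases h : i' = i
        · subst h
          rw [hF'.iarr _ (by simp)]
          exact ⟨by simpa [hu, h72] using (h2 u hu i').1, fun x => g2 u hu x⟩
        · have h' : (i' : ℕ) ≠ i := Fin.val_ne_of_ne h
          rw [hF'.iarr _ (by simp)]
          refine ⟨by simpa [h'] using (h2 u hu i').1, fun x => ?_⟩
          rw [hF'.rarr _ (by simp [h'])]
          simpa using (h2 u hu i').2 x
  have hnode : ∀ u c, S.NodeOf u c → HoldsNode S σ b μ1 u c := by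
    have hW : ∀ u, μ1.rarr (nm b 21 0) u =
        if u = 0 then μ.rarr (nm b 21 0) (μ.ireg 69) else μ.rarr (nm b 21 0) u := by
      intro u
      rw [hF1.rarr _ (by simp)]
      simp
    rintro u c ⟨hc, hu⟩
    obtain ⟨j, hj, rfl⟩ := hex c hc
    have hV' := hV.node j hj
    rcases hu with rfl | ⟨rfl, hc'⟩
    · have h0 := (AgentSystem.nodeId_pos (hc.nonempty hS)).ne'
      refine ⟨by rw [hW, if_neg h0]; exact hV'.1, fun i => ?_⟩
      rw [(h2 _ h0 i).1]
      exact ⟨(hV'.2 i).1, fun x => ((h2 _ h0 i).2 x).trans ((hV'.2 i).2 x)⟩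
    · rw [hc', ← h69, ← hc'] at hV'
      refine ⟨by rw [hW, if_pos rfl]; exact hV'.1, fun i => ?_⟩
      rw [(h1 i i.2).1]
      exact ⟨(hV'.2 i).1, fun x => ((h1 i i.2).2 x).trans ((hV'.2 i).2 x)⟩
  refine Run.of_loopFree (by simp) fun _ _ => ?_
  have h62 : μ1.ireg 62 = μ.ireg 62 := by rw [hF1.ireg _ (by simp)]; simp
  have h69' : μ1.ireg 69 = μ.ireg 69 := by rw [hF1.ireg _ (by simp)]; simp
  have h72' : μ1.ireg 72 = 0 := by rw [hF1.ireg _ (by simp)]; simp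
  have hA1 : μ1.iarr (nm b 10 0) = μ.iarr (nm b 10 0) := by
    rw [hF1.iarr _ (by simp)]; simp
  have hB1 : μ1.iarr (nm b 11 0) = μ.iarr (nm b 11 0) := by
    rw [hF1.iarr _ (by simp)]; simp
  set μ2 := (seq (storeI (nm b 10 0) 62 72) <| seq (storeI (nm b 11 0) 62 69) <| seq (inc 62) <|
    seq (storeI (nm b 10 0) 62 69) <| seq (storeI (nm b 11 0) 62 72) (inc 62)).exec μ1 with hμ2
  have hA : ∀ n, μ2.iarr (nm b 10 0) n = if n = μ.ireg 62 + 1 then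
      AgentSystem.nodeId S.srcNode else if n = μ.ireg 62 then 0 else μ.iarr (nm b 10 0) n := by
    intro n
    simp [hμ2, inc, h62, h69', h72', h69, hA1]
  have hB : ∀ n, μ2.iarr (nm b 11 0) n = if n = μ.ireg 62 + 1 then 0
      else if n = μ.ireg 62 then AgentSystem.nodeId S.srcNode else μ.iarr (nm b 11 0) n := by
    intro n
    simp [hμ2, inc, h62, h69', h72', h69, hB1]
  have hm : μ2.ireg 62 = μ.ireg 62 + 2 := by simp [hμ2, inc, h62]
  have hn2 : ∀ u c, S.NodeOf u c → HoldsNode S σ b μ2 u c := fun u c h =>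
    (hnode u c h).congr (by simp [hμ2, inc]) (by simp [hμ2, inc]) (by simp [hμ2, inc])
  clear_value μ2
  have hold : ∀ n < μ.ireg 62, μ2.iarr (nm b 10 0) n = μ.iarr (nm b 10 0) n ∧
      μ2.iarr (nm b 11 0) n = μ.iarr (nm b 11 0) n := by
    intro n hn
    rw [hA, hB]
    simp [show n ≠ μ.ireg 62 + 1 by omega, show n ≠ μ.ireg 62 by omega]
  have hcases : ∀ n < μ.ireg 62 + 2, n < μ.ireg 62 ∨ n = μ.ireg 62 ∨ n = μ.ireg 62 + 1 := by
    intro n hn; omega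
  refine ⟨⟨hn2, fun n hn => ?_, fun c c' hc hf => ?_, ⟨μ.ireg 62, by omega, by simp [hA, hB]⟩,
    fun n hn => ?_⟩, hm⟩
  · rw [hm] at hn ⊢
    rcases hcases n hn with h | rfl | rfl
    · obtain ⟨n', hn', h1, h2⟩ := hV.sound.1 n h
      exact ⟨n', by omega, by rw [(hold n' hn').1, (hold n h).2, h1],
        by rw [(hold n' hn').2, (hold n h).1, h2]⟩
    · exact ⟨μ.ireg 62 + 1, by omega, by simp [hA, hB]⟩
    · exact ⟨μ.ireg 62, by omega, by simp [hA, hB]⟩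
  · obtain ⟨j, hj, rfl⟩ := hex c hc
    obtain ⟨n, hn, h1, h2⟩ := hV.facet j hj c' hf
    exact ⟨n, by omega, by rw [(hold n hn).1, (hold n hn).2]; exact ⟨h1, h2⟩⟩
  · rw [hm] at hn
    have hs : S.NodeOf (AgentSystem.nodeId S.srcNode) S.srcNode := ⟨hS.isNode_src, .inl rfl⟩
    have hs' : S.NodeOf 0 S.srcNode := ⟨hS.isNode_src, .inr ⟨rfl, rfl⟩⟩
    rcases hcases n hn with h | rfl | rfl
    · rw [(hold n h).1, (hold n h).2]
      obtain ⟨c, c', h1, h2, h3, h4, h5⟩ := hV.sound.2 n h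
      exact ⟨c, c', ⟨h1, .inl h4⟩, ⟨h2, .inl h5⟩, h3⟩
    · exact ⟨_, _, by simpa [hA] using hs', by simpa [hB] using hs, .inl fun _ => subset_rfl⟩
    · exact ⟨_, _, by simpa [hA] using hs, by simpa [hB] using hs', .inl fun _ => subset_rfl⟩

theorem edgeWeights_spec {μ : Memory} (hS : S.Valid D) (hG : GraphStored S σ b μ) :
    Run (edgeWeights b) μ fun T μ' => S.IsEdgeList σ (μ.iarr (nm b 10 0)) (μ.iarr (nm b 11 0))
      (μ'.rarr (nm b 3 0)) (μ.ireg 62) ∧ T ≤ 9 * μ.ireg 62 + 2 := by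
  refine (Run.forI_loopFree (fun n μ' => ∀ v < n, μ'.rarr (nm b 3 0) v =
    max (μ.rarr (nm b 21 0) (μ.iarr (nm b 10 0) v)) (μ.rarr (nm b 21 0) (μ.iarr (nm b 11 0) v)))
    (by simp) (by simp) (by simp) (by simp) (by simp) (by simp) (by simp) ?_).mono ?_
  · rintro n μ' hn hF hi hv v hv'
    have h1 := hF.iarr (nm b 10 0) (by simp)
    have h2 := hF.iarr (nm b 11 0) (by simp)
    have h3 := hF.rarr (nm b 21 0) (by simp)
    rcases Nat.lt_succ_iff_lt_or_eq.1 hv' with h | rfl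
    · simpa [hi, h.ne] using hv v h
    · simp [hi, h1, h2, h3]
  · rintro T μ' hF ⟨hv, hT⟩
    refine ⟨?_, by simpa using hT⟩
    have hw : ∀ n < μ.ireg 62, ∀ c c', S.NodeOf (μ.iarr (nm b 10 0) n) c →
        S.NodeOf (μ.iarr (nm b 11 0) n) c' →
        μ'.rarr (nm b 3 0) n = max (S.weight σ c) (S.weight σ c') := by
      intro n hn c c' hc hc'
      rw [hv n hn, (hG.node _ _ hc).1, (hG.node _ _ hc').1]
    refine ⟨fun n hn => ?_, fun c c' hc hc' hf => ?_, ?_, fun n hn => ?_⟩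
    · obtain ⟨n', hn', h1, h2⟩ := hG.symm n hn
      exact ⟨n', hn', h1, h2, by rw [hv n' hn', hv n hn, h1, h2, max_comm]⟩
    · obtain ⟨n, hn, h1, h2⟩ := hG.facet c c' hc hf
      exact ⟨n, hn, h1, h2, hw n hn c c' ⟨hc, .inl h1⟩ ⟨hc', .inl h2⟩⟩
    · obtain ⟨n, hn, h1, h2⟩ := hG.clone
      refine ⟨n, hn, h1, h2, ?_⟩
      rw [hw n hn _ _ ⟨hS.isNode_src, .inr ⟨h1, rfl⟩⟩ ⟨hS.isNode_src, .inl h2⟩, max_self]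
    · obtain ⟨c, c', hc, hc', h⟩ := hG.sound n hn
      exact ⟨c, c', hc, hc', h, hw n hn c c' hc hc'⟩

end

/-! ### Computing an optimal motion -/

namespace Program
section
variable {d k e : ℕ} [NeZero k] (σ : Fin d → Fin e) (b : ℕ) (ly : Layout k)

/-- Build the graph of product cells, and find a path in it from the start to the end that minimizes
the largest weight. -/
noncomputable def solve (D : ℕ) [NeZero D] : Program :=
  seq (powers b ly) <| seq (counts ly) <| seq (setI 62 0) <|
  seq (nest (visit σ b ly D) (List.finRange k)) <|
  seq (vertexNode b k 69 ly.src) <| seq (vertexNode b k 71 ly.tgt) <| seq (clone b k e) <|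
  seq (edgeWeights b) <| seq (seq (mv 28 62) (seq (setI 30 0) (mv 31 71))) (bottleneckPath b)

end
end Program

section
variable {d k e D b : ℕ} [NeZero k] [NeZero D] {σ : Fin d → Fin e} {ly : Layout k}
  {S : AgentSystem k e}

theorem counts_spec {μ : Memory} (hly : ly.Holds S D μ) :
    Run (counts ly) μ fun _ μ' => ∀ i : Fin k, μ'.ireg (countReg i) = S.numCells i := by
  refine (Run.rep (fun n _ μ' => ∀ i : Fin k, i < n → μ'.ireg (countReg i) = S.numCells i)
    (by simp) ?_).mono fun _ _ _ h i => h i i.2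
  intro i T μ' hF h
  refine Run.of_loopFree (by simp) fun _ _ i' hi' => ?_
  have := hF.iarr ly.cells (by simp)
  rcases Nat.lt_succ_iff_lt_or_eq.1 hi' with h' | h'
  · simpa [countReg, h'.ne] using h i' h'
  · obtain rfl := Fin.ext h'
    simp [countReg, this, hly.cells]

/-- What is known about the memory before the product cells are enumerated. -/
theorem enumerate_spec {μ : Memory} (hly : ly.Holds S D μ) (hb : ly.Below b)
    (hp : HoldsPowers S b μ) (hS : S.Valid D)
    (hc : ∀ i : Fin k, μ.ireg (countReg i) = S.numCells i) (h62 : μ.ireg 62 = 0) :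
    Run (nest (visit σ b ly D) (List.finRange k)) μ fun T μ' =>
      Visited S σ b {j | ∀ i, j i < S.numCells i} μ' ∧
      T + μ'.ireg 62 ≤ ((visit σ b ly D).steps + 2 * D * k + 5 * k) * ∏ i, S.numCells i := by
  have hN0 : ∀ i, 0 < S.numCells i := fun i => by
    obtain ⟨j, hj, -⟩ := hS.isNode_src i
    omega
  have hne : ∀ {A t x}, A < b → A ≠ nm b t x := fun {A t x} h h' => by
    have := le_nm b t x
    omega
  have hsound : EdgesSound S (μ.iarr (nm b 10 0)) (μ.iarr (nm b 11 0)) (μ.ireg 62) := by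
    rw [h62]
    exact ⟨by simp, by simp⟩
  refine (nest_spec (N := S.numCells) (t := (visit σ b ly D).steps + 2 * D * k)
    (Φ := fun μ => μ.ireg 62) (Inv := fun P μ' => Visited S σ b P μ' ∧ ly.Holds S D μ' ∧
      HoldsPowers S b μ' ∧ ∀ i : Fin k, μ'.ireg (countReg i) = S.numCells i) ?_ ?_ ?_ ?_ hN0 ?_
    (List.nodup_finRange k) (P := ∅) (j₀ := fun _ => 0) (by simp)
    ⟨⟨by simp, hsound, by simp⟩, hly, hp, hc⟩).mono ?_
  · intro i
    simp [visit, loadNode, loadCell, loadSlot, storeBest, bestOp, emit, cellReg, dropReg]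
  · intro i
    simp [visit, loadNode, loadCell, loadSlot, storeBest, bestOp, emit, countReg, dropReg]
  · rintro P μ' x v ⟨h1, h2, h3, h4⟩ hx
    have h62 : (62 : ℕ) ≠ x := by
      rcases hx with rfl | ⟨i, rfl⟩ <;> simp [cellReg]
    have hcr : ∀ i : Fin k, countReg i ≠ x := by
      intro i
      rcases hx with rfl | ⟨i', rfl⟩ <;> simp [cellReg, countReg]
    refine ⟨⟨⟨fun j hj => (h1.node j hj).congr (by simp) (by simp) (by simp), ?_, ?_⟩,
      h2.frame' rfl rfl, h3, fun i => by simpa [hcr i] using h4 i⟩, by simp [h62]⟩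
    · simpa [h62] using h1.sound
    · simpa [h62] using h1.facet
  · exact fun P μ' h => h.2.2.2
  · rintro P μ' j hr hj ⟨h1, h2, h3, h4⟩
    refine (visit_spec h2 h3 hS hj hr h1).mono ?_
    rintro T μ'' hF ⟨g1, g2⟩
    refine ⟨⟨g1, h2.frame hb (fun A hA => hF.iarr A ?_) (fun A hA => hF.rarr A ?_), ?_, ?_⟩, g2⟩
    · simp [visit, loadNode, loadCell, loadSlot, storeBest, bestOp, emit, hne hA]
    · simp [visit, loadNode, loadCell, loadSlot, storeBest, bestOp, emit, hne hA]
    · simpa only [HoldsPowers, hF.iarr (nm b 22 0)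
        (by simp [visit, loadNode, loadCell, loadSlot, storeBest, bestOp, emit])] using h3
    · intro i
      rw [hF.ireg _ (by simp [visit, loadNode, loadCell, loadSlot, storeBest, bestOp, emit,
        countReg, dropReg])]
      exact h4 i
  · rintro T μ' - ⟨⟨h, -⟩, hT⟩
    refine ⟨by simpa using h, ?_⟩
    rw [h62, List.length_finRange, ← List.ofFn_eq_map, List.prod_ofFn] at hT
    simpa using hT

/-- A path of product cells from the start to the end is stored. -/
structure PathStored (S : AgentSystem k e) (σ : Fin d → Fin e) (b : ℕ) (μ : Memory) : Prop where
  node : ∀ u c, S.NodeOf u c → HoldsNode S σ b μ u c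
  pos : 0 < μ.ireg 29
  path : ∃ p : ℝ, (∀ θ, S.Reach σ θ S.srcNode S.tgtNode → S.weight σ S.srcNode ≤ θ → p ≤ θ) ∧
    ∃ node : ℕ → Fin k → Finset ℕ, (∀ l ≤ μ.ireg 29, S.NodeOf (μ.iarr (nm b 12 0) l) (node l) ∧
      S.weight σ (node l) ≤ p) ∧ node 0 = S.srcNode ∧ node (μ.ireg 29) = S.tgtNode ∧
      ∀ l < μ.ireg 29, ∃ c, S.NodeOf (max (μ.iarr (nm b 12 0) l) (μ.iarr (nm b 12 0) (l + 1))) c ∧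
        (∀ i, node l i ⊆ c i) ∧ ∀ i, node (l + 1) i ⊆ c i

theorem AgentSystem.Valid.src_lt (hS : S.Valid D) (i : Fin k) : S.src i < S.numVerts i := by
  obtain ⟨j, hj, h⟩ := hS.isNode_src i
  obtain ⟨a, ha, h'⟩ := Finset.mem_image.1 (h ▸ Finset.mem_singleton_self _ : S.src i ∈ S.cell i j)
  exact h' ▸ hS.idx_lt i j hj a (Finset.mem_range.1 ha)

theorem AgentSystem.Valid.tgt_lt (hS : S.Valid D) (i : Fin k) : S.tgt i < S.numVerts i := by
  obtain ⟨j, hj, h⟩ := hS.isNode_tgt i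
  obtain ⟨a, ha, h'⟩ := Finset.mem_image.1 (h ▸ Finset.mem_singleton_self _ : S.tgt i ∈ S.cell i j)
  exact h' ▸ hS.idx_lt i j hj a (Finset.mem_range.1 ha)

/-- Besides the product cells, the vertices contribute to the running time, for the powers of `2`. -/
theorem solve_spec (σ : Fin d → Fin e) (D b : ℕ) [NeZero D] (ly : Layout k) (hb : ly.Below b) :
    ∃ C, ∀ (S : AgentSystem k e) (μ : Memory), ly.Holds S D μ → S.Valid D →
      (∃ θ, S.Reach σ θ S.srcNode S.tgtNode) →
      Run (solve σ b ly D) μ fun T μ' => PathStored S σ b μ' ∧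
        T + μ'.ireg 29 ≤ C * (∏ i, S.numCells i + ∑ i, S.numVerts i) := by
  set K := (visit σ b ly D).steps + 2 * D * k + 5 * k with hK
  set c₀ := 4 * k + (counts ly).steps + (vertexNode b k 69 ly.src).steps +
    (vertexNode b k 71 ly.tgt).steps + (clone b k e).steps with hc₀
  refine ⟨2 ^ k + 10 + c₀ + 2000000 * K + 3000000, fun S μ hly hS ⟨θ, hθ⟩ => ?_⟩
  have hne : ∀ {A t x}, A < b → A ≠ nm b t x := fun {A t x} h h' => by
    have := le_nm b t x
    omega
  have hN0 : 0 < ∏ i, S.numCells i := Finset.prod_pos fun i _ => by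
    obtain ⟨j, hj, -⟩ := hS.isNode_src i
    omega
  refine Run.seq' (powers_spec hly) fun T1 μ1 hF1 ⟨hp1, hT1⟩ => ?_
  have hly1 := hly.frame hb (fun A hA => hF1.iarr A (by simp [powers, mv, hne hA]))
    (fun A hA => hF1.rarr A (by simp [powers, mv]))
  refine Run.seq' ((counts_spec hly1).time_le (by simp [counts])) fun T2 μ2 hF2 ⟨hc2, hT2⟩ => ?_
  refine Run.seq (Run.of_loopFree (by simp) fun T3 hT3 => ?_)
  have hly3 : ly.Holds S D ((setI 62 0).exec μ2) := hly1.frame'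
    (funext fun A => by simp [hF2.iarr A (by simp [counts])])
    (funext fun A => by simp [hF2.rarr A (by simp [counts])])
  have hp3 : HoldsPowers S b ((setI 62 0).exec μ2) := by
    simpa [HoldsPowers, hF2.iarr (nm b 22 0) (by simp [counts])] using hp1
  refine Run.seq' (enumerate_spec hly3 hb hp3 hS (by simpa [countReg] using hc2) (by simp))
    fun T4 μ4 hF4 ⟨hV4, hT4⟩ => ?_
  have hly4 := hly3.frame hb (fun A hA => hF4.iarr A (by
      simp [visit, loadNode, loadCell, loadSlot, storeBest, bestOp, emit, hne hA]))
    (fun A hA => hF4.rarr A (by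
      simp [visit, loadNode, loadCell, loadSlot, storeBest, bestOp, emit, hne hA]))
  have hp4 : HoldsPowers S b μ4 := by
    simpa only [HoldsPowers, hF4.iarr (nm b 22 0)
      (by simp [visit, loadNode, loadCell, loadSlot, storeBest, bestOp, emit])] using hp3
  refine Run.seq' ((vertexNode_spec (by simp) (by simp) (by simp) hly4.src hS.src_lt hp4).time_le
    (by simp [vertexNode])) fun T5 μ5 hF5 ⟨h69, hT5⟩ => ?_
  have hly5 := hly4.frame hb (fun A hA => hF5.iarr A (by simp [vertexNode]))
    (fun A hA => hF5.rarr A (by simp [vertexNode]))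
  have hp5 : HoldsPowers S b μ5 := by
    simpa only [HoldsPowers, hF5.iarr (nm b 22 0) (by simp [vertexNode])] using hp4
  refine Run.seq' ((vertexNode_spec (by simp) (by simp) (by simp) hly5.tgt hS.tgt_lt hp5).time_le
    (by simp [vertexNode])) fun T6 μ6 hF6 ⟨h71, hT6⟩ => ?_
  have h69' : μ6.ireg 69 = AgentSystem.nodeId S.srcNode := by
    rw [hF6.ireg _ (by simp [vertexNode])]
    exact h69
  have hm6 : μ6.ireg 62 = μ4.ireg 62 := by
    rw [hF6.ireg _ (by simp [vertexNode]), hF5.ireg _ (by simp [vertexNode])]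
  have hV6 : Visited S σ b {j | ∀ i, j i < S.numCells i} μ6 := by
    have hi : ∀ A, μ6.iarr A = μ4.iarr A := fun A => by
      rw [hF6.iarr _ (by simp [vertexNode]), hF5.iarr _ (by simp [vertexNode])]
    have hr : ∀ A, μ6.rarr A = μ4.rarr A := fun A => by
      rw [hF6.rarr _ (by simp [vertexNode]), hF5.rarr _ (by simp [vertexNode])]
    refine ⟨fun j hj => (hV4.node j hj).congr (fun _ => hi _) (fun _ => hr _) (hr _), ?_, ?_⟩
    · rw [hi, hi, hm6]; exact hV4.sound
    · rw [hi, hi, hm6]; exact hV4.facet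
  refine Run.seq' ((clone_spec hS hV6 h69').time_le (by simp [Program.clone]))
    fun T7 μ7 hF7 ⟨⟨hG, hm7⟩, hT7⟩ => ?_
  have h71' : μ7.ireg 71 = AgentSystem.nodeId S.tgtNode := by
    rw [hF7.ireg _ (by simp [Program.clone])]
    exact h71
  refine Run.seq' (edgeWeights_spec hS hG) fun T8 μ8 hF8 ⟨hE, hT8⟩ => ?_
  have h62 : μ8.ireg 62 = μ7.ireg 62 := hF8.ireg _ (by simp [edgeWeights])
  have h71'' : μ8.ireg 71 = AgentSystem.nodeId S.tgtNode := by
    rw [hF8.ireg _ (by simp [edgeWeights]), h71']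
  have hA := hF8.iarr (nm b 10 0) (by simp [edgeWeights])
  have hB := hF8.iarr (nm b 11 0) (by simp [edgeWeights])
  refine Run.seq (Run.of_loopFree (by simp [mv]) fun T9 hT9 => ?_)
  simp only [steps, mv] at hT9
  set μ9 := (seq (mv 28 62) (seq (setI 30 0) (mv 31 71))).exec μ8 with hμ9
  have h29 : μ9.ireg 28 = μ7.ireg 62 := by simp [hμ9, mv, h62]
  have h30 : μ9.ireg 30 = 0 := by simp [hμ9, mv]
  have h31 : μ9.ireg 31 = AgentSystem.nodeId S.tgtNode := by simp [hμ9, mv, h71'']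
  have hnode9 : ∀ u c, S.NodeOf u c → HoldsNode S σ b μ9 u c := fun u c h =>
    (hG.node u c h).congr
      (fun x => by simp [hμ9, mv, hF8.iarr (nm b 20 x) (by simp [edgeWeights])])
      (fun x => by simp [hμ9, mv, hF8.rarr (nm b 20 x) (by simp [edgeWeights])])
      (by simp [hμ9, mv, hF8.rarr (nm b 21 0) (by simp [edgeWeights])])
  have hA9 : μ9.iarr (nm b 10 0) = μ7.iarr (nm b 10 0) := by simp [hμ9, mv, hA]
  have hB9 : μ9.iarr (nm b 11 0) = μ7.iarr (nm b 11 0) := by simp [hμ9, mv, hB]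
  have hW9 : μ9.rarr (nm b 3 0) = μ8.rarr (nm b 3 0) := by simp [hμ9, mv]
  clear_value μ9
  have hconn : ∀ θ, S.Reach σ θ S.srcNode S.tgtNode → S.weight σ S.srcNode ≤ θ →
      Relation.ReflTransGen (LinkLE (μ7.iarr (nm b 10 0)) (μ7.iarr (nm b 11 0))
        (μ8.rarr (nm b 3 0)) (μ7.ireg 62) θ) 0 (AgentSystem.nodeId S.tgtNode) :=
    fun θ h h' => hE.connected h h'
  refine (bottleneckPath_spec b μ9 hA9 hB9 hW9 h29 h30 h31 hE.symm
    (AgentSystem.nodeId_pos (hS.isNode_tgt.nonempty hS)).ne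
    ⟨_, hconn (max θ (S.weight σ S.srcNode)) (hθ.mono (le_max_left _ _)) (le_max_right _ _)⟩).mono ?_
  rintro T10 μ10 hF10 ⟨hT10, hL, hLm, hs, ht, p, hp, hl⟩
  obtain ⟨node, h1, h2, h3, h4⟩ := hE.path hS hL hs ht hl
  refine ⟨⟨fun u c h => (hnode9 u c h).congr (fun x => hF10.iarr _ ?_) (fun x => hF10.rarr _ ?_)
    (hF10.rarr _ ?_), hL, p, fun θ h h' => hp.2 (hconn θ h h'), node, h1, h2, h3, h4⟩, ?_⟩
  iterate 3 simp [bottleneckPath, bottleneckRound, selectPivot, sampleLevel, sampleBlock, sortBlock,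
      copyFourth, markLt, markLe, markGe, mark, components, initSearch, buildLists, search,
      searchLoop, ifEq, idLabels, contract, loadEdges, followParents, mv]
  rw [hm7, hm6] at hT10 hLm hT8
  rw [← hK] at hT4
  simp only [steps] at hT3
  have e1 : K * ∏ i, S.numCells i ≤ K * (∏ i, S.numCells i + ∑ i, S.numVerts i) :=
    Nat.mul_le_mul_left _ (Nat.le_add_right _ _)
  have e2 : (2 ^ k + 10) * ∑ i, S.numVerts i ≤
      (2 ^ k + 10) * (∏ i, S.numCells i + ∑ i, S.numVerts i) :=
    Nat.mul_le_mul_left _ (Nat.le_add_left _ _)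
  have e3 : c₀ + 3000000 ≤ (c₀ + 3000000) * (∏ i, S.numCells i + ∑ i, S.numVerts i) :=
    Nat.le_mul_of_pos_right _ (by omega)
  have e4 : ∀ Q, (2 ^ k + 10 + c₀ + 2000000 * K + 3000000) * Q =
      (2 ^ k + 10) * Q + (c₀ + 3000000) * Q + 2000000 * (K * Q) := fun Q => by ring
  rw [e4]
  omega

end

namespace Program
section
variable {k : ℕ} (b : ℕ) (ox oj : Fin k → ℕ) (w : ℕ)

/-- Output the first `w` coordinates of the positions at one node of the path, and the indices of the
cells for the following piece of the path. -/
def collectStep : Program :=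
  seq (seq (loadI 79 (nm b 12 0) 76) <| seq (mv 81 76) <| seq (inc 81) <|
    seq (loadI 82 (nm b 12 0) 81) <| ifI 79 82 (mv 83 82) (mv 83 79)) <|
  seq (rep k fun i => seq (seq (loadI 84 (nm b 20 i) 83) <| seq (storeI (oj i) 76 84) (mv 85 77)) <|
    rep w fun c => seq (loadR 1 (nm b 20 (Nat.pair i c)) 79) <|
      seq (storeR (ox i) 85 1) (inc 85)) <|
  seq (setI 80 w) (addI 77 77 80)

/-- Output the first `w` coordinates of the positions along the path, and the indices of the cells
for each piece of the path. -/
def collect : Program :=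
  seq (seq (mv 78 29) (inc 78)) <| seq (setI 77 0) <| forI 76 78 (collectStep b ox oj w)

end
end Program

section
variable {d k e D b : ℕ} {ox oj : Fin k → ℕ} {w : ℕ}

theorem collectStep_spec {μ : Memory} {l : ℕ} (hox : ∀ i, ox i < b) (hoj : ∀ i, oj i < b)
    (hxi : Function.Injective ox) (hji : Function.Injective oj)
    (h76 : μ.ireg 76 = l) (h77 : μ.ireg 77 = l * w)
    {u u' : ℕ} (hu : μ.iarr (nm b 12 0) l = u) (hu' : μ.iarr (nm b 12 0) (l + 1) = u') :
    Run (collectStep b ox oj w) μ fun _ μ' => μ'.ireg 77 = (l + 1) * w ∧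
        ∀ i : Fin k, (∀ l', μ'.iarr (oj i) l' =
            if l' = l then μ.iarr (nm b 20 i) (max u u') else μ.iarr (oj i) l') ∧
          (∀ n < l * w, μ'.rarr (ox i) n = μ.rarr (ox i) n) ∧
          ∀ c < w, μ'.rarr (ox i) (l * w + c) = μ.rarr (nm b 20 (Nat.pair i c)) u := by
  have hne : ∀ {A t x}, A < b → nm b t x ≠ A := fun {A t x} h h' => by
    have := le_nm b t x
    omega
  have hstart : Run (seq (loadI 79 (nm b 12 0) 76) <| seq (mv 81 76) <| seq (inc 81) <|
        seq (loadI 82 (nm b 12 0) 81) <| ifI 79 82 (mv 83 82) (mv 83 79)) μ fun _ μ' =>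
      μ'.ireg 79 = u ∧ μ'.ireg 83 = max u u' := by
    refine Run.of_loopFree (by simp [mv]) fun _ _ => ?_
    rcases le_or_gt u u' with h | h
    · simp [mv, inc, h76, hu, hu', h]
    · simp [mv, inc, h76, hu, hu', h.le, not_le.2 h]
  refine Run.seq' hstart fun T1 μ1 hF1 ⟨h79, h83⟩ => ?_
  have i1 : μ1.iarr = μ.iarr := funext fun A => hF1.iarr A (by simp)
  have r1 : μ1.rarr = μ.rarr := funext fun A => hF1.rarr A (by simp)
  have h76' := (hF1.ireg 76 (by simp)).trans h76
  have h77' := (hF1.ireg 77 (by simp)).trans h77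
  refine Run.seq' (Run.rep (fun n _ μ' => ∀ i : Fin k,
      (i < n → (∀ l', μ'.iarr (oj i) l' =
            if l' = l then μ.iarr (nm b 20 i) (max u u') else μ.iarr (oj i) l') ∧
          (∀ n < l * w, μ'.rarr (ox i) n = μ.rarr (ox i) n) ∧
          ∀ c < w, μ'.rarr (ox i) (l * w + c) = μ.rarr (nm b 20 (Nat.pair i c)) u) ∧
      (n ≤ i → μ'.iarr (oj i) = μ.iarr (oj i) ∧ μ'.rarr (ox i) = μ.rarr (ox i)))
    (fun i => ⟨by simp, fun _ => ⟨by rw [i1], by rw [r1]⟩⟩) ?_) fun T2 μ2 hF2 hI => ?_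
  · rintro i T μ' hF hI
    have g76 : μ'.ireg 76 = l := by rw [hF.ireg _ (by simp)]; exact h76'
    have g77 : μ'.ireg 77 = l * w := by rw [hF.ireg _ (by simp)]; exact h77'
    have g79 : μ'.ireg 79 = u := by rw [hF.ireg _ (by simp)]; exact h79
    have g83 : μ'.ireg 83 = max u u' := by rw [hF.ireg _ (by simp)]; exact h83
    have gi : ∀ x, μ'.iarr (nm b 20 x) = μ.iarr (nm b 20 x) := fun x => by
      rw [hF.iarr _ (by simp [hne (hoj _)]), i1]
    have gr : ∀ x, μ'.rarr (nm b 20 x) = μ.rarr (nm b 20 x) := fun x => by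
      rw [hF.rarr _ (by simp [hne (hox _)]), r1]
    have hi0 := (hI i).2 le_rfl
    refine Run.seq (Run.of_loopFree (by simp [mv]) fun _ _ => ?_)
    refine (Run.rep (fun m _ μ'' => μ''.ireg 85 = l * w + m ∧
      (∀ n < l * w, μ''.rarr (ox i) n = μ.rarr (ox i) n) ∧
      ∀ c < m, μ''.rarr (ox i) (l * w + c) = μ.rarr (nm b 20 (Nat.pair i c)) u)
      ⟨by simp [mv, g77], by simp [mv, hi0.2], by simp⟩ ?_).mono ?_
    · rintro c T' μ'' hF' ⟨h85, f1, f2⟩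
      have e79 : μ''.ireg 79 = u := by
        rw [hF'.ireg _ (by simp)]; simpa [mv] using g79
      have er : ∀ x, μ''.rarr (nm b 20 x) = μ.rarr (nm b 20 x) := fun x => by
        rw [hF'.rarr _ (by simp [hne (hox _)])]; simpa [mv] using gr x
      refine Run.of_loopFree (by simp) fun _ _ => ⟨?_, fun n hn => ?_, fun c' hc' => ?_⟩
      · simp [inc, h85]; rfl
      · simpa [inc, h85, show n ≠ l * w + c by omega] using f1 n hn
      · rcases Nat.lt_succ_iff_lt_or_eq.1 hc' with h | rfl
        · simpa [inc, h85, h.ne] using f2 c' h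
        · simp [inc, h85, e79, er]
    · rintro T' μ'' hF' ⟨-, f1, f2⟩ i'
      have hj' : μ''.iarr = ((seq (loadI 84 (nm b 20 i) 83) <|
          seq (storeI (oj i) 76 84) (mv 85 77)).exec μ').iarr :=
        funext fun A => hF'.iarr A (by simp)
      have hx' : ∀ i', i' ≠ i → μ''.rarr (ox i') = μ'.rarr (ox i') := fun i' h => by
        rw [hF'.rarr _ (by simp [hxi.eq_iff, h])]; simp [mv]
      rw [hj']
      by_cases h : i' = i
      · subst h
        refine ⟨fun _ => ⟨fun l' => ?_, f1, f2⟩, fun h => by omega⟩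
        by_cases hl : l' = l
        · simp [mv, hl, g76, g83, gi]
        · simp [mv, hl, g76, hi0.1]
      · have h' : (i' : ℕ) ≠ i := Fin.val_ne_of_ne h
        have := hI i'
        rw [hx' i' h]
        simp only [mv, exec, Memory.iarr_setI]
        rw [Memory.iarr_stI_of_ne _ _ _ _ _ (fun h' => h (hji h'))]
        simp only [Memory.iarr_setI]
        exact ⟨fun h1 => this.1 (by omega), fun h1 => this.2 (by omega)⟩
  · have g77 : μ2.ireg 77 = l * w := by rw [hF2.ireg _ (by simp)]; exact h77'
    refine Run.of_loopFree (by simp) fun _ _ => ⟨by simp [g77]; ring, fun i => ?_⟩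
    simpa using (hI i).1 i.2

/-- The cell for a piece of the path is taken from the end with the larger number, which contains the
other one. -/
theorem collect_spec (hox : ∀ i, ox i < b) (hoj : ∀ i, oj i < b)
    (hxi : Function.Injective ox) (hji : Function.Injective oj) :
    ∃ C, ∀ μ : Memory, Run (collect b ox oj w) μ fun T μ' =>
      (∀ i : Fin k, (∀ l < μ.ireg 29, μ'.iarr (oj i) l =
          μ.iarr (nm b 20 i) (max (μ.iarr (nm b 12 0) l) (μ.iarr (nm b 12 0) (l + 1)))) ∧
        ∀ l ≤ μ.ireg 29, ∀ c < w, μ'.rarr (ox i) (l * w + c) =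
          μ.rarr (nm b 20 (Nat.pair i c)) (μ.iarr (nm b 12 0) l)) ∧
      T ≤ C * (μ.ireg 29 + 1) := by
  have hne : ∀ {A t x}, A < b → nm b t x ≠ A := fun {A t x} h h' => by
    have := le_nm b t x
    omega
  refine ⟨(collectStep b ox oj w).steps + 20, fun μ => ?_⟩
  refine Run.seq (Run.of_loopFree (by simp [mv]) fun T1 hT1 => ?_)
  refine Run.seq (Run.of_loopFree (by simp) fun T2 hT2 => ?_)
  simp only [steps, mv, inc] at hT1 hT2
  set μ0 := (setI 77 0).exec ((seq (mv 78 29) (inc 78)).exec μ) with hμ0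
  have h78 : μ0.ireg 78 = μ.ireg 29 + 1 := by simp [hμ0, mv, inc]
  have h77 : μ0.ireg 77 = 0 := by simp [hμ0]
  have hi0 : μ0.iarr = μ.iarr := by simp [hμ0, mv, inc]
  have hr0 : μ0.rarr = μ.rarr := by simp [hμ0, mv, inc]
  clear_value μ0
  refine (Run.forI (collectStep b ox oj w).steps (fun n μ' => μ'.ireg 77 = n * w ∧ ∀ i : Fin k,
      (∀ l < n, μ'.iarr (oj i) l =
          μ.iarr (nm b 20 i) (max (μ.iarr (nm b 12 0) l) (μ.iarr (nm b 12 0) (l + 1)))) ∧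
        ∀ l < n, ∀ c < w, μ'.rarr (ox i) (l * w + c) =
          μ.rarr (nm b 20 (Nat.pair i c)) (μ.iarr (nm b 12 0) l))
    (by simp) (by simp) (by simp) (by simp [collectStep]) (by simp [collectStep])
    ⟨by simp [h77], by simp⟩ ?_).mono ?_
  · rintro n μ' hn hF hi ⟨g77, hI⟩
    have gi : ∀ t x, μ'.iarr (nm b t x) = μ.iarr (nm b t x) := fun t x => by
      rw [hF.iarr _ (by simp [collectStep, hne (hoj _)]), hi0]
    have gr : ∀ t x, μ'.rarr (nm b t x) = μ.rarr (nm b t x) := fun t x => by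
      rw [hF.rarr _ (by simp [collectStep, hne (hox _)]), hr0]
    refine ((collectStep_spec hox hoj hxi hji hi g77 rfl rfl).time_le
      (by simp [collectStep, mv])).mono ?_
    rintro T μ'' - ⟨⟨e1, e2⟩, hT⟩
    refine ⟨⟨by simpa using e1, fun i => ?_⟩, hT⟩
    obtain ⟨e3, e4, e5⟩ := e2 i
    simp only [gi, gr] at e3 e5
    refine ⟨fun l hl => ?_, fun l hl c hc => ?_⟩
    · simp only [Memory.iarr_setI, e3]
      rcases Nat.lt_succ_iff_lt_or_eq.1 hl with h | rfl
      · rw [if_neg h.ne]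
        exact (hI i).1 l h
      · rw [if_pos rfl]
    · simp only [Memory.rarr_setI]
      rcases Nat.lt_succ_iff_lt_or_eq.1 hl with h | rfl
      · rw [e4 _ ?_]
        · exact (hI i).2 l h c hc
        · have := Nat.mul_le_mul_right w (Nat.succ_le_of_lt h)
          rw [Nat.succ_mul] at this
          omega
      · exact e5 c hc
  · rintro T μ' - ⟨⟨-, hI⟩, hT⟩
    rw [h78] at hI hT
    refine ⟨fun i => ⟨fun l hl => (hI i).1 l (by omega), fun l hl => (hI i).2 l (by omega)⟩, ?_⟩
    simp only [mv, Program.inc] at *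
    nlinarith

end

/-! ### Optimal motions -/

/-- The agents move along the polygonal curves with vertices `X 0 i, …, X L i`, the `l`-th piece in
cell number `J i l`, with the smallest possible leash length. Cells of consecutive pieces have a
common face that contains the common end point of the pieces. -/
structure OptimalMotion {d k e : ℕ} [NeZero k] (S : AgentSystem k e) (σ : Fin d → Fin e) (L : ℕ)
    (X : ℕ → Fin k → Pt e) (J : Fin k → ℕ → ℕ) : Prop where
  path : ∃ N : ℕ → Fin k → Finset ℕ, N 0 = S.srcNode ∧ N L = S.tgtNode ∧
    (∀ l ≤ L, ∀ i, X l i ∈ S.hull (N l) i) ∧ ∀ l < L, ∀ i, J i l < S.numCells i ∧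
      N l i ⊆ S.cell i (J i l) ∧ N (l + 1) i ⊆ S.cell i (J i l)
  leash : ∃ p, (∀ l ≤ L, ∀ i, dist (proj σ (X l 0)) (proj σ (X l i)) ≤ p) ∧
    ∀ θ, S.Reach σ θ S.srcNode S.tgtNode → S.weight σ S.srcNode ≤ θ → p ≤ θ

section
variable {d k e : ℕ} [NeZero k]

namespace OptimalMotion
variable {S : AgentSystem k e} {σ : Fin d → Fin e} {L : ℕ} {X : ℕ → Fin k → Pt e}
  {J : Fin k → ℕ → ℕ}

theorem start (h : OptimalMotion S σ L X J) (i : Fin k) : X 0 i = S.pos i (S.src i) := by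
  obtain ⟨N, h1, -, h2, -⟩ := h.path
  have := h2 0 (Nat.zero_le _) i
  simpa [AgentSystem.hull, h1, AgentSystem.srcNode] using this

theorem target (h : OptimalMotion S σ L X J) (i : Fin k) : X L i = S.pos i (S.tgt i) := by
  obtain ⟨N, -, h1, h2, -⟩ := h.path
  have := h2 L le_rfl i
  simpa [AgentSystem.hull, h1, AgentSystem.tgtNode] using this

theorem cell (h : OptimalMotion S σ L X J) {l : ℕ} (hl : l < L) (i : Fin k) :
    J i l < S.numCells i ∧ X l i ∈ convexHull ℝ (S.pos i '' S.cell i (J i l)) ∧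
      X (l + 1) i ∈ convexHull ℝ (S.pos i '' S.cell i (J i l)) := by
  obtain ⟨N, -, -, h1, h2⟩ := h.path
  obtain ⟨g1, g2, g3⟩ := h2 l hl i
  exact ⟨g1, convexHull_mono (Set.image_mono (Finset.coe_subset.2 g2)) (h1 l hl.le i),
    convexHull_mono (Set.image_mono (Finset.coe_subset.2 g3)) (h1 (l + 1) hl i)⟩

end OptimalMotion

/-- An optimal motion of a valid system of agents can be computed in time linear in the number of
product cells, provided that the end can be reached. -/
theorem plan_spec (σ : Fin d → Fin e) (D b w : ℕ) [NeZero D] (ly : Layout k) (hb : ly.Below b)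
    (hw : w ≤ e) {ox oj : Fin k → ℕ} (hox : ∀ i, ox i < b) (hoj : ∀ i, oj i < b)
    (hxi : Function.Injective ox) (hji : Function.Injective oj) :
    ∃ C, ∀ (S : AgentSystem k e) (μ : Memory), ly.Holds S D μ → S.Valid D →
      (∃ θ, S.Reach σ θ S.srcNode S.tgtNode) →
      Run (seq (solve σ b ly D) (collect b ox oj w)) μ fun T μ' => 0 < μ'.ireg 29 ∧
        T + μ'.ireg 29 ≤ C * (∏ i, S.numCells i + ∑ i, S.numVerts i) ∧
        ∃ X : ℕ → Fin k → Pt e,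
          (∀ i, ∀ l ≤ μ'.ireg 29, ∀ c : Fin w,
            μ'.rarr (ox i) (l * w + c) = X l i (Fin.castLE hw c)) ∧
          OptimalMotion S σ (μ'.ireg 29) X fun i => μ'.iarr (oj i) := by
  obtain ⟨C, hC⟩ := solve_spec σ D b ly hb
  obtain ⟨C', hC'⟩ := collect_spec (w := w) hox hoj hxi hji
  refine ⟨C + 2 * C' * (C + 1), fun S μ hly hS hr => ?_⟩
  refine Run.seq' (hC S μ hly hS hr) fun T μ1 hF1 ⟨hP, hT⟩ => ?_
  refine (hC' μ1).mono ?_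
  rintro T' μ2 hF2 ⟨h, hT'⟩
  have h29 : μ2.ireg 29 = μ1.ireg 29 := hF2.ireg _ (by simp [collect, collectStep])
  obtain ⟨p, hp, node, h1, h2, h3, h4⟩ := hP.path
  have hN : ∀ l ≤ μ1.ireg 29, S.IsNode (node l) := fun l hl => (h1 l hl).1.1
  have hB : ∀ l ≤ μ1.ireg 29, IsBest σ (S.hull (node l)) (S.best σ (node l)).1
      (S.weight σ (node l)) := fun l hl => (hN l hl).isBest hS
  rw [h29]
  refine ⟨hP.pos, ?_, fun l => (S.best σ (node l)).1, fun i l hl c => ?_, ?_, ?_⟩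
  · have h0 : 0 < ∏ i, S.numCells i := Finset.prod_pos fun i _ => by
      obtain ⟨j, hj, -⟩ := hS.isNode_src i
      omega
    have hQ : 1 ≤ ∏ i, S.numCells i + ∑ i, S.numVerts i := by omega
    generalize ∏ i, S.numCells i + ∑ i, S.numVerts i = Q at *
    have e1 : μ1.ireg 29 + 1 ≤ 2 * ((C + 1) * Q) := by nlinarith
    have e2 := Nat.mul_le_mul_left C' e1
    have e3 : (C + 2 * C' * (C + 1)) * Q = C * Q + C' * (2 * ((C + 1) * Q)) := by ring
    omega
  · rw [(h i).2 l hl c c.2]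
    exact ((hP.node _ _ (h1 l hl).1).2 i).2 (Fin.castLE hw c)
  · refine ⟨node, h2, h3, fun l hl i => (hB l hl).mem i, fun l hl i => ?_⟩
    obtain ⟨c, hc, g1, g2⟩ := h4 l hl
    obtain ⟨g3, g4⟩ := ((hP.node _ _ hc).2 i).1
    rw [← (h i).1 l hl] at g3 g4
    rw [g4]
    exact ⟨g3, g1 i, g2 i⟩
  · exact ⟨p, fun l hl i => ((hB l hl).dist_le i).trans (h1 l hl).2, hp⟩

end

/-! ### Polygonal curves -/

section
variable {V : Type*} [AddCommGroup V] [Module ℝ V]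

/-- Between consecutive breakpoints, the curve is the linear interpolation of the vertices. -/
theorem polyline_eq {m : ℕ} {τ : Fin (m + 1) → ℝ} (hτ : StrictMono τ) (p : Fin (m + 1) → V)
    (j : Fin m) {x : ℝ} (hx : x ∈ Set.Icc (τ j.castSucc) (τ j.succ)) :
    polyline τ p x = p j.castSucc +
      ((x - τ j.castSucc) / (τ j.succ - τ j.castSucc)) • (p j.succ - p j.castSucc) := by
  let g : ℕ → V := fun n => if h : n < m + 1 then p ⟨n, h⟩ else 0
  -- The sum telescopes when the curve is cut off at `x`.
  let G : ℕ → V := fun n => if n ≤ j then g n else g j +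
    ((x - τ j.castSucc) / (τ j.succ - τ j.castSucc)) • (p j.succ - p j.castSucc)
  have hgj : g j = p j.castSucc := by simp [g]; rfl
  have hterm : ∀ i : Fin m, max 0 (min 1 ((x - τ i.castSucc) / (τ i.succ - τ i.castSucc))) •
      (p i.succ - p i.castSucc) = G (i + 1) - G i := by
    intro i
    have hpos : ∀ i : Fin m, 0 < τ i.succ - τ i.castSucc := fun i =>
      sub_pos.2 (hτ i.castSucc_lt_succ)
    have hgi : g i = p i.castSucc := by simp [g]; rfl
    have hgi' : g (i + 1) = p i.succ := by simp [g]; rfl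
    rcases lt_trichotomy i j with h | rfl | h
    · have hle : τ i.succ ≤ τ j.castSucc := hτ.monotone (by
        rw [Fin.le_def]; simp; omega)
      have h1 : (i : ℕ) + 1 ≤ j := by omega
      have : 1 ≤ (x - τ i.castSucc) / (τ i.succ - τ i.castSucc) := by
        rw [le_div_iff₀ (hpos i)]
        linarith [hx.1]
      simp [G, h1, (by omega : (i : ℕ) ≤ j), hgi, hgi', min_eq_left this]
    · have h0 : 0 ≤ (x - τ i.castSucc) / (τ i.succ - τ i.castSucc) :=
        div_nonneg (by linarith [hx.1]) (hpos i).le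
      have h1 : (x - τ i.castSucc) / (τ i.succ - τ i.castSucc) ≤ 1 := by
        rw [div_le_one (hpos i)]
        linarith [hx.2]
      simp [G, min_eq_right h1, max_eq_right h0]
    · have hle : τ j.succ ≤ τ i.castSucc := hτ.monotone (by
        rw [Fin.le_def]; simp; omega)
      have h1 : (x - τ i.castSucc) / (τ i.succ - τ i.castSucc) ≤ 0 :=
        div_nonpos_of_nonpos_of_nonneg (by linarith [hx.2]) (hpos i).le
      simp [G, not_le.2 (show (j : ℕ) < i from h), show ¬ (i : ℕ) + 1 ≤ j by omega,
        max_eq_left ((min_le_right _ _).trans h1)]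
  rw [polyline, Finset.sum_congr rfl fun i _ => hterm i,
    Fin.sum_univ_eq_sum_range (fun n => G (n + 1) - G n), Finset.sum_range_sub]
  have h0 : g 0 = p 0 := by simp [g]
  have hm : ¬ m ≤ (j : ℕ) := by omega
  simp [G, hm, hgj, h0]

theorem uniformPolyline_eq {L : ℕ} (p : ℕ → V) {l : ℕ} (hl : l < L) {x : ℝ}
    (hx : x ∈ Set.Icc ((l : ℝ) / L) (((l : ℝ) + 1) / L)) :
    uniformPolyline L p x = (1 - (L * x - l)) • p l + (L * x - l) • p (l + 1) := by
  have hL : (0 : ℝ) < L := by exact_mod_cast (Nat.zero_le l).trans_lt hl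
  have hτ : StrictMono fun l : Fin (L + 1) => ((l : ℕ) : ℝ) / L := fun a b hab => by
    have : ((a : ℕ) : ℝ) < (b : ℕ) := by exact_mod_cast hab
    dsimp only
    gcongr
  rw [uniformPolyline, polyline_eq hτ _ ⟨l, hl⟩ (by simpa using hx)]
  have : (x - (l : ℝ) / L) / (((l : ℝ) + 1) / L - l / L) = L * x - l := by
    field_simp
    ring
  simp only [Fin.castSucc_mk, Fin.succ_mk, Nat.cast_add, Nat.cast_one, this]
  module

theorem exists_piece {L : ℕ} (hL : 0 < L) {x : ℝ} (hx : x ∈ Set.Icc (0 : ℝ) 1) :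
    ∃ l < L, x ∈ Set.Icc ((l : ℝ) / L) (((l : ℝ) + 1) / L) := by
  have hL' : (0 : ℝ) < L := by exact_mod_cast hL
  by_cases h : x = 1
  · refine ⟨L - 1, by omega, ?_⟩
    rw [Nat.cast_sub hL, h]
    constructor
    · rw [div_le_one hL']; simp
    · simp [hL'.ne']
  · have hx1 : x < 1 := lt_of_le_of_ne hx.2 h
    have h0 : 0 ≤ L * x := mul_nonneg hL'.le hx.1
    refine ⟨⌊L * x⌋₊, ?_, ?_, ?_⟩
    · rw [Nat.floor_lt h0]
      nlinarith
    · rw [div_le_iff₀ hL', mul_comm x]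
      exact Nat.floor_le h0
    · rw [le_div_iff₀ hL', mul_comm x]
      exact (Nat.lt_floor_add_one _).le

theorem piece_coeff {L l : ℕ} (hl : l < L) {x : ℝ}
    (hx : x ∈ Set.Icc ((l : ℝ) / L) (((l : ℝ) + 1) / L)) : L * x - l ∈ Set.Icc (0 : ℝ) 1 := by
  have hL : (0 : ℝ) < L := by exact_mod_cast (Nat.zero_le l).trans_lt hl
  obtain ⟨h1, h2⟩ := hx
  rw [div_le_iff₀ hL] at h1
  rw [le_div_iff₀ hL] at h2
  constructor <;> linarith

theorem uniformPolyline_zero {L : ℕ} (hL : 0 < L) (p : ℕ → V) : uniformPolyline L p 0 = p 0 := by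
  rw [uniformPolyline_eq p hL ⟨by simp, by positivity⟩]
  simp

theorem uniformPolyline_one {L : ℕ} (hL : 0 < L) (p : ℕ → V) : uniformPolyline L p 1 = p L := by
  have hL' : (0 : ℝ) < L := by exact_mod_cast hL
  rw [uniformPolyline_eq p (show L - 1 < L by omega)]
  · rw [Nat.cast_sub hL, Nat.sub_add_cancel hL]
    simp
  · rw [Nat.cast_sub hL]
    constructor
    · rw [div_le_one hL']; simp
    · simp [hL'.ne']

/-- A polygonal curve stays in a convex set that contains the end points of the piece. -/
theorem uniformPolyline_mem {L : ℕ} (p : ℕ → V) {l : ℕ} (hl : l < L) {x : ℝ}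
    (hx : x ∈ Set.Icc ((l : ℝ) / L) (((l : ℝ) + 1) / L)) {s : Set V} (hs : Convex ℝ s)
    (h1 : p l ∈ s) (h2 : p (l + 1) ∈ s) : uniformPolyline L p x ∈ s := by
  rw [uniformPolyline_eq p hl hx]
  have := piece_coeff hl hx
  exact hs h1 h2 (by linarith [this.2]) this.1 (by ring)

theorem map_uniformPolyline {V' : Type*} [AddCommGroup V'] [Module ℝ V'] (f : V →ₗ[ℝ] V') (L : ℕ)
    (p : ℕ → V) (x : ℝ) : f (uniformPolyline L p x) = uniformPolyline L (fun l => f (p l)) x := by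
  simp [uniformPolyline, polyline]

theorem uniformPolyline_congr {L : ℕ} {p q : ℕ → V} (h : ∀ l ≤ L, p l = q l) (x : ℝ) :
    uniformPolyline L p x = uniformPolyline L q x := by
  unfold uniformPolyline
  congr 1
  funext l
  exact h l (Nat.lt_succ_iff.1 l.2)

end

theorem continuous_polyline {V : Type*} [NormedAddCommGroup V] [NormedSpace ℝ V] {m : ℕ}
    (τ : Fin (m + 1) → ℝ) (p : Fin (m + 1) → V) : Continuous (polyline τ p) := by
  unfold polyline
  fun_prop

theorem continuous_uniformPolyline {V : Type*} [NormedAddCommGroup V] [NormedSpace ℝ V] (L : ℕ)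
    (p : ℕ → V) : Continuous (uniformPolyline L p) := by
  unfold uniformPolyline
  exact continuous_polyline _ _

theorem isReparam_uniformPolyline {L : ℕ} (hL : 0 < L) {p : ℕ → ℝ} (h0 : p 0 = 0) (h1 : p L = 1)
    (h : ∀ l ≤ L, p l ∈ Set.Icc (0 : ℝ) 1) : IsReparam (uniformPolyline L p) where
  continuousOn := (continuous_uniformPolyline L p).continuousOn
  mapsTo x hx := by
    obtain ⟨l, hl, hx⟩ := exists_piece hL hx
    exact uniformPolyline_mem p hl hx (convex_Icc 0 1) (h l hl.le) (h (l + 1) hl)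
  zero := by rw [uniformPolyline_zero hL, h0]
  one := by rw [uniformPolyline_one hL, h1]

/-- By compactness, the leash length is attained, and it inherits upper bounds. -/
theorem exists_isLeashLength {k d : ℕ} [NeZero k] {γ : Fin k → ℝ → Pt d} {p : ℝ}
    (hc : ∀ i, ContinuousOn (γ i) (Set.Icc 0 1))
    (hp : ∀ t ∈ Set.Icc (0 : ℝ) 1, ∀ i, dist (γ 0 t) (γ i t) ≤ p) :
    ∃ δ ≤ p, IsLeashLength γ δ := by
  have hS : {r : ℝ | ∃ t ∈ Set.Icc (0 : ℝ) 1, ∃ i : Fin k, r = dist (γ 0 t) (γ i t)} =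
      ⋃ i, (fun t => dist (γ 0 t) (γ i t)) '' Set.Icc 0 1 := by
    ext r
    simp only [Set.mem_ofPred_eq, Set.mem_iUnion, Set.mem_image]
    constructor
    · rintro ⟨t, ht, i, rfl⟩
      exact ⟨i, t, ht, rfl⟩
    · rintro ⟨i, t, ht, rfl⟩
      exact ⟨t, ht, i, rfl⟩
  have hK : IsCompact {r : ℝ | ∃ t ∈ Set.Icc (0 : ℝ) 1, ∃ i : Fin k, r = dist (γ 0 t) (γ i t)} := by
    rw [hS]
    exact isCompact_iUnion fun i => isCompact_Icc.image_of_continuousOn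
      (continuous_dist.comp_continuousOn ((hc 0).prodMk (hc i)))
  obtain ⟨δ, hδ⟩ := hK.exists_isGreatest ⟨_, 0, by simp, 0, rfl⟩
  refine ⟨δ, ?_, hδ⟩
  obtain ⟨t, ht, i, rfl⟩ := hδ.1
  exact hp t ht i

/-- Between the vertices, the distances are at most those at the vertices. -/
theorem dist_uniformPolyline_le {d L : ℕ} {u v : ℕ → Pt d} {p : ℝ}
    (h : ∀ l ≤ L, dist (u l) (v l) ≤ p) (hL : 0 < L) {t : ℝ} (ht : t ∈ Set.Icc (0 : ℝ) 1) :
    dist (uniformPolyline L u t) (uniformPolyline L v t) ≤ p := by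
  obtain ⟨l, hl, hx⟩ := exists_piece hL ht
  rw [uniformPolyline_eq u hl hx, uniformPolyline_eq v hl hx]
  have := piece_coeff hl hx
  exact dist_combination_le (by linarith [this.2]) this.1 (by ring) (h l hl.le) (h (l + 1) hl)

/-! ### Polygonal curves as systems of agents -/

namespace PolygonalCurve
variable {d : ℕ} (P : PolygonalCurve d)

/-- The vertices of the graph of the curve, in `ℝ^(d + 1)`. -/
noncomputable def graphVertex (v : ℕ) : Pt (d + 1) :=
  if h : v < P.edges + 1 then WithLp.toLp 2 (Fin.cons (P.time ⟨v, h⟩) (P.vertex ⟨v, h⟩)) else 0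

/-- The point of the graph of the curve at time `x`. -/
noncomputable def graphPoint (x : ℝ) : Pt (d + 1) := WithLp.toLp 2 (Fin.cons x (P.curve x))

/-- The vertices of the vertex or edge of the curve that contains time `x` in its relative interior:
no breakpoint separates them from `x`. -/
noncomputable def cellAt (x : ℝ) : Finset ℕ :=
  {v : Fin (P.edges + 1) | ∀ w, ¬ (P.time v < P.time w ∧ P.time w ≤ x) ∧
    ¬ (x ≤ P.time w ∧ P.time w < P.time v)}.toFinset.map Fin.valEmbedding

variable {P}

theorem graphVertex_eq (v : Fin (P.edges + 1)) :
    P.graphVertex v = WithLp.toLp 2 (Fin.cons (P.time v) (P.vertex v)) := by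
  rw [graphVertex, dif_pos v.2]

theorem curve_edge (j : Fin P.edges) {s : ℝ} (hs : s ∈ Set.Icc (0 : ℝ) 1) :
    P.curve (P.time j.castSucc + s * (P.time j.succ - P.time j.castSucc)) =
      P.vertex j.castSucc + s • (P.vertex j.succ - P.vertex j.castSucc) := by
  have h : 0 < P.time j.succ - P.time j.castSucc :=
    sub_pos.2 (P.time_strictMono j.castSucc_lt_succ)
  rw [curve, polyline_eq P.time_strictMono _ j]
  · rw [add_sub_cancel_left, mul_div_cancel_right₀ _ h.ne']
  · constructor <;> nlinarith [hs.1, hs.2]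

theorem curve_time (v : Fin (P.edges + 1)) : P.curve (P.time v) = P.vertex v := by
  induction v using Fin.cases with
  | zero =>
    have := curve_edge (P := P) ⟨0, P.edges_pos⟩ (s := 0) (by simp)
    simpa using this
  | succ j =>
    have := curve_edge (P := P) j (s := 1) (by simp)
    simpa using this

theorem graphPoint_edge (j : Fin P.edges) {s : ℝ} (hs : s ∈ Set.Icc (0 : ℝ) 1) :
    P.graphPoint (P.time j.castSucc + s * (P.time j.succ - P.time j.castSucc)) =
      (1 - s) • P.graphVertex j + s • P.graphVertex (j + 1) := by
  have h1 := graphVertex_eq j.castSucc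
  have h2 := graphVertex_eq j.succ
  simp only [Fin.val_castSucc, Fin.val_succ] at h1 h2
  rw [h1, h2, graphPoint, curve_edge j hs]
  ext c
  induction c using Fin.cases with
  | zero => simp; ring
  | succ c => simp; ring

theorem graphPoint_time (v : Fin (P.edges + 1)) : P.graphPoint (P.time v) = P.graphVertex v := by
  rw [graphPoint, curve_time, graphVertex_eq]

theorem mem_cellAt {x : ℝ} {v : ℕ} : v ∈ P.cellAt x ↔ ∃ h : v < P.edges + 1, ∀ w,
    ¬ (P.time ⟨v, h⟩ < P.time w ∧ P.time w ≤ x) ∧ ¬ (x ≤ P.time w ∧ P.time w < P.time ⟨v, h⟩) := by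
  simp only [cellAt, Finset.mem_map, Set.mem_toFinset, Set.mem_ofPred_eq, Fin.valEmbedding_apply]
  constructor
  · rintro ⟨v, hv, rfl⟩
    exact ⟨v.2, hv⟩
  · rintro ⟨h, hv⟩
    exact ⟨⟨v, h⟩, hv, rfl⟩

theorem cellAt_time (v : Fin (P.edges + 1)) : P.cellAt (P.time v) = {(v : ℕ)} := by
  ext w
  rw [mem_cellAt, Finset.mem_singleton]
  constructor
  · rintro ⟨h, hw⟩
    by_contra hne
    have h1 : P.time ⟨w, h⟩ ≠ P.time v := fun h' =>
      hne (congrArg Fin.val (P.time_strictMono.injective h'))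
    rcases lt_or_gt_of_ne h1 with h2 | h2
    · exact (hw v).1 ⟨h2, le_rfl⟩
    · exact (hw v).2 ⟨le_rfl, h2⟩
  · rintro rfl
    exact ⟨v.2, fun w => ⟨fun h => absurd h.1 (not_lt.2 h.2), fun h => absurd h.2 (not_lt.2 h.1)⟩⟩

theorem cellAt_edge (j : Fin P.edges) {x : ℝ} (h1 : P.time j.castSucc < x)
    (h2 : x < P.time j.succ) : P.cellAt x = {(j : ℕ), (j : ℕ) + 1} := by
  have mono := P.time_strictMono
  ext v
  rw [mem_cellAt, Finset.mem_insert, Finset.mem_singleton]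
  constructor
  · rintro ⟨h, hv⟩
    by_contra hne
    rcases lt_or_gt_of_ne (show v ≠ j by omega) with h3 | h3
    · exact (hv j.castSucc).1 ⟨mono h3, h1.le⟩
    · exact (hv j.succ).2 ⟨h2.le, mono (by rw [Fin.lt_def]; simp; omega)⟩
  · intro hv
    have key : ∀ w : Fin (P.edges + 1), (w ≤ j.castSucc ∧ P.time w ≤ P.time j.castSucc) ∨
        (j.succ ≤ w ∧ P.time j.succ ≤ P.time w) := by
      intro w
      rcases le_or_gt w j.castSucc with h | h
      · exact .inl ⟨h, mono.monotone h⟩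
      · exact .inr ⟨h, mono.monotone h⟩
    have hv' : ∃ h : v < P.edges + 1, (⟨v, h⟩ : Fin (P.edges + 1)) = j.castSucc ∨
        (⟨v, h⟩ : Fin (P.edges + 1)) = j.succ := by
      rcases hv with rfl | rfl
      · exact ⟨by omega, .inl rfl⟩
      · exact ⟨by omega, .inr rfl⟩
    obtain ⟨h, hv'⟩ := hv'
    refine ⟨h, fun w => ⟨fun hw => ?_, fun hw => ?_⟩⟩
    · rcases hv' with h' | h' <;> rw [h'] at hw <;> rcases key w with h3 | h3 <;>
        linarith [hw.1, hw.2, h3.2]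
    · rcases hv' with h' | h' <;> rw [h'] at hw <;> rcases key w with h3 | h3 <;>
        linarith [hw.1, hw.2, h3.2]

theorem time_or_edge {x : ℝ} (hx : x ∈ Set.Icc (0 : ℝ) 1) :
    (∃ v, x = P.time v) ∨ ∃ j : Fin P.edges, P.time j.castSucc < x ∧ x < P.time j.succ := by
  obtain ⟨v, hv, hmax⟩ := Finset.exists_max_image
    (Finset.univ.filter fun v => P.time v ≤ x) id ⟨0, by simp [P.time_zero, hx.1]⟩
  simp only [Finset.mem_filter, Finset.mem_univ, true_and, id] at hv hmax
  rcases hv.eq_or_lt with h | h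
  · exact .inl ⟨v, h.symm⟩
  · refine .inr ?_
    induction v using Fin.lastCases with
    | last => rw [P.time_last] at h; exact absurd hx.2 (not_le.2 h)
    | cast j =>
      refine ⟨j, h, ?_⟩
      by_contra h'
      exact absurd (hmax _ (not_lt.1 h')) (not_le.2 j.castSucc_lt_succ)

/-- Near a point in time, the curve is in a cell that contains the cell at that time. -/
theorem eventually_cellAt_subset (x : ℝ) : ∀ᶠ y in nhds x, P.cellAt x ⊆ P.cellAt y := by
  have key : ∀ v w : Fin (P.edges + 1), (¬ (P.time v < P.time w ∧ P.time w ≤ x) ∧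
      ¬ (x ≤ P.time w ∧ P.time w < P.time v)) → ∀ᶠ y in nhds x,
      ¬ (P.time v < P.time w ∧ P.time w ≤ y) ∧ ¬ (y ≤ P.time w ∧ P.time w < P.time v) := by
    rintro v w ⟨h1, h2⟩
    refine .and ?_ ?_
    · by_cases h : P.time v < P.time w
      · filter_upwards [gt_mem_nhds (not_le.1 fun h' => h1 ⟨h, h'⟩)] with y hy h'
        exact absurd h'.2 (not_le.2 hy)
      · exact .of_forall fun y h' => h h'.1
    · by_cases h : P.time w < P.time v
      · filter_upwards [lt_mem_nhds (not_le.1 fun h' => h2 ⟨h', h⟩)] with y hy h'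
        exact absurd h'.1 (not_le.2 hy)
      · exact .of_forall fun y h' => h h'.2
  have : ∀ v w : Fin (P.edges + 1), ∀ᶠ y in nhds x, (¬ (P.time v < P.time w ∧ P.time w ≤ x) ∧
      ¬ (x ≤ P.time w ∧ P.time w < P.time v)) → ¬ (P.time v < P.time w ∧ P.time w ≤ y) ∧
      ¬ (y ≤ P.time w ∧ P.time w < P.time v) := by
    intro v w
    by_cases h : ¬ (P.time v < P.time w ∧ P.time w ≤ x) ∧ ¬ (x ≤ P.time w ∧ P.time w < P.time v)
    · exact (key v w h).mono fun _ h _ => h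
    · exact .of_forall fun _ h' => absurd h' h
  filter_upwards [Filter.eventually_all.2 fun v => Filter.eventually_all.2 (this v)] with y hy v hv
  obtain ⟨h, hv⟩ := mem_cellAt.1 hv
  exact mem_cellAt.2 ⟨h, fun w => hy _ w (hv w)⟩

/-- At each point in time, the graph is in the convex hull of the corresponding cell. -/
theorem graphPoint_mem {x : ℝ} (hx : x ∈ Set.Icc (0 : ℝ) 1) :
    P.graphPoint x ∈ convexHull ℝ (P.graphVertex '' P.cellAt x) := by
  rcases time_or_edge (P := P) hx with ⟨v, rfl⟩ | ⟨j, h1, h2⟩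
  · rw [cellAt_time, graphPoint_time]
    simp
  · have h : 0 < P.time j.succ - P.time j.castSucc := by linarith
    have hs : (x - P.time j.castSucc) / (P.time j.succ - P.time j.castSucc) ∈
        Set.Icc (0 : ℝ) 1 := ⟨div_nonneg (by linarith) h.le, by rw [div_le_one h]; linarith⟩
    have hp := graphPoint_edge j hs
    rw [div_mul_cancel₀ _ h.ne', add_sub_cancel] at hp
    rw [hp, cellAt_edge j h1 h2]
    refine convex_convexHull ℝ _ (subset_convexHull ℝ _ (Set.mem_image_of_mem _ (by simp)))
      (subset_convexHull ℝ _ (Set.mem_image_of_mem _ (by simp))) (by linarith [hs.2]) hs.1 (by ring)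

end PolygonalCurve

section
variable {k d : ℕ}

/-- The cells of the `i`-th agent are the vertices (with even numbers) and the edges (with odd
numbers) of the graph of the `i`-th curve. -/
noncomputable def curveSystem (P : Fin k → PolygonalCurve d) : AgentSystem k (d + 1) where
  numCells i := 2 * (P i).edges + 1
  numVerts i := (P i).edges + 1
  len _ j := 1 + j % 2
  idx _ j a := j / 2 + a
  pos i := (P i).graphVertex
  src _ := 0
  tgt i := (P i).edges

variable {P : Fin k → PolygonalCurve d}

theorem curveSystem_cell_vertex (i : Fin k) (v : ℕ) : (curveSystem P).cell i (2 * v) = {v} := by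
  simp [AgentSystem.cell, curveSystem]

theorem curveSystem_cell_edge (i : Fin k) (v : ℕ) :
    (curveSystem P).cell i (2 * v + 1) = {v, v + 1} := by
  have h1 : (2 * v + 1) / 2 = v := by omega
  simp [AgentSystem.cell, curveSystem, h1, Finset.range_add_one, Finset.pair_comm]

theorem curveSystem_valid : (curveSystem P).Valid 2 where
  len_pos i j _ := by simp [curveSystem]
  len_le i j _ := by simp only [curveSystem]; omega
  idx_inj i j _ a _ b _ h := by simpa [curveSystem] using h
  idx_lt i j hj a ha := by simp only [curveSystem] at *; omega
  exists_face i j hj U hU hne := by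
    simp only [curveSystem] at hj
    rcases Nat.even_or_odd' j with ⟨v, rfl | rfl⟩
    · rw [curveSystem_cell_vertex, Finset.subset_singleton_iff] at hU
      exact ⟨2 * v, hj, by rw [curveSystem_cell_vertex, hU.resolve_left hne.ne_empty]⟩
    · rw [curveSystem_cell_edge, ← Finset.coe_subset, Finset.coe_pair,
        Set.subset_pair_iff_eq] at hU
      norm_cast at hU
      rcases hU with rfl | rfl | rfl | rfl
      · simp at hne
      · exact ⟨2 * v, by simp only [curveSystem]; omega, curveSystem_cell_vertex _ _⟩
      · exact ⟨2 * (v + 1), by simp only [curveSystem]; omega, curveSystem_cell_vertex _ _⟩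
      · exact ⟨2 * v + 1, hj, curveSystem_cell_edge _ _⟩
  isNode_src i := ⟨2 * 0, by simp [curveSystem], curveSystem_cell_vertex _ _⟩
  isNode_tgt i := ⟨2 * (P i).edges, by simp [curveSystem], curveSystem_cell_vertex _ _⟩

theorem curveSystem_isNode {x : Fin k → ℝ} (hx : ∀ i, x i ∈ Set.Icc (0 : ℝ) 1) :
    (curveSystem P).IsNode fun i => (P i).cellAt (x i) := by
  intro i
  rcases PolygonalCurve.time_or_edge (P := P i) (hx i) with ⟨v, hv⟩ | ⟨j, h1, h2⟩
  · exact ⟨2 * v, by simp only [curveSystem]; omega,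
      by simp only [hv, PolygonalCurve.cellAt_time, curveSystem_cell_vertex]⟩
  · exact ⟨2 * j + 1, by simp only [curveSystem]; omega,
      by simp only [PolygonalCurve.cellAt_edge j h1 h2, curveSystem_cell_edge]⟩

theorem proj_graphPoint (P : PolygonalCurve d) (x : ℝ) :
    proj Fin.succ (P.graphPoint x) = P.curve x := by
  ext c
  simp [PolygonalCurve.graphPoint]

/-- The points of the cells are points of the graph of the curve. -/
theorem curveSystem_mem_cell {i : Fin k} {j : ℕ} (hj : j < (curveSystem P).numCells i)
    {y : Pt (d + 1)}
    (hy : y ∈ convexHull ℝ ((curveSystem P).pos i '' (curveSystem P).cell i j)) :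
    y 0 ∈ Set.Icc (0 : ℝ) 1 ∧ y = (P i).graphPoint (y 0) := by
  have hI : ∀ v, (P i).time v ∈ Set.Icc (0 : ℝ) 1 := fun v => by
    rw [← (P i).time_zero, ← (P i).time_last]
    exact ⟨(P i).time_strictMono.monotone (Fin.zero_le v),
      (P i).time_strictMono.monotone (Fin.le_last v)⟩
  have h0 : ∀ v : Fin ((P i).edges + 1), (P i).graphVertex v 0 = (P i).time v := fun v => by
    rw [PolygonalCurve.graphVertex_eq]; simp
  simp only [curveSystem] at hj
  change y ∈ convexHull ℝ ((P i).graphVertex '' _) at hy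
  rcases Nat.even_or_odd' j with ⟨v, rfl | rfl⟩
  · rw [curveSystem_cell_vertex] at hy
    simp only [Finset.coe_singleton, Set.image_singleton, convexHull_singleton,
      Set.mem_singleton_iff] at hy
    have := h0 ⟨v, by omega⟩
    have h' := PolygonalCurve.graphPoint_time (P := P i) ⟨v, by omega⟩
    simp only at this h'
    rw [hy, this]
    exact ⟨hI _, h'.symm⟩
  · have hv : v < (P i).edges := by omega
    rw [curveSystem_cell_edge] at hy
    simp only [Finset.coe_insert, Finset.coe_singleton, Set.image_insert_eq, Set.image_singleton,
      convexHull_pair] at hy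
    rw [segment_eq_image] at hy
    obtain ⟨s, hs, rfl⟩ := hy
    have h1 := h0 (Fin.castSucc ⟨v, hv⟩)
    have h2 := h0 (Fin.succ ⟨v, hv⟩)
    simp only [Fin.val_castSucc, Fin.val_succ] at h1 h2
    have he : ((1 - s) • (P i).graphVertex v + s • (P i).graphVertex (v + 1)) 0 =
        (P i).time (Fin.castSucc ⟨v, hv⟩) +
          s * ((P i).time (Fin.succ ⟨v, hv⟩) - (P i).time (Fin.castSucc ⟨v, hv⟩)) := by
      simp [h1, h2]; ring
    simp only [he]
    refine ⟨?_, (PolygonalCurve.graphPoint_edge ⟨v, hv⟩ hs).symm⟩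
    have := convex_Icc (0 : ℝ) 1 (hI (Fin.castSucc ⟨v, hv⟩)) (hI (Fin.succ ⟨v, hv⟩))
      (by linarith [hs.2] : 0 ≤ 1 - s) hs.1 (by ring)
    convert this using 1
    simp only [smul_eq_mul]
    ring

variable [NeZero k]

/-- Reparameterizations of leash length `δ` give rise to a chain of product cells of weight at most
`δ`. -/
theorem curveSystem_reach {ρ : Fin k → ℝ → ℝ} (hρ : ∀ i, IsReparam (ρ i)) {δ : ℝ}
    (hδ : IsLeashLength (fun i t => (P i).curve (ρ i t)) δ) :
    (curveSystem P).Reach Fin.succ δ (curveSystem P).srcNode (curveSystem P).tgtNode ∧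
      (curveSystem P).weight Fin.succ (curveSystem P).srcNode ≤ δ := by
  have hmem : ∀ t ∈ Set.Icc (0 : ℝ) 1, ∀ i, ρ i t ∈ Set.Icc (0 : ℝ) 1 :=
    fun t ht i => (hρ i).mapsTo ht
  have hn : ∀ t ∈ Set.Icc (0 : ℝ) 1, (curveSystem P).IsNode fun i => (P i).cellAt (ρ i t) :=
    fun t ht => curveSystem_isNode (hmem t ht)
  have hw : ∀ t ∈ Set.Icc (0 : ℝ) 1,
      (curveSystem P).weight Fin.succ (fun i => (P i).cellAt (ρ i t)) ≤ δ := by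
    intro t ht
    refine (hn t ht).weight_le curveSystem_valid (x := fun i => (P i).graphPoint (ρ i t))
      (fun i => PolygonalCurve.graphPoint_mem (hmem t ht i)) fun i => ?_
    rw [proj_graphPoint, proj_graphPoint]
    exact hδ.2 ⟨t, ht, i, rfl⟩
  have h := AgentSystem.Reach.of_motion curveSystem_valid hn hw fun t ht =>
    Filter.eventually_all.2 fun i =>
      ((hρ i).continuousOn t ht).eventually (PolygonalCurve.eventually_cellAt_subset _)
  have h0 : (fun i => (P i).cellAt (ρ i 0)) = (curveSystem P).srcNode := funext fun i => by
    rw [(hρ i).zero, ← (P i).time_zero, PolygonalCurve.cellAt_time]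
    rfl
  have h1 : (fun i => (P i).cellAt (ρ i 1)) = (curveSystem P).tgtNode := funext fun i => by
    rw [(hρ i).one, ← (P i).time_last, PolygonalCurve.cellAt_time]
    rfl
  rw [h0, h1] at h
  exact ⟨h, h0 ▸ hw 0 (by simp)⟩

theorem isReparam_id : IsReparam fun t => t :=
  ⟨continuousOn_id, fun _ h => h, rfl, rfl⟩

/-- The end can be reached, as the curves themselves are an admissible motion. -/
theorem curveSystem_exists_reach : ∃ θ, (curveSystem P).Reach Fin.succ θ (curveSystem P).srcNode
    (curveSystem P).tgtNode := by
  obtain ⟨b, hb⟩ : ∃ b, ∀ t ∈ Set.Icc (0 : ℝ) 1, ∀ i,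
      dist ((P 0).curve t) ((P i).curve t) ≤ b := by
    choose b hb using fun i => isCompact_Icc.exists_bound_of_continuousOn
      (f := fun t => dist ((P 0).curve t) ((P i).curve t))
      (((continuous_polyline _ _).dist (continuous_polyline _ _)).continuousOn :
        ContinuousOn _ (Set.Icc (0 : ℝ) 1))
    refine ⟨∑ i, |b i|, fun t ht i => ?_⟩
    refine (Real.le_norm_self _).trans ((hb i t ht).trans ((le_abs_self _).trans ?_))
    exact Finset.single_le_sum (f := fun i => |b i|) (fun _ _ => abs_nonneg _) (Finset.mem_univ i)
  obtain ⟨δ, -, hδ⟩ := exists_isLeashLength (γ := fun i => (P i).curve)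
    (fun i => (continuous_polyline _ _).continuousOn) hb
  exact ⟨δ, (curveSystem_reach (fun _ => isReparam_id) hδ).1⟩

/-- The times of an optimal motion on the graphs of the curves form an optimal
reparameterization. -/
theorem OptimalMotion.areOptimalReparams {L : ℕ} (hL : 0 < L) {X : ℕ → Fin k → Pt (d + 1)}
    {J : Fin k → ℕ → ℕ} (h : OptimalMotion (curveSystem P) Fin.succ L X J)
    {ρ : Fin k → ℕ → ℝ} (hρ : ∀ i, ∀ l ≤ L, ρ i l = X l i 0) :
    AreOptimalReparams P fun i => uniformPolyline L (ρ i) := by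
  have h0 : ∀ i, X 0 i 0 = 0 := fun i => by
    have : X 0 i = (P i).graphVertex (0 : Fin ((P i).edges + 1)) := h.start i
    rw [this, PolygonalCurve.graphVertex_eq]
    simpa using (P i).time_zero
  have h1 : ∀ i, X L i 0 = 1 := fun i => by
    have : X L i = (P i).graphVertex (Fin.last (P i).edges) := h.target i
    rw [this, PolygonalCurve.graphVertex_eq]
    simpa using (P i).time_last
  have hI : ∀ i, ∀ l ≤ L, X l i 0 ∈ Set.Icc (0 : ℝ) 1 := by
    intro i l hl
    rcases hl.lt_or_eq with hl | rfl
    · obtain ⟨g1, g2, -⟩ := h.cell hl i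
      exact (curveSystem_mem_cell g1 g2).1
    · simp [h1]
  have hrep : ∀ i, IsReparam (uniformPolyline L (ρ i)) := fun i =>
    isReparam_uniformPolyline hL ((hρ i 0 (Nat.zero_le _)).trans (h0 i))
      ((hρ i L le_rfl).trans (h1 i)) fun l hl => hρ i l hl ▸ hI i l hl
  have hcurve : ∀ i, ∀ t ∈ Set.Icc (0 : ℝ) 1, (P i).curve (uniformPolyline L (ρ i) t) =
      uniformPolyline L (fun l => proj Fin.succ (X l i)) t := by
    intro i t ht
    obtain ⟨l, hl, hx⟩ := exists_piece hL ht
    obtain ⟨g1, g2, g3⟩ := h.cell hl i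
    have hm := uniformPolyline_mem (fun l => X l i) hl hx (convex_convexHull ℝ _) g2 g3
    have he := (curveSystem_mem_cell g1 hm).2
    have hz : uniformPolyline L (fun l => X l i) t 0 = uniformPolyline L (ρ i) t := by
      rw [uniformPolyline_congr (hρ i)]
      exact map_uniformPolyline (EuclideanSpace.projₗ (𝕜 := ℝ) (0 : Fin (d + 1))) L (fun l => X l i) t
    rw [← map_uniformPolyline, he, proj_graphPoint, hz]
  obtain ⟨p, hp, hmin⟩ := h.leash
  have hdist : ∀ t ∈ Set.Icc (0 : ℝ) 1, ∀ i, dist ((P 0).curve (uniformPolyline L (ρ 0) t))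
      ((P i).curve (uniformPolyline L (ρ i) t)) ≤ p := by
    intro t ht i
    rw [hcurve 0 t ht, hcurve i t ht]
    exact dist_uniformPolyline_le (fun l hl => hp l hl i) hL ht
  obtain ⟨δ, hδp, hδ⟩ := exists_isLeashLength
    (γ := fun i t => (P i).curve (uniformPolyline L (ρ i) t))
    (fun i => ((continuous_polyline _ _).comp (continuous_uniformPolyline L (ρ i))).continuousOn)
    hdist
  refine ⟨hrep, δ, hδ, fun ρ' hρ' δ' hδ' => hδp.trans ?_⟩
  obtain ⟨g1, g2⟩ := curveSystem_reach hρ' hδ'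
  exact hmin δ' g1 g2

end

/-! ### Storing polygonal curves as a system of agents -/

namespace Program

/-- Store the vertex number `v` of the graph and the cells number `2 * v` and `2 * v + 1`, where `v`
is in integer register `11`. -/
def storeVertex (d tm vx len idx co : ℕ) : Program :=
  seq (seq (mulC 7 11 2) <| seq (mulC 8 11 4) <| seq (mulC 9 11 (d + 1)) <| seq (mulC 10 11 d) <|
    seq (setI 12 1) <| seq (addI 13 7 12) <| seq (setI 14 2) <|
    seq (storeI len 7 12) <| seq (storeI len 13 14) <| seq (storeI idx 8 11) <|
    seq (addI 15 8 14) <| seq (storeI idx 15 11) <| seq (addI 15 15 12) <| seq (addI 16 11 12) <|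
    seq (storeI idx 15 16) <| seq (loadR 1 tm 11) (storeR co 9 1)) <|
  rep d fun _ => seq (loadR 1 vx 10) <| seq (inc 10) <| seq (inc 9) (storeR co 9 1)

/-- Store the curve number `i`, whose breakpoints are in the real array `tm` and whose vertices are in
the real array `vx`, as an agent. -/
def storeCurve (d i tm vx len idx co : ℕ) : Program :=
  seq (seq (setI 2 i) <| seq (loadI 1 0 2) <| seq (setI 3 1) <| seq (addI 4 1 3) <|
    seq (addI 5 1 4) <| seq (setI 6 0) <| seq (storeI 1 2 4) <| seq (storeI 2 2 5) <|
    seq (storeI 3 2 6) (storeI 4 2 1)) <|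
  forI 11 4 (storeVertex d tm vx len idx co)

section
variable (d i tm vx len idx co x : ℕ)
@[simp] theorem wIA_storeVertex :
    (storeVertex d tm vx len idx co).wIA x ↔ x = len ∨ x = idx := by
  simp [storeVertex]
@[simp] theorem wRA_storeVertex : (storeVertex d tm vx len idx co).wRA x ↔ x = co := by
  simp [storeVertex]
@[simp] theorem wIA_storeCurve : (storeCurve d i tm vx len idx co).wIA x ↔
    x = 1 ∨ x = 2 ∨ x = 3 ∨ x = 4 ∨ x = len ∨ x = idx := by
  simp [storeCurve]; tauto
@[simp] theorem wRA_storeCurve : (storeCurve d i tm vx len idx co).wRA x ↔ x = co := by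
  simp [storeCurve]
end

end Program

section
variable {d i tm vx len idx co : ℕ}

theorem storeVertex_spec (h1 : len ≠ idx) (h3 : co ≠ vx) {v : ℕ} {μ : Memory}
    (h11 : μ.ireg 11 = v) : Run (storeVertex d tm vx len idx co) μ fun _ μ' =>
      (∀ x, μ'.iarr len x = if x = 2 * v + 1 then 2 else if x = 2 * v then 1 else μ.iarr len x) ∧
      (∀ x, μ'.iarr idx x = if x = 4 * v + 3 then v + 1 else if x = 4 * v + 2 then v else
        if x = 4 * v then v else μ.iarr idx x) ∧
      ∀ x, μ'.rarr co x = if (d + 1) * v < x ∧ x ≤ (d + 1) * v + d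
        then μ.rarr vx (d * v + (x - ((d + 1) * v + 1)))
        else if x = (d + 1) * v then μ.rarr tm v else μ.rarr co x := by
  have hs : Run (seq (mulC 7 11 2) <| seq (mulC 8 11 4) <| seq (mulC 9 11 (d + 1)) <|
      seq (mulC 10 11 d) <| seq (setI 12 1) <| seq (addI 13 7 12) <| seq (setI 14 2) <|
      seq (storeI len 7 12) <| seq (storeI len 13 14) <| seq (storeI idx 8 11) <|
      seq (addI 15 8 14) <| seq (storeI idx 15 11) <| seq (addI 15 15 12) <|
      seq (addI 16 11 12) <| seq (storeI idx 15 16) <| seq (loadR 1 tm 11) (storeR co 9 1)) μ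
      fun _ μ' => μ'.ireg 9 = (d + 1) * v ∧ μ'.ireg 10 = d * v ∧
      (∀ x, μ'.iarr len x = if x = 2 * v + 1 then 2 else if x = 2 * v then 1 else μ.iarr len x) ∧
      (∀ x, μ'.iarr idx x = if x = 4 * v + 3 then v + 1 else if x = 4 * v + 2 then v else
        if x = 4 * v then v else μ.iarr idx x) ∧
      ∀ x, μ'.rarr co x = if x = (d + 1) * v then μ.rarr tm v else μ.rarr co x := by
    refine Run.of_loopFree (by simp) fun _ _ => ?_
    simp only [exec, exec_mulC _ _ _ (show 11 ≠ 7 by decide),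
      exec_mulC _ _ _ (show 11 ≠ 8 by decide), exec_mulC _ _ _ (show 11 ≠ 9 by decide),
      exec_mulC _ _ _ (show 11 ≠ 10 by decide)]
    simp [h11, h1, h1.symm, add_assoc]
  refine Run.seq' hs fun T μ1 hF1 ⟨h9, h10, hl, hx, hc⟩ => ?_
  have hvx := hF1.rarr vx (by simp [h3.symm])
  refine (Run.rep (fun n _ μ' => μ'.ireg 9 = (d + 1) * v + n ∧ μ'.ireg 10 = d * v + n ∧
      ∀ x, μ'.rarr co x = if (d + 1) * v < x ∧ x ≤ (d + 1) * v + n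
        then μ.rarr vx (d * v + (x - ((d + 1) * v + 1))) else μ1.rarr co x)
      ⟨h9, h10, fun x => by rw [if_neg (by omega)]⟩ ?_).mono ?_
  · rintro n T μ2 hF2 ⟨g9, g10, g⟩
    have hvx2 := (hF2.rarr vx (by simp [h3.symm])).trans hvx
    refine Run.of_loopFree (by simp) fun _ _ => ?_
    simp only [exec, exec_inc (show 10 ≠ 0 by decide), exec_inc (show 9 ≠ 0 by decide)]
    simp [g9, g10, hvx2, add_assoc]
    intro x
    rw [g x]
    by_cases hx : x = (d + 1) * v + (n + 1)
    · subst hx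
      rw [if_pos rfl, if_pos ⟨by omega, le_rfl⟩]
      congr 2
      omega
    · rw [if_neg hx]
      by_cases hx' : (d + 1) * v < x ∧ x ≤ (d + 1) * v + n
      · rw [if_pos hx', if_pos ⟨hx'.1, by omega⟩]
      · rw [if_neg hx', if_neg (by omega)]
  · rintro T μ2 hF2 ⟨-, -, g⟩
    have e1 := hF2.iarr len (by simp)
    have e2 := hF2.iarr idx (by simp)
    refine ⟨by simpa only [e1] using hl, by simpa only [e2] using hx, fun x => ?_⟩
    rw [g x, hc x]

theorem storeCurve_spec (h1 : len ≠ idx) (h2 : co ≠ tm) (h3 : co ≠ vx) (h4 : 4 < len)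
    (h5 : 4 < idx) {m : ℕ} {μ : Memory} (hm : μ.iarr 0 i = m) :
    Run (storeCurve d i tm vx len idx co) μ fun T μ' =>
      T ≤ ((storeVertex d tm vx len idx co).steps + 3) * (m + 1) + 12 ∧
      (∀ x, μ'.iarr 1 x = if x = i then m + 1 else μ.iarr 1 x) ∧
      (∀ x, μ'.iarr 2 x = if x = i then 2 * m + 1 else μ.iarr 2 x) ∧
      (∀ x, μ'.iarr 3 x = if x = i then 0 else μ.iarr 3 x) ∧
      (∀ x, μ'.iarr 4 x = if x = i then m else μ.iarr 4 x) ∧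
      ∀ v < m + 1, μ'.iarr len (2 * v) = 1 ∧ μ'.iarr len (2 * v + 1) = 2 ∧
        μ'.iarr idx (4 * v) = v ∧ μ'.iarr idx (4 * v + 2) = v ∧
        μ'.iarr idx (4 * v + 3) = v + 1 ∧ μ'.rarr co ((d + 1) * v) = μ.rarr tm v ∧
        ∀ c < d, μ'.rarr co ((d + 1) * v + (c + 1)) = μ.rarr vx (d * v + c) := by
  have hs : Run (seq (setI 2 i) <| seq (loadI 1 0 2) <| seq (setI 3 1) <| seq (addI 4 1 3) <|
    seq (addI 5 1 4) <| seq (setI 6 0) <| seq (storeI 1 2 4) <| seq (storeI 2 2 5) <|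
    seq (storeI 3 2 6) (storeI 4 2 1)) μ fun T μ' => T ≤ 10 ∧ μ'.ireg 4 = m + 1 ∧
      (∀ x, μ'.iarr 1 x = if x = i then m + 1 else μ.iarr 1 x) ∧
      (∀ x, μ'.iarr 2 x = if x = i then 2 * m + 1 else μ.iarr 2 x) ∧
      (∀ x, μ'.iarr 3 x = if x = i then 0 else μ.iarr 3 x) ∧
      (∀ x, μ'.iarr 4 x = if x = i then m else μ.iarr 4 x) := by
    refine Run.of_loopFree (by simp) fun T hT => ?_
    simp at hT
    simp [hm, hT, show m + (m + 1) = 2 * m + 1 by omega]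
  refine Run.seq' hs fun T μ1 hF1 ⟨hT, e4, a1, a2, a3, a4⟩ => ?_
  have htm := hF1.rarr tm (by simp)
  have hvx := hF1.rarr vx (by simp)
  have hlf : (storeVertex d tm vx len idx co).loopFree := by simp [storeVertex]
  refine (Run.forI (storeVertex d tm vx len idx co).steps (fun n μ' => ∀ v < n,
      μ'.iarr len (2 * v) = 1 ∧ μ'.iarr len (2 * v + 1) = 2 ∧
      μ'.iarr idx (4 * v) = v ∧ μ'.iarr idx (4 * v + 2) = v ∧
      μ'.iarr idx (4 * v + 3) = v + 1 ∧ μ'.rarr co ((d + 1) * v) = μ.rarr tm v ∧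
      ∀ c < d, μ'.rarr co ((d + 1) * v + (c + 1)) = μ.rarr vx (d * v + c))
    (by decide) (by decide) (by decide) (by simp [storeVertex]) (by simp [storeVertex])
    (fun v hv => absurd hv (Nat.not_lt_zero v)) fun n μ2 hn hF2 h11 hI => ?_).mono
      fun T' μ2 hF2 ⟨hI, hT'⟩ => ?_
  · have htm2 := (hF2.rarr tm (by simp [h2.symm])).trans htm
    have hvx2 := (hF2.rarr vx (by simp [h3.symm])).trans hvx
    refine (Run.time_le hlf (storeVertex_spec h1 h3 h11)).mono
      fun T3 μ3 hF3 ⟨⟨b1, b2, b3⟩, hT3⟩ => ⟨fun v hv => ?_, hT3⟩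
    simp only [Memory.iarr_setI, Memory.rarr_setI]
    have hb : (d + 1) * v + (d + 1) ≤ (d + 1) * n ∨ v = n := by
      rcases Nat.lt_succ_iff_lt_or_eq.1 hv with h | h
      · exact .inl (Nat.mul_le_mul_left (d + 1) (Nat.succ_le_of_lt h))
      · exact .inr h
    simp only [b1, b2, b3, htm2, hvx2]
    rcases hb with hb | rfl
    · have hvn : v < n := by
        by_contra h
        have := Nat.mul_le_mul_left (d + 1) (not_lt.1 h)
        omega
      obtain ⟨q1, q2, q3, q4, q5, q6, q7⟩ := hI v hvn
      refine ⟨?_, ?_, ?_, ?_, ?_, ?_, fun c hc => ?_⟩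
      · rw [if_neg (by omega), if_neg (by omega), q1]
      · rw [if_neg (by omega), if_neg (by omega), q2]
      · rw [if_neg (by omega), if_neg (by omega), if_neg (by omega), q3]
      · rw [if_neg (by omega), if_neg (by omega), if_neg (by omega), q4]
      · rw [if_neg (by omega), if_neg (by omega), if_neg (by omega), q5]
      · rw [if_neg (by omega), if_neg (by omega), q6]
      · rw [if_neg (by omega), if_neg (by omega), q7 c hc]
    · refine ⟨?_, ?_, ?_, ?_, ?_, ?_, fun c hc => ?_⟩
      · rw [if_neg (by omega), if_pos rfl]
      · rw [if_pos rfl]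
      · rw [if_neg (by omega), if_neg (by omega), if_pos rfl]
      · rw [if_neg (by omega), if_pos rfl]
      · rw [if_pos rfl]
      · rw [if_neg (by omega), if_pos rfl]
      · rw [if_pos ⟨by omega, by omega⟩]
        congr 2
        omega
  · rw [e4] at hT' hI
    have hne : ∀ x ≤ 4, ¬ (forI 11 4 (storeVertex d tm vx len idx co)).wIA x := by
      intro x hx
      simp
      omega
    refine ⟨by omega, ?_, ?_, ?_, ?_, hI⟩
    · simpa only [hF2.iarr 1 (hne 1 (by decide))] using a1
    · simpa only [hF2.iarr 2 (hne 2 (by decide))] using a2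
    · simpa only [hF2.iarr 3 (hne 3 (by decide))] using a3
    · simpa only [hF2.iarr 4 (hne 4 (by decide))] using a4

end

section
variable {k d : ℕ}

/-- The arrays in which polygonal curves are stored as agents. -/
def curveLayout (k : ℕ) : Layout k where
  verts := 1
  cells := 2
  src := 3
  tgt := 4
  len i := 5 + 2 * i
  idx i := 6 + 2 * i
  coord i := 3 * k + i

theorem curveLayout_below : (curveLayout k).Below (10 + 8 * k) := by
  constructor <;> simp only [curveLayout] <;> omega

/-- Store all curves of the input as agents. -/
def Program.storeCurves (k d : ℕ) : Program :=
  rep k fun i => storeCurve d i i (k + i) (5 + 2 * i) (6 + 2 * i) (3 * k + i)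

theorem table_apply {α : Type*} [Zero α] {n w : ℕ} (row : Fin n → ℕ → α) (j : Fin n) {c : ℕ}
    (hc : c < w) : table w row (w * j + c) = row j c := by
  rw [table, Nat.mul_add_div (by omega), Nat.div_eq_of_lt hc, Nat.mul_add_mod, Nat.mod_eq_of_lt hc,
    add_zero, padded, dif_pos j.2]

/-- The transformation of the input takes linear time. -/
theorem storeCurves_spec : ∃ C, ∀ P : Fin k → PolygonalCurve d,
    Run (storeCurves k d) (curvesInput P) fun T μ =>
      (curveLayout k).Holds (curveSystem P) 2 μ ∧ T ≤ C * ∑ i, (P i).complexity + 1 := by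
  let c (i : Fin k) := (storeVertex d i (k + i) (5 + 2 * i) (6 + 2 * i) (3 * k + i)).steps + 3
  have hc : ∀ i, c i ≤ ∑ i, c i := fun i =>
    Finset.single_le_sum (fun _ _ => Nat.zero_le _) (Finset.mem_univ i)
  refine ⟨∑ i, c i + 12, fun P => ?_⟩
  refine (Run.rep (fun n T μ => T ≤ (∑ i, c i + 12) * ∑ i with (i : Fin k) < n,
      (P i).complexity + 1 ∧ ∀ i : Fin k, i < n →
      μ.iarr 1 i = (P i).edges + 1 ∧ μ.iarr 2 i = 2 * (P i).edges + 1 ∧ μ.iarr 3 i = 0 ∧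
      μ.iarr 4 i = (P i).edges ∧ ∀ v < (P i).edges + 1, μ.iarr (5 + 2 * i) (2 * v) = 1 ∧
        μ.iarr (5 + 2 * i) (2 * v + 1) = 2 ∧ μ.iarr (6 + 2 * i) (4 * v) = v ∧
        μ.iarr (6 + 2 * i) (4 * v + 2) = v ∧ μ.iarr (6 + 2 * i) (4 * v + 3) = v + 1 ∧
        ∀ c : Fin (d + 1), μ.rarr (3 * k + i) ((d + 1) * v + c) = (P i).graphVertex v c)
    ⟨by simp, fun i hi => absurd hi (Nat.not_lt_zero _)⟩ ?_).mono ?_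
  · rintro i T μ hF ⟨hT, hI⟩
    have hm : μ.iarr 0 i = (P i).edges := by
      rw [hF.iarr 0 (by simp; omega)]
      simp [curvesInput, padded]
    have htm : ∀ v (hv : v < (P i).edges + 1), μ.rarr i v = (P i).time ⟨v, hv⟩ := fun v hv => by
      rw [hF.rarr i (by simp; omega)]
      simp [curvesInput, padded, hv]
    have hvx : ∀ v (hv : v < (P i).edges + 1) (c : Fin d),
        μ.rarr (k + i) (d * v + c) = (P i).vertex ⟨v, hv⟩ c := fun v hv c => by
      rw [hF.rarr (k + i) (by simp; omega)]
      have hk : padded (fun i => table d fun j => padded fun c => (P i).vertex j c) (k + i - k) =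
          table d fun j => padded fun c => (P i).vertex j c := by
        rw [Nat.add_sub_cancel_left, padded, dif_pos i.2]
      simp only [curvesInput, if_neg (show ¬ k + (i : ℕ) < k by omega), hk]
      rw [table_apply _ ⟨v, hv⟩ c.2, padded, dif_pos c.2]
    refine (storeCurve_spec (by omega) (by omega) (by omega) (by omega) (by omega) hm).mono
      fun T' μ' hF' ⟨hT', a1, a2, a3, a4, a⟩ => ⟨?_, fun i' hi' => ?_⟩
    · have : (Finset.univ.filter fun i' : Fin k => (i' : ℕ) < i + 1) =
          insert i (Finset.univ.filter fun i' : Fin k => (i' : ℕ) < i) := by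
        ext i'
        simp only [Finset.mem_filter, Finset.mem_univ, true_and, Finset.mem_insert, Fin.ext_iff]
        omega
      rw [this, Finset.sum_insert (by simp), mul_add]
      have h1 := Nat.mul_le_mul_right ((P i).edges + 1) (hc i)
      have h2 : (∑ i, c i + 12) * (P i).complexity =
        (∑ i, c i) * ((P i).edges + 1) + 12 * ((P i).edges + 1) := by
        rw [PolygonalCurve.complexity]; ring
      simp only [c] at h1 hT' h2 hT ⊢
      omega
    · rcases Nat.lt_succ_iff_lt_or_eq.1 hi' with h | h
      · have hne : (i' : ℕ) ≠ i := h.ne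
        obtain ⟨q1, q2, q3, q4, q⟩ := hI i' h
        refine ⟨by rw [a1, if_neg hne, q1], by rw [a2, if_neg hne, q2], by rw [a3, if_neg hne, q3],
          by rw [a4, if_neg hne, q4], ?_⟩
        rw [hF'.iarr (5 + 2 * i') (by simp; omega),
          hF'.iarr (6 + 2 * i') (by simp; omega),
          hF'.rarr (3 * k + i') (by simp; omega)]
        exact q
      · obtain rfl := Fin.ext h
        refine ⟨by rw [a1, if_pos rfl], by rw [a2, if_pos rfl], by rw [a3, if_pos rfl],
          by rw [a4, if_pos rfl], fun v hv => ?_⟩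
        obtain ⟨q1, q2, q3, q4, q5, q6, q7⟩ := a v hv
        refine ⟨q1, q2, q3, q4, q5, fun c => ?_⟩
        rw [PolygonalCurve.graphVertex_eq (P := P i') ⟨v, hv⟩]
        induction c using Fin.cases with
        | zero => simpa [q6] using htm v hv
        | succ c => simpa [q7 c c.2] using hvx v hv c
  · rintro T μ hF ⟨hT, hI⟩
    refine ⟨?_, by simpa using hT⟩
    constructor
    · exact fun i => (hI i i.2).1
    · exact fun i => (hI i i.2).2.1
    · exact fun i => (hI i i.2).2.2.1
    · exact fun i => (hI i i.2).2.2.2.1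
    · intro i j hj
      simp only [curveSystem, curveLayout] at hj ⊢
      obtain ⟨v, rfl | rfl⟩ := Nat.even_or_odd' j
      · rw [((hI i i.2).2.2.2.2 v (by omega)).1]; omega
      · rw [((hI i i.2).2.2.2.2 v (by omega)).2.1]; omega
    · intro i j hj a ha
      simp only [curveSystem, curveLayout] at hj ha ⊢
      obtain ⟨v, rfl | rfl⟩ := Nat.even_or_odd' j
      · obtain rfl : a = 0 := by omega
        have := ((hI i i.2).2.2.2.2 v (by omega)).2.2.1
        rw [show 2 * (2 * v) + 0 = 4 * v by ring, this]
        omega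
      · obtain rfl | rfl : a = 0 ∨ a = 1 := by omega
        · have := ((hI i i.2).2.2.2.2 v (by omega)).2.2.2.1
          rw [show 2 * (2 * v + 1) + 0 = 4 * v + 2 by ring, this]
          omega
        · have := ((hI i i.2).2.2.2.2 v (by omega)).2.2.2.2.1
          rw [show 2 * (2 * v + 1) + 1 = 4 * v + 3 by ring, this]
          omega
    · exact fun i v hv c => ((hI i i.2).2.2.2.2 v hv).2.2.2.2.2 c

end

/-! ### The program for polygonal curves -/

/-- An optimal reparameterization of polygonal curves can be computed in time `O(n ^ k)`. -/
theorem exists_program_curves (k d : ℕ) [NeZero k] : ∃ (A : Program) (C : ℕ),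
    ∀ P : Fin k → PolygonalCurve d, ∃ (T : ℕ) (σ : Memory), Runs A (curvesInput P) T σ ∧
      T ≤ C * (∑ i, (P i).complexity) ^ k ∧ 0 < σ.ireg 0 ∧
      AreOptimalReparams P (outReparam k σ) := by
  obtain ⟨C₁, h₁⟩ := storeCurves_spec (k := k) (d := d)
  obtain ⟨C₂, h₂⟩ := plan_spec (k := k) (Fin.succ : Fin d → Fin (d + 1)) 2 (10 + 8 * k) 1
    (curveLayout k) curveLayout_below (by omega) (ox := fun i => 2 * k + i)
    (oj := fun i => i) (by intro i; omega) (by intro i; omega)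
    (fun i j h => Fin.ext (by simpa using h)) (fun i j h => Fin.ext h)
  refine ⟨seq (storeCurves k d)
    (seq (seq (solve (Fin.succ : Fin d → Fin (d + 1)) (10 + 8 * k) (curveLayout k) 2)
    (collect (10 + 8 * k) (fun i : Fin k => 2 * k + i) (fun i => i) 1)) (mv 0 29)),
    C₁ + C₂ * (2 ^ k + 1) + 3, fun P => ?_⟩
  change Run _ _ fun T σ => T ≤ _ ∧ 0 < σ.ireg 0 ∧ AreOptimalReparams P (outReparam k σ)
  refine Run.seq' (h₁ P) fun T1 μ1 hF1 ⟨hly, hT1⟩ => ?_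
  refine Run.seq' (h₂ _ _ hly curveSystem_valid curveSystem_exists_reach)
    fun T2 μ2 hF2 ⟨hL, hT2, X, hX, hopt⟩ => ?_
  refine Run.of_loopFree (by simp [mv]) fun T3 hT3 => ?_
  refine ⟨?_, by simpa [mv] using hL, ?_⟩
  · obtain ⟨n, hn⟩ : ∃ n, n = ∑ i, (P i).complexity := ⟨_, rfl⟩
    have hle : ∀ i, (P i).complexity ≤ n := fun i => hn ▸
      Finset.single_le_sum (f := fun i => (P i).complexity) (fun _ _ => Nat.zero_le _)
        (Finset.mem_univ i)
    have hn1 : 1 ≤ n := le_trans (by simp [PolygonalCurve.complexity]) (hle 0)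
    have hnk : n ≤ n ^ k := Nat.le_self_pow (NeZero.ne k) n
    have hprod : ∏ i, (curveSystem P).numCells i ≤ 2 ^ k * n ^ k := by
      rw [← mul_pow]
      refine (Finset.prod_le_pow_card _ _ (2 * n) fun i _ => ?_).trans (by simp)
      have := hle i
      simp only [curveSystem, PolygonalCurve.complexity] at this ⊢
      omega
    have hsum : ∑ i, (curveSystem P).numVerts i = n := hn.symm
    rw [hsum] at hT2
    rw [← hn] at hT1 ⊢
    simp [mv] at hT3
    have e1 := Nat.mul_le_mul_left C₂ (add_le_add hprod hnk)
    have e2 := Nat.mul_le_mul_left C₁ hnk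
    have e3 : (C₁ + C₂ * (2 ^ k + 1) + 3) * n ^ k =
      C₁ * n ^ k + C₂ * (2 ^ k * n ^ k + n ^ k) + 3 * n ^ k := by ring
    omega
  · have h0 : ((mv 0 29).exec μ2).ireg 0 = μ2.ireg 29 := by simp [mv]
    have hr : ((mv 0 29).exec μ2).rarr = μ2.rarr := by simp [mv]
    unfold outReparam
    rw [h0, hr]
    refine hopt.areOptimalReparams hL fun i l hl => ?_
    have := hX i l hl 0
    simpa using this

/-! ### The lowest face of a simplex that contains a point -/

section
variable {d : ℕ}

open Classical in
/-- The lowest face of the simplex `Ψ` that contains `x`. -/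
noncomputable def carrier (Ψ : Finset (Pt d)) (x : Pt d) : Finset (Pt d) :=
  Ψ.filter fun v => ∀ Υ ⊆ Ψ, x ∈ convexHull ℝ (Υ : Set (Pt d)) → v ∈ Υ

variable {Ψ Υ : Finset (Pt d)} {x : Pt d}

theorem carrier_subset_left (Ψ : Finset (Pt d)) (x : Pt d) : carrier Ψ x ⊆ Ψ :=
  by classical exact Finset.filter_subset _ _

theorem carrier_subset (h : Υ ⊆ Ψ) (hx : x ∈ convexHull ℝ (Υ : Set (Pt d))) : carrier Ψ x ⊆ Υ := by
  classical exact fun _ hv => (Finset.mem_filter.1 hv).2 Υ h hx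

/-- The intersection of the faces that contain `x` contains `x`, by affine independence. -/
theorem mem_carrier (hΨ : AffineIndependent ℝ (fun v : Ψ => (v : Pt d)))
    (hx : x ∈ convexHull ℝ (Ψ : Set (Pt d))) : x ∈ convexHull ℝ (carrier Ψ x : Set (Pt d)) := by
  classical
  -- A smallest face containing `x` is contained in all others, as the intersection of two faces
  -- containing `x` contains `x`.
  obtain ⟨Υ, hΥ, hmin⟩ := Finset.exists_min_image
    (Ψ.powerset.filter fun Υ : Finset (Pt d) => x ∈ convexHull ℝ (Υ : Set (Pt d))) Finset.card
    ⟨Ψ, by simpa using hx⟩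
  simp only [Finset.mem_filter, Finset.mem_powerset] at hΥ hmin
  suffices Υ ⊆ carrier Ψ x from convexHull_mono (Finset.coe_subset.2 this) hΥ.2
  intro v hv
  refine Finset.mem_filter.2 ⟨hΥ.1 hv, fun Ξ hΞ hxΞ => ?_⟩
  have hI : x ∈ convexHull ℝ ((Υ ∩ Ξ : Finset (Pt d)) : Set (Pt d)) := by
    rw [Finset.coe_inter, AffineIndependent.convexHull_inter (s := Ψ) hΨ hΥ.1 hΞ]
    exact ⟨hΥ.2, hxΞ⟩
  have h1 := hmin _ ⟨Finset.inter_subset_left.trans hΥ.1, hI⟩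
  have h2 := Finset.eq_of_subset_of_card_le Finset.inter_subset_left h1
  exact Finset.mem_of_mem_inter_right (h2.symm ▸ hv : v ∈ Υ ∩ Ξ)

/-- A face of a simplex that contains an inner point of a segment contains the whole segment. -/
theorem left_mem_face (hΨ : AffineIndependent ℝ (fun v : Ψ => (v : Pt d))) (hΥ : Υ ⊆ Ψ)
    {a b : Pt d} (ha : a ∈ convexHull ℝ (Ψ : Set (Pt d))) (hb : b ∈ convexHull ℝ (Ψ : Set (Pt d)))
    {s t : ℝ} (hs : 0 < s) (ht : 0 < t) (hst : s + t = 1)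
    (h : s • a + t • b ∈ convexHull ℝ (Υ : Set (Pt d))) : a ∈ convexHull ℝ (Υ : Set (Pt d)) := by
  classical
  rw [Finset.mem_convexHull'] at ha hb h ⊢
  obtain ⟨u, hu0, hu1, rfl⟩ := ha
  obtain ⟨w, hw0, hw1, rfl⟩ := hb
  obtain ⟨c, hc0, hc1, hc⟩ := h
  have key := (affineIndependent_iff.1 hΨ) Finset.univ
    (fun v => s * u v + t * w v - if (v : Pt d) ∈ Υ then c v else 0) ?_ ?_
  · have hout : ∀ v ∈ Ψ, v ∉ Υ → u v = 0 := by
      intro v hv hvΥ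
      have := key ⟨v, hv⟩ (Finset.mem_univ _)
      simp only [hvΥ, if_false, sub_zero] at this
      have h1 := mul_nonneg hs.le (hu0 v hv)
      have h2 := mul_nonneg ht.le (hw0 v hv)
      have h3 : s * u v = 0 := by linarith
      exact (mul_eq_zero.1 h3).resolve_left hs.ne'
    refine ⟨u, fun v hv => hu0 v (hΥ hv), ?_, ?_⟩
    · rw [← hu1]
      exact Finset.sum_subset hΥ hout
    · exact Finset.sum_subset hΥ fun v hv hvΥ => by rw [hout v hv hvΥ, zero_smul]
  · rw [Finset.univ_eq_attach, Finset.sum_attach Ψ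
      (fun v => s * u v + t * w v - if v ∈ Υ then c v else 0), Finset.sum_sub_distrib,
      Finset.sum_add_distrib, ← Finset.mul_sum, ← Finset.mul_sum, hu1, hw1, ← Finset.sum_filter,
      Finset.filter_mem_eq_inter, Finset.inter_eq_right.2 hΥ, hc1]
    linarith
  · rw [Finset.univ_eq_attach, Finset.sum_attach Ψ
      (fun v => (s * u v + t * w v - if v ∈ Υ then c v else 0) • v)]
    have : ∀ v ∈ Ψ, (s * u v + t * w v - if v ∈ Υ then c v else 0) • v =
        s • (u v • v) + t • (w v • v) - if v ∈ Υ then c v • v else 0 := by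
      intro v _
      split_ifs <;> module
    rw [Finset.sum_congr rfl this, Finset.sum_sub_distrib, Finset.sum_add_distrib,
      ← Finset.smul_sum, ← Finset.smul_sum, ← Finset.sum_filter, Finset.filter_mem_eq_inter,
      Finset.inter_eq_right.2 hΥ, hc, sub_self]

/-- The lowest face is constant on an open segment. -/
theorem carrier_segment (hΨ : AffineIndependent ℝ (fun v : Ψ => (v : Pt d))) {a b : Pt d}
    (ha : a ∈ convexHull ℝ (Ψ : Set (Pt d))) (hb : b ∈ convexHull ℝ (Ψ : Set (Pt d)))
    {s t : ℝ} (hs : s ∈ Set.Ioo (0 : ℝ) 1) (ht : t ∈ Set.Ioo (0 : ℝ) 1) :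
    carrier Ψ ((1 - s) • a + s • b) = carrier Ψ ((1 - t) • a + t • b) := by
  have key : ∀ s ∈ Set.Ioo (0 : ℝ) 1, ∀ t ∈ Set.Ioo (0 : ℝ) 1,
      carrier Ψ ((1 - s) • a + s • b) ⊆ carrier Ψ ((1 - t) • a + t • b) := by
    intro s hs t ht
    have hsub := carrier_subset_left Ψ ((1 - t) • a + t • b)
    have h := mem_carrier hΨ (convex_convexHull ℝ _ ha hb (by linarith [ht.2] : 0 ≤ 1 - t) ht.1.le
      (by ring))
    refine carrier_subset hsub (convex_convexHull ℝ _ ?_ ?_ (by linarith [hs.2] : 0 ≤ 1 - s)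
      hs.1.le (by ring))
    · exact left_mem_face hΨ hsub ha hb (by linarith [ht.2]) ht.1 (by ring) h
    · refine left_mem_face hΨ hsub hb ha ht.1 (by linarith [ht.2] : 0 < 1 - t) (by ring) ?_
      rwa [add_comm (t • b)]
  exact (key s hs t ht).antisymm (key t ht s hs)

namespace SpatialComplex
variable {K : SpatialComplex d}

theorem nonempty_of_mem (h : Ψ ∈ K.faces) : Ψ.Nonempty := (K.isRelLowerSet_faces h).1

theorem mem_of_subset (h : Ψ ∈ K.faces) (hΥ : Υ ⊆ Ψ) (hne : Υ.Nonempty) : Υ ∈ K.faces :=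
  (K.isRelLowerSet_faces h).2 hΥ hne

theorem carrier_mem (h : Ψ ∈ K.faces) (hx : x ∈ convexHull ℝ (Ψ : Set (Pt d))) :
    carrier Ψ x ∈ K.faces := by
  refine mem_of_subset h (carrier_subset_left _ _) ?_
  rw [← Finset.coe_nonempty, ← convexHull_nonempty_iff (𝕜 := ℝ)]
  exact ⟨x, mem_carrier (K.affineIndependent Ψ h) hx⟩

/-- Simplices with a common vertex have the same lowest faces. -/
theorem carrier_congr (h : Ψ ∈ K.faces) (h' : Υ ∈ K.faces) {Ξ : Finset (Pt d)} (hΞ : Ξ.Nonempty)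
    (h1 : Ξ ⊆ Ψ) (h2 : Ξ ⊆ Υ) (hx : x ∈ convexHull ℝ (Ψ : Set (Pt d)))
    (hx' : x ∈ convexHull ℝ (Υ : Set (Pt d))) : carrier Ψ x = carrier Υ x := by
  classical
  have key : ∀ {Ψ Υ : Finset (Pt d)}, Ψ ∈ K.faces → Υ ∈ K.faces → Ξ ⊆ Ψ → Ξ ⊆ Υ →
      x ∈ convexHull ℝ (Ψ : Set (Pt d)) → x ∈ convexHull ℝ (Υ : Set (Pt d)) →
      carrier Ψ x ⊆ carrier Υ x := by
    intro Ψ Υ h h' h1 h2 hx hx'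
    obtain ⟨v, hv⟩ := hΞ
    have hI : x ∈ convexHull ℝ ((Ψ ∩ Υ : Finset (Pt d)) : Set (Pt d)) := by
      rw [Finset.coe_inter, ← K.locallyConsistent Ψ h Υ h' ⟨v, h1 hv, h2 hv⟩]
      exact ⟨hx, hx'⟩
    have h3 : carrier Υ x ⊆ Ψ := (carrier_subset Finset.inter_subset_right hI).trans
      Finset.inter_subset_left
    exact carrier_subset h3 (mem_carrier (K.affineIndependent Υ h') hx')
  exact (key h h' h1 h2 hx hx').antisymm (key h' h h2 h1 hx' hx)

/-! ### Simplicial paths can only grow near a point in time -/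

section
variable {s e : Pt d} {π : ℝ → Pt d} {φ : ℝ → Finset (Pt d)} {F : Filter ℝ}

/-- A simplicial path is constant on one side of a point in time: the numbers
that approach this point along the filter `F` are eventually all above, or all below, any given one. -/
theorem IsSimplicialPath.exists_germ (h : K.IsSimplicialPath φ) [F.NeBot]
    (hF : ∀ c, (∀ᶠ s in F, c < s) ∨ ∀ᶠ s in F, s < c) (hI : ∀ᶠ s in F, s ∈ Set.Icc (0 : ℝ) 1) :
    ∃ Ψ ∈ K.faces, ∀ᶠ s in F, φ s = Ψ := by
  by_contra hcon
  push Not at hcon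
  have hor : ∀ c, ∀ᶠ s in F, s ≠ c := fun c =>
    (hF c).elim (fun h => h.mono fun _ h => ne_of_gt h) (fun h => h.mono fun _ h => ne_of_lt h)
  have key : ∀ Ψ ∈ K.faces, ∀ᶠ s in F, φ s ≠ Ψ := by
    intro Ψ hΨ
    obtain ⟨J, Q, hJ⟩ := h.tame Ψ hΨ
    have hnot : ∀ ab ∈ J, ∀ᶠ s in F, s ∉ Set.Ioo ab.1 ab.2 := by
      intro ab hab
      rcases hF ab.1 with h1 | h1
      · rcases hF ab.2 with h2 | h2
        · exact h2.mono fun s hs h' => absurd h'.2 hs.not_gt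
        · refine absurd ?_ (hcon Ψ hΨ)
          filter_upwards [h1, h2] with s hs1 hs2 hne
          have : s ∈ {t | t ∈ Set.Icc (0 : ℝ) 1 ∧ φ t = Ψ} := by
            rw [hJ]
            exact .inl (Set.mem_biUnion hab ⟨hs1, hs2⟩)
          exact hne this.2
      · exact h1.mono fun s hs h' => absurd h'.1 hs.not_gt
    filter_upwards [hI, (Finset.eventually_all J).2 hnot,
      (Finset.eventually_all Q).2 fun c _ => hor c] with s hs h1 h2 he
    have : s ∈ {t | t ∈ Set.Icc (0 : ℝ) 1 ∧ φ t = Ψ} := ⟨hs, he⟩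
    rw [hJ] at this
    rcases this with h3 | h3
    · obtain ⟨ab, hab, h3⟩ := Set.mem_iUnion₂.1 h3
      exact h1 ab hab h3
    · exact h2 s h3 rfl
  obtain ⟨s, hs, h'⟩ := (hI.and ((K.finite.eventually_all).2 key)).exists
  exact h' _ (h.mem s hs) rfl

/-- If a curve is in the simplex `Ψ` close to the time `t`, on one side, then its simplex at the time
`t` is a face of `Ψ`: the two are adjacent, and `Ψ` cannot be a proper face of the latter, which is the
lowest one. -/
theorem IsCurveIn.subset_germ (h : K.IsCurveIn s e π φ) [F.NeBot] {t x y : ℝ} (hx : 0 ≤ x)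
    (hxy : x ≤ y) (hy : y ≤ 1) (ht : t ∈ Set.Icc x y) {Ψ : Finset (Pt d)}
    (hne : ∀ u ∈ Set.Icc x y, u ≠ t → φ u = Ψ) (hF : F ≤ nhdsWithin t (Set.Icc x y \ {t})) :
    φ t ⊆ Ψ := by
  have hF' : ∀ᶠ u in F, u ∈ Set.Icc x y \ {t} := hF self_mem_nhdsWithin
  have hI : Set.Icc x y ⊆ Set.Icc 0 1 := Set.Icc_subset_Icc hx hy
  obtain ⟨u, hu⟩ := hF'.exists
  have himg : φ '' Set.Icc x y = {φ t, Ψ} := by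
    ext Υ
    simp only [Set.mem_image, Set.mem_insert_iff, Set.mem_singleton_iff]
    constructor
    · rintro ⟨v, hv, rfl⟩
      by_cases hvt : v = t
      · exact .inl (hvt ▸ rfl)
      · exact .inr (hne v hv hvt)
    · rintro (rfl | rfl)
      · exact ⟨t, ht, rfl⟩
      · exact ⟨u, hu.1, hne u hu.1 hu.2⟩
  rcases h.simplicial.adjacent x y hx hxy hy _ _ himg with hsub | hsub
  · exact hsub
  -- By continuity, the curve is in `Ψ` at time `t`, and so `Ψ` is not a proper face.
  · by_contra hns
    refine h.lowest t (hI ht) Ψ ⟨hsub, hns⟩ ?_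
    have hcl : IsClosed (convexHull ℝ (Ψ : Set (Pt d))) :=
      (Ψ.finite_toSet.isCompact_convexHull (𝕜 := ℝ)).isClosed
    refine hcl.mem_of_tendsto (f := π) (b := F) ?_ ?_
    · exact (h.continuousOn t (hI ht)).mono_left
        (hF.trans (nhdsWithin_mono t (Set.sdiff_subset.trans hI)))
    · filter_upwards [hF'] with u hu
      rw [← hne u hu.1 hu.2]
      exact h.mem u (hI hu.1)

/-- Near a point in time, the simplex of a curve contains the simplex at that time. -/
theorem IsCurveIn.eventually_subset (h : K.IsCurveIn s e π φ) {t : ℝ}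
    (ht : t ∈ Set.Icc (0 : ℝ) 1) : ∀ᶠ u in nhdsWithin t (Set.Icc 0 1), φ t ⊆ φ u := by
  rw [eventually_nhdsWithin_iff, ← nhdsLT_sup_nhdsGE, Filter.eventually_sup, ← Set.Ioi_insert,
    nhdsWithin_insert, Filter.eventually_sup, Filter.eventually_pure]
  refine ⟨?_, fun _ => subset_rfl, ?_⟩
  · rcases ht.1.eq_or_lt with rfl | h0
    · filter_upwards [self_mem_nhdsWithin] with u hu hu'
      exact absurd hu'.1 (not_le.2 hu)
    obtain ⟨Ψ, hΨ, hg⟩ := h.simplicial.exists_germ (F := nhdsWithin t (Set.Iio t))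
      (fun c => (lt_or_ge c t).imp (fun hc => mem_nhdsWithin_of_mem_nhds (lt_mem_nhds hc))
        fun hc => Filter.mem_of_superset self_mem_nhdsWithin fun s hs => lt_of_lt_of_le hs hc)
      (by filter_upwards [self_mem_nhdsWithin, mem_nhdsWithin_of_mem_nhds (lt_mem_nhds h0)]
            with s h1 h2 using ⟨h2.le, (le_of_lt h1).trans ht.2⟩)
    obtain ⟨l, hl, hl'⟩ := mem_nhdsLT_iff_exists_Ico_subset.1 (hg.and
      (mem_nhdsWithin_of_mem_nhds (lt_mem_nhds h0)))
    have := h.subset_germ (F := nhdsWithin t (Set.Iio t)) (t := t) (x := l) (y := t)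
      (le_of_lt (hl' ⟨le_rfl, hl⟩).2) (le_of_lt hl) ht.2 ⟨le_of_lt hl, le_rfl⟩ (Ψ := Ψ)
      (fun u hu hne => (hl' ⟨hu.1, lt_of_le_of_ne hu.2 hne⟩).1) (by
        refine nhdsWithin_le_iff.2 ?_
        filter_upwards [self_mem_nhdsWithin, mem_nhdsWithin_of_mem_nhds (lt_mem_nhds hl)]
          with u h1 h2 using ⟨⟨le_of_lt h2, le_of_lt h1⟩, ne_of_lt h1⟩)
    exact hg.mono fun u hu _ => hu ▸ this
  · rcases ht.2.eq_or_lt with rfl | h0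
    · filter_upwards [self_mem_nhdsWithin] with u hu hu'
      exact absurd hu'.2 (not_le.2 hu)
    obtain ⟨Ψ, hΨ, hg⟩ := h.simplicial.exists_germ (F := nhdsWithin t (Set.Ioi t))
      (fun c => (lt_or_ge t c).symm.imp
        (fun hc => Filter.mem_of_superset self_mem_nhdsWithin fun s hs => lt_of_le_of_lt hc hs)
        fun hc => mem_nhdsWithin_of_mem_nhds (gt_mem_nhds hc))
      (by filter_upwards [self_mem_nhdsWithin, mem_nhdsWithin_of_mem_nhds (gt_mem_nhds h0)]
            with s h1 h2 using ⟨ht.1.trans (le_of_lt h1), h2.le⟩)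
    obtain ⟨l, hl, hl'⟩ := mem_nhdsGT_iff_exists_Ioc_subset.1 (hg.and
      (mem_nhdsWithin_of_mem_nhds (gt_mem_nhds h0)))
    have := h.subset_germ (F := nhdsWithin t (Set.Ioi t)) (t := t) (x := t) (y := l)
      ht.1 (le_of_lt hl) (le_of_lt (hl' ⟨hl, le_rfl⟩).2) ⟨le_rfl, le_of_lt hl⟩ (Ψ := Ψ)
      (fun u hu hne => (hl' ⟨lt_of_le_of_ne hu.1 (Ne.symm hne), hu.2⟩).1) (by
        refine nhdsWithin_le_iff.2 ?_
        filter_upwards [self_mem_nhdsWithin, mem_nhdsWithin_of_mem_nhds (gt_mem_nhds hl)]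
          with u h1 h2 using ⟨⟨le_of_lt h1, le_of_lt h2⟩, ne_of_gt h1⟩)
    exact hg.mono fun u hu _ => hu ▸ this

end
end SpatialComplex
end

/-! ### The simplicial path of a polygonal curve -/

theorem eventually_mem_of_isClosed {α : Type*} [TopologicalSpace α] {C : Set α} (hC : IsClosed C)
    (t : α) : ∀ᶠ u in nhds t, u ∈ C → t ∈ C := by
  by_cases h : t ∈ C
  · exact .of_forall fun _ _ => h
  · filter_upwards [hC.isOpen_compl.mem_nhds h] with u hu hu'
    exact absurd hu' hu

/-- If near each point in time the simplex contains the one at that time, and exactly two simplices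
are used, then they are adjacent: otherwise the simplex would be locally constant. -/
theorem isSimplicialPath_adjacent {d : ℕ} {φ : ℝ → Finset (Pt d)} (h : ∀ t ∈ Set.Icc (0 : ℝ) 1,
      ∀ᶠ u in nhdsWithin t (Set.Icc 0 1), φ t ⊆ φ u) {x y : ℝ} (hx : 0 ≤ x) (hy : y ≤ 1)
    {Ψ Υ : Finset (Pt d)} (himg : φ '' Set.Icc x y = {Ψ, Υ}) : AdjacentSimplices Ψ Υ := by
  by_contra hna
  have hI : Set.Icc x y ⊆ Set.Icc 0 1 := Set.Icc_subset_Icc hx hy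
  have hval : ∀ t ∈ Set.Icc x y, φ t = Ψ ∨ φ t = Υ := fun t ht => by
    have : φ t ∈ ({Ψ, Υ} : Set (Finset (Pt d))) := himg ▸ Set.mem_image_of_mem φ ht
    simpa using this
  obtain ⟨a, ha, haΨ⟩ : Ψ ∈ φ '' Set.Icc x y := himg ▸ Set.mem_insert _ _
  obtain ⟨b, hb, hbΥ⟩ : Υ ∈ φ '' Set.Icc x y := himg ▸ Set.mem_insert_of_mem _ rfl
  -- If the two simplices are not adjacent, then the path is locally constant on `[x, y]`.
  have hab : φ a = φ b := by
    refine isPreconnected_Icc.induction₂ (fun s t => φ s = φ t) (fun t ht => ?_)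
      (fun _ _ _ _ _ _ h h' => h.trans h') (fun _ _ _ _ h => h.symm) ha hb
    filter_upwards [nhdsWithin_mono t hI (h t (hI ht)), self_mem_nhdsWithin] with u hu huI
    rcases hval t ht with h1 | h1 <;> rcases hval u huI with h2 | h2
    · rw [h1, h2]
    · exact absurd (.inl (h1 ▸ h2 ▸ hu)) hna
    · exact absurd (.inr (h1 ▸ h2 ▸ hu)) hna
    · rw [h1, h2]
  exact hna (.inl (by rw [← haΨ, ← hbΥ, hab]))

namespace SpatialComplex
variable {d : ℕ} {K : SpatialComplex d} {s e : Pt d}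

/-- A polygonal curve that passes from simplex to simplex through common faces has a simplicial
path: at each point in time, the lowest face of the current simplex that contains the point. -/
theorem exists_isCurveIn {L : ℕ} (hL : 0 < L) {Ψ M : ℕ → Finset (Pt d)} {x : ℕ → Pt d}
    (hΨ : ∀ l < L, Ψ l ∈ K.faces) (hM0 : M 0 = {s}) (hML : M L = {e})
    (hx : ∀ l ≤ L, x l ∈ convexHull ℝ (M l : Set (Pt d))) (h1 : ∀ l < L, M l ⊆ Ψ l)
    (h2 : ∀ l < L, M (l + 1) ⊆ Ψ l) : ∃ φ, K.IsCurveIn s e (uniformPolyline L x) φ ∧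
      ∀ l < L, ∀ t ∈ Set.Icc ((l : ℝ) / L) (((l : ℝ) + 1) / L), φ t ⊆ Ψ l := by
  classical
  have hL' : (0 : ℝ) < L := by exact_mod_cast hL
  have hcont := continuous_uniformPolyline L x
  have hxΨ : ∀ l < L, x l ∈ convexHull ℝ (Ψ l : Set (Pt d)) := fun l hl =>
    convexHull_mono (Finset.coe_subset.2 (h1 l hl)) (hx l hl.le)
  have hxΨ' : ∀ l < L, x (l + 1) ∈ convexHull ℝ (Ψ l : Set (Pt d)) := fun l hl =>
    convexHull_mono (Finset.coe_subset.2 (h2 l hl)) (hx (l + 1) hl)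
  have hmem : ∀ l < L, ∀ t ∈ Set.Icc ((l : ℝ) / L) (((l : ℝ) + 1) / L),
      uniformPolyline L x t ∈ convexHull ℝ (Ψ l : Set (Pt d)) := fun l hl t ht =>
    uniformPolyline_mem x hl ht (convex_convexHull ℝ _) (hxΨ l hl) (hxΨ' l hl)
  have hpiece : ∀ l < L, Set.Icc ((l : ℝ) / L) (((l : ℝ) + 1) / L) ⊆ Set.Icc 0 1 := by
    intro l hl t ht
    refine ⟨le_trans (by positivity) ht.1, ht.2.trans ?_⟩
    rw [div_le_one hL']
    exact_mod_cast hl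
  have hcongr : ∀ l < L, ∀ l' < L, l ≤ l' → ∀ t ∈ Set.Icc ((l : ℝ) / L) (((l : ℝ) + 1) / L),
      t ∈ Set.Icc ((l' : ℝ) / L) (((l' : ℝ) + 1) / L) →
      carrier (Ψ l) (uniformPolyline L x t) = carrier (Ψ l') (uniformPolyline L x t) := by
    intro l hl l' hl' hll t ht ht'
    rcases hll.eq_or_lt with rfl | hlt
    · rfl
    have hle : l' ≤ l + 1 := by
      have q1 := (piece_coeff hl ht).2
      have q2 := (piece_coeff hl' ht').1
      have : (l' : ℝ) ≤ (l : ℝ) + 1 := by linarith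
      exact_mod_cast this
    obtain rfl : l' = l + 1 := by omega
    have hne : (M (l + 1)).Nonempty := by
      rw [← Finset.coe_nonempty, ← convexHull_nonempty_iff (𝕜 := ℝ)]
      exact ⟨_, hx (l + 1) hl⟩
    exact carrier_congr (hΨ l hl) (hΨ (l + 1) hl') hne (h2 l hl) (h1 (l + 1) hl') (hmem l hl t ht)
      (hmem (l + 1) hl' t ht')
  choose! piece hp1 hp2 using fun t (ht : t ∈ Set.Icc (0 : ℝ) 1) => exists_piece hL ht
  let φ : ℝ → Finset (Pt d) := fun t => carrier (Ψ (piece t)) (uniformPolyline L x t)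
  have hφ : ∀ l < L, ∀ t ∈ Set.Icc ((l : ℝ) / L) (((l : ℝ) + 1) / L),
      φ t = carrier (Ψ l) (uniformPolyline L x t) := by
    intro l hl t ht
    have htI := hpiece l hl ht
    rcases le_total l (piece t) with h | h
    · exact (hcongr l hl _ (hp1 t htI) h t ht (hp2 t htI)).symm
    · exact hcongr _ (hp1 t htI) l hl h t (hp2 t htI) ht
  have hin : ∀ t ∈ Set.Icc (0 : ℝ) 1,
      uniformPolyline L x t ∈ convexHull ℝ (φ t : Set (Pt d)) := fun t ht =>
    mem_carrier (K.affineIndependent _ (hΨ _ (hp1 t ht))) (hmem _ (hp1 t ht) t (hp2 t ht))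
  have hsemi : ∀ t ∈ Set.Icc (0 : ℝ) 1, ∀ᶠ u in nhdsWithin t (Set.Icc 0 1), φ t ⊆ φ u := by
    intro t ht
    have g1 : ∀ᶠ u in nhds t, ∀ l ∈ Finset.range L,
        u ∈ Set.Icc ((l : ℝ) / L) (((l : ℝ) + 1) / L) →
        t ∈ Set.Icc ((l : ℝ) / L) (((l : ℝ) + 1) / L) :=
      (Finset.eventually_all _).2 fun l _ => eventually_mem_of_isClosed isClosed_Icc t
    have g2 : ∀ᶠ u in nhds t, ∀ Υ ∈ K.faces,
        u ∈ uniformPolyline L x ⁻¹' convexHull ℝ (Υ : Set (Pt d)) →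
        t ∈ uniformPolyline L x ⁻¹' convexHull ℝ (Υ : Set (Pt d)) :=
      (K.finite.eventually_all).2 fun Υ _ => eventually_mem_of_isClosed
        ((Υ.finite_toSet.isCompact_convexHull (𝕜 := ℝ)).isClosed.preimage hcont) t
    filter_upwards [mem_nhdsWithin_of_mem_nhds g1, mem_nhdsWithin_of_mem_nhds g2,
      self_mem_nhdsWithin] with u q1 q2 hu
    have hl := hp1 u hu
    have htl := q1 _ (Finset.mem_range.2 hl) (hp2 u hu)
    rw [hφ _ hl t htl]
    exact carrier_subset (carrier_subset_left _ _)
      (q2 _ (carrier_mem (hΨ _ hl) (hmem _ hl u (hp2 u hu))) (hin u hu))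
  have hconst : ∀ l < L, ∀ t ∈ Set.Ioo ((l : ℝ) / L) (((l : ℝ) + 1) / L),
      ∀ u ∈ Set.Ioo ((l : ℝ) / L) (((l : ℝ) + 1) / L), φ t = φ u := by
    intro l hl t ht u hu
    have hcoef : ∀ t ∈ Set.Ioo ((l : ℝ) / L) (((l : ℝ) + 1) / L), L * t - l ∈ Set.Ioo (0 : ℝ) 1 := by
      rintro t ⟨q1, q2⟩
      rw [div_lt_iff₀ hL'] at q1
      rw [lt_div_iff₀ hL'] at q2
      constructor <;> linarith
    have ht' := Set.Ioo_subset_Icc_self ht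
    have hu' := Set.Ioo_subset_Icc_self hu
    rw [hφ l hl t ht', hφ l hl u hu', uniformPolyline_eq x hl ht', uniformPolyline_eq x hl hu']
    exact carrier_segment (K.affineIndependent _ (hΨ l hl)) (hxΨ l hl) (hxΨ' l hl) (hcoef t ht)
      (hcoef u hu)
  have hvert : ∀ t ∈ Set.Icc (0 : ℝ) 1, ∀ l < L, t ∈ Set.Icc ((l : ℝ) / L) (((l : ℝ) + 1) / L) →
      ∀ v, M l = {v} ∧ t = l / L ∨ M (l + 1) = {v} ∧ t = (l + 1) / L → φ t = {v} := by
    intro t ht l hl htl v hv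
    have hsub : φ t ⊆ {v} := by
      rw [hφ l hl t htl]
      rcases hv with ⟨hv, rfl⟩ | ⟨hv, rfl⟩
      · refine carrier_subset (hv ▸ h1 l hl) ?_
        rw [uniformPolyline_eq x hl htl, mul_div_cancel₀ _ hL'.ne', ← hv]
        simpa using hx l hl.le
      · refine carrier_subset (hv ▸ h2 l hl) ?_
        rw [uniformPolyline_eq x hl htl, mul_div_cancel₀ _ hL'.ne', ← hv]
        simpa using hx (l + 1) hl
    refine (Finset.subset_singleton_iff.1 hsub).resolve_left fun h => ?_
    have := hin t ht
    simp [h] at this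
  refine ⟨φ, ⟨hcont.continuousOn, ⟨fun t ht => ?_, fun Υ _ => ?_, fun u v hu _ hv _ _ himg =>
    isSimplicialPath_adjacent hsemi hu hv himg⟩, hin, fun t ht Υ hΥ hmemΥ => ?_, ?_, ?_⟩, ?_⟩
  · exact carrier_mem (hΨ _ (hp1 t ht)) (hmem _ (hp1 t ht) t (hp2 t ht))
  · refine ⟨((Finset.range L).filter fun l : ℕ => ∃ t ∈ Set.Ioo ((l : ℝ) / L) (((l : ℝ) + 1) / L),
      φ t = Υ).image fun l : ℕ => ((l : ℝ) / L, ((l : ℝ) + 1) / L),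
      ((Finset.range (L + 1)).filter fun l : ℕ => φ ((l : ℝ) / L) = Υ).image fun l : ℕ => (l : ℝ) / L, ?_⟩
    ext t
    simp only [Set.mem_ofPred_eq, Set.mem_union, Set.mem_iUnion, Finset.mem_image,
      Finset.mem_filter, Finset.mem_range, Finset.coe_image, Set.mem_image, Finset.mem_coe,
      exists_prop]
    constructor
    · rintro ⟨ht, rfl⟩
      have hl := hp1 t ht
      obtain ⟨q1, q2⟩ := hp2 t ht
      rcases q1.eq_or_lt with q1 | q1
      · exact .inr ⟨piece t, ⟨by omega, by rw [q1]⟩, q1⟩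
      rcases q2.eq_or_lt with q2 | q2
      · refine .inr ⟨piece t + 1, ⟨by omega, ?_⟩, ?_⟩
        · push_cast; rw [← q2]
        · push_cast; exact q2.symm
      · exact .inl ⟨_, ⟨piece t, ⟨hl, t, ⟨q1, q2⟩, rfl⟩, rfl⟩, q1, q2⟩
    · rintro (⟨_, ⟨l, ⟨hl, u, hu, rfl⟩, rfl⟩, ht⟩ | ⟨l, ⟨hl, rfl⟩, rfl⟩)
      · exact ⟨hpiece l hl (Set.Ioo_subset_Icc_self ht), hconst l hl t ht u hu⟩
      · refine ⟨⟨by positivity, ?_⟩, rfl⟩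
        rw [div_le_one hL']
        exact_mod_cast Nat.lt_succ_iff.1 hl
  · have hle : φ t ⊆ Υ := carrier_subset (hΥ.1.trans (carrier_subset_left _ _)) hmemΥ
    exact hΥ.2 hle
  · exact hvert 0 (by simp) 0 hL ⟨by simp, by positivity⟩ s (.inl ⟨hM0, by simp⟩)
  · have hc : ((L - 1 : ℕ) : ℝ) + 1 = L := by
      exact_mod_cast Nat.sub_add_cancel hL
    refine hvert 1 (by simp) (L - 1) (by omega) ⟨?_, ?_⟩ e (.inr ⟨?_, ?_⟩)
    · rw [div_le_one hL']; linarith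
    · rw [hc, div_self hL'.ne']
    · rw [Nat.sub_add_cancel hL, hML]
    · rw [hc, div_self hL'.ne']
  · intro l hl t ht
    rw [hφ l hl t ht]
    exact carrier_subset_left _ _

end SpatialComplex

/-! ### Complexes as systems of agents -/

namespace Listing
variable {d : ℕ} {K : SpatialComplex d} (I : Listing K)

/-- The vertex number `v`. -/
noncomputable def point (v : ℕ) : Pt d := if h : v < I.numVerts then I.vert ⟨v, h⟩ else 0

open Classical in
/-- The numbers of the vertices of a simplex. -/
noncomputable def names (Ψ : Finset (Pt d)) : Finset ℕ :=
  (Finset.univ.filter fun v => I.vert v ∈ Ψ).map Fin.valEmbedding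

variable {I} {Ψ Υ : Finset (Pt d)}

theorem point_val (v : Fin I.numVerts) : I.point v = I.vert v := by rw [point, dif_pos v.2]

theorem mem_names {v : ℕ} : v ∈ I.names Ψ ↔ v < I.numVerts ∧ I.point v ∈ Ψ := by
  simp only [names, Finset.mem_map, Finset.mem_filter, Finset.mem_univ, true_and,
    Fin.valEmbedding_apply]
  constructor
  · rintro ⟨v, hv, rfl⟩
    exact ⟨v.2, by rwa [point_val]⟩
  · rintro ⟨h, hv⟩
    exact ⟨⟨v, h⟩, by rwa [← point_val], rfl⟩

theorem names_mono (h : Ψ ⊆ Υ) : I.names Ψ ⊆ I.names Υ := fun _ hv =>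
  mem_names.2 ⟨(mem_names.1 hv).1, h (mem_names.1 hv).2⟩

theorem names_singleton (v : Fin I.numVerts) : I.names {I.vert v} = {(v : ℕ)} := by
  ext w
  rw [mem_names, Finset.mem_singleton, Finset.mem_singleton]
  constructor
  · rintro ⟨h, hw⟩
    rw [point, dif_pos h] at hw
    exact congrArg Fin.val (I.vert_injective hw)
  · rintro rfl
    exact ⟨v.2, point_val v⟩

theorem vert_mem (v : Fin I.numVerts) : {I.vert v} ∈ K.faces := (I.mem_range_vert _).1 ⟨v, rfl⟩

theorem image_names (h : Ψ ∈ K.faces) : I.point '' I.names Ψ = Ψ := by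
  ext x
  simp only [Set.mem_image, Finset.mem_coe, mem_names]
  constructor
  · rintro ⟨v, ⟨-, hv⟩, rfl⟩
    exact hv
  · intro hx
    obtain ⟨v, rfl⟩ := (I.mem_range_vert x).2
      (SpatialComplex.mem_of_subset h (by simpa using hx) (Finset.singleton_nonempty x))
    exact ⟨v, ⟨v.2, by rwa [point_val]⟩, point_val v⟩

/-- Sets of numbers of vertices of a simplex belong to faces. -/
theorem exists_names_eq (h : Ψ ∈ K.faces) {U : Finset ℕ} (hU : U ⊆ I.names Ψ) (hne : U.Nonempty) :
    ∃ Υ ∈ K.faces, Υ ⊆ Ψ ∧ I.names Υ = U := by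
  classical
  have hsub : U.image I.point ⊆ Ψ := by
    intro x hx
    obtain ⟨v, hv, rfl⟩ := Finset.mem_image.1 hx
    exact (mem_names.1 (hU hv)).2
  refine ⟨U.image I.point, SpatialComplex.mem_of_subset h hsub (hne.image _), hsub, ?_⟩
  ext v
  rw [mem_names, Finset.mem_image]
  constructor
  · rintro ⟨hv, w, hw, hwv⟩
    rw [← Fin.val_mk (mem_names.1 (hU hw)).1, ← Fin.val_mk hv, point_val, point_val] at hwv
    have := congrArg Fin.val (I.vert_injective hwv)
    simp only at this
    rwa [← this]
  · exact fun hv => ⟨(mem_names.1 (hU hv)).1, v, hv, rfl⟩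

theorem names_eq_image (j : Fin K.size) : I.names (I.simplex j : Finset (Pt d)) =
    (Finset.range (I.indices j).length).image
      fun a => ((I.indices j).map fun v : Fin _ => (v : ℕ)).getD a 0 := by
  ext v
  rw [mem_names, Finset.mem_image]
  constructor
  · rintro ⟨h, hv⟩
    obtain ⟨w, hw, hwv⟩ := (I.mem_simplex j _).1 hv
    rw [point, dif_pos h] at hwv
    obtain rfl := I.vert_injective hwv
    obtain ⟨a, ha, haw⟩ := List.getElem_of_mem hw
    exact ⟨a, Finset.mem_range.2 ha, by simp [List.getD_eq_getElem?_getD, ha, haw]⟩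
  · rintro ⟨a, ha, rfl⟩
    rw [Finset.mem_range] at ha
    have : ((I.indices j).map fun v : Fin _ => (v : ℕ)).getD a 0 = (I.indices j)[a] := by
      simp [List.getD_eq_getElem?_getD, ha]
    rw [this, point_val]
    exact ⟨((I.indices j)[a]).2, (I.mem_simplex j _).2 ⟨_, List.getElem_mem ha, rfl⟩⟩

theorem card_simplex (j : Fin K.size) :
    (I.simplex j : Finset (Pt d)).card = (I.indices j).length := by
  classical
  rw [← List.toFinset_card_of_nodup (I.indices_nodup j),
    ← Finset.card_image_of_injective _ I.vert_injective]
  congr 1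
  ext v
  simp [I.mem_simplex j v]

theorem length_le (j : Fin K.size) : (I.indices j).length ≤ d + 1 := by
  rw [← card_simplex]
  have h := (K.affineIndependent _ (I.simplex j).2).card_le_finrank_succ
  have h' := Submodule.finrank_le (vectorSpan ℝ (Set.range fun v : (I.simplex j : Finset (Pt d)) =>
    (v : Pt d)))
  rw [finrank_euclideanSpace_fin] at h'
  rw [Fintype.card_coe] at h
  omega

theorem numVerts_le (I : Listing K) : I.numVerts ≤ K.size := by
  simpa using Fintype.card_le_of_injective
    (fun v : Fin I.numVerts => I.simplex.symm ⟨{I.vert v}, vert_mem v⟩) fun v w h => by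
      simpa [I.vert_injective.eq_iff] using h

end Listing

section
variable {k d : ℕ} {K : Fin k → SpatialComplex d}

/-- The cells of the `i`-th agent are the simplices of the `i`-th complex. -/
noncomputable def complexSystem (I : ∀ i, Listing (K i)) (s e : ∀ i, Fin (I i).numVerts) :
    AgentSystem k d where
  numCells i := (K i).size
  numVerts i := (I i).numVerts
  len i := padded fun j => ((I i).indices j).length
  idx i := padded fun j a => (((I i).indices j).map fun v : Fin _ => (v : ℕ)).getD a 0
  pos i := (I i).point
  src i := s i
  tgt i := e i

variable {I : ∀ i, Listing (K i)} {s e : ∀ i, Fin (I i).numVerts}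

theorem complexSystem_len {i : Fin k} (j : Fin (K i).size) :
    (complexSystem I s e).len i j = ((I i).indices j).length := by
  simp [complexSystem, padded]

theorem complexSystem_idx {i : Fin k} (j : Fin (K i).size) (a : ℕ) :
    (complexSystem I s e).idx i j a = (((I i).indices j).map fun v : Fin _ => (v : ℕ)).getD a 0 := by
  simp [complexSystem, padded]

theorem complexSystem_cell {i : Fin k} (j : Fin (K i).size) :
    (complexSystem I s e).cell i j = (I i).names ((I i).simplex j : Finset (Pt d)) := by
  rw [Listing.names_eq_image, AgentSystem.cell, complexSystem_len]
  exact Finset.image_congr fun a _ => complexSystem_idx j a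

theorem complexSystem_exists_cell {i : Fin k} {Ψ : Finset (Pt d)} (h : Ψ ∈ (K i).faces) :
    ∃ j < (complexSystem I s e).numCells i, (complexSystem I s e).cell i j = (I i).names Ψ :=
  ⟨(I i).simplex.symm ⟨Ψ, h⟩, Fin.is_lt _, by rw [complexSystem_cell, Equiv.apply_symm_apply]⟩

theorem complexSystem_isNode {Ψ : Fin k → Finset (Pt d)} (h : ∀ i, Ψ i ∈ (K i).faces) :
    (complexSystem I s e).IsNode fun i => (I i).names (Ψ i) :=
  fun i => complexSystem_exists_cell (h i)

theorem complexSystem_srcNode :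
    (complexSystem I s e).srcNode = fun i => (I i).names {(I i).vert (s i)} :=
  funext fun i => (Listing.names_singleton (s i)).symm

theorem complexSystem_tgtNode :
    (complexSystem I s e).tgtNode = fun i => (I i).names {(I i).vert (e i)} :=
  funext fun i => (Listing.names_singleton (e i)).symm

theorem complexSystem_valid : (complexSystem I s e).Valid (d + 1) where
  len_pos i j hj := by
    rw [complexSystem_len ⟨j, hj⟩, ← Listing.card_simplex, Finset.card_pos]
    exact SpatialComplex.nonempty_of_mem ((I i).simplex ⟨j, hj⟩).2
  len_le i j hj := by
    rw [complexSystem_len ⟨j, hj⟩]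
    exact Listing.length_le _
  idx_inj i j hj a ha b hb h := by
    rw [complexSystem_len ⟨j, hj⟩] at ha hb
    rw [complexSystem_idx ⟨j, hj⟩, complexSystem_idx ⟨j, hj⟩] at h
    simp only [List.getD_eq_getElem?_getD, List.getElem?_map, List.getElem?_eq_getElem ha,
      List.getElem?_eq_getElem hb, Option.map_some, Option.getD_some] at h
    exact (((I i).indices_nodup _).getElem_inj_iff).1 (Fin.ext h)
  idx_lt i j hj a ha := by
    have h : (complexSystem I s e).idx i j a ∈ (complexSystem I s e).cell i j :=
      Finset.mem_image_of_mem _ (Finset.mem_range.2 ha)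
    rw [complexSystem_cell ⟨j, hj⟩] at h
    exact (Listing.mem_names.1 h).1
  exists_face i j hj U hU hne := by
    rw [complexSystem_cell ⟨j, hj⟩] at hU
    obtain ⟨Υ, hΥ, -, rfl⟩ := Listing.exists_names_eq ((I i).simplex ⟨j, hj⟩).2 hU hne
    exact complexSystem_exists_cell hΥ
  isNode_src := complexSystem_srcNode (I := I) (s := s) (e := e) ▸
    complexSystem_isNode fun _ => Listing.vert_mem _
  isNode_tgt := complexSystem_tgtNode (I := I) (s := s) (e := e) ▸
    complexSystem_isNode fun _ => Listing.vert_mem _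

theorem proj_id (x : Pt d) : proj (id : Fin d → Fin d) x = x := by
  ext c
  simp

variable [NeZero k]

/-- Curves in the complexes give rise to a chain of product cells. -/
theorem complexSystem_reach {π : Fin k → ℝ → Pt d} {φ : Fin k → ℝ → Finset (Pt d)}
    {ρ : Fin k → ℝ → ℝ} (hπ : ∀ i, (K i).IsCurveIn ((I i).vert (s i)) ((I i).vert (e i)) (π i) (φ i))
    (hρ : ∀ i, IsReparam (ρ i)) {δ : ℝ} (hδ : IsLeashLength (fun i t => π i (ρ i t)) δ) :
    (complexSystem I s e).Reach id δ (complexSystem I s e).srcNode (complexSystem I s e).tgtNode ∧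
      (complexSystem I s e).weight (id : Fin d → Fin d) (complexSystem I s e).srcNode ≤ δ := by
  have hmem : ∀ t ∈ Set.Icc (0 : ℝ) 1, ∀ i, ρ i t ∈ Set.Icc (0 : ℝ) 1 :=
    fun t ht i => (hρ i).mapsTo ht
  have hf : ∀ t ∈ Set.Icc (0 : ℝ) 1, ∀ i, φ i (ρ i t) ∈ (K i).faces :=
    fun t ht i => (hπ i).simplicial.mem _ (hmem t ht i)
  have hn : ∀ t ∈ Set.Icc (0 : ℝ) 1,
      (complexSystem I s e).IsNode fun i => (I i).names (φ i (ρ i t)) :=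
    fun t ht => complexSystem_isNode (hf t ht)
  have hw : ∀ t ∈ Set.Icc (0 : ℝ) 1, (complexSystem I s e).weight (id : Fin d → Fin d)
      (fun i => (I i).names (φ i (ρ i t))) ≤ δ := by
    intro t ht
    refine (hn t ht).weight_le complexSystem_valid (x := fun i => π i (ρ i t)) (fun i => ?_)
      fun i => ?_
    · have := (hπ i).mem _ (hmem t ht i)
      rwa [← Listing.image_names (I := I i) (hf t ht i)] at this
    · rw [proj_id, proj_id]
      exact hδ.2 ⟨t, ht, i, rfl⟩
  have h := AgentSystem.Reach.of_motion complexSystem_valid hn hw fun t ht =>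
    Filter.eventually_all.2 fun i => by
      have h1 : Filter.Tendsto (ρ i) (nhdsWithin t (Set.Icc 0 1))
          (nhdsWithin (ρ i t) (Set.Icc 0 1)) :=
        tendsto_nhdsWithin_iff.2 ⟨(hρ i).continuousOn t ht,
          Filter.eventually_of_mem self_mem_nhdsWithin fun u hu => hmem u hu i⟩
      exact (h1.eventually ((hπ i).eventually_subset (hmem t ht i))).mono fun u hu =>
        Listing.names_mono hu
  have h0 : (fun i => (I i).names (φ i (ρ i 0))) = (complexSystem I s e).srcNode := by
    rw [complexSystem_srcNode]
    funext i
    rw [(hρ i).zero, (hπ i).start]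
  have h1 : (fun i => (I i).names (φ i (ρ i 1))) = (complexSystem I s e).tgtNode := by
    rw [complexSystem_tgtNode]
    funext i
    rw [(hρ i).one, (hπ i).target]
  rw [h0, h1] at h
  exact ⟨h, h0 ▸ hw 0 (by simp)⟩

theorem AgentSystem.Reach.exists_trans {e : ℕ} {S : AgentSystem k e} {σ : Fin d → Fin e}
    {a b c : Fin k → Finset ℕ} (h : ∃ θ, S.Reach σ θ a b) (h' : ∃ θ, S.Reach σ θ b c) :
    ∃ θ, S.Reach σ θ a c := by
  obtain ⟨θ, h⟩ := h
  obtain ⟨θ', h'⟩ := h'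
  exact ⟨max θ θ', (h.mono (le_max_left _ _)).trans (h'.mono (le_max_right _ _))⟩

/-- In connected complexes the end can be reached, by moving the agents one after the other. -/
theorem complexSystem_exists_reach (hK : ∀ i, (K i).Connected) :
    ∃ θ, (complexSystem I s e).Reach (id : Fin d → Fin d) θ (complexSystem I s e).srcNode
      (complexSystem I s e).tgtNode := by
  classical
  have step : ∀ Ψ : Fin k → Finset (Pt d), (∀ i, Ψ i ∈ (K i).faces) → ∀ i, ∀ Υ ∈ (K i).faces,
      ∃ θ, (complexSystem I s e).Reach (id : Fin d → Fin d) θ (fun i => (I i).names (Ψ i))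
        (fun i' => (I i').names (Function.update Ψ i Υ i')) := by
    intro Ψ hΨ i Υ hΥ
    have hupd : ∀ Υ ∈ (K i).faces, ∀ i', Function.update Ψ i Υ i' ∈ (K i').faces := by
      intro Υ hΥ i'
      by_cases h : i' = i
      · subst h; simpa using hΥ
      · simpa [h] using hΨ i'
    have hface : ∀ Υ ∈ (K i).faces, ∀ Ξ ∈ (K i).faces, Υ ⊆ Ξ →
        ∃ θ, (complexSystem I s e).Reach (id : Fin d → Fin d) θ
          (fun i' => (I i').names (Function.update Ψ i Υ i'))
          (fun i' => (I i').names (Function.update Ψ i Ξ i')) := by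
      intro Υ hΥ Ξ hΞ hsub
      refine ⟨_, .of_subset complexSystem_valid (complexSystem_isNode (hupd Υ hΥ))
        (complexSystem_isNode (hupd Ξ hΞ)) (fun i' => Listing.names_mono ?_) le_rfl⟩
      by_cases h : i' = i
      · subst h; simpa using hsub
      · simp [h]
    have hchain := hK i (Ψ i) (hΨ i) Υ hΥ
    suffices H : Υ ∈ (K i).faces ∧ ∃ θ, (complexSystem I s e).Reach (id : Fin d → Fin d) θ
        (fun i => (I i).names (Ψ i)) (fun i' => (I i').names (Function.update Ψ i Υ i')) from H.2
    clear hΥ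
    induction hchain with
    | refl => exact ⟨hΨ i, 0, by rw [Function.update_eq_self]; exact .refl⟩
    | tail _ h ih =>
      refine ⟨h.1, AgentSystem.Reach.exists_trans ih.2 ?_⟩
      rcases h.2 with hsub | hsub
      · exact hface _ ih.1 _ h.1 hsub
      · exact (hface _ h.1 _ ih.1 hsub).imp fun _ h => h.symm
  have all : ∀ A : Finset (Fin k), ∃ θ, (complexSystem I s e).Reach (id : Fin d → Fin d) θ
      (complexSystem I s e).srcNode
      (fun i => (I i).names (if i ∈ A then {(I i).vert (e i)} else {(I i).vert (s i)})) := by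
    intro A
    induction A using Finset.induction_on with
    | empty => exact ⟨0, by rw [complexSystem_srcNode]; exact .refl⟩
    | insert i A _ ih =>
      refine AgentSystem.Reach.exists_trans ih ?_
      have := step (fun i => if i ∈ A then {(I i).vert (e i)} else {(I i).vert (s i)})
        (fun i => by split_ifs <;> exact Listing.vert_mem _) i {(I i).vert (e i)}
        (Listing.vert_mem _)
      convert this using 5 with θ i'
      by_cases h : i' = i
      · subst h; simp
      · simp [h]
  have := all Finset.univ
  simpa [complexSystem_tgtNode] using this

/-- The polygonal curves of an optimal motion through the simplices are optimal. -/
theorem OptimalMotion.areOptimalCurves {L : ℕ} (hL : 0 < L) {X : ℕ → Fin k → Pt d}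
    {J : Fin k → ℕ → ℕ} (h : OptimalMotion (complexSystem I s e) id L X J)
    {π : Fin k → ℝ → Pt d} (hπ : ∀ i, π i = uniformPolyline L fun l => X l i) {ρ : Fin k → ℝ → ℝ}
    (hρ : ∀ i, IsReparam (ρ i)) (hρ' : ∀ i, ∀ t ∈ Set.Icc (0 : ℝ) 1, ρ i t = t) :
    ∃ φ : Fin k → ℝ → Finset (Pt d), (∀ i, ∀ l < L, ∃ hj : J i l < (K i).size,
      ∀ t ∈ Set.Icc ((l : ℝ) / L) (((l : ℝ) + 1) / L),
        φ i t ⊆ ((I i).simplex ⟨J i l, hj⟩ : Finset (Pt d))) ∧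
      AreOptimalCurves K (fun i => (I i).vert (s i)) (fun i => (I i).vert (e i)) π φ ρ := by
  classical
  obtain ⟨N, hN0, hNL, hX, hJ⟩ := h.path
  have hJ' : ∀ l < L, ∀ i, J i l < (K i).size := fun l hl i => (hJ l hl i).1
  have ex : ∀ i, ∃ φ, (K i).IsCurveIn ((I i).vert (s i)) ((I i).vert (e i)) (π i) φ ∧
      ∀ l < L, ∃ hj : J i l < (K i).size, ∀ t ∈ Set.Icc ((l : ℝ) / L) (((l : ℝ) + 1) / L),
        φ t ⊆ ((I i).simplex ⟨J i l, hj⟩ : Finset (Pt d)) := by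
    intro i
    have hcell : ∀ l (hl : l < L), (complexSystem I s e).cell i (J i l) =
        (I i).names ((I i).simplex ⟨J i l, hJ' l hl i⟩ : Finset (Pt d)) := fun l hl =>
      complexSystem_cell ⟨J i l, hJ' l hl i⟩
    have hsub : ∀ l (hl : l < L) U, U ⊆ (complexSystem I s e).cell i (J i l) →
        U.image (I i).point ⊆ ((I i).simplex ⟨J i l, hJ' l hl i⟩ : Finset (Pt d)) := by
      intro l hl U hU x hx
      obtain ⟨v, hv, rfl⟩ := Finset.mem_image.1 hx
      have := hU hv
      rw [hcell l hl] at this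
      exact (Listing.mem_names.1 this).2
    obtain ⟨φ, h1, h2⟩ := SpatialComplex.exists_isCurveIn (K := K i) (s := (I i).vert (s i))
      (e := (I i).vert (e i)) hL
      (Ψ := fun l => if hl : J i l < (K i).size then ((I i).simplex ⟨J i l, hl⟩ : Finset (Pt d))
        else ∅) (M := fun l => (N l i).image (I i).point) (x := fun l => X l i)
      (fun l hl => by simp only [hJ' l hl i, dif_pos]; exact ((I i).simplex _).2)
      (by simp [hN0, AgentSystem.srcNode, complexSystem, Listing.point_val])
      (by simp [hNL, AgentSystem.tgtNode, complexSystem, Listing.point_val])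
      (fun l hl => by simpa [AgentSystem.hull, complexSystem] using hX l hl i)
      (fun l hl => by
        simp only [hJ' l hl i, dif_pos]; exact hsub l hl _ (hJ l hl i).2.1)
      (fun l hl => by
        simp only [hJ' l hl i, dif_pos]; exact hsub l hl _ (hJ l hl i).2.2)
    refine ⟨φ, hπ i ▸ h1, fun l hl => ⟨hJ' l hl i, fun t ht => ?_⟩⟩
    have := h2 l hl t ht
    rwa [dif_pos (hJ' l hl i)] at this
  choose φ hφ1 hφ2 using ex
  obtain ⟨p, hp, hmin⟩ := h.leash
  simp only [proj_id] at hp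
  have hdist : ∀ t ∈ Set.Icc (0 : ℝ) 1, ∀ i, dist (π 0 (ρ 0 t)) (π i (ρ i t)) ≤ p := by
    intro t ht i
    rw [hρ' 0 t ht, hρ' i t ht, hπ, hπ]
    exact dist_uniformPolyline_le (fun l hl => hp l hl i) hL ht
  obtain ⟨δ, hδp, hδ⟩ := exists_isLeashLength (γ := fun i t => π i (ρ i t))
    (fun i => by
      rw [hπ]
      exact (continuous_uniformPolyline L _).comp_continuousOn (hρ i).continuousOn) hdist
  refine ⟨φ, hφ2, hφ1, hρ, δ, hδ, fun π' φ' ρ' hπ' hr' δ' hδ' => hδp.trans ?_⟩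
  obtain ⟨g1, g2⟩ := complexSystem_reach hπ' hr' hδ'
  exact hmin δ' g1 g2

/-! ### The program for complexes -/

/-- The arrays of the input that hold complexes as agents. -/
def complexLayout (k : ℕ) : Layout k where
  verts := 0
  cells := 1
  src := 2
  tgt := 3
  len i := 4 + 2 * i
  idx i := 5 + 2 * i
  coord i := i

theorem complexLayout_below : (complexLayout k).Below (10 + 8 * k) := by
  constructor <;> simp only [complexLayout] <;> omega

theorem padded_val {α : Type*} [Zero α] {n : ℕ} (f : Fin n → α) (i : Fin n) : padded f i = f i := by
  rw [padded, dif_pos i.2]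

/-- The input is a system of agents as it stands. -/
theorem complexLayout_holds :
    (complexLayout k).Holds (complexSystem I s e) (d + 1) (complexesInput I s e) where
  verts i := padded_val (fun i => (I i).numVerts) i
  cells i := padded_val (fun i => (K i).size) i
  src i := padded_val (fun i => (s i : ℕ)) i
  tgt i := padded_val (fun i => (e i : ℕ)) i
  len i j hj := by
    have h : (complexesInput I s e).iarr (4 + 2 * i) = padded fun j => ((I i).indices j).length := by
      rw [add_comm]
      simp only [complexesInput, Nat.mul_mod_right, if_pos, Nat.mul_div_cancel_left _ two_pos]
      exact padded_val _ i
    exact congrFun h j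
  idx i j hj a ha := by
    have h : (complexesInput I s e).iarr (5 + 2 * i) = table (d + 1)
        fun j a => (((I i).indices j).map fun v : Fin _ => (v : ℕ)).getD a 0 := by
      rw [show 5 + 2 * (i : ℕ) = (2 * i + 1) + 4 by omega]
      simp only [complexesInput, Nat.mul_add_mod, Nat.mod_succ, one_ne_zero, if_false,
        show (2 * (i : ℕ) + 1) / 2 = i by omega]
      -- The definition of the input coerces the list of indices entrywise, as a monadic `do` block.
      simp [padded, ← List.map_eq_flatMap, Function.comp_def]
    rw [complexSystem_idx ⟨j, hj⟩]
    exact (congrFun h _).trans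
      (table_apply _ ⟨j, hj⟩ (ha.trans_le (complexSystem_valid.len_le i j hj)))
  coord i v hv c := by
    have h : (complexesInput I s e).rarr i = table d fun v => padded fun c => (I i).vert v c :=
      padded_val (fun i => table d fun v => padded fun c => (I i).vert v c) i
    refine (congrFun h _).trans ((table_apply _ ⟨v, hv⟩ c.2).trans ((padded_val _ c).trans ?_))
    change _ = (I i).point v c
    exact congrArg (fun x : Pt d => x c) (Listing.point_val (I := I i) ⟨v, hv⟩).symm

end

theorem semialgebraicFun_zero : SemialgebraicFun fun _ : Fin 0 → ℝ => 0 :=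
  .of_graph (.refl _) (fun _ : Fin 0 → ℝ => 0) (.eq .zero (.var none))

theorem semialgebraicFun_one : SemialgebraicFun fun _ : Fin 0 → ℝ => 1 :=
  .of_graph (.refl _) (fun _ : Fin 0 → ℝ => 1) (.eq .one (.var none))

theorem semialgebraicFun_add : SemialgebraicFun fun v : Fin 2 → ℝ => v 0 + v 1 :=
  .of_graph (.refl _) (fun v : Fin 2 → ℝ => v 0 + v 1)
    (.eq (.add (.var (some 0)) (.var (some 1))) (.var none))

theorem semialgebraicFun_div : SemialgebraicFun fun v : Fin 2 → ℝ => v 0 / v 1 := by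
  refine .of_graph (.refl _) (fun v : Fin 2 → ℝ => v 0 / v 1) ?_
  have : {w : Option (Fin 2) → ℝ | (w ∘ some) 0 / (w ∘ some) 1 = w none} =
      {w | (w (some 1) = 0 → w none = 0) ∧
        (¬ w (some 1) = 0 → w (some 0) = w none * w (some 1))} := by
    ext w
    simp only [Function.comp_apply, Set.mem_ofPred_eq]
    by_cases h : w (some 1) = 0
    · simp [h, eq_comm]
    · simp [h, div_eq_iff h]
  rw [this]
  exact .and (.imp (.eq (.var _) .zero) (.eq (.var _) .zero))
    (.imp (.not (.eq (.var _) .zero)) (.eq (.var _) (.mul (.var _) (.var _))))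

namespace Program

/-- Store the numbers `0, 1/L, …, 1` in the real arrays `2 * k + i`, where `L` is in integer
register `29`. -/
noncomputable def storeTimes (k : ℕ) : Program :=
  seq (seq (opR 1 _ semialgebraicFun_zero ![]) <| seq (opR 2 _ semialgebraicFun_one ![]) <|
    opR 3 _ semialgebraicFun_zero ![]) <|
  seq (forI 1 29 (opR 3 _ semialgebraicFun_add ![3, 2])) <|
  seq (seq (setI 2 1) (addI 3 29 2)) <|
  forI 1 3 <| seq (opR 4 _ semialgebraicFun_div ![1, 3]) <|
    seq (rep k fun i => storeR (2 * k + i) 1 4) (opR 1 _ semialgebraicFun_add ![1, 2])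

/-- The identity, as a polygonal map with `L` pieces, is stored in time `O(L)`. -/
theorem storeTimes_spec (k : ℕ) : ∃ C, ∀ μ : Memory, Run (storeTimes k) μ fun T μ' =>
    T ≤ C * (μ.ireg 29 + 1) ∧ ∀ i : Fin k, ∀ l ≤ μ.ireg 29,
      μ'.rarr (2 * k + i) l = l / (μ.ireg 29 : ℝ) := by
  let body := seq (opR 4 _ semialgebraicFun_div ![1, 3]) <|
    seq (rep k fun i => storeR (2 * k + i) 1 4) (opR 1 _ semialgebraicFun_add ![1, 2])
  have hlf : body.loopFree := by simp [body]
  refine ⟨body.steps + 16, fun μ => ?_⟩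
  obtain ⟨L, hL⟩ : ∃ L, L = μ.ireg 29 := ⟨_, rfl⟩
  have h1 : Run (seq (opR 1 _ semialgebraicFun_zero ![]) <|
      seq (opR 2 _ semialgebraicFun_one ![]) <| opR 3 _ semialgebraicFun_zero ![]) μ
      fun T μ' => T ≤ 3 ∧ μ'.ireg 29 = L ∧ μ'.rreg 1 = 0 ∧ μ'.rreg 2 = 1 ∧ μ'.rreg 3 = 0 :=
    Run.of_loopFree (by simp) fun T hT => by simpa [hL] using hT
  refine Run.seq' h1 fun T1 μ1 hF1 ⟨hT1, e29, e1, e2, e3⟩ => ?_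
  refine Run.seq' (Run.forI_loopFree (fun j μ' => μ'.rreg 3 = j) (by decide) (by decide) (by decide)
    (by simp) (by simp) (by simp) (by simpa using e3) fun j μ2 hj hF hi hI => ?_)
    fun T2 μ2 hF2 ⟨g3, hT2⟩ => ?_
  · have := (hF.rreg 2 (by simp)).trans e2
    simp [hI, this]
  have g29 := (hF2.ireg 29 (by simp)).trans e29
  have g1 := (hF2.rreg 1 (by simp)).trans e1
  have g2 := (hF2.rreg 2 (by simp)).trans e2
  rw [e29] at g3 hT2
  have h3 : Run (seq (setI 2 1) (addI 3 29 2)) μ2 fun T μ' => T ≤ 2 ∧ μ'.ireg 3 = L + 1 :=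
    Run.of_loopFree (by simp) fun T hT => by simpa [g29] using hT
  refine Run.seq' h3 fun T3 μ3 hF3 ⟨hT3, f3⟩ => ?_
  have k1 := (hF3.rreg 1 (by simp)).trans g1
  have k2 := (hF3.rreg 2 (by simp)).trans g2
  have k3 := (hF3.rreg 3 (by simp)).trans g3
  refine (Run.forI body.steps (fun j μ' => μ'.rreg 1 = j ∧ ∀ i : Fin k, ∀ l < j,
    μ'.rarr (2 * k + i) l = l / (L : ℝ)) (by decide) (by decide) (by decide) (by simp) (by simp)
    (by simpa using k1) fun j μ4 hj hF hi ⟨hI1, hI⟩ => ?_).mono fun T4 μ4 hF4 ⟨⟨_, h⟩, hT4⟩ => ?_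
  · have q2 := (hF.rreg 2 (by simp)).trans k2
    have q3 := (hF.rreg 3 (by simp)).trans k3
    refine (Run.time_le hlf (R := fun _ μ' => μ'.rreg 1 = (j : ℝ) + 1 ∧ ∀ i : Fin k,
      ∀ l < j + 1, μ'.rarr (2 * k + i) l = l / (L : ℝ)) ?_).mono
      fun T5 μ5 hF5 ⟨⟨p1, p2⟩, hT5⟩ => ⟨⟨by simpa using p1, by simpa using p2⟩, hT5⟩
    refine Run.seq (Run.of_loopFree (by simp) fun _ _ => ?_)
    refine Run.seq' (Run.rep (fun n _ μ' => ∀ i : Fin k, (∀ l < j,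
      μ'.rarr (2 * k + i) l = l / (L : ℝ)) ∧ (i < n → μ'.rarr (2 * k + i) j = j / (L : ℝ)))
      ?_ ?_) fun T5 μ5 hF5 h5 => ?_
    · intro i
      exact ⟨by simpa using hI i, by simp⟩
    · rintro n T μ5 hF5 h5
      have r1 := hF5.ireg 1 (by simp)
      have r4 := hF5.rreg 4 (by simp)
      simp [hI1, q3] at r1 r4
      refine Run.of_loopFree (by simp) fun _ _ i => ⟨fun l hl => ?_, fun hin => ?_⟩
      · simp [r1, hi, (show l ≠ j by omega)]
        exact (h5 i).1 l hl
      · rcases Nat.lt_succ_iff_lt_or_eq.1 hin with h | h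
        · simp [r1, hi, (show (i : ℕ) ≠ n from h.ne)]
          exact (h5 i).2 h
        · simp [r1, r4, hi, h]
    · have r1 := hF5.rreg 1 (by simp)
      have r2 := hF5.rreg 2 (by simp)
      simp [hI1, q2] at r1 r2
      refine Run.of_loopFree (by simp) fun _ _ => ⟨by simp [r1, r2], fun i l hl => ?_⟩
      rcases Nat.lt_succ_iff_lt_or_eq.1 hl with h | rfl
      · simpa using (h5 i).1 l h
      · simpa using (h5 i).2 i.2
  · rw [f3] at h hT4
    rw [← hL]
    refine ⟨?_, fun i l hl => h i l (by omega)⟩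
    simp only [steps] at hT2
    change T4 ≤ (body.steps + 3) * (L + 1) + 2 at hT4
    have : (body.steps + 16) * (L + 1) = (body.steps + 3) * (L + 1) + 13 * L + 13 := by ring
    omega

end Program

/-- An optimal motion in complexes can be computed in time `O(n ^ k)`. -/
theorem exists_program_complexes (k d : ℕ) [NeZero k] : ∃ (A : Program) (C : ℕ),
    ∀ (K : Fin k → SpatialComplex d), (∀ i, (K i).Connected) →
      ∀ (I : ∀ i, Listing (K i)) (s e : ∀ i, Fin (I i).numVerts),
      ∃ (T : ℕ) (σ : Memory), Runs A (complexesInput I s e) T σ ∧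
        T ≤ C * (∑ i, (K i).size) ^ k ∧
        0 < σ.ireg 0 ∧
        ∃ φ : Fin k → ℝ → Finset (Pt d), (∀ i, OutSimplices I σ i (φ i)) ∧
          AreOptimalCurves K (fun i => (I i).vert (s i)) (fun i => (I i).vert (e i))
            (outCurve k d σ) φ (outReparam k σ) := by
  obtain ⟨C₁, h₁⟩ := plan_spec (k := k) (id : Fin d → Fin d) (d + 1) (10 + 8 * k) d
    (complexLayout k) complexLayout_below le_rfl (ox := fun i => k + i)
    (oj := fun i => 4 + 2 * k + i) (by intro i; omega) (by intro i; omega)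
    (fun i j h => Fin.ext (by simpa using h)) (fun i j h => Fin.ext (by simpa using h))
  obtain ⟨C₂, h₂⟩ := storeTimes_spec k
  refine ⟨seq (seq (solve (id : Fin d → Fin d) (10 + 8 * k) (complexLayout k) (d + 1))
    (collect (10 + 8 * k) (fun i : Fin k => k + i) (fun i => 4 + 2 * k + i) d))
    (seq (storeTimes k) (mv 0 29)), 2 * C₁ + C₂ * (2 * C₁ + 1) + 2, fun K hK I s e => ?_⟩
  change Run _ _ fun T σ => T ≤ _ ∧ 0 < σ.ireg 0 ∧
    ∃ φ : Fin k → ℝ → Finset (Pt d), (∀ i, OutSimplices I σ i (φ i)) ∧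
      AreOptimalCurves K (fun i => (I i).vert (s i)) (fun i => (I i).vert (e i))
        (outCurve k d σ) φ (outReparam k σ)
  refine Run.seq' (h₁ _ _ complexLayout_holds complexSystem_valid (complexSystem_exists_reach hK))
    fun T1 μ1 hF1 ⟨hL, hT1, X, hX, hopt⟩ => ?_
  refine Run.seq' (h₂ μ1) fun T2 μ2 hF2 ⟨hT2, htime⟩ => ?_
  have h29 := hF2.ireg 29 (by simp [storeTimes])
  have hxarr : ∀ i : Fin k, μ2.rarr (k + i) = μ1.rarr (k + i) := fun i =>
    hF2.rarr _ (by simp [storeTimes]; omega)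
  have hjarr : ∀ A, μ2.iarr A = μ1.iarr A := fun A => hF2.iarr A (by simp [storeTimes])
  refine Run.of_loopFree (by simp [mv]) fun T3 hT3 => ?_
  obtain ⟨L, hLdef⟩ : ∃ L, L = μ1.ireg 29 := ⟨_, rfl⟩
  rw [← hLdef] at hL hT1 hT2 hX hopt htime h29
  have f0 : ((mv 0 29).exec μ2).ireg 0 = L := by simp [mv, h29]
  have fr : ((mv 0 29).exec μ2).rarr = μ2.rarr := by simp [mv]
  have fi : ((mv 0 29).exec μ2).iarr = μ2.iarr := by simp [mv]
  refine ⟨?_, by rwa [f0], ?_⟩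
  · obtain ⟨n, hn⟩ : ∃ n, n = ∑ i, (K i).size := ⟨_, rfl⟩
    have hle : ∀ i, (K i).size ≤ n := fun i => hn ▸
      Finset.single_le_sum (f := fun i => (K i).size) (fun _ _ => Nat.zero_le _)
        (Finset.mem_univ i)
    have hn1 : 1 ≤ n := (Nat.succ_le_of_lt ((Nat.zero_le _).trans_lt (s 0).2)).trans ((I 0).numVerts_le.trans (hle 0))
    have hnk : n ≤ n ^ k := Nat.le_self_pow (NeZero.ne k) n
    have hprod : ∏ i, (complexSystem I s e).numCells i ≤ n ^ k :=
      (Finset.prod_le_pow_card _ _ n fun i _ => hle i).trans (by simp)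
    have hsum : ∑ i, (complexSystem I s e).numVerts i ≤ n :=
      hn ▸ Finset.sum_le_sum fun i _ => (I i).numVerts_le
    rw [← hn]
    simp [mv] at hT3
    have e1 := Nat.mul_le_mul_left C₁ (add_le_add hprod (hsum.trans hnk))
    have e2 : L + 1 ≤ (2 * C₁ + 1) * n ^ k := by
      have : (2 * C₁ + 1) * n ^ k = C₁ * (n ^ k + n ^ k) + n ^ k := by ring
      omega
    have e3 := Nat.mul_le_mul_left C₂ e2
    have e4 : (2 * C₁ + C₂ * (2 * C₁ + 1) + 2) * n ^ k =
      C₁ * (n ^ k + n ^ k) + C₂ * ((2 * C₁ + 1) * n ^ k) + 2 * n ^ k := by ring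
    omega
  · have hL' : (0 : ℝ) < L := by exact_mod_cast hL
    have hρ : ∀ i, outReparam k ((mv 0 29).exec μ2) i = uniformPolyline L fun l => (l : ℝ) / L := by
      intro i
      funext t
      unfold outReparam
      rw [f0, fr]
      exact uniformPolyline_congr (htime i) t
    have hπ : ∀ i, outCurve k d ((mv 0 29).exec μ2) i = uniformPolyline L fun l => X l i := by
      intro i
      funext t
      unfold outCurve
      rw [f0, fr]
      refine uniformPolyline_congr (fun l hl => ?_) t
      ext c
      simp only [hxarr]
      exact hX i l hl c
    obtain ⟨φ, hφ, hfin⟩ := hopt.areOptimalCurves hL hπ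
      (ρ := outReparam k ((mv 0 29).exec μ2)) (fun i => by
      rw [hρ]
      refine isReparam_uniformPolyline hL (by simp) (div_self hL'.ne') fun l hl => ⟨by positivity, ?_⟩
      rw [div_le_one hL']
      exact_mod_cast hl) fun i t ht => by
        obtain ⟨l, hl, hx⟩ := exists_piece hL ht
        rw [hρ, uniformPolyline_eq _ hl hx]
        push_cast
        simp only [smul_eq_mul]
        field_simp
        ring
    refine ⟨φ, fun i l hl => ?_, hfin⟩
    rw [f0] at hl
    obtain ⟨hj, hsub⟩ := hφ i l hl
    simp only [f0, fi, hjarr]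
    exact ⟨hj, hsub⟩

theorem mainTheorem8 (k d : ℕ) [NeZero k] :
    -- polygonal curves of total complexity `n`, in time `O(n ^ k)`
    (∃ (A : Program) (C : ℕ), ∀ P : Fin k → PolygonalCurve d,
      ∃ (T : ℕ) (σ : Memory), Runs A (curvesInput P) T σ ∧
        T ≤ C * (∑ i, (P i).complexity) ^ k ∧
        0 < σ.ireg 0 ∧ AreOptimalReparams P (outReparam k σ)) ∧
    -- connected complexes of total complexity `n`, in time `O(n ^ k)`
    (∃ (A : Program) (C : ℕ), ∀ (K : Fin k → SpatialComplex d), (∀ i, (K i).Connected) →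
      ∀ (I : ∀ i, Listing (K i)) (s e : ∀ i, Fin (I i).numVerts),
      ∃ (T : ℕ) (σ : Memory), Runs A (complexesInput I s e) T σ ∧
        T ≤ C * (∑ i, (K i).size) ^ k ∧
        0 < σ.ireg 0 ∧
        ∃ φ : Fin k → ℝ → Finset (Pt d), (∀ i, OutSimplices I σ i (φ i)) ∧
          AreOptimalCurves K (fun i => (I i).vert (s i)) (fun i => (I i).vert (e i))
            (outCurve k d σ) φ (outReparam k σ)) :=
  ⟨exists_program_curves k d, exists_program_complexes k d⟩
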